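/- Let $\ell,\tau_{max}>0$ and let $\bar\varepsilon,\underline\gamma,\bar\gamma,\underline a,\bar a,\underline\rho,\bar\rho,\bar w,\bar C,c_1,c_2$ be positive constants. Let $P:(0,\infty)\to\mathbb R$ be smooth, strongly convex on $[\tfrac23\underline\rho,\tfrac32\bar\rho]$, and such that $\rho P''(\rho)\ge 4\bar\varepsilon^2\bar w^2$ for all $\tfrac23\underline\rho\le\rho\le\tfrac32\bar\rho$. Then there are constants $C>0$ and $\Delta\tau_0>0$, depending only on the data listed so far (in particular not on $\varepsilon$), such that the following holds for all $0\le\varepsilon\le\bar\varepsilon$ (including $\varepsilon=0$), $\underline\gamma\le\gamma\le\bar\gamma$ and $\underline a\le a\le\bar a$. Let $(\rho,w)$ be a classical solution on $(0,\ell)\times(0,\tau_{max}]$ of $$a\,\partial_\tau\rho+\partial_x m=0,\qquad \varepsilon^2\partial_\tau w+\partial_x\eta=-\gamma|w|w,\qquad m=a\rho w,\quad \eta=\tfrac12\varepsilon^2w^2+P'(\rho),$$ with boundary values $\eta(\tau,0)=h_\partial^0(\tau)$ and $\eta(\tau,\ell)=h_\partial^\ell(\tau)$; that is, $\rho,w\in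 C^1([0,\tau_{max}];L^2(0,\ell))\cap C^0([0,\tau_{max}];H^1(0,\ell))$, $\rho>0$, and the equations hold for every $\tau\in(0,\tau_{max}]$ and almost every $x$. Assume that $\underline\rho\le\rho\le\bar\rho$ and $-\bar w\le w\le\bar w$ for all $\tau\in[0,\tau_{max}]$ and almost every $x$, and that the norms of $\rho$ and of $w$ in $W^{2,\infty}(0,\tau_{max};L^2(0,\ell))$ and in $W^{1,\infty}(0,\tau_{max};H^1(0,\ell))$ are at most $\bar C$. Let $M,N\ge1$ be integers, $h=\ell/M$, $\Delta\tau=\tau_{max}/N$, $x_i=ih$, $\tau^n=n\Delta\tau$. Let $Q_h$ be the space of piecewise constant functions and $R_h$ the space of continuous piecewise linear functions on the mesh with elements $[x_{i-1},x_i]$, $1\le i\le M$. Write $\langle u,v\rangle=\int_0^\ell uv\,dx$ and $\bar d_\tau u^n=(u^n-u^{n-1})/\Delta\tau$. A discrete solution is a family $(\rho_h^n,m_h^n)\in Q_h\times R_h$, $0\le n\le N$, such that $\rho_h^0$ is the $L^2$-orthogonal projection of $\rho(0)$ onto $Q_h$, $m_h^0\in R_h$ is the piecewise linear interpolant of $m(0)$,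 and for $1\le n\le N$, with $w_h^n=m_h^n/(a\rho_h^n)$ and $\eta_h^n=\tfrac12\varepsilon^2(w_h^n)^2+P'(\rho_h^n)$, $$\langle a\,\bar d_\tau\rho_h^n,q_h\rangle+\langle\partial_xm_h^n,q_h\rangle=0\qquad\forall q_h\in Q_h,$$ $$\langle\varepsilon^2\bar d_\tau w_h^n,r_h\rangle-\langle\eta_h^n,\partial_xr_h\rangle+h_\partial^\ell(\tau^n)r_h(\ell)-h_\partial^0(\tau^n)r_h(0)+\langle\gamma|w_h^n|w_h^n,r_h\rangle=0\qquad\forall r_h\in R_h.$$ It is called admissible if $\tfrac23\underline\rho\le\rho_h^n\le\tfrac32\bar\rho$ and $|w_h^n|\le\tfrac32\bar w$ almost everywhere on $(0,\ell)$ for all $0\le n\le N$. If $\Delta\tau\le\Delta\tau_0$ and $c_1\Delta\tau\le h\le c_2\Delta\tau$, then there is exactly one admissible discrete solution, and for all $0\le n\le N$ it satisfies $$\|\rho(\tau^n)-\rho_h^n\|_{L^2(0,\ell)}^2+\varepsilon^2\|m(\tau^n)-m_h^n\|_{L^2(0,\ell)}^2+\sum_{k=1}^n\Delta\tau\,\|m(\tau^k)-m_h^k\|_{L^3(0,\ell)}^3\le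 C(\Delta\tau^2+h^2).$$ -/

import Mathlib

open Set MeasureTheory
open scoped ContDiff InnerProductSpace

namespace PipeFlow

noncomputable section

/-! ## Function spaces -/

/-- `v` is the weak (distributional) derivative of `u` on the open interval `(α, β)`, for functions
with values in a Banach space `X`. -/
def HasWeakDerivOn {X : Type*} [NormedAddCommGroup X] [NormedSpace ℝ X] (α β : ℝ)
    (u v : ℝ → X) : Prop :=
  LocallyIntegrableOn u (Ioo α β) ∧ LocallyIntegrableOn v (Ioo α β) ∧
    ∀ φ : ℝ → ℝ, ContDiff ℝ ∞ φ → HasCompactSupport φ → tsupport φ ⊆ Ioo α β →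
      ∫ t in Ioo α β, deriv φ t • u t = - ∫ t in Ioo α β, φ t • v t

/-- The Lebesgue space `L²(0, ℓ)`. -/
abbrev L2 (ℓ : ℝ) : Type := Lp ℝ 2 (volume.restrict (Ioo 0 ℓ))

/-- A continuous compactly supported function is square integrable on `(0, ℓ)`. -/
lemma memLp_test (ℓ : ℝ) {φ : ℝ → ℝ} (hc : Continuous φ) (hs : HasCompactSupport φ) :
    MemLp φ 2 (volume.restrict (Ioo 0 ℓ)) :=
  hc.memLp_of_hasCompactSupport hs

/-- Integration of an element of `L²(0, ℓ)` against a test function is an inner product. -/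
lemma integral_test (ℓ : ℝ) {φ : ℝ → ℝ} (hφ : MemLp φ 2 (volume.restrict (Ioo 0 ℓ)))
    (f : L2 ℓ) : ∫ x in Ioo 0 ℓ, φ x • f x = ⟪hφ.toLp φ, f⟫_ℝ := by
  rw [L2.inner_def]
  refine integral_congr_ae ?_
  filter_upwards [hφ.coeFn_toLp] with x hx
  simp [hx, mul_comm]

lemma locallyIntegrableOn_L2 (ℓ : ℝ) (f : L2 ℓ) : LocallyIntegrableOn f (Ioo 0 ℓ) :=
  IntegrableOn.locallyIntegrableOn ((Lp.memLp f).integrable (by norm_num))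

lemma hasWeakDerivOn_L2_iff (ℓ : ℝ) (f g : L2 ℓ) :
    HasWeakDerivOn 0 ℓ f g ↔ ∀ φ : ℝ → ℝ, ContDiff ℝ ∞ φ → HasCompactSupport φ →
      tsupport φ ⊆ Ioo 0 ℓ →
      ∫ x in Ioo 0 ℓ, deriv φ x • f x = - ∫ x in Ioo 0 ℓ, φ x • g x :=
  ⟨fun h => h.2.2, fun h => ⟨locallyIntegrableOn_L2 ℓ f, locallyIntegrableOn_L2 ℓ g, h⟩⟩

/-- The Sobolev space `H¹(0, ℓ)`: pairs `(f, f')` of an `L²` function and its weak derivative, with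
the norm `(‖f‖² + ‖f'‖²)^(1/2)`. -/
def H1 (ℓ : ℝ) : Submodule ℝ (WithLp 2 (L2 ℓ × L2 ℓ)) where
  carrier := {p | HasWeakDerivOn 0 ℓ p.fst p.snd}
  zero_mem' := by
    refine (hasWeakDerivOn_L2_iff ℓ _ _).2 fun φ h1 h2 _ => ?_
    have hd := memLp_test ℓ (h1.continuous_deriv (by simp)) h2.deriv
    have hv := memLp_test ℓ h1.continuous h2
    rw [integral_test ℓ hd, integral_test ℓ hv]
    simp
  add_mem' := by
    intro p q hp hq
    refine (hasWeakDerivOn_L2_iff ℓ _ _).2 fun φ h1 h2 h3 => ?_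
    have ep := hp.2.2 φ h1 h2 h3
    have eq := hq.2.2 φ h1 h2 h3
    have hd := memLp_test ℓ (h1.continuous_deriv (by simp)) h2.deriv
    have hv := memLp_test ℓ h1.continuous h2
    rw [integral_test ℓ hd, integral_test ℓ hv] at ep eq ⊢
    simp only [WithLp.add_fst, WithLp.add_snd, inner_add_right, ep, eq]
    ring
  smul_mem' := by
    intro c p hp
    refine (hasWeakDerivOn_L2_iff ℓ _ _).2 fun φ h1 h2 h3 => ?_
    have ep := hp.2.2 φ h1 h2 h3
    have hd := memLp_test ℓ (h1.continuous_deriv (by simp)) h2.deriv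
    have hv := memLp_test ℓ h1.continuous h2
    rw [integral_test ℓ hd, integral_test ℓ hv] at ep ⊢
    simp only [WithLp.smul_fst, WithLp.smul_snd, inner_smul_right, ep]
    ring

/-- `H¹(0, ℓ)` is complete, so that integrals of `H¹`-valued functions are genuine. -/
instance instCompleteSpaceH1 (ℓ : ℝ) : CompleteSpace (H1 ℓ) := by
  have hcl : IsClosed (H1 ℓ : Set (WithLp 2 (L2 ℓ × L2 ℓ))) := by
    have : (H1 ℓ : Set (WithLp 2 (L2 ℓ × L2 ℓ))) =
        ⋂ φ : {φ : ℝ → ℝ // ContDiff ℝ ∞ φ ∧ HasCompactSupport φ ∧ tsupport φ ⊆ Ioo 0 ℓ},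
          {p : WithLp 2 (L2 ℓ × L2 ℓ) |
            ⟪(memLp_test ℓ (φ.2.1.continuous_deriv (by simp)) φ.2.2.1.deriv).toLp _, p.fst⟫_ℝ =
              - ⟪(memLp_test ℓ φ.2.1.continuous φ.2.2.1).toLp _, p.snd⟫_ℝ} := by
      ext p
      simp only [mem_iInter, mem_ofPred_eq, SetLike.mem_coe]
      change HasWeakDerivOn 0 ℓ p.fst p.snd ↔ _
      rw [hasWeakDerivOn_L2_iff]
      constructor
      · intro h φ
        rw [← integral_test, ← integral_test]
        exact h φ φ.2.1 φ.2.2.1 φ.2.2.2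
      · intro h φ h1 h2 h3
        have := h ⟨φ, h1, h2, h3⟩
        rwa [← integral_test, ← integral_test] at this
    rw [this]
    refine isClosed_iInter fun φ => isClosed_eq ?_ ?_
    · exact continuous_const.inner (by fun_prop)
    · exact (continuous_const.inner (by fun_prop)).neg
  exact completeSpace_coe_iff_isComplete.2 hcl.isComplete

/-- The embedding of `H¹(0, ℓ)` into `L²(0, ℓ)`. -/
def toL2 {ℓ : ℝ} (u : H1 ℓ) : L2 ℓ := (u : WithLp 2 (L2 ℓ × L2 ℓ)).fst

/-- `c` is the continuous representative on `[0, ℓ]` of the function `u ∈ H¹(0, ℓ)`. -/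
def IsH1Rep {ℓ : ℝ} (u : H1 ℓ) (c : ℝ → ℝ) : Prop :=
  ContinuousOn c (Icc 0 ℓ) ∧ ∀ᵐ x ∂(volume.restrict (Ioo 0 ℓ)), toL2 u x = c x

/-- `u ∈ W^{k,∞}(0, T; X)` with norm at most `C`, that is, the weak time derivatives of `u` up to
order `k` exist and are essentially bounded by `C` in the norm of `X`. -/
def BoundedInWkInfty {X : Type*} [NormedAddCommGroup X] [NormedSpace ℝ X] (k : ℕ) (T C : ℝ)
    (u : ℝ → X) : Prop :=
  ∃ d : ℕ → ℝ → X, d 0 = u ∧ (∀ j < k, HasWeakDerivOn 0 T (d j) (d (j + 1))) ∧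
    ∀ j ≤ k, AEStronglyMeasurable (d j) (volume.restrict (Ioo 0 T)) ∧
      ∀ᵐ t ∂(volume.restrict (Ioo 0 T)), ‖d j t‖ ≤ C

/-! ## The gas flow problem on a pipe -/

/-- Mass flux `m = a ρ w`. -/
def massFlux (a r v : ℝ) : ℝ := a * r * v

/-- Total specific enthalpy `h = ε² w² / 2 + P'(ρ)`. -/
def enthalpy (P : ℝ → ℝ) (ε r v : ℝ) : ℝ := ε ^ 2 * v ^ 2 / 2 + deriv P r

/-- Classical solutions `(ρ, w)` on `[0, T] × [0, ℓ]` of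
`a ∂_τ ρ + ∂_x m = 0` and `ε² ∂_τ w + ∂_x h = - γ |w| w`, with boundary values `hL`, `hR` of the
enthalpy at `x = 0` and `x = ℓ`. Here `R`, `W` are the curves in `H¹(0, ℓ)` that are given by the
functions `ρ τ`, `w τ`; time derivatives are taken in `L²(0, ℓ)`. -/
structure IsClassicalSolution (P : ℝ → ℝ) (ε γ a ℓ T : ℝ) (hL hR : ℝ → ℝ)
    (ρ w : ℝ → ℝ → ℝ) (R W : ℝ → H1 ℓ) : Prop where
  rep_density : ∀ τ ∈ Icc 0 T, IsH1Rep (R τ) (ρ τ)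
  rep_velocity : ∀ τ ∈ Icc 0 T, IsH1Rep (W τ) (w τ)
  continuous_density : ContinuousOn R (Icc 0 T)
  continuous_velocity : ContinuousOn W (Icc 0 T)
  contDiff_density : ContDiffOn ℝ 1 (fun τ => toL2 (R τ)) (Icc 0 T)
  contDiff_velocity : ContDiffOn ℝ 1 (fun τ => toL2 (W τ)) (Icc 0 T)
  density_pos : ∀ τ ∈ Icc 0 T, ∀ x ∈ Icc 0 ℓ, 0 < ρ τ x
  mass : ∀ τ ∈ Ioc 0 T, ∃ mx : ℝ → ℝ,
    HasWeakDerivOn 0 ℓ (fun x => massFlux a (ρ τ x) (w τ x)) mx ∧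
    ∀ᵐ x ∂(volume.restrict (Ioo 0 ℓ)),
      a * derivWithin (fun s => toL2 (R s)) (Icc 0 T) τ x + mx x = 0
  momentum : ∀ τ ∈ Ioc 0 T, ∃ hx : ℝ → ℝ,
    HasWeakDerivOn 0 ℓ (fun x => enthalpy P ε (ρ τ x) (w τ x)) hx ∧
    ∀ᵐ x ∂(volume.restrict (Ioo 0 ℓ)),
      ε ^ 2 * derivWithin (fun s => toL2 (W s)) (Icc 0 T) τ x + hx x = - γ * |w τ x| * w τ x
  boundary_left : ∀ τ ∈ Ioc 0 T, enthalpy P ε (ρ τ 0) (w τ 0) = hL τ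
  boundary_right : ∀ τ ∈ Ioc 0 T, enthalpy P ε (ρ τ ℓ) (w τ ℓ) = hR τ

/-! ## The discretization -/

/-- The grid point `x_i = i h`, where `h = ℓ / M`. -/
def node (ℓ : ℝ) (M i : ℕ) : ℝ := i * (ℓ / M)

/-- The function in `Q_h = P₀(T_h)` with value `q i` on the `i`-th element (`i = 0, …, M - 1`). -/
def p0 (ℓ : ℝ) {M : ℕ} (q : Fin M → ℝ) (x : ℝ) : ℝ :=
  ∑ i : Fin M, (Ioo (node ℓ M i) (node ℓ M ((i : ℕ) + 1))).indicator (fun _ => q i) x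

/-- The function in `R_h = P₁(T_h) ∩ H¹(0, ℓ)` with nodal values `r i` (`i = 0, …, M`), as a
combination of the hat functions. -/
def p1 (ℓ : ℝ) {M : ℕ} (r : Fin (M + 1) → ℝ) (x : ℝ) : ℝ :=
  ∑ i : Fin (M + 1), r i * max 0 (1 - |x - node ℓ M i| / (ℓ / M))

/-- Discrete velocity `w_h = m_h / (a ρ_h)`. -/
def discreteVelocity (a ℓ : ℝ) {M : ℕ} (q : Fin M → ℝ) (r : Fin (M + 1) → ℝ) (x : ℝ) : ℝ :=
  p1 ℓ r x / (a * p0 ℓ q x)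

/-- The set of admissible states `(ρ, w)`:
`2 ρmin / 3 ≤ ρ ≤ 3 ρmax / 2` and `-3 wmax / 2 ≤ w ≤ 3 wmax / 2` almost everywhere on `(0, ℓ)`. -/
def IsAdmissibleState (ℓ ρmin ρmax wmax : ℝ) (r v : ℝ → ℝ) : Prop :=
  ∀ᵐ x ∂(volume.restrict (Ioo 0 ℓ)),
    2 * ρmin / 3 ≤ r x ∧ r x ≤ 3 * ρmax / 2 ∧ -(3 * wmax / 2) ≤ v x ∧ v x ≤ 3 * wmax / 2

/-- Solutions of the fully discrete scheme on a mesh with `M` elements and with `N` time steps of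
size `T / N`: `ρh n`, `mh n` are the coefficients of `ρ_hⁿ ∈ Q_h`, `m_hⁿ ∈ R_h`, and `ρ0`, `m0` are
the initial density and mass flux. -/
structure IsDiscreteSolution (P : ℝ → ℝ) (ε γ a ℓ T : ℝ) (hL hR : ℝ → ℝ) (ρ0 m0 : ℝ → ℝ)
    (M N : ℕ) (ρh : Fin (N + 1) → Fin M → ℝ) (mh : Fin (N + 1) → Fin (M + 1) → ℝ) : Prop where
  /-- `ρ_h⁰` is the `L²`-orthogonal projection of `ρ0` onto `Q_h`. -/
  init_density : ∀ q : Fin M → ℝ,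
    ∫ x in (0 : ℝ)..ℓ, p0 ℓ (ρh 0) x * p0 ℓ q x = ∫ x in (0 : ℝ)..ℓ, ρ0 x * p0 ℓ q x
  /-- `m_h⁰` is the piecewise linear interpolant of `m0`. -/
  init_flux : ∀ i : Fin (M + 1), mh 0 i = m0 (node ℓ M i)
  mass : ∀ (n : Fin N) (q : Fin M → ℝ),
    (∫ x in (0 : ℝ)..ℓ,
        a * ((p0 ℓ (ρh n.succ) x - p0 ℓ (ρh n.castSucc) x) / (T / N)) * p0 ℓ q x)
      + ∫ x in (0 : ℝ)..ℓ, deriv (p1 ℓ (mh n.succ)) x * p0 ℓ q x = 0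
  momentum : ∀ (n : Fin N) (r : Fin (M + 1) → ℝ),
    (∫ x in (0 : ℝ)..ℓ,
        ε ^ 2 * ((discreteVelocity a ℓ (ρh n.succ) (mh n.succ) x
          - discreteVelocity a ℓ (ρh n.castSucc) (mh n.castSucc) x) / (T / N)) * p1 ℓ r x)
      - (∫ x in (0 : ℝ)..ℓ,
          enthalpy P ε (p0 ℓ (ρh n.succ) x) (discreteVelocity a ℓ (ρh n.succ) (mh n.succ) x)
            * deriv (p1 ℓ r) x)
      + (hR ((((n : ℕ) : ℝ) + 1) * (T / N)) * p1 ℓ r ℓ - hL ((((n : ℕ) : ℝ) + 1) * (T / N)) * p1 ℓ r 0)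
      + (∫ x in (0 : ℝ)..ℓ,
          γ * |discreteVelocity a ℓ (ρh n.succ) (mh n.succ) x|
            * discreteVelocity a ℓ (ρh n.succ) (mh n.succ) x * p1 ℓ r x) = 0

/-- All states `(ρ_hⁿ, w_hⁿ)`, `0 ≤ n ≤ N`, are admissible. -/
def IsAdmissibleDiscrete (a ℓ ρmin ρmax wmax : ℝ) {M N : ℕ} (ρh : Fin (N + 1) → Fin M → ℝ)
    (mh : Fin (N + 1) → Fin (M + 1) → ℝ) : Prop :=
  ∀ n, IsAdmissibleState ℓ ρmin ρmax wmax (p0 ℓ (ρh n)) (discreteVelocity a ℓ (ρh n) (mh n))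

end

end PipeFlow

open PipeFlow

namespace PipeFlow

/-! ## Weak derivatives and primitives -/

/-! The proof is a relative energy argument: the discrete solution is compared with a reference
state built from the exact one, and a single estimate yields both the error bound and the existence
of the discrete solution.

Reference states. At every time level take the cell means `R` of the density and the nodal
interpolant `m` of the mass flux, with velocity `W = m / (a R)`. They satisfy the scheme up to
residuals of size `Δτ + h` in `L²` (`Snapshots.referenceStates`): `f` in the mass balance, and in
the momentum balance `ε² fa + γ fb` tested with functions and `g`, the enthalpy interpolation error,
tested with derivatives. The last one is the delicate one, since moving the derivative to `g` would
cost its smallness. But the mass balance turns the derivative of the flux error into `-f` minus `a`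
times the time difference of the density error. Hence `g` is handled by summation by parts in time:
the energy is modified by `-g (ρ_h - R)`, and only the increment of `g` over one step enters the
estimate. That increment must be `Δτ` times the spatial error, which is what the mixed bound in
`Close` provides.

Stability. The subsonic condition makes `P(ρ) + ε² ρ w² / 2` convex in `(ρ, w)`. Its Bregman
distance controls the squared density error plus `ε²` times the squared velocity error
(`PressureLaw.relEnergy_coercive`). The implicit Euler step leaves a convexity remainder of
favourable sign (`PressureLaw.relEnergy_step`). Friction contributes the dissipation `(|w| + |W|) (w
- W)²`, up to a density error; it bounds the cube of the velocity error and does not depend on `ε`,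
so it gives the `L³` estimate of the flux even for `ε = 0`. `PressureLaw.error_step` combines these
pointwise, and a discrete Gronwall argument gives `FlowBounds.error_bound`. Only the upper bound of
`ε` enters the constants.

One time step. The mass balance gives the new density explicitly in terms of the new flux, so the
flux is the only unknown. For small `Δτ` the momentum residual is strictly monotone in the flux on
admissible states (`FlowBounds.step_monotone_pointwise`): the convexity of the energy, divided by
`Δτ`, absorbs the density defect of the friction. This gives uniqueness (`FlowBounds.step_unique`).

Existence. On the compact convex set of fluxes for which flux and density stay within `δ` of the
reference state, the monotone variational inequality has a solution (`exists_variational_solution`).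
Tested with the reference flux, it gives the one inequality that the error estimate needs, so the
error bound holds before the equation is known. The density error is then small in the maximum norm
because `h` is bounded below by `c₁ Δτ`. For the flux error, the slopes are bounded in `L²` and the
`L³` norm tends to zero, which excludes large nodal values (`le_integral_cube_of_node`). Hence the
constraints are inactive for small `Δτ` and the inequality is an equation
(`FlowBounds.exists_discrete`). By uniqueness the error bound passes to every admissible discrete
solution, and the interpolation errors lead back to the exact solution. -/

lemma integral_deriv_mul_primitive {φ v : ℝ → ℝ} {a b : ℝ}
    (hφ : AbsolutelyContinuousOnInterval φ a b) (hv : IntervalIntegrable v volume a b) :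
    ∫ x in a..b, deriv φ x * (∫ t in a..x, v t)
      = φ b * (∫ t in a..b, v t) - ∫ x in a..b, φ x * v x := by
  have hU : AbsolutelyContinuousOnInterval (fun x => ∫ t in a..x, v t) a b :=
    hv.absolutelyContinuousOnInterval_intervalIntegral (by simp)
  have h := hU.integral_mul_deriv_eq_deriv_mul hφ
  simp only [intervalIntegral.integral_same, zero_mul, sub_zero] at h
  have e1 : ∫ x in a..b, deriv (fun x => ∫ t in a..x, v t) x * φ x = ∫ x in a..b, φ x * v x := by
    apply intervalIntegral.integral_congr_ae
    filter_upwards [hv.ae_hasDerivAt_integral] with x hx hx'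
    rw [(hx (uIoc_subset_uIcc hx') a (by simp)).deriv, mul_comm]
  rw [e1] at h
  rw [mul_comm (φ b), ← h]
  exact intervalIntegral.integral_congr fun x _ => mul_comm _ _

/-- A function whose weak derivative vanishes is almost everywhere constant. -/
lemma ae_const_of_weakDeriv_zero {α β : ℝ} (hαβ : α < β) {u : ℝ → ℝ}
    (hu : LocallyIntegrableOn u (Ioo α β))
    (h : ∀ φ : ℝ → ℝ, ContDiff ℝ ∞ φ → HasCompactSupport φ → tsupport φ ⊆ Ioo α β →
      ∫ t in Ioo α β, deriv φ t * u t = 0) :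
    ∃ c, ∀ᵐ t ∂(volume.restrict (Ioo α β)), u t = c := by
  -- A reference test function of unit mass, supported well inside the interval; its pairing with
  -- `u` is the constant.
  let θb : ContDiffBump ((α + β) / 2) := ⟨(β - α) / 8, (β - α) / 4, by linarith, by linarith⟩
  set θ : ℝ → ℝ := θb.normed volume with hθ
  have hθc : ContDiff ℝ ∞ θ := θb.contDiff_normed
  have hθs : HasCompactSupport θ := θb.hasCompactSupport_normed
  have hθt : tsupport θ ⊆ Ioo α β := by
    rw [hθ, θb.tsupport_normed_eq, Real.closedBall_eq_Icc]
    intro x hx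
    have : θb.rOut = (β - α) / 4 := rfl
    rw [this] at hx
    constructor <;> linarith [hx.1, hx.2]
  have hθi : ∫ x, θ x = 1 := θb.integral_normed
  have hint : ∀ ψ : ℝ → ℝ, Continuous ψ → HasCompactSupport ψ → tsupport ψ ⊆ Ioo α β →
      Integrable (fun x => ψ x * u x) (volume.restrict (Ioo α β)) := by
    intro ψ h1 h2 h3
    have hK : IntegrableOn u (tsupport ψ) :=
      hu.integrableOn_compact_subset h3 h2
    obtain ⟨C, hC⟩ := h1.bounded_above_of_compact_support h2
    have hK2 : IntegrableOn (fun x => ψ x * u x) (tsupport ψ) :=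
      Integrable.bdd_mul hK h1.aestronglyMeasurable (Filter.Eventually.of_forall hC)
    refine (IntegrableOn.integrable_of_forall_notMem_eq_zero hK2 ?_).integrableOn
    intro x hx
    simp [image_eq_zero_of_notMem_tsupport hx]
  refine ⟨∫ t in Ioo α β, θ t * u t, ?_⟩
  set c := ∫ t in Ioo α β, θ t * u t with hc
  have hloc : LocallyIntegrableOn (fun x => u x - c) (Ioo α β) :=
    hu.sub ((locallyIntegrable_const c).locallyIntegrableOn _)
  have key := isOpen_Ioo.ae_eq_zero_of_integral_contDiff_smul_eq_zero hloc ?_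
  · rw [ae_restrict_iff' measurableSet_Ioo]
    filter_upwards [key] with x hx hx'
    linarith [hx hx']
  intro ψ h1 h2 h3
  -- Subtracting `I θ` from `ψ` leaves a function of zero mean. Its primitive has compact support,
  -- so it is an admissible test function in `h`.
  set I := ∫ x, ψ x with hI
  set g : ℝ → ℝ := fun x => ψ x - I * θ x with hg
  have hgc : ContDiff ℝ ∞ g := h1.sub (contDiff_const.mul hθc)
  have hgi : ∫ x, g x = 0 := by
    rw [hg, integral_sub (h1.continuous.integrable_of_hasCompactSupport h2)
      ((hθc.continuous.integrable_of_hasCompactSupport hθs).const_mul _), integral_const_mul, hθi]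
    simp [hI]
  set K := tsupport ψ ∪ tsupport θ with hK
  have hKc : IsCompact K := IsCompact.union h2 hθs
  have hKne : K.Nonempty := by
    by_contra hne
    rw [not_nonempty_iff_eq_empty] at hne
    have : θ = 0 := by
      rw [← tsupport_eq_empty_iff]
      exact (union_empty_iff.1 hne).2
    simp [this] at hθi
  have hKs : K ⊆ Ioo α β := union_subset h3 hθt
  have hs := hKs (hKc.sInf_mem hKne)
  have ht := hKs (hKc.sSup_mem hKne)
  set s := sInf K
  set t := sSup K
  have hKI : K ⊆ Icc s t := fun x hx => ⟨csInf_le hKc.bddBelow hx, le_csSup hKc.bddAbove hx⟩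
  have hg0 : ∀ x, x ∉ Icc s t → g x = 0 := by
    intro x hx
    have h1 : x ∉ tsupport ψ := fun h => hx (hKI (Or.inl h))
    have h2 : x ∉ tsupport θ := fun h => hx (hKI (Or.inr h))
    simp [hg, image_eq_zero_of_notMem_tsupport h1, image_eq_zero_of_notMem_tsupport h2]
  have hst : s ≤ t := by
    obtain ⟨x, hx⟩ := hKne
    exact (hKI hx).1.trans (hKI hx).2
  have hgst : ∫ x in s..t, g x = 0 := by
    rw [intervalIntegral.integral_of_le hst, ← integral_Icc_eq_integral_Ioc, ← hgi]
    exact setIntegral_eq_integral_of_forall_compl_eq_zero hg0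
  set φ : ℝ → ℝ := fun x => ∫ y in s..x, g y with hφ
  have hφd : ∀ x, HasDerivAt φ (g x) x := fun x =>
    intervalIntegral.integral_hasDerivAt_right (hgc.continuous.intervalIntegrable _ _)
      (hgc.continuous.stronglyMeasurableAtFilter _ _) hgc.continuous.continuousAt
  have hφd' : deriv φ = g := funext fun x => (hφd x).deriv
  have hφc : ContDiff ℝ ∞ φ := by
    rw [contDiff_infty_iff_deriv]
    exact ⟨fun x => (hφd x).differentiableAt, by rw [hφd']; exact hgc⟩
  have hφ0 : ∀ x, x ∉ Icc s t → φ x = 0 := by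
    intro x hx
    rcases lt_or_ge x s with h | h
    · simp only [hφ]
      rw [intervalIntegral.integral_symm, neg_eq_zero]
      rw [intervalIntegral.integral_congr_ae (g := fun _ => (0 : ℝ))]
      · simp
      · have : ∀ᵐ y : ℝ, y ≠ s := by
          simp [ae_iff]
        filter_upwards [this] with y hy hy'
        rw [uIoc_of_le h.le] at hy'
        exact hg0 y fun hh => hy (le_antisymm hy'.2 hh.1)
    · have hxt : t < x := by
        by_contra hh
        exact hx ⟨h, not_lt.1 hh⟩
      simp only [hφ]
      rw [← intervalIntegral.integral_add_adjacent_intervals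
        (hgc.continuous.intervalIntegrable s t) (hgc.continuous.intervalIntegrable t x), hgst,
        zero_add]
      rw [intervalIntegral.integral_congr_ae (g := fun _ => (0 : ℝ))]
      · simp
      · refine Filter.Eventually.of_forall fun y hy' => ?_
        rw [uIoc_of_le hxt.le] at hy'
        exact hg0 y fun hh => (not_lt.2 hh.2) hy'.1
  have hφt : tsupport φ ⊆ Icc s t := by
    refine closure_minimal ?_ isClosed_Icc
    intro x hx
    by_contra hh
    exact hx (hφ0 x hh)
  have hφs : HasCompactSupport φ := isCompact_Icc.of_isClosed_subset (isClosed_tsupport _) hφt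
  have hsub : Icc s t ⊆ Ioo α β := fun x hx => ⟨hs.1.trans_le hx.1, hx.2.trans_lt ht.2⟩
  have main := h φ hφc hφs (hφt.trans hsub)
  rw [hφd'] at main
  have i1 := hint ψ h1.continuous h2 h3
  have i2 := hint θ hθc.continuous hθs hθt
  have e1 : ∫ t in Ioo α β, g t * u t = (∫ t in Ioo α β, ψ t * u t) - I * c := by
    rw [hc, ← integral_const_mul, ← integral_sub i1 (i2.const_mul _)]
    refine integral_congr_ae (Filter.Eventually.of_forall fun x => ?_)
    simp only [hg]; ring
  have e2 : ∫ x, ψ x • (u x - c) = ∫ x in Ioo α β, (ψ x * u x - c * ψ x) := by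
    rw [← setIntegral_eq_integral_of_forall_compl_eq_zero (s := Ioo α β)]
    · refine integral_congr_ae (Filter.Eventually.of_forall fun x => ?_)
      simp only [smul_eq_mul]; ring
    · intro x hx
      have : x ∉ tsupport ψ := fun hh => hx (h3 hh)
      simp [image_eq_zero_of_notMem_tsupport this]
  have e3 : ∫ x in Ioo α β, ψ x = I := by
    apply setIntegral_eq_integral_of_forall_compl_eq_zero
    intro x hx
    exact image_eq_zero_of_notMem_tsupport fun hh => hx (h3 hh)
  have i3 : Integrable ψ (volume.restrict (Ioo α β)) :=
    (h1.continuous.integrable_of_hasCompactSupport h2).restrict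
  rw [e2, integral_sub i1 (i3.const_mul _), integral_const_mul, e3]
  rw [e1] at main
  linarith

/-- A function with an integrable weak derivative is almost everywhere a primitive of it. -/
lemma HasWeakDerivOn.ae_eq_primitive {α β : ℝ} (hαβ : α < β) {u v : ℝ → ℝ}
    (h : HasWeakDerivOn α β u v) (hv : IntegrableOn v (Ioo α β)) :
    ∃ c, ∀ᵐ t ∂(volume.restrict (Ioo α β)), u t = c + ∫ s in α..t, v s := by
  have hvi : IntervalIntegrable v volume α β := by
    rw [intervalIntegrable_iff_integrableOn_Ioo_of_le hαβ.le]; exact hv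
  have hUc : ContinuousOn (fun t => ∫ s in α..t, v s) (Icc α β) := by
    have := (hvi.absolutelyContinuousOnInterval_intervalIntegral (c := α) (by simp)).continuousOn
    rwa [uIcc_of_le hαβ.le] at this
  have hUi : IntegrableOn (fun t => ∫ s in α..t, v s) (Ioo α β) :=
    (hUc.integrableOn_compact isCompact_Icc).mono_set Ioo_subset_Icc_self
  have key : ∃ c, ∀ᵐ t ∂(volume.restrict (Ioo α β)), (u t - ∫ s in α..t, v s) = c := by
    refine ae_const_of_weakDeriv_zero hαβ (h.1.sub hUi.locallyIntegrableOn) ?_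
    intro φ h1 h2 h3
    have hw := h.2.2 φ h1 h2 h3
    have hφd : Continuous (deriv φ) := h1.continuous_deriv (by simp)
    have hβ : φ β = 0 := image_eq_zero_of_notMem_tsupport fun hh => lt_irrefl _ (h3 hh).2
    have hac : AbsolutelyContinuousOnInterval φ α β :=
      (h1.of_le (by simp)).contDiffOn.absolutelyContinuousOnInterval
    have hib := integral_deriv_mul_primitive hac hvi
    rw [hβ, zero_mul, zero_sub, intervalIntegral.integral_of_le hαβ.le,
      intervalIntegral.integral_of_le hαβ.le, integral_Ioc_eq_integral_Ioo,
      integral_Ioc_eq_integral_Ioo] at hib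
    simp only [smul_eq_mul] at hw
    obtain ⟨C, hC⟩ := hφd.bounded_above_of_compact_support h2.deriv
    have i2 : Integrable (fun x => deriv φ x * ∫ s in α..x, v s) (volume.restrict (Ioo α β)) :=
      Integrable.bdd_mul hUi hφd.aestronglyMeasurable (Filter.Eventually.of_forall hC)
    have i1 : Integrable (fun x => deriv φ x * u x) (volume.restrict (Ioo α β)) := by
      have hK : IntegrableOn u (tsupport φ) := h.1.integrableOn_compact_subset h3 h2
      have hK2 : IntegrableOn (fun x => deriv φ x * u x) (tsupport φ) :=
        Integrable.bdd_mul hK hφd.aestronglyMeasurable (Filter.Eventually.of_forall hC)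
      refine (IntegrableOn.integrable_of_forall_notMem_eq_zero hK2 ?_).integrableOn
      intro x hx
      have : x ∉ tsupport (deriv φ) := fun hh => hx (tsupport_deriv_subset hh)
      simp [image_eq_zero_of_notMem_tsupport this]
    simp only [mul_sub]
    rw [integral_sub i1 i2, hw, hib]
    ring
  obtain ⟨c, hc⟩ := key
  exact ⟨c, by filter_upwards [hc] with x hx; linarith⟩

/-- A function continuous on `[α, β]` with an integrable weak derivative is a primitive of it. -/
lemma HasWeakDerivOn.sub_eq_integral {α β : ℝ} {u v : ℝ → ℝ}
    (h : HasWeakDerivOn α β u v) (hv : IntegrableOn v (Ioo α β)) (hu : ContinuousOn u (Icc α β))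
    {x y : ℝ} (hx : x ∈ Icc α β) (hy : y ∈ Icc α β) :
    u y - u x = ∫ s in x..y, v s := by
  rcases eq_or_lt_of_le (hx.1.trans hx.2) with rfl | hαβ
  · have h1 : x = α := le_antisymm hx.2 hx.1
    have h2 : y = α := le_antisymm hy.2 hy.1
    simp [h1, h2]
  obtain ⟨c, hc⟩ := h.ae_eq_primitive hαβ hv
  have hvi : IntervalIntegrable v volume α β := by
    rw [intervalIntegrable_iff_integrableOn_Ioo_of_le hαβ.le]; exact hv
  have hUc : ContinuousOn (fun t => c + ∫ s in α..t, v s) (Icc α β) := by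
    have := (hvi.absolutelyContinuousOnInterval_intervalIntegral (c := α) (by simp)).continuousOn
    rw [uIcc_of_le hαβ.le] at this
    exact continuousOn_const.add this
  have hae : u =ᵐ[volume.restrict (Icc α β)] fun t => c + ∫ s in α..t, v s := by
    rw [← restrict_Ioo_eq_restrict_Icc]; exact hc
  -- Both sides are continuous, so equality almost everywhere is equality at every point, endpoints
  -- included.
  have heq : EqOn u (fun t => c + ∫ s in α..t, v s) (Icc α β) :=
    Measure.eqOn_Icc_of_ae_eq volume hαβ.ne hae hu hUc
  have hvs : ∀ z ∈ Icc α β, IntervalIntegrable v volume α z := fun z hz =>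
    hvi.mono_set (by rw [uIcc_of_le hαβ.le, uIcc_of_le hz.1]; exact Icc_subset_Icc_right hz.2)
  rw [heq hx, heq hy]
  simp only [add_sub_add_left_eq_sub]
  rw [intervalIntegral.integral_interval_sub_left (hvs y hy) (hvs x hx)]

/-- Reduces weak derivatives of Banach space valued curves to the scalar case; norms are recovered
later with norming functionals. -/
lemma HasWeakDerivOn.clm_comp {X : Type*} [NormedAddCommGroup X] [NormedSpace ℝ X]
    [CompleteSpace X] {α β : ℝ} {u v : ℝ → X} (h : HasWeakDerivOn α β u v) (f : X →L[ℝ] ℝ) :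
    HasWeakDerivOn α β (fun t => f (u t)) (fun t => f (v t)) := by
  have hli : ∀ w : ℝ → X, LocallyIntegrableOn w (Ioo α β) →
      LocallyIntegrableOn (fun t => f (w t)) (Ioo α β) := by
    intro w hw x hx
    obtain ⟨s, hs, hi⟩ := hw x hx
    exact ⟨s, hs, f.integrable_comp hi⟩
  have hint : ∀ w : ℝ → X, LocallyIntegrableOn w (Ioo α β) → ∀ ψ : ℝ → ℝ, Continuous ψ →
      HasCompactSupport ψ → tsupport ψ ⊆ Ioo α β →
      Integrable (fun x => ψ x • w x) (volume.restrict (Ioo α β)) := by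
    intro w hw ψ h1 h2 h3
    have hK : IntegrableOn w (tsupport ψ) := hw.integrableOn_compact_subset h3 h2
    obtain ⟨C, hC⟩ := h1.bounded_above_of_compact_support h2
    have hK2 : IntegrableOn (fun x => ψ x • w x) (tsupport ψ) :=
      Integrable.bdd_smul hK C h1.aestronglyMeasurable (Filter.Eventually.of_forall hC)
    refine (IntegrableOn.integrable_of_forall_notMem_eq_zero hK2 ?_).integrableOn
    intro x hx
    simp [image_eq_zero_of_notMem_tsupport hx]
  refine ⟨hli u h.1, hli v h.2.1, fun φ h1 h2 h3 => ?_⟩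
  have e := congrArg f (h.2.2 φ h1 h2 h3)
  rw [map_neg, ← f.integral_comp_comm, ← f.integral_comp_comm] at e
  · simpa using e
  · exact hint v h.2.1 φ h1.continuous h2 h3
  · exact hint u h.1 _ (h1.continuous_deriv (by simp)) h2.deriv
      ((tsupport_deriv_subset).trans h3)


/-! ## Pointwise inequalities for the energy and the friction -/

/-- Quantitative bounds for a pressure potential on the interval `[α, β]` of densities. -/
structure PressureLaw (P : ℝ → ℝ) (α β κ L : ℝ) : Prop where
  pos : 0 < α
  le : α ≤ β
  kappa_pos : 0 < κ
  L_pos : 0 < L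
  hasDerivAt : ∀ r ∈ Icc α β, HasDerivAt P (deriv P r) r
  hasDerivAt_deriv : ∀ r ∈ Icc α β, HasDerivAt (deriv P) (deriv (deriv P) r) r
  lower : ∀ r ∈ Icc α β, κ ≤ r * deriv (deriv P) r
  upper : ∀ r ∈ Icc α β, |deriv (deriv P) r| ≤ L
  lipschitz : ∀ r ∈ Icc α β, ∀ s ∈ Icc α β,
    |deriv (deriv P) r - deriv (deriv P) s| ≤ L * |r - s|

section Pressure

variable {P : ℝ → ℝ} {α β κ L : ℝ}

lemma PressureLaw.uIcc_subset (_hP : PressureLaw P α β κ L) {r s : ℝ} (hr : r ∈ Icc α β)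
    (hs : s ∈ Icc α β) : uIcc r s ⊆ Icc α β :=
  uIcc_subset_Icc hr hs

lemma PressureLaw.exists_deriv_sub (hP : PressureLaw P α β κ L) {r s : ℝ} (hr : r ∈ Icc α β)
    (hs : s ∈ Icc α β) :
    ∃ ξ ∈ uIcc r s, deriv P r - deriv P s = deriv (deriv P) ξ * (r - s) := by
  have main : ∀ x ∈ Icc α β, ∀ y ∈ Icc α β, x < y →
      ∃ ξ ∈ uIcc x y, deriv P y - deriv P x = deriv (deriv P) ξ * (y - x) := by
    intro x hx y hy hxy
    have hsub : Icc x y ⊆ Icc α β := Icc_subset_Icc hx.1 hy.2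
    obtain ⟨ξ, hξ, h⟩ := exists_hasDerivAt_eq_slope (deriv P) (deriv (deriv P)) hxy
      (fun z hz => (hP.hasDerivAt_deriv z (hsub hz)).continuousAt.continuousWithinAt)
      (fun z hz => hP.hasDerivAt_deriv z (hsub (Ioo_subset_Icc_self hz)))
    refine ⟨ξ, by rw [uIcc_of_le hxy.le]; exact Ioo_subset_Icc_self hξ, ?_⟩
    rw [h]
    field_simp [sub_ne_zero.2 hxy.ne']
  rcases lt_trichotomy r s with h | h | h
  · obtain ⟨ξ, h1, h2⟩ := main r hr s hs h
    exact ⟨ξ, h1, by linarith⟩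
  · exact ⟨r, by simp, by simp [h]⟩
  · obtain ⟨ξ, h1, h2⟩ := main s hs r hr h
    exact ⟨ξ, by rwa [uIcc_comm], by linarith⟩

/-- Rolle's theorem for the Taylor remainder minus a suitable multiple of the square, followed by
the mean value theorem for `P'`. -/
lemma PressureLaw.exists_taylor (hP : PressureLaw P α β κ L) {r s : ℝ} (hr : r ∈ Icc α β)
    (hs : s ∈ Icc α β) :
    ∃ ξ ∈ uIcc r s, P r - P s - deriv P s * (r - s) = deriv (deriv P) ξ * (r - s) ^ 2 / 2 := by
  rcases eq_or_ne r s with h | h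
  · exact ⟨r, by simp, by simp [h]⟩
  have hne : r - s ≠ 0 := sub_ne_zero.2 h
  -- Chosen so that the auxiliary function vanishes at `r` as well as at `s`.
  set A := (P r - P s - deriv P s * (r - s)) / (r - s) ^ 2 with hA
  set φ : ℝ → ℝ := fun t => P t - P s - deriv P s * (t - s) - A * (t - s) ^ 2 with hφ
  have hφ' : ∀ t ∈ Icc α β, HasDerivAt φ (deriv P t - deriv P s - 2 * A * (t - s)) t := by
    intro t ht
    have h1 := ((hP.hasDerivAt t ht).sub_const (P s)).sub
      (((hasDerivAt_id t).sub_const s).const_mul (deriv P s))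
    have h2 := h1.sub ((((hasDerivAt_id t).sub_const s).pow 2).const_mul A)
    convert! h2 using 1
    simp; ring
  have hr0 : φ r = 0 := by
    simp only [hφ, hA]; field_simp; ring
  have hs0 : φ s = 0 := by simp [hφ]
  have hroll : ∃ t ∈ uIcc r s, t ≠ s ∧ deriv P t - deriv P s - 2 * A * (t - s) = 0 := by
    rcases lt_or_gt_of_ne h with h | h
    · have hsub : Icc r s ⊆ Icc α β := Icc_subset_Icc hr.1 hs.2
      obtain ⟨t, ht, h0⟩ := exists_hasDerivAt_eq_zero h
        (fun z hz => (hφ' z (hsub hz)).continuousAt.continuousWithinAt) (hr0.trans hs0.symm)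
        (fun z hz => hφ' z (hsub (Ioo_subset_Icc_self hz)))
      exact ⟨t, by rw [uIcc_of_le h.le]; exact Ioo_subset_Icc_self ht, ht.2.ne, h0⟩
    · have hsub : Icc s r ⊆ Icc α β := Icc_subset_Icc hs.1 hr.2
      obtain ⟨t, ht, h0⟩ := exists_hasDerivAt_eq_zero h
        (fun z hz => (hφ' z (hsub hz)).continuousAt.continuousWithinAt) (hs0.trans hr0.symm)
        (fun z hz => hφ' z (hsub (Ioo_subset_Icc_self hz)))
      exact ⟨t, by rw [uIcc_of_ge h.le]; exact Ioo_subset_Icc_self ht, ht.1.ne', h0⟩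
  obtain ⟨t, ht, hts, h0⟩ := hroll
  obtain ⟨ξ, hξ, h1⟩ := hP.exists_deriv_sub (hP.uIcc_subset hr hs ht) hs
  refine ⟨ξ, uIcc_subset_uIcc_right ht hξ, ?_⟩
  have hts' : t - s ≠ 0 := sub_ne_zero.2 hts
  have h2 : deriv (deriv P) ξ = 2 * A := by
    rw [h1] at h0
    have : (deriv (deriv P) ξ - 2 * A) * (t - s) = 0 := by linarith
    rcases mul_eq_zero.1 this with h | h
    · linarith
    · exact absurd h hts'
  rw [h2, hA]; field_simp

lemma PressureLaw.deriv_lipschitz (hP : PressureLaw P α β κ L) {r s : ℝ} (hr : r ∈ Icc α β)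
    (hs : s ∈ Icc α β) : |deriv P r - deriv P s| ≤ L * |r - s| := by
  obtain ⟨ξ, hξ, h⟩ := hP.exists_deriv_sub hr hs
  rw [h, abs_mul]
  exact mul_le_mul_of_nonneg_right (hP.upper ξ (hP.uIcc_subset hr hs hξ)) (abs_nonneg _)

/-- The difference quotients of `P'` are bounded below by those of `2κ (r - s) / (r + s)`. -/
lemma PressureLaw.deriv_slope (hP : PressureLaw P α β κ L) {r s : ℝ} (hr : r ∈ Icc α β)
    (hs : s ∈ Icc α β) :
    2 * κ * (r - s) ^ 2 ≤ (r + s) * ((deriv P r - deriv P s) * (r - s)) := by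
  have main : ∀ x ∈ Icc α β, ∀ y ∈ Icc α β, x ≤ y →
      2 * κ * ((y - x) / (y + x)) ≤ deriv P y - deriv P x := by
    intro x hx y hy hxy
    have hx0 : 0 < x := hP.pos.trans_le hx.1
    have hsub : Icc x y ⊆ Icc α β := Icc_subset_Icc hx.1 hy.2
    -- The comparison function vanishes at `t = x`, and its derivative is at most `κ / t`, the lower
    -- bound for `P''`.
    have hd : ∀ t ∈ Icc x y, HasDerivAt (fun t => deriv P t - 2 * κ * ((t - x) / (t + x)))
        (deriv (deriv P) t - 2 * κ * (2 * x / (t + x) ^ 2)) t := by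
      intro t ht
      have ht0 : 0 < t := hx0.trans_le ht.1
      have h1 := ((hasDerivAt_id t).sub_const x).div ((hasDerivAt_id t).add_const x)
        (by simp; linarith : id t + x ≠ 0)
      have h2 := (hP.hasDerivAt_deriv t (hsub ht)).sub (h1.const_mul (2 * κ))
      convert! h2 using 1
      simp only [id]; ring
    have hm : MonotoneOn (fun t => deriv P t - 2 * κ * ((t - x) / (t + x))) (Icc x y) := by
      apply monotoneOn_of_hasDerivWithinAt_nonneg (convex_Icc x y)
        (f' := fun t => deriv (deriv P) t - 2 * κ * (2 * x / (t + x) ^ 2))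
      · exact fun t ht => (hd t ht).continuousAt.continuousWithinAt
      · exact fun t ht => (hd t (interior_subset ht)).hasDerivWithinAt
      · intro t ht
        have ht' := interior_subset ht
        have ht0 : 0 < t := hx0.trans_le ht'.1
        have hl := hP.lower t (hsub ht')
        have h3 : κ / t ≤ deriv (deriv P) t := by
          rw [div_le_iff₀ ht0]; linarith
        -- This is `4 x t ≤ (t + x)²`.
        have h4 : 2 * κ * (2 * x / (t + x) ^ 2) ≤ κ / t := by
          rw [mul_div_assoc', div_le_div_iff₀ (by positivity) ht0]
          nlinarith [mul_nonneg hP.kappa_pos.le (sq_nonneg (t - x))]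
        linarith
    have := hm (left_mem_Icc.2 hxy) (right_mem_Icc.2 hxy) hxy
    simp at this
    linarith
  have hr0 : 0 < r := hP.pos.trans_le hr.1
  have hs0 : 0 < s := hP.pos.trans_le hs.1
  rcases le_total s r with h | h
  · have h1 := main s hs r hr h
    rw [mul_div_assoc', div_le_iff₀ (by linarith)] at h1
    nlinarith [sub_nonneg.2 h]
  · have h1 := main r hr s hs h
    rw [mul_div_assoc', div_le_iff₀ (by linarith)] at h1
    nlinarith [sub_nonneg.2 h]

/-- Strict monotonicity of the energy gradient on the set of admissible states. -/
lemma PressureLaw.energy_monotone (hP : PressureLaw P α β κ L) {εmax wmax ε : ℝ}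
    (hκ : κ = 4 * εmax ^ 2 * wmax ^ 2) (hε : 0 ≤ ε) (hεm : ε ≤ εmax)
    {r s w v : ℝ} (hr : r ∈ Icc α β) (hs : s ∈ Icc α β)
    (hw : |w| ≤ 3 * wmax / 2) (hv : |v| ≤ 3 * wmax / 2) :
    7 / 16 * (κ / β) * (r - s) ^ 2 ≤
      (enthalpy P ε r w - enthalpy P ε s v) * (r - s) + ε ^ 2 * ((w - v) * (r * w - s * v)) := by
  have hr0 : 0 < r := hP.pos.trans_le hr.1
  have hs0 : 0 < s := hP.pos.trans_le hs.1
  have hβ : 0 < β := hr0.trans_le hr.2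
  have h1 := hP.deriv_slope hr hs
  have hww : ((w + v) / 2) ^ 2 ≤ 9 / 4 * wmax ^ 2 := by
    have : |(w + v) / 2| ≤ 3 * wmax / 2 := by
      rw [abs_div, abs_two]
      have := abs_add_le w v
      linarith
    calc ((w + v) / 2) ^ 2 = |(w + v) / 2| ^ 2 := (sq_abs _).symm
      _ ≤ (3 * wmax / 2) ^ 2 := by gcongr
      _ = _ := by ring
  have hε2 : ε ^ 2 ≤ εmax ^ 2 := by gcongr
  -- The velocity bound `3 wmax / 2` and the factor `4` in `κ` give `9 / 16 < 1`. The gap `7 / 16`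
  -- is the strict monotonicity in the density.
  have h2 : ε ^ 2 * ((w + v) / 2) ^ 2 ≤ 9 / 16 * κ := by
    calc ε ^ 2 * ((w + v) / 2) ^ 2 ≤ εmax ^ 2 * (9 / 4 * wmax ^ 2) := by gcongr
      _ = _ := by rw [hκ]; ring
  set m := (r + s) / 2 with hm
  set z := (w + v) / 2 with hz
  have hm0 : 0 < m := by positivity
  have hmβ : m ≤ β := by rw [hm]; linarith [hr.2, hs.2]
  have h3 : κ * (r - s) ^ 2 ≤ m * ((deriv P r - deriv P s) * (r - s)) := by
    rw [hm]; linarith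
  have h4 : (enthalpy P ε r w - enthalpy P ε s v) * (r - s) + ε ^ 2 * ((w - v) * (r * w - s * v))
      = (deriv P r - deriv P s) * (r - s) + ε ^ 2 * (2 * z * (w - v) * (r - s) + m * (w - v) ^ 2) := by
    simp only [enthalpy, hz, hm]; ring
  -- Multiplying by the mean density `m` and completing the square in the velocity difference leaves
  -- a negative term `ε² z² (r - s)²`. `PressureLaw.deriv_slope` is stated with `r + s` so that it
  -- supplies exactly this factor `m`.
  have h5 : 7 / 16 * κ * (r - s) ^ 2 ≤ m * ((deriv P r - deriv P s) * (r - s) +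
      ε ^ 2 * (2 * z * (w - v) * (r - s) + m * (w - v) ^ 2)) := by
    have e : m * ((deriv P r - deriv P s) * (r - s) +
      ε ^ 2 * (2 * z * (w - v) * (r - s) + m * (w - v) ^ 2)) =
      m * ((deriv P r - deriv P s) * (r - s)) - (ε ^ 2 * z ^ 2) * (r - s) ^ 2
        + ε ^ 2 * (m * (w - v) + z * (r - s)) ^ 2 := by ring
    rw [e]
    have := mul_le_mul_of_nonneg_right h2 (sq_nonneg (r - s))
    have := mul_nonneg (sq_nonneg ε) (sq_nonneg (m * (w - v) + z * (r - s)))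
    linarith
  rw [h4]
  set Q := (deriv P r - deriv P s) * (r - s) +
      ε ^ 2 * (2 * z * (w - v) * (r - s) + m * (w - v) ^ 2)
  have hQ : 0 ≤ Q := by
    have : 0 ≤ m * Q := le_trans (by have := hP.kappa_pos; positivity) h5
    exact nonneg_of_mul_nonneg_right this hm0
  have h6 : 7 / 16 * κ * (r - s) ^ 2 ≤ β * Q := h5.trans (by gcongr)
  calc 7 / 16 * (κ / β) * (r - s) ^ 2 = (7 / 16 * κ * (r - s) ^ 2) / β := by ring
    _ ≤ Q := by rw [div_le_iff₀ hβ]; linarith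

end Pressure

/-! ### Monotonicity of the friction law -/

/-- The surplus is `(|w| - |v|)² (|w| + |v|) / 2`. The weight `|w| + |v|` vanishes where both
velocities do, so friction controls a cubic and not a quadratic quantity. -/
lemma abs_mul_self_monotone (w v : ℝ) :
    (|w| + |v|) * (w - v) ^ 2 / 2 ≤ (|w| * w - |v| * v) * (w - v) := by
  have e : (|w| * w - |v| * v) * (w - v) - (|w| + |v|) * (w - v) ^ 2 / 2
      = (|w| - |v|) * (w ^ 2 - v ^ 2) / 2 := by ring
  have : 0 ≤ (|w| - |v|) * (w ^ 2 - v ^ 2) := by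
    rw [← sq_abs w, ← sq_abs v]
    have : (|w| - |v|) * (|w| ^ 2 - |v| ^ 2) = (|w| - |v|) ^ 2 * (|w| + |v|) := by ring
    rw [this]; positivity
  linarith

lemma abs_mul_self_sub_le (w v : ℝ) :
    |(|w| * w - |v| * v)| ≤ (|w| + |v|) * |w - v| := by
  rcases abs_cases w with ⟨h1, h1'⟩ | ⟨h1, h1'⟩ <;> rcases abs_cases v with ⟨h2, h2'⟩ | ⟨h2, h2'⟩ <;>
  rcases abs_cases (w - v) with ⟨h3, h3'⟩ | ⟨h3, h3'⟩ <;> rw [h1, h2, h3, abs_le] <;>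
  constructor <;> nlinarith

/-- Monotonicity of the friction term with respect to the mass flux, up to a density error. -/
lemma friction_monotone {α B r s w v : ℝ} (hα : 0 < α) (hr : α ≤ r) (hs : α ≤ s)
    (hw : |w| ≤ B) (hv : |v| ≤ B) :
    α / 4 * ((|w| + |v|) * (w - v) ^ 2) - 2 * B ^ 3 / α * (r - s) ^ 2 ≤
      (|w| * w - |v| * v) * (r * w - s * v) := by
  have hB : 0 ≤ B := (abs_nonneg _).trans hw
  have h1 := abs_mul_self_monotone w v
  have h2 := abs_mul_self_sub_le w v
  have e : (|w| * w - |v| * v) * (r * w - s * v) =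
      (r + s) / 2 * ((|w| * w - |v| * v) * (w - v))
        + (w + v) / 2 * ((|w| * w - |v| * v) * (r - s)) := by ring
  set q := |w| + |v| with hq
  have hq0 : 0 ≤ q := by positivity
  have hqB : q ≤ 2 * B := by linarith
  have h3 : α * (q * (w - v) ^ 2 / 2) ≤ (r + s) / 2 * ((|w| * w - |v| * v) * (w - v)) := by
    apply mul_le_mul _ h1 (by positivity) (by linarith)
    linarith
  have hz : |(w + v) / 2| ≤ B := by
    rw [abs_div, abs_two]
    have := abs_add_le w v
    linarith
  have h4 : |(w + v) / 2 * ((|w| * w - |v| * v) * (r - s))| ≤ B * ((q * |w - v|) * |r - s|) := by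
    rw [abs_mul, abs_mul]
    gcongr
  -- Young's inequality inside the factor `q`; the bound `q ≤ 2 B` is spent only on the density
  -- part, so the velocity part keeps the degenerate weight and can be absorbed.
  have h5 : B * ((q * |w - v|) * |r - s|) ≤
      α / 4 * (q * (w - v) ^ 2) + 2 * B ^ 3 / α * (r - s) ^ 2 := by
    rw [← sq_abs (w - v), ← sq_abs (r - s)]
    set x := |w - v|
    set y := |r - s|
    have h6 : B * (x * y) ≤ α / 4 * x ^ 2 + B ^ 2 / α * y ^ 2 := by
      have : 0 ≤ (α / 2 * x - B * y) ^ 2 / α := by positivity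
      have e2 : (α / 2 * x - B * y) ^ 2 / α = α / 4 * x ^ 2 - B * (x * y) + B ^ 2 / α * y ^ 2 := by
        field_simp; ring
      linarith
    calc B * ((q * x) * y) = q * (B * (x * y)) := by ring
      _ ≤ q * (α / 4 * x ^ 2 + B ^ 2 / α * y ^ 2) := by gcongr
      _ = α / 4 * (q * x ^ 2) + q * (B ^ 2 / α * y ^ 2) := by ring
      _ ≤ α / 4 * (q * x ^ 2) + 2 * B * (B ^ 2 / α * y ^ 2) := by gcongr
      _ = _ := by ring
  have := (abs_le.1 h4).1
  rw [e]
  linarith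

/-! ### Relative energy: coercivity and one time step -/

/-- The relative energy of a state `(r, w)` with respect to a reference state `(R, W)`. -/
noncomputable def relEnergy (P : ℝ → ℝ) (ε r w R W : ℝ) : ℝ :=
  P r - P R - deriv P R * (r - R)
    + ε ^ 2 / 2 * (r * (w - W) ^ 2 + 2 * W * (w - W) * (r - R))

section Pressure

variable {P : ℝ → ℝ} {α β κ L : ℝ}

/-- The relative energy is the Bregman distance of `P(ρ) + ε² ρ w² / 2` in the variables `(ρ, w)`.
The mixed term is dominated because `ε² W²` is well below `r P''(ξ)`; the bound on `R / r` passes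
from the intermediate density `ξ` to `r`. -/
lemma PressureLaw.relEnergy_coercive (hP : PressureLaw P α β κ L) {εmax wmax ε : ℝ}
    (hκ : κ = 4 * εmax ^ 2 * wmax ^ 2) (hε : 0 ≤ ε) (hεm : ε ≤ εmax)
    {r w R W : ℝ} (hr : r ∈ Icc α β) (hR : R ∈ Icc α β) (hrR : 16 * R ≤ 17 * r)
    (hW : |W| ≤ 5 * wmax / 4) :
    min (κ / (5 * β)) (α / 8) * ((r - R) ^ 2 + ε ^ 2 * (w - W) ^ 2) ≤ relEnergy P ε r w R W := by
  obtain ⟨ξ, hξ, h⟩ := hP.exists_taylor hr hR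
  have hξI := hP.uIcc_subset hr hR hξ
  have hr0 : 0 < r := hP.pos.trans_le hr.1
  have hβ : 0 < β := hr0.trans_le hr.2
  have hξ0 : 0 < ξ := hP.pos.trans_le hξI.1
  have hκ0 := hP.kappa_pos
  have hξr : 16 * ξ ≤ 17 * r := by
    have := hξ.2
    rcases le_total r R with h | h
    · rw [sup_eq_right.2 h] at this; linarith
    · rw [sup_eq_left.2 h] at this; linarith
  have hl := hP.lower ξ hξI
  set p2 := deriv (deriv P) ξ
  have hp2 : 0 < p2 := pos_of_mul_pos_right (hκ0.trans_le hl) hξ0.le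
  have h16 : 16 / 17 * κ ≤ r * p2 := by nlinarith
  have hW2 : ε ^ 2 * W ^ 2 ≤ 25 / 64 * κ := by
    calc ε ^ 2 * W ^ 2 = ε ^ 2 * |W| ^ 2 := by rw [sq_abs]
      _ ≤ εmax ^ 2 * (5 * wmax / 4) ^ 2 := by gcongr
      _ = _ := by rw [hκ]; ring
  have e : relEnergy P ε r w R W
      = (p2 * (r - R) ^ 2 + ε ^ 2 * (r * (w - W) ^ 2 + 2 * W * (w - W) * (r - R))) / 2 := by
    rw [relEnergy, h]; ring
  rw [e]
  set x := r - R
  set y := w - W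
  -- Completing the square with three quarters of the velocity term costs `4/3 ε² W² ≤ 4/3 · 25/64
  -- κ`, and `16/17 - 25/48 > 2/5`.
  have h1 : 2 / 5 * κ * x ^ 2 + r ^ 2 * (ε ^ 2 * y ^ 2) / 4 ≤
      r * (p2 * x ^ 2 + ε ^ 2 * (r * y ^ 2 + 2 * W * y * x)) := by
    have e2 : r * (p2 * x ^ 2 + ε ^ 2 * (r * y ^ 2 + 2 * W * y * x)) =
        (r * p2) * x ^ 2 - 4 / 3 * (ε ^ 2 * W ^ 2) * x ^ 2 + r ^ 2 * (ε ^ 2 * y ^ 2) / 4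
          + 3 * ε ^ 2 * (r * y / 2 + 2 / 3 * W * x) ^ 2 := by ring
    rw [e2]
    have := mul_le_mul_of_nonneg_right h16 (sq_nonneg x)
    have := mul_le_mul_of_nonneg_right hW2 (sq_nonneg x)
    have := mul_nonneg (sq_nonneg ε) (sq_nonneg (r * y / 2 + 2 / 3 * W * x))
    have := mul_nonneg hκ0.le (sq_nonneg x)
    nlinarith
  have h2 : 2 / 5 * (κ / β) * x ^ 2 + α * (ε ^ 2 * y ^ 2) / 4 ≤
      p2 * x ^ 2 + ε ^ 2 * (r * y ^ 2 + 2 * W * y * x) := by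
    have h3 : r * (2 / 5 * (κ / β) * x ^ 2 + α * (ε ^ 2 * y ^ 2) / 4) ≤
        2 / 5 * κ * x ^ 2 + r ^ 2 * (ε ^ 2 * y ^ 2) / 4 := by
      have a1 : r * (κ / β) ≤ κ := by
        rw [mul_div_assoc', div_le_iff₀ hβ, mul_comm]
        exact mul_le_mul_of_nonneg_left hr.2 hκ0.le
      have a2 : r * α ≤ r ^ 2 := by rw [sq]; exact mul_le_mul_of_nonneg_left hr.1 hr0.le
      have b1 := mul_le_mul_of_nonneg_right a1 (sq_nonneg x)
      have b2 := mul_le_mul_of_nonneg_right a2 (mul_nonneg (sq_nonneg ε) (sq_nonneg y))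
      nlinarith
    exact le_of_mul_le_mul_left (h3.trans h1) hr0
  have h3 : min (κ / (5 * β)) (α / 8) * x ^ 2 ≤ κ / (5 * β) * x ^ 2 := by
    gcongr; exact min_le_left _ _
  have h4 : min (κ / (5 * β)) (α / 8) * (ε ^ 2 * y ^ 2) ≤ α / 8 * (ε ^ 2 * y ^ 2) := by
    gcongr; exact min_le_right _ _
  have h5 : κ / (5 * β) = 1 / 5 * (κ / β) := by field_simp
  rw [h5] at h3 h4 ⊢
  linarith

/-- Collects the terms in which two values of `P''` are compared. Each carries the Lipschitz bound
and a factor `η`, so the sum is `η` times a quadratic form and is harmless in Gronwall's inequality.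
-/
lemma density_remainder_le {L η : ℝ} (hL : 0 ≤ L) (hη : 0 ≤ η) (x y : ℝ) :
    L * (2 * (|x| + |y| + η)) * (η * |y|) + L * (2 * (|x| + |y| + η)) * (η * |x|)
      + L * (2 * (|x| + |y| + η)) * (η * η) / 2 ≤ η * (6 * L * (x ^ 2 + y ^ 2 + η ^ 2)) := by
  rw [← sq_abs x, ← sq_abs y]
  generalize |x| = x
  generalize |y| = y
  have e1 : (x + y + η) * (y + x + η / 2) ≤ 3 * (x ^ 2 + y ^ 2 + η ^ 2) := by
    nlinarith [sq_nonneg (x - y), sq_nonneg (x - η), sq_nonneg (y - η)]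
  have := mul_le_mul_of_nonneg_left e1 (mul_nonneg hL hη)
  linarith

/-- Here `d` is a density error, for which `ε²` may be replaced by its upper bound; the velocity
errors `x`, `y` keep the weight `ε²`, the only one the energy controls. -/
lemma velocity_remainder_le {ε εmax η : ℝ} (hε : 0 ≤ ε) (hεm : ε ≤ εmax) (hη : 0 ≤ η)
    (d x y : ℝ) :
    ε ^ 2 * (|d| * |y| * η + |x| * |y| * η + x ^ 2 * η / 2) ≤
      η * (εmax ^ 2 * d ^ 2 + 2 * (ε ^ 2 * x ^ 2 + ε ^ 2 * y ^ 2)) := by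
  have e1 : |d| * |y| ≤ d ^ 2 + y ^ 2 := by
    rw [← sq_abs d, ← sq_abs y]; nlinarith [sq_nonneg (|d| - |y|), sq_nonneg (|d| + |y|)]
  have e2 : |x| * |y| ≤ (x ^ 2 + y ^ 2) / 2 := by
    rw [← sq_abs x, ← sq_abs y]; nlinarith [sq_nonneg (|x| - |y|)]
  have e3 : |d| * |y| * η + |x| * |y| * η + x ^ 2 * η / 2 ≤ η * (d ^ 2 + 2 * (x ^ 2 + y ^ 2)) := by
    have := mul_le_mul_of_nonneg_left (add_le_add e1 e2) hη
    have := mul_nonneg hη (sq_nonneg x)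
    have := mul_nonneg hη (sq_nonneg y)
    linarith
  have e4 := mul_le_mul_of_nonneg_left e3 (sq_nonneg ε)
  have e5 : ε ^ 2 * (η * d ^ 2) ≤ εmax ^ 2 * (η * d ^ 2) := by gcongr
  linarith

set_option maxHeartbeats 400000 in
/-- One time step of the relative energy. -/
lemma PressureLaw.relEnergy_step (hP : PressureLaw P α β κ L) {εmax wmax ε : ℝ}
    (hκ : κ = 4 * εmax ^ 2 * wmax ^ 2) (hε : 0 ≤ ε) (hεm : ε ≤ εmax)
    {r w r' w' R W R' W' η : ℝ} (hr : r ∈ Icc α β) (hR : R ∈ Icc α β)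
    (hr' : r' ∈ Icc α β) (hR' : R' ∈ Icc α β) (hrr : 9 * r ≤ 16 * r')
    (hw : |w| ≤ 3 * wmax / 2) (hη1 : |R - R'| ≤ η) (hη2 : |W - W'| ≤ η) :
    relEnergy P ε r w R W - relEnergy P ε r' w' R' W' ≤
      (enthalpy P ε r w - enthalpy P ε R W) * ((r - R) - (r' - R'))
      + ε ^ 2 * ((r * w - R * W) * ((w - W) - (w' - W')))
      + η * ((6 * L + εmax ^ 2) * ((r - R) ^ 2 + (r' - R') ^ 2 + η ^ 2)
        + 2 * (ε ^ 2 * (w - W) ^ 2 + ε ^ 2 * (w' - W') ^ 2)) := by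
  obtain ⟨ξ, hξ, h1⟩ := hP.exists_taylor hr' hr
  obtain ⟨ζ, hζ, h2⟩ := hP.exists_taylor hR' hR
  obtain ⟨θ, hθ, h3⟩ := hP.exists_deriv_sub hr hR
  obtain ⟨χ, hχ, h4⟩ := hP.exists_deriv_sub hR hR'
  have hη0 : 0 ≤ η := (abs_nonneg _).trans hη1
  have hξI := hP.uIcc_subset hr' hr hξ
  have hζI := hP.uIcc_subset hR' hR hζ
  have hθI := hP.uIcc_subset hr hR hθ
  have hχI := hP.uIcc_subset hR hR' hχ
  obtain ⟨d1, hd1⟩ : ∃ d1, d1 = r - R := ⟨_, rfl⟩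
  obtain ⟨d1', hd1'⟩ : ∃ d1', d1' = r' - R' := ⟨_, rfl⟩
  obtain ⟨d2, hd2⟩ : ∃ d2, d2 = w - W := ⟨_, rfl⟩
  obtain ⟨d2', hd2'⟩ : ∃ d2', d2' = w' - W' := ⟨_, rfl⟩
  obtain ⟨δ1, hδ1⟩ : ∃ δ1, δ1 = R - R' := ⟨_, rfl⟩
  obtain ⟨δ2, hδ2⟩ : ∃ δ2, δ2 = W - W' := ⟨_, rfl⟩
  rw [← hd1, ← hd1', ← hd2, ← hd2']
  rw [← hδ1] at hη1
  rw [← hδ2] at hη2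
  set S := |d1| + |d1'| + η with hS
  have hS0 : 0 ≤ S := by positivity
  have nearR : R ∈ Icc (R - S) (R + S) := ⟨by linarith, by linarith⟩
  have nearr : r ∈ Icc (R - S) (R + S) := by
    have := abs_le.1 (le_refl |d1|)
    have := abs_nonneg d1'
    constructor <;> linarith
  have nearR' : R' ∈ Icc (R - S) (R + S) := by
    have := abs_le.1 hη1
    have := abs_nonneg d1'
    have := abs_nonneg d1
    constructor <;> linarith
  have nearr' : r' ∈ Icc (R - S) (R + S) := by
    have := abs_le.1 hη1
    have := abs_le.1 (le_refl |d1'|)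
    have := abs_nonneg d1
    constructor <;> linarith
  have near : ∀ x y z u v t : ℝ, x ∈ Icc (R - S) (R + S) → y ∈ Icc (R - S) (R + S) →
      z ∈ uIcc x y → u ∈ Icc (R - S) (R + S) → v ∈ Icc (R - S) (R + S) → t ∈ uIcc u v →
      z ∈ Icc α β → t ∈ Icc α β →
      |deriv (deriv P) z - deriv (deriv P) t| ≤ L * (2 * S) := by
    intro x y z u v t hx hy hz hu hv ht hz' ht'
    have a := uIcc_subset_Icc hx hy hz
    have b := uIcc_subset_Icc hu hv ht
    refine (hP.lipschitz z hz' t ht').trans (mul_le_mul_of_nonneg_left ?_ hP.L_pos.le)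
    rw [abs_le]; constructor <;> linarith [a.1, a.2, b.1, b.2]
  have b1 := near _ _ _ _ _ _ nearr' nearr hξ nearR nearR' hχ hξI hχI
  have b2 := near _ _ _ _ _ _ nearr nearR hθ nearr' nearr hξ hθI hξI
  have b3 := near _ _ _ _ _ _ nearR' nearR hζ nearr' nearr hξ hζI hξI
  have hl := hP.lower ξ hξI
  have hκ0 := hP.kappa_pos
  have hξ0 : 0 < ξ := hP.pos.trans_le hξI.1
  have hr'0 : 0 < r' := hP.pos.trans_le hr'.1
  have hξr : 9 * ξ ≤ 16 * r' := by
    have := hξ.2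
    rcases le_total r r' with h | h
    · rw [sup_eq_left.2 h] at this; linarith
    · rw [sup_eq_right.2 h] at this; linarith
  set pξ := deriv (deriv P) ξ
  set pζ := deriv (deriv P) ζ
  set pθ := deriv (deriv P) θ
  set pχ := deriv (deriv P) χ
  have hpξ : 0 < pξ := pos_of_mul_pos_right (hκ0.trans_le hl) hξ0.le
  have h9 : ε ^ 2 * w ^ 2 ≤ r' * pξ := by
    calc ε ^ 2 * w ^ 2 = ε ^ 2 * |w| ^ 2 := by rw [sq_abs]
      _ ≤ εmax ^ 2 * (3 * wmax / 2) ^ 2 := by gcongr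
      _ = 9 / 16 * κ := by rw [hκ]; ring
      _ ≤ 9 / 16 * (ξ * pξ) := by linarith
      _ ≤ r' * pξ := by nlinarith
  -- Convexity remainder of the implicit step: `ε² w² ≤ r' P''(ξ)` makes the quadratic form in the
  -- error increments nonnegative, so it can be dropped.
  have hpsd : 0 ≤ pξ * (d1' - d1) ^ 2 + 2 * ε ^ 2 * w * (d1' - d1) * (d2' - d2)
      + ε ^ 2 * r' * (d2' - d2) ^ 2 := by
    have : 0 ≤ r' * (pξ * (d1' - d1) ^ 2 + 2 * ε ^ 2 * w * (d1' - d1) * (d2' - d2)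
      + ε ^ 2 * r' * (d2' - d2) ^ 2) := by
      have e : r' * (pξ * (d1' - d1) ^ 2 + 2 * ε ^ 2 * w * (d1' - d1) * (d2' - d2)
          + ε ^ 2 * r' * (d2' - d2) ^ 2) = (r' * pξ - ε ^ 2 * w ^ 2) * (d1' - d1) ^ 2
          + ε ^ 2 * (w * (d1' - d1) + r' * (d2' - d2)) ^ 2 := by ring
      rw [e]
      have := sub_nonneg.2 h9
      positivity
    exact nonneg_of_mul_nonneg_right this hr'0
  have hr_e : r = R + d1 := by linarith
  have hr'_e : r' = R - δ1 + d1' := by linarith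
  have hw_e : w = W + d2 := by linarith
  have hw'_e : w' = W - δ2 + d2' := by linarith
  have hR'_e : R' = R - δ1 := by linarith
  have hW'_e : W' = W - δ2 := by linarith
  have hpr : deriv P r = deriv P R + pθ * d1 := by rw [hd1]; linarith
  have hpR' : deriv P R' = deriv P R - pχ * δ1 := by rw [hδ1]; linarith
  have hPr' : P r' = P r + deriv P r * (r' - r) + pξ * (r' - r) ^ 2 / 2 := by linarith
  have hPR' : P R' = P R + deriv P R * (R' - R) + pζ * (R' - R) ^ 2 / 2 := by linarith
  -- Exact expansion: energy gradient differences at the new level times the error increments, minus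
  -- the convexity remainder, plus terms that contain an increment `δ1` or `δ2` of the reference
  -- state.
  have key : relEnergy P ε r w R W - relEnergy P ε r' w' R' W' =
      (enthalpy P ε r w - enthalpy P ε R W) * (d1 - d1')
      + ε ^ 2 * ((r * w - R * W) * (d2 - d2'))
      - (pξ * (d1' - d1) ^ 2 + 2 * ε ^ 2 * w * (d1' - d1) * (d2' - d2)
          + ε ^ 2 * r' * (d2' - d2) ^ 2) / 2
      + ((pξ - pχ) * (δ1 * d1') + (pθ - pξ) * (δ1 * d1) + (pζ - pξ) * (δ1 * δ1) / 2)
      + ε ^ 2 * (d1' * d2' * δ2 + d2 * d2' * δ1 - d2 ^ 2 * δ1 / 2) := by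
    simp only [relEnergy, enthalpy]
    rw [hPr', hPR', hpr, hpR', hr'_e, hr_e, hw'_e, hw_e, hR'_e, hW'_e]
    ring
  have hL0 := hP.L_pos
  have c1 : (pξ - pχ) * (δ1 * d1') ≤ L * (2 * S) * (η * |d1'|) := by
    refine (le_abs_self _).trans ?_
    rw [abs_mul, abs_mul]; gcongr
  have c2 : (pθ - pξ) * (δ1 * d1) ≤ L * (2 * S) * (η * |d1|) := by
    refine (le_abs_self _).trans ?_
    rw [abs_mul, abs_mul]; gcongr
  have c3 : (pζ - pξ) * (δ1 * δ1) ≤ L * (2 * S) * (η * η) := by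
    refine (le_abs_self _).trans ?_
    rw [abs_mul, abs_mul]
    gcongr
  have c4 : d1' * d2' * δ2 ≤ |d1'| * |d2'| * η := by
    refine (le_abs_self _).trans ?_
    rw [abs_mul, abs_mul]; gcongr
  have c5 : d2 * d2' * δ1 ≤ |d2| * |d2'| * η := by
    refine (le_abs_self _).trans ?_
    rw [abs_mul, abs_mul]; gcongr
  have c6 : - d2 ^ 2 * δ1 ≤ d2 ^ 2 * η := by
    have h := mul_le_mul_of_nonneg_left (neg_le.1 (abs_le.1 hη1).1) (sq_nonneg d2)
    rwa [mul_neg, ← neg_mul] at h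
  have s1 := density_remainder_le hL0.le hη0 d1 d1'
  rw [← hS] at s1
  have s2 := velocity_remainder_le hε hεm hη0 d1' d2 d2'
  have s3 : ε ^ 2 * (d1' * d2' * δ2 + d2 * d2' * δ1 - d2 ^ 2 * δ1 / 2) ≤
      ε ^ 2 * (|d1'| * |d2'| * η + |d2| * |d2'| * η + d2 ^ 2 * η / 2) := by
    apply mul_le_mul_of_nonneg_left _ (sq_nonneg ε)
    linarith
  have s4 : 0 ≤ η * (εmax ^ 2 * (d1 ^ 2 + η ^ 2)) := by positivity
  rw [key]
  linarith

end Pressure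


section Pressure

variable {P : ℝ → ℝ} {α β κ L : ℝ}

lemma two_mul_le_of_sq_le {u v Z : ℝ} (h : u ^ 2 + v ^ 2 ≤ Z) : u * v ≤ Z := by
  nlinarith [sq_nonneg (u - v), sq_nonneg u, sq_nonneg v]

/-- The factor `ε²` stays with the velocity error: one `ε` is needed to match the energy norm and
the other one is bounded. -/
lemma PressureLaw.abs_enthalpy_sub_le (hP : PressureLaw P α β κ L) {B ε : ℝ} (hLB : L ≤ B)
    {r w R W : ℝ} (hr : r ∈ Icc α β) (hR : R ∈ Icc α β) (hw : |w| ≤ B) (hW : |W| ≤ B) :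
    |enthalpy P ε r w - enthalpy P ε R W| ≤ B * (ε ^ 2 * |w - W|) + B * |r - R| := by
  have e : enthalpy P ε r w - enthalpy P ε R W
      = (w + W) / 2 * (ε ^ 2 * (w - W)) + (deriv P r - deriv P R) := by
    simp only [enthalpy]; ring
  rw [e]
  refine (abs_add_le _ _).trans (add_le_add ?_ ?_)
  · rw [abs_mul, abs_mul, abs_of_nonneg (sq_nonneg ε)]
    gcongr
    rw [abs_div, abs_two]
    have := abs_add_le w W
    linarith
  · exact (hP.deriv_lipschitz hr hR).trans (by gcongr)

/-- The part of the flux error that is not controlled by the friction. -/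
lemma friction_defect_le {α B γ σ r w R W fb : ℝ} (hα : 0 < α) (hB : 1 ≤ B) (hγ : 0 ≤ γ)
    (hσ : 0 ≤ σ) (hr0 : 0 ≤ r) (hr : r ≤ B) (hR0 : 0 ≤ R) (hR : R ≤ B) (hw : |w| ≤ B)
    (hW : |W| ≤ B) (hfb : |fb| ≤ (2 * |W| + B * σ) * (B * σ)) :
    - (γ * (fb * (r * w - R * W))) ≤
      γ * (α / 8 * (|W| * (w - W) ^ 2)
        + (8 * B ^ 5 / α + 6 * B ^ 4) * ((r - R) ^ 2 + σ ^ 2)) := by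
  have hB0 : 0 ≤ B := by linarith
  have e : r * w - R * W = r * (w - W) + W * (r - R) := by ring
  have hG : |r * w - R * W| ≤ B * |w - W| + B * |r - R| := by
    rw [e]
    refine (abs_add_le _ _).trans ?_
    rw [abs_mul, abs_mul, abs_of_nonneg hr0]
    gcongr
  have hd2 : |w - W| ≤ 2 * B := by
    have := abs_sub w W; linarith
  have hd1 : |r - R| ≤ B := by rw [abs_le]; constructor <;> linarith
  rw [← mul_neg]
  refine mul_le_mul_of_nonneg_left ?_ hγ
  refine (neg_le_abs _).trans ?_
  rw [abs_mul]
  refine (mul_le_mul hfb hG (abs_nonneg _) (by positivity)).trans ?_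
  rw [← sq_abs (w - W), ← sq_abs (r - R)]
  revert hd1 hd2 hW
  have := abs_nonneg W
  have := abs_nonneg (r - R)
  have := abs_nonneg (w - W)
  generalize |W| = V at *
  generalize |r - R| = x at *
  generalize |w - W| = y at *
  intro hW hd2 hd1
  -- Young's inequality before multiplication by `V = |W|`. The leading part of the bound on `fb`
  -- carries this factor, so the square of the velocity error appears with the weight that the
  -- dissipation has; the remaining part is already quadratic in `σ`.
  have a1 : 2 * B ^ 2 * (σ * y) ≤ α / 8 * y ^ 2 + 8 * B ^ 4 / α * σ ^ 2 := by
    have h0 : 0 ≤ (α / 8 * y - B ^ 2 * σ) ^ 2 * (8 / α) := by positivity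
    have e : (α / 8 * y - B ^ 2 * σ) ^ 2 * (8 / α) =
        α / 8 * y ^ 2 - 2 * B ^ 2 * (σ * y) + 8 * B ^ 4 / α * σ ^ 2 := by
      field_simp; ring
    linarith
  have a2 : V * (2 * B ^ 2 * (σ * y)) ≤ α / 8 * (V * y ^ 2) + 8 * B ^ 5 / α * σ ^ 2 := by
    calc V * (2 * B ^ 2 * (σ * y)) ≤ V * (α / 8 * y ^ 2 + 8 * B ^ 4 / α * σ ^ 2) := by gcongr
      _ = α / 8 * (V * y ^ 2) + V * (8 * B ^ 4 / α * σ ^ 2) := by ring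
      _ ≤ α / 8 * (V * y ^ 2) + B * (8 * B ^ 4 / α * σ ^ 2) := by gcongr
      _ = _ := by ring
  have a3 : 2 * B ^ 2 * V * (σ * x) ≤ B ^ 3 * (x ^ 2 + σ ^ 2) := by
    have h1 : 2 * (σ * x) ≤ x ^ 2 + σ ^ 2 := by nlinarith [sq_nonneg (σ - x)]
    calc 2 * B ^ 2 * V * (σ * x) = B ^ 2 * V * (2 * (σ * x)) := by ring
      _ ≤ B ^ 2 * B * (x ^ 2 + σ ^ 2) := by gcongr
      _ = _ := by ring
  have a4 : B ^ 3 * σ ^ 2 * y ≤ 2 * B ^ 4 * σ ^ 2 := by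
    calc B ^ 3 * σ ^ 2 * y ≤ B ^ 3 * σ ^ 2 * (2 * B) := by gcongr
      _ = _ := by ring
  have a5 : B ^ 3 * σ ^ 2 * x ≤ B ^ 4 * σ ^ 2 := by
    calc B ^ 3 * σ ^ 2 * x ≤ B ^ 3 * σ ^ 2 * B := by gcongr
      _ = _ := by ring
  have a6 : B ^ 3 * (x ^ 2 + σ ^ 2) ≤ B ^ 4 * (x ^ 2 + σ ^ 2) := by
    gcongr; norm_num
  have a7 : 0 ≤ 8 * B ^ 5 / α * x ^ 2 := by positivity
  have a8 : 0 ≤ B ^ 4 * x ^ 2 := by positivity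
  have a9 : 0 ≤ B ^ 4 * σ ^ 2 := by positivity
  linarith

set_option maxHeartbeats 1000000 in
/-- The pointwise error inequality of one time step. -/
lemma PressureLaw.error_step (hP : PressureLaw P α β κ L) {εmax wmax γmin B : ℝ}
    (hκ : κ = 4 * εmax ^ 2 * wmax ^ 2) (hB : 1 ≤ B) (hLB : L ≤ B) (hβB : β ≤ B)
    (hεB : εmax ≤ B) (hwB : 3 * wmax / 2 ≤ B) (hγmin : 0 < γmin) :
    ∃ C > 0, ∀ ε γ a t r w r' w' R W R' W' σ fa fb f1 g g' : ℝ, 0 ≤ ε → ε ≤ εmax → γmin ≤ γ →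
      γ ≤ B → 0 < a → 1 / a ≤ B → 0 < t → r ∈ Icc α β → R ∈ Icc α β → r' ∈ Icc α β →
      R' ∈ Icc α β → 9 * r ≤ 16 * r' → |w| ≤ 3 * wmax / 2 → |W| ≤ 3 * wmax / 2 →
      |R - R'| ≤ B * t → |W - W'| ≤ B * t → 0 ≤ σ → |g| ≤ B * σ → |g - g'| ≤ B * t * σ →
      |fb| ≤ (2 * |W| + B * σ) * (B * σ) →
      relEnergy P ε r w R W - relEnergy P ε r' w' R' W' - (g * (r - R) - g' * (r' - R'))
        + t * (γmin * (α / 8) * ((|w| + |W|) * (w - W) ^ 2)) ≤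
      t / a * (ε ^ 2 * (((w - W) - (w' - W')) / t) * (a * (r * w - R * W))
          - (enthalpy P ε r w - enthalpy P ε R W) * (- f1 - a * ((r - R) - (r' - R')) / t)
          + γ * (|w| * w - |W| * W) * (a * (r * w - R * W))
          + (ε ^ 2 * fa + γ * fb) * (a * (r * w - R * W))
          + g * (- f1 - a * ((r - R) - (r' - R')) / t))
      + C * t * ((r - R) ^ 2 + ε ^ 2 * (w - W) ^ 2 + (r' - R') ^ 2 + ε ^ 2 * (w' - W') ^ 2
          + fa ^ 2 + f1 ^ 2 + σ ^ 2 + t ^ 2) := by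
  have hα := hP.pos
  have hB0 : 0 ≤ B := by linarith
  have hBB : B ≤ B * B := le_mul_of_one_le_left hB0 hB
  have hBB2 : B * B ≤ B * B ^ 2 := by rw [sq]; gcongr
  -- One summand for each of `T0`, `T1`, `T3`, `T4`, `T2`, `T5`, `T6`, in this order.
  refine ⟨B * (6 * B + B ^ 2 + 2) * B ^ 2 + 2 * B ^ 3 + 2 * B ^ 3 + B * (8 * B ^ 5 / α + 6 * B ^ 4)
    + B * (2 * B ^ 3 / α) + B ^ 2 + B, by positivity, ?_⟩
  intro ε γ a t r w r' w' R W R' W' σ fa fb f1 g g' hε hεm hγm hγB ha haB ht hr hR hr' hR' hrr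
    hw hW hη1 hη2 hσ hg hgg hfb
  have hwB' : |w| ≤ B := hw.trans hwB
  have hWB' : |W| ≤ B := hW.trans hwB
  have hγ0 : 0 ≤ γ := hγmin.le.trans hγm
  have hstep := hP.relEnergy_step (w' := w') hκ hε hεm hr hR hr' hR' hrr hw hη1 hη2
  have hfr := friction_monotone (B := B) hP.pos hr.1 hR.1 hwB' hWB'
  have hdef := friction_defect_le hP.pos hB hγ0 hσ (hP.pos.le.trans hr.1) (hr.2.trans hβB)
    (hP.pos.le.trans hR.1) (hR.2.trans hβB) hwB' hWB' hfb
  have hη := hP.abs_enthalpy_sub_le (ε := ε) hLB hr hR hwB' hWB'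
  have hG : |r * w - R * W| ≤ B * |w - W| + B * |r - R| := by
    have e : r * w - R * W = r * (w - W) + W * (r - R) := by ring
    rw [e]
    refine (abs_add_le _ _).trans ?_
    rw [abs_mul, abs_mul, abs_of_nonneg (hP.pos.le.trans hr.1)]
    gcongr
    exact hr.2.trans hβB
  obtain ⟨G, hGdef⟩ : ∃ G, G = r * w - R * W := ⟨_, rfl⟩
  obtain ⟨H, hHdef⟩ : ∃ H, H = enthalpy P ε r w - enthalpy P ε R W := ⟨_, rfl⟩
  obtain ⟨Fr, hFr⟩ : ∃ Fr, Fr = |w| * w - |W| * W := ⟨_, rfl⟩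
  rw [← hGdef] at hstep hfr hdef hG ⊢
  rw [← hHdef] at hstep hη ⊢
  rw [← hFr] at hfr ⊢
  obtain ⟨q, hq⟩ : ∃ q, q = |w| + |W| := ⟨_, rfl⟩
  have hWq : |W| ≤ q := by rw [hq]; linarith [abs_nonneg w]
  rw [← hq] at hfr ⊢
  generalize r - R = d1 at *
  generalize r' - R' = d1' at *
  generalize w - W = d2 at *
  generalize w' - W' = d2' at *
  obtain ⟨Z, hZ⟩ : ∃ Z, Z = d1 ^ 2 + ε ^ 2 * d2 ^ 2 + d1' ^ 2 + ε ^ 2 * d2' ^ 2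
          + fa ^ 2 + f1 ^ 2 + σ ^ 2 + t ^ 2 := ⟨_, rfl⟩
  have n2 : 0 ≤ ε ^ 2 * d2 ^ 2 := by positivity
  have n4 : 0 ≤ ε ^ 2 * d2' ^ 2 := by positivity
  have hy2 : (ε * |d2|) ^ 2 = ε ^ 2 * d2 ^ 2 := by rw [mul_pow, sq_abs]
  have hεB' : ε ≤ B := hεm.trans hεB
  have p1 : ε * |d2| * |f1| ≤ Z := two_mul_le_of_sq_le (by
    rw [hy2, sq_abs, hZ]; linarith [sq_nonneg d1, sq_nonneg d1', sq_nonneg fa, sq_nonneg σ, sq_nonneg t])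
  have p2 : |d1| * |f1| ≤ Z := two_mul_le_of_sq_le (by
    rw [sq_abs, sq_abs, hZ]; linarith [sq_nonneg d1', sq_nonneg fa, sq_nonneg σ, sq_nonneg t])
  have p3 : ε * |d2| * |fa| ≤ Z := two_mul_le_of_sq_le (by
    rw [hy2, sq_abs, hZ]; linarith [sq_nonneg d1, sq_nonneg d1', sq_nonneg f1, sq_nonneg σ, sq_nonneg t])
  have p4 : |d1| * |fa| ≤ Z := two_mul_le_of_sq_le (by
    rw [sq_abs, sq_abs, hZ]; linarith [sq_nonneg d1', sq_nonneg f1, sq_nonneg σ, sq_nonneg t])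
  have p5 : σ * |f1| ≤ Z := two_mul_le_of_sq_le (by
    rw [sq_abs, hZ]; linarith [sq_nonneg d1, sq_nonneg d1', sq_nonneg fa, sq_nonneg t])
  have p6 : σ * |d1'| ≤ Z := two_mul_le_of_sq_le (by
    rw [sq_abs, hZ]; linarith [sq_nonneg d1, sq_nonneg f1, sq_nonneg fa, sq_nonneg t])
  have p7 : d1 ^ 2 + σ ^ 2 ≤ Z := by
    rw [hZ]; linarith [sq_nonneg d1', sq_nonneg f1, sq_nonneg fa, sq_nonneg t]
  have p8 : d1 ^ 2 ≤ Z := by linarith [sq_nonneg σ]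
  have p9 : d1 ^ 2 + d1' ^ 2 + t ^ 2 ≤ Z := by
    rw [hZ]; linarith [sq_nonneg σ, sq_nonneg f1, sq_nonneg fa]
  have p10 : ε ^ 2 * d2 ^ 2 + ε ^ 2 * d2' ^ 2 ≤ Z := by
    rw [hZ]; linarith [sq_nonneg σ, sq_nonneg f1, sq_nonneg fa, sq_nonneg d1, sq_nonneg d1',
      sq_nonneg t]
  have hZ0 : 0 ≤ Z := (sq_nonneg d1).trans p8
  rw [← hZ]
  have hta : t / a ≤ t * B := by
    rw [div_eq_mul_one_div]; gcongr
  have hta0 : 0 ≤ t / a := by positivity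
  have T0 : B * t * ((6 * L + εmax ^ 2) * (d1 ^ 2 + d1' ^ 2 + (B * t) ^ 2)
        + 2 * (ε ^ 2 * d2 ^ 2 + ε ^ 2 * d2' ^ 2)) ≤ t * (B * (6 * B + B ^ 2 + 2) * B ^ 2 * Z) := by
    have hεm0 : 0 ≤ εmax := hε.trans hεm
    have hB2 : 1 ≤ B ^ 2 := one_le_pow₀ hB
    have e1 : d1 ^ 2 + d1' ^ 2 + (B * t) ^ 2 ≤ B ^ 2 * Z := by
      have : d1 ^ 2 + d1' ^ 2 ≤ B ^ 2 * (d1 ^ 2 + d1' ^ 2) :=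
        le_mul_of_one_le_left (by positivity) hB2
      calc d1 ^ 2 + d1' ^ 2 + (B * t) ^ 2 ≤ B ^ 2 * (d1 ^ 2 + d1' ^ 2 + t ^ 2) := by
            rw [mul_pow]; linarith
        _ ≤ _ := by gcongr
    have e2 : ε ^ 2 * d2 ^ 2 + ε ^ 2 * d2' ^ 2 ≤ B ^ 2 * Z :=
      p10.trans (le_mul_of_one_le_left hZ0 hB2)
    calc _ ≤ B * t * ((6 * B + B ^ 2) * (B ^ 2 * Z) + 2 * (B ^ 2 * Z)) := by gcongr
      _ = _ := by ring
  have T1 : - (t / a * (H * f1)) ≤ t * (2 * B ^ 3 * Z) := by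
    rw [← mul_neg]
    have e1 : -(H * f1) ≤ 2 * B ^ 2 * Z := by
      refine (neg_le_abs _).trans ?_
      rw [abs_mul]
      calc |H| * |f1| ≤ (B * (ε ^ 2 * |d2|) + B * |d1|) * |f1| := by gcongr
        _ = B * ε * (ε * |d2| * |f1|) + B * (|d1| * |f1|) := by ring
        _ ≤ B * B * Z + B * Z := by gcongr
        _ ≤ B * B * Z + B * B * Z := by
            have := mul_le_mul_of_nonneg_right hBB hZ0
            linarith
        _ = _ := by ring
    calc t / a * -(H * f1) ≤ t / a * (2 * B ^ 2 * Z) := by gcongr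
      _ ≤ t * B * (2 * B ^ 2 * Z) := by gcongr
      _ = _ := by ring
  have T3 : - (t * (ε ^ 2 * fa * G)) ≤ t * (2 * B ^ 3 * Z) := by
    rw [← mul_neg]
    refine mul_le_mul_of_nonneg_left ?_ ht.le
    refine (neg_le_abs _).trans ?_
    rw [abs_mul, abs_mul, abs_of_nonneg (sq_nonneg ε)]
    calc ε ^ 2 * |fa| * |G| ≤ ε ^ 2 * |fa| * (B * |d2| + B * |d1|) := by gcongr
      _ = B * ε * (ε * |d2| * |fa|) + B * ε ^ 2 * (|d1| * |fa|) := by ring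
      _ ≤ B * B * Z + B * B ^ 2 * Z := by gcongr
      _ ≤ B * B ^ 2 * Z + B * B ^ 2 * Z := by
            have := mul_le_mul_of_nonneg_right hBB2 hZ0
            linarith
      _ = _ := by ring
  -- Friction provides the dissipation with factor `α / 4` (`T2`). Half of it is spent here, and
  -- `T7` keeps the other half for the left-hand side.
  have T4 : - (t * (γ * (fb * G))) ≤
      t * (γ * (α / 8 * (q * d2 ^ 2))) + t * (B * (8 * B ^ 5 / α + 6 * B ^ 4) * Z) := by
    rw [← mul_neg, ← mul_add]
    refine mul_le_mul_of_nonneg_left (hdef.trans ?_) ht.le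
    rw [mul_add]
    have : γ * ((8 * B ^ 5 / α + 6 * B ^ 4) * (d1 ^ 2 + σ ^ 2)) ≤
      B * ((8 * B ^ 5 / α + 6 * B ^ 4) * Z) := by gcongr
    have : γ * (α / 8 * (|W| * d2 ^ 2)) ≤ γ * (α / 8 * (q * d2 ^ 2)) := by gcongr
    linarith
  have T2 : - (t * (γ * (Fr * G))) ≤
      - (t * (γ * (α / 4 * (q * d2 ^ 2)))) + t * (B * (2 * B ^ 3 / α) * Z) := by
    have e1 : γ * (α / 4 * (q * d2 ^ 2) - 2 * B ^ 3 / α * d1 ^ 2) ≤ γ * (Fr * G) := by gcongr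
    have e2 : γ * (2 * B ^ 3 / α * d1 ^ 2) ≤ B * (2 * B ^ 3 / α * Z) := by gcongr
    have e3 : γ * (α / 4 * (q * d2 ^ 2)) - B * (2 * B ^ 3 / α) * Z ≤ γ * (Fr * G) := by linarith
    have := mul_le_mul_of_nonneg_left e3 ht.le
    linarith
  have T5 : t / a * (g * f1) ≤ t * (B ^ 2 * Z) := by
    have e1 : g * f1 ≤ B * Z := by
      refine (le_abs_self _).trans ?_
      rw [abs_mul]
      calc |g| * |f1| ≤ B * σ * |f1| := by gcongr
        _ = B * (σ * |f1|) := by ring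
        _ ≤ _ := by gcongr
    calc t / a * (g * f1) ≤ t / a * (B * Z) := by gcongr
      _ ≤ t * B * (B * Z) := by gcongr
      _ = _ := by ring
  have T6 : - ((g - g') * d1') ≤ t * (B * Z) := by
    refine (neg_le_abs _).trans ?_
    rw [abs_mul]
    calc |g - g'| * |d1'| ≤ B * t * σ * |d1'| := by gcongr
      _ = t * (B * (σ * |d1'|)) := by ring
      _ ≤ _ := by gcongr
  have T7 : t * (γmin * (α / 8) * (q * d2 ^ 2)) ≤ t * (γ * (α / 8 * (q * d2 ^ 2))) := by
    have hq0 : 0 ≤ q := (abs_nonneg W).trans hWq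
    rw [mul_assoc γmin]
    gcongr
  -- The combination of mass and momentum residuals reproduces the energy gradient paired with the
  -- error increments. The residual `g` meets the increment `d1 - d1'`, which is rewritten as the
  -- change of `g (r - R)` plus `(g - g') d1'`.
  have e : t / a * (ε ^ 2 * ((d2 - d2') / t) * (a * G) - H * (- f1 - a * (d1 - d1') / t)
          + γ * Fr * (a * G) + (ε ^ 2 * fa + γ * fb) * (a * G)
          + g * (- f1 - a * (d1 - d1') / t)) =
      ε ^ 2 * (G * (d2 - d2')) + H * (d1 - d1') + t / a * (H * f1) + t * (γ * (Fr * G))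
        + t * (ε ^ 2 * fa * G) + t * (γ * (fb * G)) - t / a * (g * f1) - g * (d1 - d1') := by
    field_simp; ring
  rw [e]
  linarith

end Pressure


/-! ## The mesh -/

/-- The `i`-th cell of the mesh. -/
def cell (ℓ : ℝ) (M i : ℕ) : Set ℝ := Ioo (node ℓ M i) (node ℓ M (i + 1))

/-- Lebesgue measure on `(0, ℓ)`. -/
noncomputable abbrev pipeMeasure (ℓ : ℝ) : Measure ℝ := volume.restrict (Ioo 0 ℓ)

/-- The slopes of a piecewise linear function. -/
noncomputable def slopes (ℓ : ℝ) {M : ℕ} (r : Fin (M + 1) → ℝ) (i : Fin M) : ℝ :=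
  (r i.succ - r i.castSucc) / (ℓ / M)

section Mesh

variable {ℓ : ℝ} {M : ℕ}

lemma node_succ (i : ℕ) : node ℓ M (i + 1) = node ℓ M i + ℓ / M := by
  simp only [node]; push_cast; ring

lemma node_zero : node ℓ M 0 = 0 := by simp [node]

lemma node_last (hM : 0 < M) : node ℓ M M = ℓ := by
  have : (M : ℝ) ≠ 0 := by positivity
  simp only [node]; field_simp

lemma meshSize_pos (hℓ : 0 < ℓ) (hM : 0 < M) : 0 < ℓ / M := by positivity

lemma node_mono (hℓ : 0 < ℓ) {i j : ℕ} (h : i ≤ j) : node ℓ M i ≤ node ℓ M j := by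
  simp only [node]; gcongr

lemma node_mem_Icc (hℓ : 0 < ℓ) (hM : 0 < M) {i : ℕ} (hi : i ≤ M) : node ℓ M i ∈ Icc 0 ℓ := by
  constructor
  · rw [← node_zero (ℓ := ℓ) (M := M)]; exact node_mono hℓ (Nat.zero_le _)
  · conv_rhs => rw [← node_last (ℓ := ℓ) hM]
    exact node_mono hℓ hi

lemma cell_subset (hℓ : 0 < ℓ) (hM : 0 < M) (i : Fin M) : cell ℓ M i ⊆ Ioo 0 ℓ := by
  intro x hx
  exact ⟨(node_mem_Icc hℓ hM i.2.le).1.trans_lt hx.1,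
    hx.2.trans_le (node_mem_Icc hℓ hM (Nat.succ_le_of_lt i.2)).2⟩

lemma Icc_node_subset (hℓ : 0 < ℓ) (hM : 0 < M) (i : Fin M) :
    Icc (node ℓ M i) (node ℓ M (i + 1)) ⊆ Icc 0 ℓ :=
  Icc_subset_Icc (node_mem_Icc hℓ hM i.2.le).1 (node_mem_Icc hℓ hM (Nat.succ_le_of_lt i.2)).2

/-- Every point of the pipe lies in a closed cell. -/
lemma exists_mem_Icc_node (hℓ : 0 < ℓ) (hM : 0 < M) {x : ℝ} (hx : x ∈ Icc 0 ℓ) :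
    ∃ i : Fin M, x ∈ Icc (node ℓ M i) (node ℓ M (i + 1)) := by
  have hh := meshSize_pos hℓ hM
  rcases eq_or_lt_of_le hx.2 with h | h
  · refine ⟨⟨M - 1, by omega⟩, ?_⟩
    simp only
    rw [Nat.sub_add_cancel hM, node_last hM, h]
    refine ⟨?_, le_rfl⟩
    exact (node_mem_Icc hℓ hM (Nat.sub_le M 1)).2
  · have h0 : 0 ≤ x / (ℓ / M) := div_nonneg hx.1 hh.le
    have hlt : ⌊x / (ℓ / M)⌋₊ < M := by
      rw [Nat.floor_lt h0, div_lt_iff₀ hh]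
      have : (M : ℝ) ≠ 0 := by positivity
      calc x < ℓ := h
        _ = M * (ℓ / M) := by field_simp
    refine ⟨⟨_, hlt⟩, ?_, ?_⟩
    · simp only [node]
      rw [← le_div_iff₀ hh]
      exact Nat.floor_le h0
    · simp only [node]
      rw [← div_le_iff₀ hh]
      exact_mod_cast (Nat.lt_floor_add_one _).le

/-- Almost every point of the pipe lies in a cell. -/
lemma ae_mem_cell (hℓ : 0 < ℓ) (hM : 0 < M) :
    ∀ᵐ x ∂(pipeMeasure ℓ), ∃ i : Fin M, x ∈ cell ℓ M i := by
  have hc : (range (node ℓ M)).Countable := countable_range _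
  have h0 : ∀ᵐ x ∂(pipeMeasure ℓ), x ∉ range (node ℓ M) :=
    ae_restrict_of_ae (by
      rw [ae_iff]
      simp only [not_not, ofPred_mem_eq]
      exact hc.measure_zero volume)
  filter_upwards [h0, ae_restrict_mem measurableSet_Ioo] with x hx hx'
  obtain ⟨i, hi⟩ := exists_mem_Icc_node hℓ hM (Ioo_subset_Icc_self hx')
  refine ⟨i, lt_of_le_of_ne hi.1 fun h => hx ⟨_, h⟩, lt_of_le_of_ne hi.2 fun h => hx ⟨_, h.symm⟩⟩

lemma cell_disjoint (hℓ : 0 < ℓ) {i j : ℕ} {x : ℝ} (hi : x ∈ cell ℓ M i) (hj : x ∈ cell ℓ M j) :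
    i = j := by
  rcases lt_trichotomy i j with h | h | h
  · have := node_mono (ℓ := ℓ) (M := M) hℓ (Nat.succ_le_of_lt h)
    exact absurd (hi.2.trans_le this) (not_lt.2 hj.1.le)
  · exact h
  · have := node_mono (ℓ := ℓ) (M := M) hℓ (Nat.succ_le_of_lt h)
    exact absurd (hj.2.trans_le this) (not_lt.2 hi.1.le)

lemma p0_eq (hℓ : 0 < ℓ) (q : Fin M → ℝ) {i : Fin M} {x : ℝ} (hx : x ∈ cell ℓ M i) :
    p0 ℓ q x = q i := by
  rw [p0, Finset.sum_eq_single i]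
  · exact indicator_of_mem hx _
  · intro j _ hj
    refine indicator_of_notMem (fun h => hj ?_) _
    exact Fin.ext (cell_disjoint hℓ (i := j) (j := i) h hx)
  · simp

lemma p1_eq (hℓ : 0 < ℓ) (hM : 0 < M) (r : Fin (M + 1) → ℝ) {i : Fin M} {x : ℝ}
    (hx : x ∈ Icc (node ℓ M i) (node ℓ M (i + 1))) :
    p1 ℓ r x = r i.castSucc + slopes ℓ r i * (x - node ℓ M i) := by
  have hh := meshSize_pos hℓ hM
  have hx2 := hx.2
  rw [node_succ] at hx2
  rw [p1, Finset.sum_eq_add_of_mem i.castSucc i.succ (Finset.mem_univ _) (Finset.mem_univ _)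
    (Fin.castSucc_lt_succ).ne]
  · have h1 : |x - node ℓ M (i.castSucc : ℕ)| = x - node ℓ M i := by
      rw [Fin.val_castSucc]; exact abs_of_nonneg (sub_nonneg.2 hx.1)
    have h2 : |x - node ℓ M (i.succ : ℕ)| = node ℓ M i + ℓ / M - x := by
      rw [Fin.val_succ, node_succ, abs_sub_comm]; exact abs_of_nonneg (by linarith)
    have h3 : (x - node ℓ M i) / (ℓ / M) ≤ 1 := by rw [div_le_one hh]; linarith
    have h4 : (node ℓ M i + ℓ / M - x) / (ℓ / M) ≤ 1 := by
      rw [div_le_one hh]; linarith [hx.1]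
    rw [h1, h2, max_eq_right (by linarith), max_eq_right (by linarith), slopes]
    have hM' : (M : ℝ) ≠ 0 := by positivity
    field_simp
    ring
  · intro j _ hj
    have : max 0 (1 - |x - node ℓ M (j : ℕ)| / (ℓ / M)) = 0 := by
      apply max_eq_left
      rw [sub_nonpos, one_le_div hh]
      rcases lt_or_ge (j : ℕ) (i : ℕ) with h | h
      · have h1 := node_mono (ℓ := ℓ) (M := M) hℓ (Nat.succ_le_of_lt h)
        rw [Nat.succ_eq_add_one, node_succ] at h1
        rw [abs_of_nonneg (by linarith [hx.1])]
        linarith [hx.1]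
      · have h2 : (i : ℕ) + 1 + 1 ≤ (j : ℕ) := by
          have a1 : (j : ℕ) ≠ i := fun h => hj.1 (Fin.ext (by simpa using h))
          have a2 : (j : ℕ) ≠ i + 1 := fun h => hj.2 (Fin.ext (by simpa using h))
          omega
        have h1 := node_mono (ℓ := ℓ) (M := M) hℓ h2
        rw [node_succ, node_succ] at h1
        rw [abs_sub_comm, abs_of_nonneg (by linarith)]
        linarith
    rw [this, mul_zero]

lemma p1_node_castSucc (hℓ : 0 < ℓ) (hM : 0 < M) (r : Fin (M + 1) → ℝ) (i : Fin M) :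
    p1 ℓ r (node ℓ M i) = r i.castSucc := by
  rw [p1_eq hℓ hM r (i := i) (left_mem_Icc.2 (node_mono hℓ (Nat.le_succ _)))]
  simp

lemma p1_node_succ (hℓ : 0 < ℓ) (hM : 0 < M) (r : Fin (M + 1) → ℝ) (i : Fin M) :
    p1 ℓ r (node ℓ M (i + 1)) = r i.succ := by
  have hh := meshSize_pos hℓ hM
  rw [p1_eq hℓ hM r (i := i) (right_mem_Icc.2 (node_mono hℓ (Nat.le_succ _))), node_succ, slopes]
  have hM' : (M : ℝ) ≠ 0 := by positivity
  field_simp; ring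

lemma p1_node (hℓ : 0 < ℓ) (hM : 0 < M) (r : Fin (M + 1) → ℝ) (j : Fin (M + 1)) :
    p1 ℓ r (node ℓ M j) = r j := by
  rcases Fin.eq_castSucc_or_eq_last j with ⟨i, rfl⟩ | rfl
  · exact p1_node_castSucc hℓ hM r i
  · obtain ⟨m, rfl⟩ : ∃ m, M = m + 1 := ⟨M - 1, by omega⟩
    have := p1_node_succ hℓ hM r (Fin.last m)
    simpa using this

lemma p1_zero (hℓ : 0 < ℓ) (hM : 0 < M) (r : Fin (M + 1) → ℝ) : p1 ℓ r 0 = r 0 := by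
  have := p1_node hℓ hM r 0
  simpa [node] using this

lemma p1_right (hℓ : 0 < ℓ) (hM : 0 < M) (r : Fin (M + 1) → ℝ) : p1 ℓ r ℓ = r (Fin.last M) := by
  have := p1_node hℓ hM r (Fin.last M)
  rwa [Fin.val_last, node_last hM] at this

/-- On a closed cell, `p1` is a convex combination of the two nodal values. -/
lemma p1_convex (hℓ : 0 < ℓ) (hM : 0 < M) {i : Fin M} {x : ℝ}
    (hx : x ∈ Icc (node ℓ M i) (node ℓ M (i + 1))) :
    ∃ θ ∈ Icc (0 : ℝ) 1, ∀ r : Fin (M + 1) → ℝ,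
      p1 ℓ r x = (1 - θ) * r i.castSucc + θ * r i.succ := by
  have hh := meshSize_pos hℓ hM
  have hx2 := hx.2
  rw [node_succ] at hx2
  refine ⟨(x - node ℓ M i) / (ℓ / M), ⟨div_nonneg (sub_nonneg.2 hx.1) hh.le, ?_⟩, fun r => ?_⟩
  · rw [div_le_one hh]; linarith
  · rw [p1_eq hℓ hM r hx, slopes]
    have hM' : (M : ℝ) ≠ 0 := by positivity
    field_simp; ring

lemma abs_p1_le (hℓ : 0 < ℓ) (hM : 0 < M) {r : Fin (M + 1) → ℝ} {C : ℝ} (hr : ∀ j, |r j| ≤ C)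
    {x : ℝ} (hx : x ∈ Icc 0 ℓ) : |p1 ℓ r x| ≤ C := by
  obtain ⟨i, hi⟩ := exists_mem_Icc_node hℓ hM hx
  obtain ⟨θ, hθ, h⟩ := p1_convex hℓ hM hi
  rw [h r]
  have h1 := abs_le.1 (hr i.castSucc)
  have h2 := abs_le.1 (hr i.succ)
  rw [abs_le]
  constructor <;> nlinarith [hθ.1, hθ.2]

lemma deriv_p1_eq (hℓ : 0 < ℓ) (hM : 0 < M) (r : Fin (M + 1) → ℝ) {i : Fin M} {x : ℝ}
    (hx : x ∈ cell ℓ M i) : deriv (p1 ℓ r) x = slopes ℓ r i := by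
  have : p1 ℓ r =ᶠ[nhds x] fun y => r i.castSucc + slopes ℓ r i * (y - node ℓ M i) := by
    filter_upwards [isOpen_Ioo.mem_nhds hx] with y hy
    exact p1_eq hℓ hM r (Ioo_subset_Icc_self hy)
  rw [this.deriv_eq]
  simp

lemma deriv_p1_ae (hℓ : 0 < ℓ) (hM : 0 < M) (r : Fin (M + 1) → ℝ) :
    deriv (p1 ℓ r) =ᵐ[pipeMeasure ℓ] p0 ℓ (slopes ℓ r) := by
  filter_upwards [ae_mem_cell hℓ hM] with x ⟨i, hi⟩
  rw [deriv_p1_eq hℓ hM r hi, p0_eq hℓ _ hi]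

lemma measurable_p0 (q : Fin M → ℝ) : Measurable (p0 ℓ q) := by
  unfold p0
  exact Finset.measurable_fun_sum _ fun i _ => measurable_const.indicator measurableSet_Ioo

lemma continuous_p1 (r : Fin (M + 1) → ℝ) : Continuous (p1 ℓ r) := by
  unfold p1
  fun_prop

/-- Sums of Lipschitz hat functions; this permits integration by parts against test functions with
kinks at the nodes. -/
lemma absolutelyContinuous_p1 (r : Fin (M + 1) → ℝ) (a b : ℝ) :
    AbsolutelyContinuousOnInterval (p1 ℓ r) a b := by
  have hat : ∀ c : ℝ, ∀ h : ℝ,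
      AbsolutelyContinuousOnInterval (fun x => max 0 (1 - |x - c| / h)) a b := by
    intro c h
    apply LipschitzOnWith.absolutelyContinuousOnInterval (K := Real.toNNReal (1 / |h|))
    apply LipschitzOnWith.of_dist_le_mul
    intro x _ y _
    rw [Real.dist_eq, Real.dist_eq, Real.coe_toNNReal _ (by positivity)]
    have h1 : |max 0 (1 - |x - c| / h) - max 0 (1 - |y - c| / h)|
        ≤ |(1 - |x - c| / h) - (1 - |y - c| / h)| := by
      rw [max_comm 0, max_comm 0]; exact abs_max_sub_max_le_abs _ _ _
    refine h1.trans ?_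
    have e : (1 - |x - c| / h) - (1 - |y - c| / h) = (|y - c| - |x - c|) * (1 / h) := by ring
    rw [e, abs_mul, abs_div, abs_one, mul_comm (1 / |h|)]
    refine mul_le_mul_of_nonneg_right ?_ (by positivity)
    have := abs_abs_sub_abs_le (y - c) (x - c)
    rw [abs_sub_comm x y]
    simpa using this
  have hsum : ∀ s : Finset (Fin (M + 1)), AbsolutelyContinuousOnInterval
      (fun x => ∑ i ∈ s, r i * max 0 (1 - |x - node ℓ M i| / (ℓ / M))) a b := by
    intro s
    induction s using Finset.induction_on with
    | empty =>
      simp only [Finset.sum_empty]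
      exact (LipschitzOnWith.absolutelyContinuousOnInterval (K := 0)
        (LipschitzWith.const (0 : ℝ)).lipschitzOnWith)
    | insert i s hi ih =>
      simp only [Finset.sum_insert hi]
      exact ((hat _ _).const_mul _).add ih
  exact hsum Finset.univ

lemma integral_p0 (hℓ : 0 < ℓ) (hM : 0 < M) (q : Fin M → ℝ) :
    ∫ x, p0 ℓ q x ∂(pipeMeasure ℓ) = ℓ / M * ∑ i, q i := by
  have hh := meshSize_pos hℓ hM
  unfold p0
  rw [integral_finsetSum]
  · rw [Finset.mul_sum]
    refine Finset.sum_congr rfl fun i _ => ?_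
    rw [integral_indicator measurableSet_Ioo, Measure.restrict_restrict measurableSet_Ioo,
      show Ioo (node ℓ M i) (node ℓ M (i + 1)) ∩ Ioo 0 ℓ = Ioo (node ℓ M i) (node ℓ M (i + 1)) from
        inter_eq_self_of_subset_left (cell_subset hℓ hM i)]
    simp only [integral_const, MeasurableSet.univ, measureReal_restrict_apply, univ_inter,
      smul_eq_mul]
    rw [Real.volume_real_Ioo_of_le (node_mono hℓ (Nat.le_succ _)), node_succ]
    ring
  · intro i _
    exact (integrable_const _).indicator measurableSet_Ioo

lemma setIntegral_cell (hℓ : 0 < ℓ) (hM : 0 < M) {f : ℝ → ℝ}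
    (hf : Integrable f (pipeMeasure ℓ)) :
    ∑ i : Fin M, ∫ x in node ℓ M i..node ℓ M (i + 1), f x = ∫ x, f x ∂(pipeMeasure ℓ) := by
  rw [Fin.sum_univ_eq_sum_range (fun i => ∫ x in node ℓ M i..node ℓ M (i + 1), f x),
    intervalIntegral.sum_integral_adjacent_intervals, node_zero, node_last hM,
    intervalIntegral.integral_of_le hℓ.le, integral_Ioc_eq_integral_Ioo]
  intro k hk
  rw [intervalIntegrable_iff_integrableOn_Ioo_of_le (node_mono hℓ (Nat.le_succ k))]
  exact IntegrableOn.mono_set hf (cell_subset hℓ hM ⟨k, hk⟩)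

end Mesh

lemma intervalIntegral_eq_pipe {ℓ : ℝ} (hℓ : 0 < ℓ) (f : ℝ → ℝ) :
    ∫ x in (0 : ℝ)..ℓ, f x = ∫ x, f x ∂(pipeMeasure ℓ) := by
  rw [intervalIntegral.integral_of_le hℓ.le, integral_Ioc_eq_integral_Ioo]

/-- The Cauchy–Schwarz inequality, from nonnegativity of the variance about the mean value. -/
lemma sq_intervalIntegral_le {f : ℝ → ℝ} {x y : ℝ} (hxy : x ≤ y)
    (hf : IntervalIntegrable f volume x y)
    (hf2 : IntervalIntegrable (fun t => f t ^ 2) volume x y) :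
    (∫ t in x..y, f t) ^ 2 ≤ (y - x) * ∫ t in x..y, f t ^ 2 := by
  rcases eq_or_lt_of_le hxy with rfl | h
  · simp
  set I := ∫ t in x..y, f t with hI
  set c := I / (y - x) with hc
  have hyx : 0 < y - x := sub_pos.2 h
  have h0 : 0 ≤ ∫ t in x..y, (f t - c) ^ 2 :=
    intervalIntegral.integral_nonneg hxy fun t _ => sq_nonneg _
  have e : ∫ t in x..y, (f t - c) ^ 2 = (∫ t in x..y, f t ^ 2) - 2 * c * I + c ^ 2 * (y - x) := by
    have e1 : ∀ t, (f t - c) ^ 2 = f t ^ 2 - 2 * c * f t + c ^ 2 := fun t => by ring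
    simp only [e1]
    rw [intervalIntegral.integral_add (hf2.sub (hf.const_mul _)) (by simp),
      intervalIntegral.integral_sub hf2 (hf.const_mul _), intervalIntegral.integral_const_mul]
    simp [mul_comm, hI]
  rw [e] at h0
  have h1 : c * (y - x) = I := by rw [hc]; field_simp
  have h2 := mul_nonneg hyx.le h0
  have h3 : (y - x) * ((∫ t in x..y, f t ^ 2) - 2 * c * I + c ^ 2 * (y - x)) =
      (y - x) * (∫ t in x..y, f t ^ 2) - 2 * (c * (y - x)) * I + (c * (y - x)) ^ 2 := by ring
  rw [h3, h1] at h2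
  linarith

/-! ### Essentially bounded functions on the pipe -/

/-- Essentially bounded measurable functions on `(0, ℓ)`. -/
def EssBdd (ℓ : ℝ) (f : ℝ → ℝ) : Prop :=
  AEStronglyMeasurable f (pipeMeasure ℓ) ∧ ∃ C, ∀ᵐ x ∂(pipeMeasure ℓ), |f x| ≤ C

namespace EssBdd

variable {ℓ : ℝ} {f g : ℝ → ℝ}

lemma congr (hf : EssBdd ℓ f) (h : f =ᵐ[pipeMeasure ℓ] g) : EssBdd ℓ g := by
  refine ⟨hf.1.congr h, ?_⟩
  obtain ⟨C, hC⟩ := hf.2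
  exact ⟨C, by filter_upwards [hC, h] with x h1 h2; rwa [← h2]⟩

lemma integrable (hf : EssBdd ℓ f) : Integrable f (pipeMeasure ℓ) := by
  obtain ⟨C, hC⟩ := hf.2
  exact Integrable.of_bound hf.1 C hC

lemma const (c : ℝ) : EssBdd ℓ fun _ => c :=
  ⟨aestronglyMeasurable_const, |c|, Filter.Eventually.of_forall fun _ => le_rfl⟩

lemma add (hf : EssBdd ℓ f) (hg : EssBdd ℓ g) : EssBdd ℓ fun x => f x + g x := by
  obtain ⟨C, hC⟩ := hf.2
  obtain ⟨D, hD⟩ := hg.2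
  refine ⟨hf.1.add hg.1, C + D, ?_⟩
  filter_upwards [hC, hD] with x h1 h2
  exact (abs_add_le _ _).trans (add_le_add h1 h2)

lemma mul (hf : EssBdd ℓ f) (hg : EssBdd ℓ g) : EssBdd ℓ fun x => f x * g x := by
  obtain ⟨C, hC⟩ := hf.2
  obtain ⟨D, hD⟩ := hg.2
  refine ⟨hf.1.mul hg.1, C * D, ?_⟩
  filter_upwards [hC, hD] with x h1 h2
  rw [abs_mul]
  exact mul_le_mul h1 h2 (abs_nonneg _) ((abs_nonneg _).trans h1)

lemma neg (hf : EssBdd ℓ f) : EssBdd ℓ fun x => - f x := by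
  simpa using (const (-1)).mul hf

lemma sub (hf : EssBdd ℓ f) (hg : EssBdd ℓ g) : EssBdd ℓ fun x => f x - g x := by
  simpa [sub_eq_add_neg] using hf.add hg.neg

lemma const_mul (c : ℝ) (hf : EssBdd ℓ f) : EssBdd ℓ fun x => c * f x := (const c).mul hf

lemma div_const (hf : EssBdd ℓ f) (c : ℝ) : EssBdd ℓ fun x => f x / c := by
  simpa [div_eq_mul_inv] using hf.mul (const c⁻¹)

lemma abs (hf : EssBdd ℓ f) : EssBdd ℓ fun x => |f x| := by
  obtain ⟨C, hC⟩ := hf.2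
  exact ⟨continuous_abs.comp_aestronglyMeasurable hf.1, C, by simpa using hC⟩

lemma pow (hf : EssBdd ℓ f) (n : ℕ) : EssBdd ℓ fun x => f x ^ n := by
  induction n with
  | zero => simpa using const 1
  | succ n ih => simpa [pow_succ] using ih.mul hf

lemma mul_integrable (hf : EssBdd ℓ f) (hg : Integrable g (pipeMeasure ℓ)) :
    Integrable (fun x => f x * g x) (pipeMeasure ℓ) := by
  obtain ⟨C, hC⟩ := hf.2
  exact hg.bdd_mul hf.1 hC

lemma p0 {M : ℕ} (q : Fin M → ℝ) : EssBdd ℓ (p0 ℓ q) := by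
  refine ⟨(measurable_p0 q).aestronglyMeasurable, ∑ i, |q i|, Filter.Eventually.of_forall ?_⟩
  intro x
  refine (Finset.abs_sum_le_sum_abs _ _).trans (Finset.sum_le_sum fun i _ => ?_)
  rw [indicator_apply]
  split_ifs <;> simp

lemma of_continuousOn (hf : ContinuousOn f (Icc 0 ℓ)) : EssBdd ℓ f := by
  refine ⟨(hf.aestronglyMeasurable measurableSet_Icc).mono_measure
    (Measure.restrict_mono Ioo_subset_Icc_self le_rfl), ?_⟩
  obtain ⟨C, hC⟩ := isCompact_Icc.exists_bound_of_continuousOn hf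
  exact ⟨C, by
    filter_upwards [ae_restrict_mem measurableSet_Ioo] with x hx
    exact hC x (Ioo_subset_Icc_self hx)⟩

lemma p1 {M : ℕ} (r : Fin (M + 1) → ℝ) : EssBdd ℓ (p1 ℓ r) :=
  of_continuousOn (continuous_p1 r).continuousOn

lemma deriv_p1 (hℓ : 0 < ℓ) {M : ℕ} (hM : 0 < M) (r : Fin (M + 1) → ℝ) :
    EssBdd ℓ (deriv (PipeFlow.p1 ℓ r)) :=
  (p0 (slopes ℓ r)).congr (deriv_p1_ae hℓ hM r).symm

lemma comp_p0 (hℓ : 0 < ℓ) {M : ℕ} (hM : 0 < M) (F : ℝ → ℝ) (q : Fin M → ℝ) :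
    EssBdd ℓ fun x => F (PipeFlow.p0 ℓ q x) := by
  refine (p0 (fun i => F (q i))).congr ?_
  filter_upwards [ae_mem_cell hℓ hM] with x ⟨i, hi⟩
  rw [p0_eq hℓ _ hi, p0_eq hℓ _ hi]

lemma discreteVelocity (hℓ : 0 < ℓ) {M : ℕ} (hM : 0 < M) (a : ℝ) (q : Fin M → ℝ)
    (r : Fin (M + 1) → ℝ) : EssBdd ℓ (discreteVelocity a ℓ q r) := by
  unfold PipeFlow.discreteVelocity
  simp only [div_eq_mul_inv]
  exact (p1 r).mul (comp_p0 hℓ hM (fun y => (a * y)⁻¹) q)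

end EssBdd


/-! ## Monotone variational inequalities -/

/-- A theorem of the alternative for matrices with entrywise nonnegative symmetric part. -/
lemma exists_simplex_mulVec_nonneg {ι : Type*} [Fintype ι] [Nonempty ι] (G : ι → ι → ℝ)
    (hG : ∀ i j, 0 ≤ G i j + G j i) :
    ∃ c ∈ stdSimplex ℝ ι, ∀ i, 0 ≤ ∑ j, c j * G i j := by
  classical
  by_contra hcon
  push Not at hcon
  let T : (ι → ℝ) →ₗ[ℝ] (ι → ℝ) :=
    { toFun := fun c i => ∑ j, c j * G i j
      map_add' := fun x y => by ext i; simp [add_mul, Finset.sum_add_distrib]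
      map_smul' := fun c x => by ext i; simp [Finset.mul_sum, mul_assoc] }
  have hTc : Continuous T := T.continuous_of_finiteDimensional
  have hC : IsCompact (T '' stdSimplex ℝ ι) := (isCompact_stdSimplex (𝕜 := ℝ) ι).image hTc
  have hCc : Convex ℝ (T '' stdSimplex ℝ ι) := (convex_stdSimplex ℝ ι).linear_image T
  have hD : IsClosed {y : ι → ℝ | ∀ i, 0 ≤ y i} := by
    simp only [ofPred_forall]
    exact isClosed_iInter fun i => isClosed_le continuous_const (continuous_apply i)
  have hDc : Convex ℝ {y : ι → ℝ | ∀ i, 0 ≤ y i} := by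
    intro x hx y hy a b ha hb _ i
    simp only [Pi.add_apply, Pi.smul_apply, smul_eq_mul]
    exact add_nonneg (mul_nonneg ha (hx i)) (mul_nonneg hb (hy i))
  have hdis : Disjoint (T '' stdSimplex ℝ ι) {y : ι → ℝ | ∀ i, 0 ≤ y i} := by
    rw [Set.disjoint_left]
    rintro _ ⟨c, hc, rfl⟩ h
    obtain ⟨i, hi⟩ := hcon c hc
    exact absurd (h i) (not_le.2 hi)
  -- Otherwise the image of the simplex misses the nonnegative orthant; a separating functional has
  -- nonnegative coefficients `y` and is negative on the image.
  obtain ⟨f, u, v, h1, huv, h2⟩ := geometric_hahn_banach_compact_closed hCc hC hDc hD hdis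
  set y : ι → ℝ := fun i => f (Pi.single i 1) with hy
  have hf : ∀ b : ι → ℝ, f b = ∑ i, b i * y i := by
    intro b
    conv_lhs => rw [← Finset.univ_sum_single b]
    rw [map_sum]
    refine Finset.sum_congr rfl fun i _ => ?_
    have : (Pi.single i (b i) : ι → ℝ) = b i • Pi.single i 1 := by
      rw [← Pi.single_smul, smul_eq_mul, mul_one]
    rw [this, map_smul, smul_eq_mul]
  have hv0 : v < 0 := by
    have := h2 0 (by simp)
    simpa using this
  -- If `y i < 0`, the point `v / y i` on the `i`-th axis lies in the orthant and is mapped to `v`,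
  -- contradicting the strict separation.
  have hy0 : ∀ i, 0 ≤ y i := by
    intro i
    by_contra hneg
    push Not at hneg
    have := h2 (Pi.single i (v / y i)) (by
      intro j
      by_cases hj : j = i
      · subst hj; simp [div_nonneg_of_nonpos hv0.le hneg.le]
      · simp [hj])
    rw [hf, Finset.sum_eq_single i] at this
    · simp only [Pi.single_eq_same] at this
      rw [div_mul_cancel₀ _ hneg.ne] at this
      exact lt_irrefl _ this
    · intro j _ hj; simp [hj]
    · simp
  set S := ∑ i, y i with hS
  have hS0 : 0 < S := by
    refine lt_of_le_of_ne (Finset.sum_nonneg fun i _ => hy0 i) fun h => ?_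
    have hz : ∀ i, y i = 0 := by
      have := (Finset.sum_eq_zero_iff_of_nonneg fun i _ => hy0 i).1 h.symm
      exact fun i => this i (Finset.mem_univ i)
    obtain ⟨i⟩ := ‹Nonempty ι›
    have := h1 (T (Pi.single i 1)) ⟨_, single_mem_stdSimplex ℝ i, rfl⟩
    rw [hf] at this
    simp [hz] at this
    linarith
  -- The normalized separating vector is itself a point of the simplex; its value is the quadratic
  -- form of `G` at `y`, up to a positive factor, and this form sees only the symmetric part.
  have hmem : (fun i => y i / S) ∈ stdSimplex ℝ ι := by
    refine ⟨fun i => div_nonneg (hy0 i) hS0.le, ?_⟩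
    rw [← Finset.sum_div, div_self hS0.ne']
  have h3 := h1 _ ⟨_, hmem, rfl⟩
  rw [hf] at h3
  have e1 : ∑ i, T (fun i => y i / S) i * y i = (∑ i, ∑ j, y i * y j * G i j) / S := by
    rw [Finset.sum_div]
    refine Finset.sum_congr rfl fun i _ => ?_
    rw [Finset.sum_div]
    change (∑ j, y j / S * G i j) * y i = _
    rw [Finset.sum_mul]
    exact Finset.sum_congr rfl fun j _ => by ring
  have e2 : 0 ≤ ∑ i, ∑ j, y i * y j * G i j := by
    have h4 : (∑ i, ∑ j, y i * y j * G i j) + (∑ i, ∑ j, y i * y j * G i j) =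
        ∑ i, ∑ j, y i * y j * (G i j + G j i) := by
      conv_lhs => rhs; rw [Finset.sum_comm]
      rw [← Finset.sum_add_distrib]
      refine Finset.sum_congr rfl fun i _ => ?_
      rw [← Finset.sum_add_distrib]
      exact Finset.sum_congr rfl fun j _ => by ring
    have : 0 ≤ ∑ i, ∑ j, y i * y j * (G i j + G j i) :=
      Finset.sum_nonneg fun i _ => Finset.sum_nonneg fun j _ =>
        mul_nonneg (mul_nonneg (hy0 i) (hy0 j)) (hG i j)
    linarith
  rw [e1] at h3
  have := div_nonneg e2 hS0.le
  linarith

/-- Monotone hemicontinuous variational inequalities on compact convex sets are solvable. -/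
theorem exists_variational_solution {E : Type*} [NormedAddCommGroup E] [NormedSpace ℝ E]
    [FiniteDimensional ℝ E] {K : Set E} (hK : IsCompact K) (hKc : Convex ℝ K) (hKn : K.Nonempty)
    (A : E → E →ₗ[ℝ] ℝ) (hmono : ∀ u ∈ K, ∀ v ∈ K, 0 ≤ A u (u - v) - A v (u - v))
    (hcont : ∀ u ∈ K, ∀ v ∈ K, Filter.Tendsto (fun t : ℝ => A (u + t • (v - u)) (v - u))
      (nhdsWithin 0 (Ioi 0)) (nhds (A u (v - u)))) :
    ∃ u ∈ K, ∀ v ∈ K, 0 ≤ A u (v - u) := by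
  have hclosed : ∀ v : K, IsClosed {u : E | 0 ≤ A v (v - u)} := by
    intro v
    have : Continuous fun u : E => A v (v - u) :=
      (A v).continuous_of_finiteDimensional.comp (continuous_const.sub continuous_id)
    exact isClosed_le continuous_const this
  have hfin : ∀ s : Finset K, (K ∩ ⋂ v ∈ s, {u : E | 0 ≤ A v (v - u)}).Nonempty := by
    intro s
    rcases s.eq_empty_or_nonempty with rfl | hs
    · simpa using hKn
    have : Nonempty s := hs.to_subtype
    -- Finite intersection property for Minty's inequalities: with `G i j = A vᵢ (vᵢ - vⱼ)`
    -- monotonicity is nonnegativity of the symmetric part, and the convex combination with weights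
    -- `c` satisfies the finitely many conditions.
    obtain ⟨c, hc, h⟩ := exists_simplex_mulVec_nonneg
      (fun i j : s => A (i : K) ((i : K) - ((j : K) : E))) (by
        intro i j
        have := hmono (i : K) (i : K).2 (j : K) (j : K).2
        have e : A (j : K) (((j : K) : E) - (i : K)) = - A (j : K) (((i : K) : E) - (j : K)) := by
          rw [← map_neg, neg_sub]
        rw [e]; linarith)
    refine ⟨∑ j : s, c j • ((j : K) : E), ?_, ?_⟩
    · exact hKc.sum_mem (fun i _ => hc.1 i) hc.2 (fun i _ => (i : K).2)
    · simp only [mem_iInter]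
      intro v hv
      have h1 := h ⟨v, hv⟩
      have e : A (v : E) ((v : E) - ∑ j : s, c j • ((j : K) : E)) =
          ∑ j : s, c j * A (v : E) ((v : E) - ((j : K) : E)) := by
        simp only [map_sub, map_sum, map_smul, smul_eq_mul, mul_sub, Finset.sum_sub_distrib]
        rw [← Finset.sum_mul, hc.2, one_mul]
      rw [mem_ofPred_eq, e]; exact h1
  obtain ⟨u, huK, hu⟩ := hK.inter_iInter_nonempty _ hclosed hfin
  refine ⟨u, huK, fun v hv => ?_⟩
  -- Minty's trick: test the dual inequality at `u + t (v - u)`, divide by `t`, and let `t` tend to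
  -- zero.
  refine ge_of_tendsto (hcont u huK v hv) ?_
  have hlt : ∀ᶠ t : ℝ in nhdsWithin 0 (Ioi 0), t < 1 :=
    Filter.Eventually.filter_mono nhdsWithin_le_nhds (gt_mem_nhds one_pos)
  filter_upwards [hlt, self_mem_nhdsWithin] with t ht1 ht0
  have ht0 : 0 < t := ht0
  have hmem : u + t • (v - u) ∈ K := hKc.add_smul_sub_mem huK hv ⟨ht0.le, ht1.le⟩
  have h1 := mem_iInter.1 hu ⟨_, hmem⟩
  have h2 : 0 ≤ A (u + t • (v - u)) (u + t • (v - u) - u) := h1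
  rw [add_sub_cancel_left, map_smul, smul_eq_mul] at h2
  exact nonneg_of_mul_nonneg_right h2 ht0


/-! ## One step of the scheme -/

/-- The constants that describe the pressure law and the range of the physical parameters. -/
structure FlowBounds (P : ℝ → ℝ) (α β κ L εmax wmax γmin B : ℝ) : Prop where
  law : PressureLaw P α β κ L
  kappa_eq : κ = 4 * εmax ^ 2 * wmax ^ 2
  one_le : 1 ≤ B
  L_le : L ≤ B
  beta_le : β ≤ B
  eps_le : εmax ≤ B
  vel_le : 3 * wmax / 2 ≤ B
  wmax_pos : 0 < wmax
  fric_pos : 0 < γmin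

/-- Admissible values of the parameters. -/
structure ParamRange (εmax γmin B ε γ a : ℝ) : Prop where
  eps_nonneg : 0 ≤ ε
  eps_le : ε ≤ εmax
  fric_ge : γmin ≤ γ
  fric_le : γ ≤ B
  area_pos : 0 < a
  inv_area_le : 1 / a ≤ B
  area_le : a ≤ B

section Linear

variable {ℓ : ℝ} {M : ℕ}

lemma p1_add (r s : Fin (M + 1) → ℝ) (x : ℝ) : p1 ℓ (r + s) x = p1 ℓ r x + p1 ℓ s x := by
  simp [p1, add_mul, Finset.sum_add_distrib]

lemma p1_smul (c : ℝ) (r : Fin (M + 1) → ℝ) (x : ℝ) : p1 ℓ (c • r) x = c * p1 ℓ r x := by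
  simp [p1, Finset.mul_sum, mul_assoc]

lemma p1_sub (r s : Fin (M + 1) → ℝ) (x : ℝ) : p1 ℓ (r - s) x = p1 ℓ r x - p1 ℓ s x := by
  simp [p1, sub_mul, Finset.sum_sub_distrib]

lemma slopes_add (r s : Fin (M + 1) → ℝ) (i : Fin M) :
    slopes ℓ (r + s) i = slopes ℓ r i + slopes ℓ s i := by
  simp [slopes]; ring

lemma slopes_smul (c : ℝ) (r : Fin (M + 1) → ℝ) (i : Fin M) :
    slopes ℓ (c • r) i = c * slopes ℓ r i := by
  simp [slopes]; ring

lemma slopes_sub (r s : Fin (M + 1) → ℝ) (i : Fin M) :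
    slopes ℓ (r - s) i = slopes ℓ r i - slopes ℓ s i := by
  simp [slopes]; ring

end Linear

/-- The residual of the discrete mass balance. -/
noncomputable def massRes (a ℓ t : ℝ) {M : ℕ} (q' q : Fin M → ℝ) (r : Fin (M + 1) → ℝ)
    (s : Fin M → ℝ) : ℝ :=
  (∫ x in (0 : ℝ)..ℓ, a * ((p0 ℓ q x - p0 ℓ q' x) / t) * p0 ℓ s x)
    + ∫ x in (0 : ℝ)..ℓ, deriv (p1 ℓ r) x * p0 ℓ s x

/-- The residual of the discrete momentum balance. -/
noncomputable def momRes (P : ℝ → ℝ) (ε γ a ℓ t bL bR : ℝ) {M : ℕ} (q' : Fin M → ℝ)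
    (r' : Fin (M + 1) → ℝ) (q : Fin M → ℝ) (r s : Fin (M + 1) → ℝ) : ℝ :=
  (∫ x in (0 : ℝ)..ℓ,
        ε ^ 2 * ((discreteVelocity a ℓ q r x - discreteVelocity a ℓ q' r' x) / t) * p1 ℓ s x)
      - (∫ x in (0 : ℝ)..ℓ,
          enthalpy P ε (p0 ℓ q x) (discreteVelocity a ℓ q r x) * deriv (p1 ℓ s) x)
      + (bR * p1 ℓ s ℓ - bL * p1 ℓ s 0)
      + (∫ x in (0 : ℝ)..ℓ,
          γ * |discreteVelocity a ℓ q r x| * discreteVelocity a ℓ q r x * p1 ℓ s x)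

/-- The density of the discrete momentum balance. -/
noncomputable def momDensity (P : ℝ → ℝ) (ε γ a ℓ t : ℝ) {M : ℕ} (q' : Fin M → ℝ)
    (r' : Fin (M + 1) → ℝ) (q : Fin M → ℝ) (r s : Fin (M + 1) → ℝ) (x : ℝ) : ℝ :=
  ε ^ 2 * ((discreteVelocity a ℓ q r x - discreteVelocity a ℓ q' r' x) / t) * p1 ℓ s x
    - enthalpy P ε (p0 ℓ q x) (discreteVelocity a ℓ q r x) * p0 ℓ (slopes ℓ s) x
    + γ * |discreteVelocity a ℓ q r x| * discreteVelocity a ℓ q r x * p1 ℓ s x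

/-- The density that solves the discrete mass balance for a given flux. -/
noncomputable def massUpdate (a ℓ t : ℝ) {M : ℕ} (q' : Fin M → ℝ) (r : Fin (M + 1) → ℝ)
    (i : Fin M) : ℝ :=
  q' i - t / a * slopes ℓ r i

/-- Admissibility of a pair of coefficient vectors. -/
def AdmState (a ℓ α β V : ℝ) {M : ℕ} (q : Fin M → ℝ) (r : Fin (M + 1) → ℝ) : Prop :=
  (∀ i, q i ∈ Icc α β) ∧ ∀ᵐ x ∂(pipeMeasure ℓ), |discreteVelocity a ℓ q r x| ≤ V

section Step

variable {P : ℝ → ℝ} {α β κ L εmax wmax γmin B ε γ a ℓ t bL bR : ℝ} {M : ℕ}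

lemma massRes_eq (hℓ : 0 < ℓ) (hM : 0 < M) (q' q : Fin M → ℝ) (r : Fin (M + 1) → ℝ)
    (s : Fin M → ℝ) :
    massRes a ℓ t q' q r s
      = ℓ / M * ∑ i, (a * ((q i - q' i) / t) + slopes ℓ r i) * s i := by
  rw [massRes, intervalIntegral_eq_pipe hℓ, intervalIntegral_eq_pipe hℓ, ← integral_add,
    ← integral_p0 hℓ hM]
  · refine integral_congr_ae ?_
    filter_upwards [ae_mem_cell hℓ hM] with x ⟨i, hi⟩
    rw [deriv_p1_eq hℓ hM r hi]
    simp only [p0_eq hℓ _ hi]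
    ring
  · exact ((EssBdd.const_mul a (((EssBdd.p0 q).sub (EssBdd.p0 q')).div_const t)).mul
      (EssBdd.p0 s)).integrable
  · exact ((EssBdd.deriv_p1 hℓ hM r).mul (EssBdd.p0 s)).integrable

/-- Both terms are constant on each cell, so the mass balance decouples into explicit formulas for
the new density. This leaves the flux as the only unknown of a time step. -/
lemma massRes_eq_zero_iff (hℓ : 0 < ℓ) (hM : 0 < M) (ha : 0 < a) (ht : 0 < t)
    (q' q : Fin M → ℝ) (r : Fin (M + 1) → ℝ) :
    (∀ s, massRes a ℓ t q' q r s = 0) ↔ q = massUpdate a ℓ t q' r := by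
  have hh := meshSize_pos hℓ hM
  have key : ∀ i, a * ((q i - q' i) / t) + slopes ℓ r i = 0 ↔ q i = massUpdate a ℓ t q' r i := by
    intro i
    rw [massUpdate]
    constructor
    · intro h
      have : slopes ℓ r i = - (a * ((q i - q' i) / t)) := by linarith
      rw [this]; field_simp; ring
    · intro h
      rw [h]; field_simp; ring
  constructor
  · intro h
    funext i
    rw [← key]
    have := h (Pi.single i 1)
    rw [massRes_eq hℓ hM, Finset.sum_eq_single i] at this
    · simpa [hh.ne'] using this
    · intro j _ hj; simp [hj]
    · simp
  · intro h s
    rw [massRes_eq hℓ hM, Finset.sum_eq_zero, mul_zero]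
    intro i _
    rw [(key i).2 (congrFun h i), zero_mul]

lemma essBdd_enthalpy (hℓ : 0 < ℓ) (hM : 0 < M) (q : Fin M → ℝ) (r : Fin (M + 1) → ℝ) :
    EssBdd ℓ fun x => enthalpy P ε (p0 ℓ q x) (discreteVelocity a ℓ q r x) := by
  unfold enthalpy
  exact ((((EssBdd.discreteVelocity hℓ hM a q r).pow 2).const_mul _).div_const 2).add
    (EssBdd.comp_p0 hℓ hM (deriv P) q)

lemma essBdd_momDensity (hℓ : 0 < ℓ) (hM : 0 < M) (q' : Fin M → ℝ) (r' : Fin (M + 1) → ℝ)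
    (q : Fin M → ℝ) (r s : Fin (M + 1) → ℝ) :
    EssBdd ℓ (momDensity P ε γ a ℓ t q' r' q r s) := by
  have hw := EssBdd.discreteVelocity hℓ hM a q r
  have hw' := EssBdd.discreteVelocity hℓ hM a q' r'
  unfold momDensity
  exact (((((hw.sub hw').div_const t).const_mul _).mul (EssBdd.p1 s)).sub
    ((essBdd_enthalpy hℓ hM q r).mul (EssBdd.p0 _))).add
    (((hw.abs.const_mul γ).mul hw).mul (EssBdd.p1 s))

lemma momRes_eq (hℓ : 0 < ℓ) (hM : 0 < M) (q' : Fin M → ℝ) (r' : Fin (M + 1) → ℝ)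
    (q : Fin M → ℝ) (r s : Fin (M + 1) → ℝ) :
    momRes P ε γ a ℓ t bL bR q' r' q r s =
      (∫ x, momDensity P ε γ a ℓ t q' r' q r s x ∂(pipeMeasure ℓ))
        + (bR * s (Fin.last M) - bL * s 0) := by
  have hw := EssBdd.discreteVelocity hℓ hM a q r
  have hw' := EssBdd.discreteVelocity hℓ hM a q' r'
  have b1 := (((hw.sub hw').div_const t).const_mul (ε ^ 2)).mul (EssBdd.p1 s)
  have b2 := (essBdd_enthalpy (P := P) (ε := ε) (a := a) hℓ hM q r).mul
    (EssBdd.p0 (slopes ℓ s))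
  have i1 := b1.integrable
  have i2 := b2.integrable
  have i3 := (((hw.abs.const_mul γ).mul hw).mul (EssBdd.p1 s)).integrable
  unfold momDensity
  rw [integral_add (b1.sub b2).integrable i3, integral_sub i1 i2, momRes, intervalIntegral_eq_pipe hℓ,
    intervalIntegral_eq_pipe hℓ, intervalIntegral_eq_pipe hℓ, p1_zero hℓ hM, p1_right hℓ hM]
  have e : ∫ x, enthalpy P ε (p0 ℓ q x) (discreteVelocity a ℓ q r x) * deriv (p1 ℓ s) x
        ∂(pipeMeasure ℓ) =
      ∫ x, enthalpy P ε (p0 ℓ q x) (discreteVelocity a ℓ q r x) * p0 ℓ (slopes ℓ s) x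
        ∂(pipeMeasure ℓ) := by
    refine integral_congr_ae ?_
    filter_upwards [deriv_p1_ae hℓ hM s] with x hx
    rw [hx]
  rw [e]; ring

lemma momDensity_add (hℓ : 0 < ℓ) (hM : 0 < M) (q' : Fin M → ℝ) (r' : Fin (M + 1) → ℝ)
    (q : Fin M → ℝ) (r s u : Fin (M + 1) → ℝ) :
    momDensity P ε γ a ℓ t q' r' q r (s + u) =ᵐ[pipeMeasure ℓ] fun x =>
      momDensity P ε γ a ℓ t q' r' q r s x + momDensity P ε γ a ℓ t q' r' q r u x := by
  filter_upwards [ae_mem_cell hℓ hM] with x ⟨i, hi⟩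
  simp only [momDensity, p1_add, p0_eq hℓ _ hi, slopes_add]
  ring

/-- The momentum residual as a linear functional of the test function. -/
noncomputable def momResₗ (P : ℝ → ℝ) (ε γ a ℓ t bL bR : ℝ) {M : ℕ} (hℓ : 0 < ℓ) (hM : 0 < M)
    (q' : Fin M → ℝ) (r' : Fin (M + 1) → ℝ) (q : Fin M → ℝ) (r : Fin (M + 1) → ℝ) :
    (Fin (M + 1) → ℝ) →ₗ[ℝ] ℝ where
  toFun s := momRes P ε γ a ℓ t bL bR q' r' q r s
  map_add' s u := by
    rw [momRes_eq hℓ hM, momRes_eq hℓ hM, momRes_eq hℓ hM,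
      integral_congr_ae (momDensity_add hℓ hM q' r' q r s u),
      integral_add (essBdd_momDensity hℓ hM _ _ _ _ _).integrable
        (essBdd_momDensity hℓ hM _ _ _ _ _).integrable]
    simp only [Pi.add_apply]; ring
  map_smul' c s := by
    rw [momRes_eq hℓ hM, momRes_eq hℓ hM]
    have : momDensity P ε γ a ℓ t q' r' q r (c • s) =ᵐ[pipeMeasure ℓ] fun x =>
        c * momDensity P ε γ a ℓ t q' r' q r s x := by
      filter_upwards [ae_mem_cell hℓ hM] with x ⟨i, hi⟩
      simp only [momDensity, p1_smul, p0_eq hℓ _ hi, slopes_smul]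
      ring
    rw [integral_congr_ae this, integral_const_mul]
    simp only [Pi.smul_apply, smul_eq_mul, RingHom.id_apply]; ring

/-- Lets a flux used as a test function be replaced by `a ρ w`, which brings the momentum terms into
the form treated by the pointwise inequalities. -/
lemma p1_eq_mul_velocity (hℓ : 0 < ℓ) (ha : 0 < a) {q : Fin M → ℝ} (r : Fin (M + 1) → ℝ)
    {i : Fin M} (hq : 0 < q i) {x : ℝ} (hx : x ∈ cell ℓ M i) :
    p1 ℓ r x = a * (q i * discreteVelocity a ℓ q r x) := by
  rw [discreteVelocity, p0_eq hℓ q hx]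
  field_simp

/-- Pointwise monotonicity of one implicit step. -/
lemma FlowBounds.step_monotone_pointwise (hF : FlowBounds P α β κ L εmax wmax γmin B)
    (hR : ParamRange εmax γmin B ε γ a) (ht : 0 < t)
    (hts : t * (B * (2 * B ^ 3 / α)) ≤ 7 / 32 * (κ / β)) {q1 q2 w1 w2 : ℝ}
    (hq1 : q1 ∈ Icc α β) (hq2 : q2 ∈ Icc α β) (hw1 : |w1| ≤ 3 * wmax / 2)
    (hw2 : |w2| ≤ 3 * wmax / 2) :
    a / t * (7 / 32 * (κ / β)) * (q1 - q2) ^ 2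
        + a * γ * (α / 4) * ((|w1| + |w2|) * (w1 - w2) ^ 2) ≤
      ε ^ 2 * ((w1 - w2) / t) * (a * (q1 * w1 - q2 * w2))
        - (enthalpy P ε q1 w1 - enthalpy P ε q2 w2) * (- (a * (q1 - q2) / t))
        + γ * (|w1| * w1 - |w2| * w2) * (a * (q1 * w1 - q2 * w2)) := by
  have h1 := hF.law.energy_monotone hF.kappa_eq hR.eps_nonneg hR.eps_le hq1 hq2 hw1 hw2
  have h2 := friction_monotone (B := B) hF.law.pos hq1.1 hq2.1 (hw1.trans hF.vel_le)
    (hw2.trans hF.vel_le)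
  have ha := hR.area_pos
  have hγ : 0 ≤ γ := hF.fric_pos.le.trans hR.fric_ge
  have hB : 0 ≤ B := zero_le_one.trans hF.one_le
  have hα := hF.law.pos
  have h3 := mul_le_mul_of_nonneg_left h1 (div_nonneg ha.le ht.le)
  have h4 := mul_le_mul_of_nonneg_left h2 (mul_nonneg ha.le hγ)
  -- The density defect of the friction consumes half of the constant `7 / 16`, because the energy
  -- term is amplified by `1 / t`.
  have h5 : a * γ * (2 * B ^ 3 / α * (q1 - q2) ^ 2) ≤
      a / t * (7 / 32 * (κ / β)) * (q1 - q2) ^ 2 := by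
    have h6 : γ * (2 * B ^ 3 / α) ≤ 7 / 32 * (κ / β) / t := by
      rw [le_div_iff₀ ht]
      calc γ * (2 * B ^ 3 / α) * t ≤ B * (2 * B ^ 3 / α) * t := by
            have := hR.fric_le
            gcongr
        _ ≤ _ := by linarith
    calc a * γ * (2 * B ^ 3 / α * (q1 - q2) ^ 2) = a * (γ * (2 * B ^ 3 / α)) * (q1 - q2) ^ 2 := by
          ring
      _ ≤ a * (7 / 32 * (κ / β) / t) * (q1 - q2) ^ 2 := by gcongr
      _ = _ := by ring
  have e : ε ^ 2 * ((w1 - w2) / t) * (a * (q1 * w1 - q2 * w2))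
        - (enthalpy P ε q1 w1 - enthalpy P ε q2 w2) * (- (a * (q1 - q2) / t))
        + γ * (|w1| * w1 - |w2| * w2) * (a * (q1 * w1 - q2 * w2)) =
      a / t * ((enthalpy P ε q1 w1 - enthalpy P ε q2 w2) * (q1 - q2)
        + ε ^ 2 * ((w1 - w2) * (q1 * w1 - q2 * w2)))
        + a * γ * ((|w1| * w1 - |w2| * w2) * (q1 * w1 - q2 * w2)) := by
    field_simp; ring
  rw [e]
  linarith

/-- Both densities come from the same previous density, so the slopes of `r1 - r2` equal `-a / t`
times the density difference. The enthalpy term thereby becomes the density part of the energy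
gradient, and the pointwise estimate applies. -/
lemma FlowBounds.momDensity_monotone (hF : FlowBounds P α β κ L εmax wmax γmin B)
    (hR : ParamRange εmax γmin B ε γ a) (hℓ : 0 < ℓ) (hM : 0 < M) (ht : 0 < t)
    (hts : t * (B * (2 * B ^ 3 / α)) ≤ 7 / 32 * (κ / β)) {q' : Fin M → ℝ}
    {r' r1 r2 : Fin (M + 1) → ℝ}
    (h1 : AdmState a ℓ α β (3 * wmax / 2) (massUpdate a ℓ t q' r1) r1)
    (h2 : AdmState a ℓ α β (3 * wmax / 2) (massUpdate a ℓ t q' r2) r2) :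
    ∀ᵐ x ∂(pipeMeasure ℓ),
      a / t * (7 / 32 * (κ / β)) *
          (p0 ℓ (massUpdate a ℓ t q' r1) x - p0 ℓ (massUpdate a ℓ t q' r2) x) ^ 2
        + a * γ * (α / 4) *
          ((|discreteVelocity a ℓ (massUpdate a ℓ t q' r1) r1 x|
            + |discreteVelocity a ℓ (massUpdate a ℓ t q' r2) r2 x|) *
          (discreteVelocity a ℓ (massUpdate a ℓ t q' r1) r1 x
            - discreteVelocity a ℓ (massUpdate a ℓ t q' r2) r2 x) ^ 2) ≤
      momDensity P ε γ a ℓ t q' r' (massUpdate a ℓ t q' r1) r1 (r1 - r2) x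
        - momDensity P ε γ a ℓ t q' r' (massUpdate a ℓ t q' r2) r2 (r1 - r2) x := by
  filter_upwards [ae_mem_cell hℓ hM, h1.2, h2.2] with x ⟨i, hi⟩ hw1 hw2
  have ha := hR.area_pos
  have hp1 := p1_eq_mul_velocity hℓ ha r1 (hF.law.pos.trans_le (h1.1 i).1) hi
  have hp2 := p1_eq_mul_velocity hℓ ha r2 (hF.law.pos.trans_le (h2.1 i).1) hi
  have hs : slopes ℓ (r1 - r2) i =
      - (a * (massUpdate a ℓ t q' r1 i - massUpdate a ℓ t q' r2 i) / t) := by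
    rw [slopes_sub]
    simp only [massUpdate]
    field_simp; ring
  have main := hF.step_monotone_pointwise hR ht hts (h1.1 i) (h2.1 i) hw1 hw2
  simp only [momDensity, p1_sub, p0_eq hℓ _ hi, hs, hp1, hp2]
  refine main.trans (le_of_eq ?_)
  ring

lemma FlowBounds.momRes_monotone (hF : FlowBounds P α β κ L εmax wmax γmin B)
    (hR : ParamRange εmax γmin B ε γ a) (hℓ : 0 < ℓ) (hM : 0 < M) (ht : 0 < t)
    (hts : t * (B * (2 * B ^ 3 / α)) ≤ 7 / 32 * (κ / β)) {q' : Fin M → ℝ}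
    {r' r1 r2 : Fin (M + 1) → ℝ}
    (h1 : AdmState a ℓ α β (3 * wmax / 2) (massUpdate a ℓ t q' r1) r1)
    (h2 : AdmState a ℓ α β (3 * wmax / 2) (massUpdate a ℓ t q' r2) r2) :
    0 ≤ momRes P ε γ a ℓ t bL bR q' r' (massUpdate a ℓ t q' r1) r1 (r1 - r2)
      - momRes P ε γ a ℓ t bL bR q' r' (massUpdate a ℓ t q' r2) r2 (r1 - r2) := by
  rw [momRes_eq hℓ hM, momRes_eq hℓ hM, add_sub_add_right_eq_sub,
    ← integral_sub (essBdd_momDensity hℓ hM _ _ _ _ _).integrable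
      (essBdd_momDensity hℓ hM _ _ _ _ _).integrable]
  refine integral_nonneg_of_ae ?_
  filter_upwards [hF.momDensity_monotone (r' := r') hR hℓ hM ht hts h1 h2] with x hx
  refine le_trans ?_ hx
  have hβ : 0 < β := hF.law.pos.trans_le hF.law.le
  have := hF.law.kappa_pos
  have := hF.law.pos
  have := hR.area_pos
  have : 0 ≤ γ := hF.fric_pos.le.trans hR.fric_ge
  positivity

/-- Two continuous piecewise linear functions that coincide almost everywhere are equal. -/
lemma eq_of_p1_ae_eq (hℓ : 0 < ℓ) (hM : 0 < M) {r1 r2 : Fin (M + 1) → ℝ}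
    (h : p1 ℓ r1 =ᵐ[pipeMeasure ℓ] p1 ℓ r2) : r1 = r2 := by
  have h' : p1 ℓ r1 =ᵐ[volume.restrict (Icc 0 ℓ)] p1 ℓ r2 := by
    rw [← restrict_Ioo_eq_restrict_Icc]; exact h
  have heq := Measure.eqOn_Icc_of_ae_eq volume hℓ.ne h' (continuous_p1 r1).continuousOn
    (continuous_p1 r2).continuousOn
  funext j
  rw [← p1_node hℓ hM r1, ← p1_node hℓ hM r2]
  exact heq (node_mem_Icc hℓ hM (Nat.lt_succ_iff.1 j.2))

/-- If both residuals vanish on `r1 - r2`, the nonnegative monotonicity density has zero integral.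
Then densities agree and, since either the velocities or their difference must vanish, so do
velocities; this also covers `ε = 0`. -/
lemma FlowBounds.step_unique (hF : FlowBounds P α β κ L εmax wmax γmin B)
    (hR : ParamRange εmax γmin B ε γ a) (hℓ : 0 < ℓ) (hM : 0 < M) (ht : 0 < t)
    (hts : t * (B * (2 * B ^ 3 / α)) ≤ 7 / 32 * (κ / β)) {q' : Fin M → ℝ}
    {r' r1 r2 : Fin (M + 1) → ℝ}
    (h1 : AdmState a ℓ α β (3 * wmax / 2) (massUpdate a ℓ t q' r1) r1)
    (h2 : AdmState a ℓ α β (3 * wmax / 2) (massUpdate a ℓ t q' r2) r2)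
    (e1 : momRes P ε γ a ℓ t bL bR q' r' (massUpdate a ℓ t q' r1) r1 (r1 - r2) = 0)
    (e2 : momRes P ε γ a ℓ t bL bR q' r' (massUpdate a ℓ t q' r2) r2 (r1 - r2) = 0) :
    r1 = r2 := by
  have hβ : 0 < β := hF.law.pos.trans_le hF.law.le
  have hκ := hF.law.kappa_pos
  have hα := hF.law.pos
  have ha := hR.area_pos
  have hγ : 0 < γ := hF.fric_pos.trans_le hR.fric_ge
  have hm := hF.momDensity_monotone (r' := r') hR hℓ hM ht hts h1 h2
  have hi1 := (essBdd_momDensity (P := P) (ε := ε) (γ := γ) (a := a) (t := t) hℓ hM q' r'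
    (massUpdate a ℓ t q' r1) r1 (r1 - r2)).integrable
  have hi2 := (essBdd_momDensity (P := P) (ε := ε) (γ := γ) (a := a) (t := t) hℓ hM q' r'
    (massUpdate a ℓ t q' r2) r2 (r1 - r2)).integrable
  have hz : ∫ x, (momDensity P ε γ a ℓ t q' r' (massUpdate a ℓ t q' r1) r1 (r1 - r2) x
        - momDensity P ε γ a ℓ t q' r' (massUpdate a ℓ t q' r2) r2 (r1 - r2) x) ∂(pipeMeasure ℓ)
      = 0 := by
    rw [integral_sub hi1 hi2]
    rw [momRes_eq hℓ hM] at e1 e2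
    linarith
  have h0 : 0 ≤ᵐ[pipeMeasure ℓ] fun x =>
      momDensity P ε γ a ℓ t q' r' (massUpdate a ℓ t q' r1) r1 (r1 - r2) x
        - momDensity P ε γ a ℓ t q' r' (massUpdate a ℓ t q' r2) r2 (r1 - r2) x := by
    filter_upwards [hm] with x hx
    refine le_trans ?_ hx
    positivity
  replace hz := (integral_eq_zero_iff_of_nonneg_ae h0 (hi1.sub hi2)).1 hz
  refine eq_of_p1_ae_eq hℓ hM ?_
  filter_upwards [hz, hm, ae_mem_cell hℓ hM] with x hx hmx ⟨i, hi⟩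
  simp only [Pi.zero_apply] at hx
  rw [hx] at hmx
  have n1 : 0 ≤ a / t * (7 / 32 * (κ / β)) *
        (p0 ℓ (massUpdate a ℓ t q' r1) x - p0 ℓ (massUpdate a ℓ t q' r2) x) ^ 2 := by
    positivity
  have n2 : 0 ≤ a * γ * (α / 4) *
        ((|discreteVelocity a ℓ (massUpdate a ℓ t q' r1) r1 x|
          + |discreteVelocity a ℓ (massUpdate a ℓ t q' r2) r2 x|) *
        (discreteVelocity a ℓ (massUpdate a ℓ t q' r1) r1 x
          - discreteVelocity a ℓ (massUpdate a ℓ t q' r2) r2 x) ^ 2) := by positivity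
  have z1 : (p0 ℓ (massUpdate a ℓ t q' r1) x - p0 ℓ (massUpdate a ℓ t q' r2) x) ^ 2 = 0 := by
    have : a / t * (7 / 32 * (κ / β)) *
        (p0 ℓ (massUpdate a ℓ t q' r1) x - p0 ℓ (massUpdate a ℓ t q' r2) x) ^ 2 = 0 := by
      linarith
    exact (mul_eq_zero.1 this).resolve_left (by positivity)
  have z2 : (|discreteVelocity a ℓ (massUpdate a ℓ t q' r1) r1 x|
          + |discreteVelocity a ℓ (massUpdate a ℓ t q' r2) r2 x|) *
        (discreteVelocity a ℓ (massUpdate a ℓ t q' r1) r1 x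
          - discreteVelocity a ℓ (massUpdate a ℓ t q' r2) r2 x) ^ 2 = 0 := by
    have : a * γ * (α / 4) * ((|discreteVelocity a ℓ (massUpdate a ℓ t q' r1) r1 x|
          + |discreteVelocity a ℓ (massUpdate a ℓ t q' r2) r2 x|) *
        (discreteVelocity a ℓ (massUpdate a ℓ t q' r1) r1 x
          - discreteVelocity a ℓ (massUpdate a ℓ t q' r2) r2 x) ^ 2) = 0 := by linarith
    exact (mul_eq_zero.1 this).resolve_left (by positivity)
  have hweq : discreteVelocity a ℓ (massUpdate a ℓ t q' r1) r1 x
      = discreteVelocity a ℓ (massUpdate a ℓ t q' r2) r2 x := by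
    rcases mul_eq_zero.1 z2 with h | h
    · have b1 := abs_nonneg (discreteVelocity a ℓ (massUpdate a ℓ t q' r1) r1 x)
      have b2 := abs_nonneg (discreteVelocity a ℓ (massUpdate a ℓ t q' r2) r2 x)
      rw [abs_eq_zero.1 (show |discreteVelocity a ℓ (massUpdate a ℓ t q' r1) r1 x| = 0 by
        linarith), abs_eq_zero.1
        (show |discreteVelocity a ℓ (massUpdate a ℓ t q' r2) r2 x| = 0 by linarith)]
    · exact sub_eq_zero.1 (pow_eq_zero_iff (by norm_num) |>.1 h)
  have hqeq : massUpdate a ℓ t q' r1 i = massUpdate a ℓ t q' r2 i := by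
    have := sub_eq_zero.1 (pow_eq_zero_iff (by norm_num) |>.1 z1)
    rwa [p0_eq hℓ _ hi, p0_eq hℓ _ hi] at this
  rw [p1_eq_mul_velocity hℓ ha r1 (hα.trans_le (h1.1 i).1) hi,
    p1_eq_mul_velocity hℓ ha r2 (hα.trans_le (h2.1 i).1) hi, hweq, hqeq]

end Step


/-! ### The variational inequality of one time step near a reference state -/

/-- The state `(R, m)` lies well inside the set of admissible states. -/
structure InnerState (a ℓ α β wmax : ℝ) {M : ℕ} (R : Fin M → ℝ) (m : Fin (M + 1) → ℝ) : Prop where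
  density : ∀ i, R i ∈ Icc (3 * α / 2) (2 * β / 3)
  velocity : ∀ᵐ x ∂(pipeMeasure ℓ), |discreteVelocity a ℓ R m x| ≤ 5 * wmax / 4

/-- The states `(q, r)` with coefficients in the `δ`-neighbourhood of `(R, m)`. -/
def Near (δ : ℝ) {M : ℕ} (R : Fin M → ℝ) (m : Fin (M + 1) → ℝ) (q : Fin M → ℝ)
    (r : Fin (M + 1) → ℝ) : Prop :=
  (∀ i, |q i - R i| ≤ δ) ∧ ∀ j, |r j - m j| ≤ δ

/-- Admissible radii of the neighbourhoods. -/
structure RadiusBounds (α wmax B δ : ℝ) : Prop where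
  pos : 0 < δ
  density : δ ≤ α / 16
  velocity : 2 * B * δ / α ≤ wmax / 4

section

variable {P : ℝ → ℝ} {α β κ L εmax wmax γmin B ε γ a ℓ t bL bR δ : ℝ} {M : ℕ}

lemma Near.density_mem (hF : FlowBounds P α β κ L εmax wmax γmin B)
    (hδ : RadiusBounds α wmax B δ) {R : Fin M → ℝ} {m : Fin (M + 1) → ℝ}
    (hS : InnerState a ℓ α β wmax R m) {q : Fin M → ℝ} {r : Fin (M + 1) → ℝ}
    (h : Near δ R m q r) (i : Fin M) : q i ∈ Icc α β := by
  have h1 := abs_le.1 (h.1 i)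
  have h2 := hS.density i
  have := hδ.density
  have := hF.law.pos
  have := hF.law.le
  constructor <;> linarith [h2.1, h2.2]

lemma InnerState.density_mem (hF : FlowBounds P α β κ L εmax wmax γmin B)
    {R : Fin M → ℝ} {m : Fin (M + 1) → ℝ}
    (hS : InnerState a ℓ α β wmax R m) (i : Fin M) : R i ∈ Icc α β := by
  have h2 := hS.density i
  have := hF.law.pos
  have := hF.law.le
  constructor <;> linarith [h2.1, h2.2]

/-- The velocity error is a flux error minus a density error times `W`, divided by the density. The
radius condition leaves a margin `wmax / 4`, which together with the inner bound `5 wmax / 4` gives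
the admissible bound `3 wmax / 2`. -/
lemma Near.velocity_sub (hF : FlowBounds P α β κ L εmax wmax γmin B)
    (hR : ParamRange εmax γmin B ε γ a) (hℓ : 0 < ℓ) (hM : 0 < M)
    (hδ : RadiusBounds α wmax B δ) {R : Fin M → ℝ} {m : Fin (M + 1) → ℝ}
    (hS : InnerState a ℓ α β wmax R m) {q : Fin M → ℝ} {r : Fin (M + 1) → ℝ}
    (h : Near δ R m q r) :
    ∀ᵐ x ∂(pipeMeasure ℓ), |discreteVelocity a ℓ q r x - discreteVelocity a ℓ R m x|
      ≤ wmax / 4 := by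
  filter_upwards [ae_mem_cell hℓ hM, hS.velocity, ae_restrict_mem measurableSet_Ioo]
    with x ⟨i, hi⟩ hW hx
  have ha := hR.area_pos
  have hq := h.density_mem hF hδ hS i
  have hRi := hS.density_mem hF i
  have hα := hF.law.pos
  have hq0 : 0 < q i := hα.trans_le hq.1
  have hp1 := p1_eq_mul_velocity hℓ ha r hq0 hi
  have hp2 := p1_eq_mul_velocity hℓ ha m (hα.trans_le hRi.1) hi
  have hd : |p1 ℓ (r - m) x| ≤ δ := abs_p1_le hℓ hM h.2 (Ioo_subset_Icc_self hx)
  rw [p1_sub, hp1, hp2] at hd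
  set w := discreteVelocity a ℓ q r x
  set W := discreteVelocity a ℓ R m x
  refine le_trans ?_ hδ.velocity
  have hB1 := hR.inv_area_le
  have hWB : |W| ≤ B := by
    have := hF.vel_le
    have := hF.wmax_pos
    linarith
  have e : q i * (w - W) = (1 / a) * (a * (q i * w) - a * (R i * W)) - W * (q i - R i) := by
    field_simp; ring
  have h1 : q i * |w - W| ≤ B * δ + B * δ := by
    rw [← abs_of_pos hq0, ← abs_mul, e]
    refine (abs_sub _ _).trans ?_
    rw [abs_mul, abs_mul, abs_of_pos (by positivity : 0 < 1 / a)]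
    have := h.1 i
    have hB : 0 ≤ B := zero_le_one.trans hF.one_le
    gcongr
  rw [le_div_iff₀ hα]
  calc |w - W| * α ≤ |w - W| * q i := by gcongr; exact hq.1
    _ ≤ _ := by linarith

lemma Near.admissible (hF : FlowBounds P α β κ L εmax wmax γmin B)
    (hR : ParamRange εmax γmin B ε γ a) (hℓ : 0 < ℓ) (hM : 0 < M)
    (hδ : RadiusBounds α wmax B δ) {R : Fin M → ℝ} {m : Fin (M + 1) → ℝ}
    (hS : InnerState a ℓ α β wmax R m) {q : Fin M → ℝ} {r : Fin (M + 1) → ℝ}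
    (h : Near δ R m q r) : AdmState a ℓ α β (3 * wmax / 2) q r := by
  refine ⟨h.density_mem hF hδ hS, ?_⟩
  filter_upwards [h.velocity_sub hF hR hℓ hM hδ hS, hS.velocity] with x h1 h2
  have := abs_sub_abs_le_abs_sub (discreteVelocity a ℓ q r x) (discreteVelocity a ℓ R m x)
  linarith

lemma massUpdate_add_smul (q' : Fin M → ℝ) (r s : Fin (M + 1) → ℝ) (c : ℝ) (i : Fin M) :
    massUpdate a ℓ t q' (r + c • s) i = massUpdate a ℓ t q' r i - c * (t / a * slopes ℓ s i) := by
  simp only [massUpdate, slopes_add, slopes_smul]; ring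

/-- Convexity holds because the density update is affine in the flux; admissibility in terms of the
velocity quotient would not be convex in this evident way. -/
lemma convex_near (R : Fin M → ℝ) (m : Fin (M + 1) → ℝ) (q' : Fin M → ℝ) :
    Convex ℝ {r | Near δ R m (massUpdate a ℓ t q' r) r} := by
  intro x hx y hy b c hb hc hbc
  have habs : ∀ u v : ℝ, |u| ≤ δ → |v| ≤ δ → |b * u + c * v| ≤ δ := by
    intro u v hu hv
    refine (abs_add_le _ _).trans ?_
    rw [abs_mul, abs_mul, abs_of_nonneg hb, abs_of_nonneg hc]
    calc b * |u| + c * |v| ≤ b * δ + c * δ := by gcongr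
      _ = δ := by rw [← add_mul, hbc, one_mul]
  refine ⟨fun i => ?_, fun j => ?_⟩
  · have := habs _ _ (hx.1 i) (hy.1 i)
    convert! this using 2
    simp only [massUpdate, slopes_add, slopes_smul]
    linear_combination (q' i - R i) * (- hbc)
  · have := habs _ _ (hx.2 j) (hy.2 j)
    convert! this using 2
    simp only [Pi.add_apply, Pi.smul_apply, smul_eq_mul]
    linear_combination (- m j) * (- hbc)

lemma continuous_slopes (i : Fin M) : Continuous fun r : Fin (M + 1) → ℝ => slopes ℓ r i := by
  unfold slopes; fun_prop

lemma isCompact_near (R : Fin M → ℝ) (m : Fin (M + 1) → ℝ) (q' : Fin M → ℝ) :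
    IsCompact {r | Near δ R m (massUpdate a ℓ t q' r) r} := by
  have hsub : {r | Near δ R m (massUpdate a ℓ t q' r) r} ⊆
      Icc (fun j => m j - δ) (fun j => m j + δ) := by
    intro r hr
    refine ⟨fun j => ?_, fun j => ?_⟩
    · linarith [(abs_le.1 (hr.2 j)).1]
    · linarith [(abs_le.1 (hr.2 j)).2]
  refine isCompact_Icc.of_isClosed_subset ?_ hsub
  simp only [Near, ofPred_and, ofPred_forall]
  refine IsClosed.inter (isClosed_iInter fun i => isClosed_le ?_ continuous_const)
    (isClosed_iInter fun j => isClosed_le ?_ continuous_const)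
  · unfold massUpdate
    exact ((continuous_const.sub (continuous_const.mul (continuous_slopes i))).sub
      continuous_const).abs
  · fun_prop

lemma FlowBounds.abs_deriv_le (hF : FlowBounds P α β κ L εmax wmax γmin B) {q : ℝ}
    (hq : q ∈ Icc α β) : |deriv P q| ≤ |deriv P α| + L * (β - α) := by
  have h := hF.law.deriv_lipschitz hq (left_mem_Icc.2 hF.law.le)
  have h1 : |q - α| ≤ β - α := by
    rw [abs_of_nonneg (by linarith [hq.1])]; linarith [hq.2]
  have h2 := abs_sub_abs_le_abs_sub (deriv P q) (deriv P α)
  have h3 := mul_le_mul_of_nonneg_left h1 hF.law.L_pos.le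
  linarith

/-- Continuity along segments suffices for Minty's argument. The segment stays in the neighbourhood,
where velocity and enthalpy are uniformly bounded, so dominated convergence applies. -/
lemma FlowBounds.momRes_hemicontinuous (hF : FlowBounds P α β κ L εmax wmax γmin B)
    (hR : ParamRange εmax γmin B ε γ a) (hℓ : 0 < ℓ) (hM : 0 < M) (ht : 0 < t)
    (hδ : RadiusBounds α wmax B δ) {R : Fin M → ℝ} {m : Fin (M + 1) → ℝ}
    (hS : InnerState a ℓ α β wmax R m) (q' : Fin M → ℝ) (r' : Fin (M + 1) → ℝ)
    {u v : Fin (M + 1) → ℝ} (hu : Near δ R m (massUpdate a ℓ t q' u) u)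
    (hv : Near δ R m (massUpdate a ℓ t q' v) v) :
    Filter.Tendsto (fun c : ℝ => momRes P ε γ a ℓ t bL bR q' r'
        (massUpdate a ℓ t q' (u + c • (v - u))) (u + c • (v - u)) (v - u))
      (nhdsWithin 0 (Ioi 0))
      (nhds (momRes P ε γ a ℓ t bL bR q' r' (massUpdate a ℓ t q' u) u (v - u))) := by
  set s := v - u with hs
  simp only [momRes_eq hℓ hM]
  refine Filter.Tendsto.add_const _ ?_
  obtain ⟨S0, hS0⟩ := (EssBdd.p1 (ℓ := ℓ) s).2
  obtain ⟨S1, hS1⟩ := (EssBdd.p0 (ℓ := ℓ) (slopes ℓ s)).2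
  obtain ⟨W', hW'⟩ := (EssBdd.discreteVelocity hℓ hM a q' r').2
  set V := 3 * wmax / 2 with hV
  have hV0 : 0 ≤ V := by rw [hV]; have := hF.wmax_pos; positivity
  have hγ : 0 ≤ γ := hF.fric_pos.le.trans hR.fric_ge
  set D := |deriv P α| + L * (β - α) with hD
  refine tendsto_integral_filter_of_dominated_convergence
    (fun _ => ε ^ 2 * ((V + W') / t) * S0 + (ε ^ 2 * V ^ 2 / 2 + D) * S1 + γ * V * V * S0) ?_ ?_
    (integrable_const _) ?_
  · exact Filter.Eventually.of_forall fun c => (essBdd_momDensity hℓ hM _ _ _ _ _).1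
  · have hlt : ∀ᶠ c : ℝ in nhdsWithin 0 (Ioi 0), c < 1 :=
      Filter.Eventually.filter_mono nhdsWithin_le_nhds (gt_mem_nhds one_pos)
    filter_upwards [hlt, self_mem_nhdsWithin] with c hc1 hc0
    have hc0 : 0 < c := hc0
    have hmem : Near δ R m (massUpdate a ℓ t q' (u + c • s)) (u + c • s) :=
      (convex_near R m q').add_smul_sub_mem (t := c) hu hv ⟨hc0.le, hc1.le⟩
    have hadm := hmem.admissible hF hR hℓ hM hδ hS
    filter_upwards [hS0, hS1, hW', hadm.2, ae_mem_cell hℓ hM] with x h0 h1 h2 h3 ⟨i, hi⟩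
    rw [Real.norm_eq_abs, momDensity]
    have hη : |enthalpy P ε (p0 ℓ (massUpdate a ℓ t q' (u + c • s)) x)
        (discreteVelocity a ℓ (massUpdate a ℓ t q' (u + c • s)) (u + c • s) x)| ≤
        ε ^ 2 * V ^ 2 / 2 + D := by
      rw [enthalpy]
      refine (abs_add_le _ _).trans (add_le_add ?_ ?_)
      · rw [abs_of_nonneg (by positivity), ← sq_abs (discreteVelocity a ℓ _ _ x)]
        gcongr
      · rw [p0_eq hℓ _ hi]; exact hF.abs_deriv_le (hadm.1 i)
    have hS00 : 0 ≤ S0 := (abs_nonneg _).trans h0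
    have hS10 : 0 ≤ S1 := (abs_nonneg _).trans h1
    refine (abs_add_le _ _).trans (add_le_add ((abs_sub _ _).trans (add_le_add ?_ ?_)) ?_)
    · rw [abs_mul, abs_mul, abs_of_nonneg (sq_nonneg ε), abs_div, abs_of_pos ht]
      have := abs_sub (discreteVelocity a ℓ (massUpdate a ℓ t q' (u + c • s)) (u + c • s) x)
        (discreteVelocity a ℓ q' r' x)
      have hW0 : 0 ≤ W' := (abs_nonneg _).trans h2
      have hsum := this.trans (add_le_add h3 h2)
      gcongr
    · rw [abs_mul]
      exact mul_le_mul hη h1 (abs_nonneg _) ((abs_nonneg _).trans hη)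
    · rw [abs_mul, abs_mul, abs_mul, abs_abs, abs_of_nonneg hγ]
      gcongr
  · filter_upwards [ae_mem_cell hℓ hM] with x ⟨i, hi⟩
    have hq0 : massUpdate a ℓ t q' u i ∈ Icc α β := hu.density_mem hF hδ hS i
    have hpos : 0 < massUpdate a ℓ t q' u i := hF.law.pos.trans_le hq0.1
    have ha := hR.area_pos
    simp only [momDensity, enthalpy, discreteVelocity, p0_eq hℓ _ hi, massUpdate_add_smul, p1_add,
      p1_smul]
    have hPc : ContinuousAt (deriv P) (massUpdate a ℓ t q' u i) :=
      (hF.law.hasDerivAt_deriv _ hq0).continuousAt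
    have hqc : ContinuousAt (fun c : ℝ => massUpdate a ℓ t q' u i - c * (t / a * slopes ℓ s i)) 0 := by
      fun_prop
    have hP2 : ContinuousAt
        (fun c : ℝ => deriv P (massUpdate a ℓ t q' u i - c * (t / a * slopes ℓ s i))) 0 := by
      refine ContinuousAt.comp (g := deriv P) ?_ hqc
      simpa using hPc
    have hwc : ContinuousAt (fun c : ℝ => (p1 ℓ u x + c * p1 ℓ s x)
        / (a * (massUpdate a ℓ t q' u i - c * (t / a * slopes ℓ s i)))) 0 := by
      refine ContinuousAt.div (by fun_prop) (by fun_prop) ?_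
      simp only [zero_mul, sub_zero]
      positivity
    have hall : ContinuousAt (fun c : ℝ =>
        ε ^ 2 * (((p1 ℓ u x + c * p1 ℓ s x)
          / (a * (massUpdate a ℓ t q' u i - c * (t / a * slopes ℓ s i)))
            - p1 ℓ r' x / (a * q' i)) / t) * p1 ℓ s x
        - (ε ^ 2 * ((p1 ℓ u x + c * p1 ℓ s x)
          / (a * (massUpdate a ℓ t q' u i - c * (t / a * slopes ℓ s i)))) ^ 2 / 2
          + deriv P (massUpdate a ℓ t q' u i - c * (t / a * slopes ℓ s i))) * slopes ℓ s i
        + γ * |(p1 ℓ u x + c * p1 ℓ s x)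
          / (a * (massUpdate a ℓ t q' u i - c * (t / a * slopes ℓ s i)))|
          * ((p1 ℓ u x + c * p1 ℓ s x)
          / (a * (massUpdate a ℓ t q' u i - c * (t / a * slopes ℓ s i)))) * p1 ℓ s x) 0 := by
      refine ContinuousAt.add (ContinuousAt.sub ?_ ?_) ?_
      · exact (continuousAt_const.mul ((hwc.sub continuousAt_const).div_const t)).mul
          continuousAt_const
      · exact (((continuousAt_const.mul (hwc.pow 2)).div_const 2).add hP2).mul continuousAt_const
      · exact ((continuousAt_const.mul hwc.abs).mul hwc).mul continuousAt_const
    have := hall.tendsto.mono_left (nhdsWithin_le_nhds (s := Ioi 0))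
    simpa using this

/-- Solvability of the variational inequality of one time step. -/
lemma FlowBounds.exists_step_inequality (hF : FlowBounds P α β κ L εmax wmax γmin B)
    (hR : ParamRange εmax γmin B ε γ a) (hℓ : 0 < ℓ) (hM : 0 < M) (ht : 0 < t)
    (hts : t * (B * (2 * B ^ 3 / α)) ≤ 7 / 32 * (κ / β))
    (hδ : RadiusBounds α wmax B δ) {R : Fin M → ℝ} {m : Fin (M + 1) → ℝ}
    (hS : InnerState a ℓ α β wmax R m) (q' : Fin M → ℝ) (r' : Fin (M + 1) → ℝ)
    (hm : ∀ i, |massUpdate a ℓ t q' m i - R i| ≤ δ) :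
    ∃ r, Near δ R m (massUpdate a ℓ t q' r) r ∧
      ∀ s, Near δ R m (massUpdate a ℓ t q' s) s →
        0 ≤ momRes P ε γ a ℓ t bL bR q' r' (massUpdate a ℓ t q' r) r (s - r) := by
  obtain ⟨r, hr, h⟩ := exists_variational_solution (isCompact_near (δ := δ) (a := a) (ℓ := ℓ)
    (t := t) R m q') (convex_near R m q') ⟨m, hm, fun j => by simp [hδ.pos.le]⟩
    (fun r => momResₗ P ε γ a ℓ t bL bR hℓ hM q' r' (massUpdate a ℓ t q' r) r)
    (fun u hu v hv => hF.momRes_monotone hR hℓ hM ht hts (hu.admissible hF hR hℓ hM hδ hS)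
      (hv.admissible hF hR hℓ hM hδ hS))
    (fun u hu v hv => hF.momRes_hemicontinuous hR hℓ hM ht hδ hS q' r' hu hv)
  exact ⟨r, hr, h⟩

/-- A solution of the variational inequality in the interior solves the equation. -/
lemma momRes_eq_zero_of_interior (hℓ : 0 < ℓ) (hM : 0 < M) {R : Fin M → ℝ}
    {m : Fin (M + 1) → ℝ} (q' : Fin M → ℝ) (r' : Fin (M + 1) → ℝ) {r : Fin (M + 1) → ℝ}
    (h1 : ∀ i, |massUpdate a ℓ t q' r i - R i| < δ) (h2 : ∀ j, |r j - m j| < δ)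
    (h : ∀ s, Near δ R m (massUpdate a ℓ t q' s) s →
        0 ≤ momRes P ε γ a ℓ t bL bR q' r' (massUpdate a ℓ t q' r) r (s - r))
    (s : Fin (M + 1) → ℝ) :
    momRes P ε γ a ℓ t bL bR q' r' (massUpdate a ℓ t q' r) r s = 0 := by
  have ev : ∀ᶠ c : ℝ in nhds 0, Near δ R m (massUpdate a ℓ t q' (r + c • s)) (r + c • s) := by
    have e1 : ∀ᶠ c : ℝ in nhds 0, ∀ i, |massUpdate a ℓ t q' (r + c • s) i - R i| ≤ δ := by
      rw [Filter.eventually_all]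
      intro i
      simp only [massUpdate_add_smul]
      have hc : ContinuousAt (fun c : ℝ =>
          |massUpdate a ℓ t q' r i - c * (t / a * slopes ℓ s i) - R i|) 0 := by fun_prop
      have hlt : |massUpdate a ℓ t q' r i - 0 * (t / a * slopes ℓ s i) - R i| < δ := by
        simpa using h1 i
      filter_upwards [hc.eventually_lt_const hlt] with c hc using hc.le
    have e2 : ∀ᶠ c : ℝ in nhds 0, ∀ j, |(r + c • s) j - m j| ≤ δ := by
      rw [Filter.eventually_all]
      intro j
      simp only [Pi.add_apply, Pi.smul_apply, smul_eq_mul]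
      have hc : ContinuousAt (fun c : ℝ => |r j + c * s j - m j|) 0 := by fun_prop
      have hlt : |r j + 0 * s j - m j| < δ := by simpa using h2 j
      filter_upwards [hc.eventually_lt_const hlt] with c hc using hc.le
    filter_upwards [e1, e2] with c hc1 hc2 using ⟨hc1, hc2⟩
  obtain ⟨c0, hc0, hb⟩ := Metric.eventually_nhds_iff.1 ev
  have key : ∀ c : ℝ, |c| < c0 →
      0 ≤ c * momRes P ε γ a ℓ t bL bR q' r' (massUpdate a ℓ t q' r) r s := by
    intro c hc
    have := h _ (hb (y := c) (by simpa [Real.dist_eq] using hc))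
    rw [add_sub_cancel_left] at this
    have e := (momResₗ P ε γ a ℓ t bL bR hℓ hM q' r' (massUpdate a ℓ t q' r) r).map_smul c s
    rw [smul_eq_mul] at e
    exact this.trans_eq e
  -- An interior point can be perturbed in both directions, so the linear functional vanishes.
  have k1 := key (c0 / 2) (by rw [abs_of_pos] <;> linarith)
  have k2 := key (-(c0 / 2)) (by rw [abs_neg, abs_of_pos] <;> linarith)
  nlinarith

end


/-! ## The error inequality -/

/-- A sequence of reference states `(R n, m n)` that satisfies the scheme up to small residuals:
`f` in the mass balance, and `ε² fa + γ fb` (tested with functions) and `g` (tested with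
derivatives) in the momentum balance. The cellwise quantity `σ` measures the spatial
approximation error. -/
structure ReferenceStates (P : ℝ → ℝ) (α β wmax B ε γ a ℓ t : ℝ) (M N : ℕ) (bL bR : ℕ → ℝ)
    (R : ℕ → Fin M → ℝ) (m : ℕ → Fin (M + 1) → ℝ) (σ f : ℕ → Fin M → ℝ)
    (fa fb g : ℕ → ℝ → ℝ) : Prop where
  inner : ∀ n ≤ N, InnerState a ℓ α β wmax (R n) (m n)
  density_sub : ∀ n < N, ∀ i, |R (n + 1) i - R n i| ≤ B * t
  velocity_sub : ∀ n < N, ∀ᵐ x ∂(pipeMeasure ℓ),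
    |discreteVelocity a ℓ (R (n + 1)) (m (n + 1)) x - discreteVelocity a ℓ (R n) (m n) x| ≤ B * t
  sigma_nonneg : ∀ n ≤ N, ∀ i, 0 ≤ σ n i
  g_bdd : ∀ n ≤ N, EssBdd ℓ (g n)
  g_le : ∀ n ≤ N, ∀ᵐ x ∂(pipeMeasure ℓ), |g n x| ≤ B * p0 ℓ (σ n) x
  g_sub : ∀ n < N, ∀ᵐ x ∂(pipeMeasure ℓ), |g (n + 1) x - g n x| ≤ B * t * p0 ℓ (σ (n + 1)) x
  fb_bdd : ∀ n < N, EssBdd ℓ (fb (n + 1))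
  fb_le : ∀ n < N, ∀ᵐ x ∂(pipeMeasure ℓ), |fb (n + 1) x| ≤
    (2 * |discreteVelocity a ℓ (R (n + 1)) (m (n + 1)) x| + B * p0 ℓ (σ (n + 1)) x)
      * (B * p0 ℓ (σ (n + 1)) x)
  fa_memLp : ∀ n < N, MemLp (fa (n + 1)) 2 (pipeMeasure ℓ)
  mass : ∀ n < N, ∀ i, a * (R (n + 1) i - R n i) / t + slopes ℓ (m (n + 1)) i = f (n + 1) i
  momentum : ∀ n < N, ∀ s,
    momRes P ε γ a ℓ t (bL (n + 1)) (bR (n + 1)) (R n) (m n) (R (n + 1)) (m (n + 1)) s =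
      ∫ x, ((ε ^ 2 * fa (n + 1) x + γ * fb (n + 1) x) * p1 ℓ s x
        + g (n + 1) x * p0 ℓ (slopes ℓ s) x) ∂(pipeMeasure ℓ)
  sigma_sq : ∀ n ≤ N, ℓ / M * ∑ i, σ n i ^ 2 ≤ B * (t ^ 2 + (ℓ / M) ^ 2)
  f_sq : ∀ n < N, ℓ / M * ∑ i, f (n + 1) i ^ 2 ≤ B * (t ^ 2 + (ℓ / M) ^ 2)
  fa_sq : ∀ n < N, ∫ x, fa (n + 1) x ^ 2 ∂(pipeMeasure ℓ) ≤ B * (t ^ 2 + (ℓ / M) ^ 2)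

/-- The modified relative energy density. -/
noncomputable def energyDensity (P : ℝ → ℝ) (ε a ℓ : ℝ) {M : ℕ} (g : ℝ → ℝ) (R : Fin M → ℝ)
    (m : Fin (M + 1) → ℝ) (q : Fin M → ℝ) (r : Fin (M + 1) → ℝ) (x : ℝ) : ℝ :=
  relEnergy P ε (p0 ℓ q x) (discreteVelocity a ℓ q r x) (p0 ℓ R x) (discreteVelocity a ℓ R m x)
    - g x * (p0 ℓ q x - p0 ℓ R x)

/-- The friction dissipation density of the error. -/
noncomputable def frictionDensity (a ℓ : ℝ) {M : ℕ} (R : Fin M → ℝ)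
    (m : Fin (M + 1) → ℝ) (q : Fin M → ℝ) (r : Fin (M + 1) → ℝ) (x : ℝ) : ℝ :=
  (|discreteVelocity a ℓ q r x| + |discreteVelocity a ℓ R m x|)
    * (discreteVelocity a ℓ q r x - discreteVelocity a ℓ R m x) ^ 2

/-- The squared error density. -/
noncomputable def errorDensity (ε a ℓ : ℝ) {M : ℕ} (R : Fin M → ℝ)
    (m : Fin (M + 1) → ℝ) (q : Fin M → ℝ) (r : Fin (M + 1) → ℝ) (x : ℝ) : ℝ :=
  (p0 ℓ q x - p0 ℓ R x) ^ 2
    + ε ^ 2 * (discreteVelocity a ℓ q r x - discreteVelocity a ℓ R m x) ^ 2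

section

variable {P : ℝ → ℝ} {α β κ L εmax wmax γmin B ε γ a ℓ t δ : ℝ} {M N : ℕ} {bL bR : ℕ → ℝ}
  {R : ℕ → Fin M → ℝ} {m : ℕ → Fin (M + 1) → ℝ} {σ f : ℕ → Fin M → ℝ} {fa fb g : ℕ → ℝ → ℝ}

lemma essBdd_energyDensity (hℓ : 0 < ℓ) (hM : 0 < M) {g : ℝ → ℝ} (hg : EssBdd ℓ g)
    (R : Fin M → ℝ) (m : Fin (M + 1) → ℝ) (q : Fin M → ℝ) (r : Fin (M + 1) → ℝ) :
    EssBdd ℓ (energyDensity P ε a ℓ g R m q r) := by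
  have hw := EssBdd.discreteVelocity hℓ hM a q r
  have hW := EssBdd.discreteVelocity hℓ hM a R m
  have hq := EssBdd.p0 (ℓ := ℓ) q
  have hR := EssBdd.p0 (ℓ := ℓ) R
  unfold energyDensity relEnergy
  refine EssBdd.sub (EssBdd.add (((EssBdd.comp_p0 hℓ hM P q).sub (EssBdd.comp_p0 hℓ hM P R)).sub
    ((EssBdd.comp_p0 hℓ hM (deriv P) R).mul (hq.sub hR))) ?_) (hg.mul (hq.sub hR))
  exact ((hq.mul ((hw.sub hW).pow 2)).add (((hW.const_mul 2).mul (hw.sub hW)).mul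
    (hq.sub hR))).const_mul _

lemma essBdd_frictionDensity (hℓ : 0 < ℓ) (hM : 0 < M) (R : Fin M → ℝ) (m : Fin (M + 1) → ℝ)
    (q : Fin M → ℝ) (r : Fin (M + 1) → ℝ) : EssBdd ℓ (frictionDensity a ℓ R m q r) := by
  have hw := EssBdd.discreteVelocity hℓ hM a q r
  have hW := EssBdd.discreteVelocity hℓ hM a R m
  exact (hw.abs.add hW.abs).mul ((hw.sub hW).pow 2)

lemma essBdd_errorDensity (hℓ : 0 < ℓ) (hM : 0 < M) (R : Fin M → ℝ) (m : Fin (M + 1) → ℝ)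
    (q : Fin M → ℝ) (r : Fin (M + 1) → ℝ) : EssBdd ℓ (errorDensity ε a ℓ R m q r) := by
  have hw := EssBdd.discreteVelocity hℓ hM a q r
  have hW := EssBdd.discreteVelocity hℓ hM a R m
  exact (((EssBdd.p0 q).sub (EssBdd.p0 R)).pow 2).add (((hw.sub hW).pow 2).const_mul _)

lemma integral_p0_sq (hℓ : 0 < ℓ) (hM : 0 < M) (q : Fin M → ℝ) :
    ∫ x, p0 ℓ q x ^ 2 ∂(pipeMeasure ℓ) = ℓ / M * ∑ i, q i ^ 2 := by
  rw [← integral_p0 hℓ hM]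
  refine integral_congr_ae ?_
  filter_upwards [ae_mem_cell hℓ hM] with x ⟨i, hi⟩
  rw [p0_eq hℓ _ hi, p0_eq hℓ _ hi]

/-- The error inequality of one time step, for solutions of the variational inequality. -/
lemma FlowBounds.energy_step (hF : FlowBounds P α β κ L εmax wmax γmin B) (hℓ : 0 < ℓ) :
    ∃ C > 0, ∀ (ε γ a t δ : ℝ) (M N : ℕ) (bL bR : ℕ → ℝ) (R : ℕ → Fin M → ℝ)
      (m : ℕ → Fin (M + 1) → ℝ) (σ f : ℕ → Fin M → ℝ) (fa fb g : ℕ → ℝ → ℝ),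
      ParamRange εmax γmin B ε γ a → 0 < M → 0 < t → B * t ≤ α / 16 →
      RadiusBounds α wmax B δ →
      ReferenceStates P α β wmax B ε γ a ℓ t M N bL bR R m σ f fa fb g →
      ∀ n < N, ∀ (q' : Fin M → ℝ) (r' r : Fin (M + 1) → ℝ), Near δ (R n) (m n) q' r' →
      Near δ (R (n + 1)) (m (n + 1)) (massUpdate a ℓ t q' r) r →
      momRes P ε γ a ℓ t (bL (n + 1)) (bR (n + 1)) q' r' (massUpdate a ℓ t q' r) r
        (r - m (n + 1)) ≤ 0 →
      (∫ x, energyDensity P ε a ℓ (g (n + 1)) (R (n + 1)) (m (n + 1))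
          (massUpdate a ℓ t q' r) r x ∂(pipeMeasure ℓ))
        + t * (γmin * (α / 8)) * (∫ x, frictionDensity a ℓ (R (n + 1)) (m (n + 1))
          (massUpdate a ℓ t q' r) r x ∂(pipeMeasure ℓ)) ≤
      (∫ x, energyDensity P ε a ℓ (g n) (R n) (m n) q' r' x ∂(pipeMeasure ℓ))
        + C * t * ((∫ x, errorDensity ε a ℓ (R n) (m n) q' r' x ∂(pipeMeasure ℓ))
          + (∫ x, errorDensity ε a ℓ (R (n + 1)) (m (n + 1)) (massUpdate a ℓ t q' r) r x
            ∂(pipeMeasure ℓ)) + (3 * B + ℓ) * (t ^ 2 + (ℓ / M) ^ 2)) := by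
  obtain ⟨C, hC, H⟩ := hF.law.error_step hF.kappa_eq hF.one_le hF.L_le hF.beta_le hF.eps_le
    hF.vel_le hF.fric_pos
  refine ⟨C, hC, ?_⟩
  intro ε γ a t δ M N bL bR R m σ f fa fb g hR hM ht htB hδ hS n hn q' r' r hnear' hnear hres
  have hn1 : n + 1 ≤ N := hn
  obtain ⟨q, hq⟩ : ∃ q, q = massUpdate a ℓ t q' r := ⟨_, rfl⟩
  rw [← hq] at hnear hres ⊢
  have ha := hR.area_pos
  have hadm' := hnear'.admissible hF hR hℓ hM hδ (hS.inner n hn.le)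
  have hadm := hnear.admissible hF hR hℓ hM hδ (hS.inner (n + 1) hn1)
  -- Difference of the discrete mass balance and the perturbed one of the reference state; this is
  -- where spatial derivatives become time differences.
  have hslope : ∀ i, slopes ℓ (r - m (n + 1)) i =
      - f (n + 1) i - a * ((q i - R (n + 1) i) - (q' i - R n i)) / t := by
    intro i
    rw [slopes_sub, ← hS.mass n hn i, hq]
    simp only [massUpdate]
    field_simp; ring
  have hmom := hS.momentum n hn (r - m (n + 1))
  have b1 : EssBdd ℓ (momDensity P ε γ a ℓ t q' r' q r (r - m (n + 1))) :=
    essBdd_momDensity hℓ hM _ _ _ _ _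
  have b2 : EssBdd ℓ (momDensity P ε γ a ℓ t (R n) (m n) (R (n + 1)) (m (n + 1))
      (r - m (n + 1))) := essBdd_momDensity hℓ hM _ _ _ _ _
  have hfai : Integrable (fa (n + 1)) (pipeMeasure ℓ) := (hS.fa_memLp n hn).integrable (by norm_num)
  have hfa2 : Integrable (fun x => fa (n + 1) x ^ 2) (pipeMeasure ℓ) :=
    (hS.fa_memLp n hn).integrable_sq
  have i3 : Integrable (fun x => (ε ^ 2 * fa (n + 1) x + γ * fb (n + 1) x)
      * p1 ℓ (r - m (n + 1)) x + g (n + 1) x * p0 ℓ (slopes ℓ (r - m (n + 1))) x)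
      (pipeMeasure ℓ) := by
    refine Integrable.add ?_ ((hS.g_bdd _ hn1).mul (EssBdd.p0 _)).integrable
    have h1 := (EssBdd.p1 (ℓ := ℓ) (r - m (n + 1))).mul_integrable
      ((hfai.const_mul (ε ^ 2)).add ((hS.fb_bdd n hn).const_mul γ).integrable)
    refine h1.congr (Filter.Eventually.of_forall fun x => ?_)
    simp only [Pi.add_apply]; ring
  -- Discrete momentum density minus that of the reference state plus the residuals of the latter,
  -- all tested with the flux error. The boundary terms cancel, and the integral is nonpositive by
  -- the assumed inequality alone.
  set Φ : ℝ → ℝ := fun x => momDensity P ε γ a ℓ t q' r' q r (r - m (n + 1)) x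
    - momDensity P ε γ a ℓ t (R n) (m n) (R (n + 1)) (m (n + 1)) (r - m (n + 1)) x
    + ((ε ^ 2 * fa (n + 1) x + γ * fb (n + 1) x)
      * p1 ℓ (r - m (n + 1)) x + g (n + 1) x * p0 ℓ (slopes ℓ (r - m (n + 1))) x) with hΦ
  have iΦ : Integrable Φ (pipeMeasure ℓ) := (b1.sub b2).integrable.add i3
  have hΦ0 : ∫ x, Φ x ∂(pipeMeasure ℓ) ≤ 0 := by
    rw [hΦ, integral_add (b1.sub b2).integrable i3, integral_sub b1.integrable b2.integrable]
    rw [momRes_eq hℓ hM] at hmom hres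
    linarith
  have e1 := essBdd_energyDensity (P := P) (ε := ε) (a := a) hℓ hM (hS.g_bdd _ hn1) (R (n + 1))
    (m (n + 1)) q r
  have e0 := essBdd_energyDensity (P := P) (ε := ε) (a := a) hℓ hM (hS.g_bdd _ hn.le) (R n)
    (m n) q' r'
  have ed := essBdd_frictionDensity (a := a) hℓ hM (R (n + 1)) (m (n + 1)) q r
  have es1 := essBdd_errorDensity (ε := ε) (a := a) hℓ hM (R (n + 1)) (m (n + 1)) q r
  have es0 := essBdd_errorDensity (ε := ε) (a := a) hℓ hM (R n) (m n) q' r'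
  have ef := (EssBdd.p0 (ℓ := ℓ) (f (n + 1))).pow 2
  have eσ := (EssBdd.p0 (ℓ := ℓ) (σ (n + 1))).pow 2
  have hpt : ∀ᵐ x ∂(pipeMeasure ℓ),
      energyDensity P ε a ℓ (g (n + 1)) (R (n + 1)) (m (n + 1)) q r x
        + t * (γmin * (α / 8)) * frictionDensity a ℓ (R (n + 1)) (m (n + 1)) q r x ≤
      energyDensity P ε a ℓ (g n) (R n) (m n) q' r' x + t / a * Φ x
        + C * t * (errorDensity ε a ℓ (R n) (m n) q' r' x
          + errorDensity ε a ℓ (R (n + 1)) (m (n + 1)) q r x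
          + fa (n + 1) x ^ 2 + (p0 ℓ (f (n + 1)) x ^ 2 + p0 ℓ (σ (n + 1)) x ^ 2 + t ^ 2)) := by
    filter_upwards [ae_mem_cell hℓ hM, hadm.2, (hS.inner (n + 1) hn1).velocity,
      hS.velocity_sub n hn, hS.g_le (n + 1) hn1, hS.g_sub n hn, hS.fb_le n hn]
      with x ⟨i, hi⟩ h1 h2 h3 h4 h5 h6
    have hα := hF.law.pos
    have hqi := hadm.1 i
    have hqi' := hadm'.1 i
    have hRi := (hS.inner (n + 1) hn1).density_mem hF i
    have hRi' := (hS.inner n hn.le).density_mem hF i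
    have hd1 := abs_le.1 (hnear.1 i)
    have hd1' := abs_le.1 (hnear'.1 i)
    have hRR := hS.density_sub n hn i
    have hRR' := abs_le.1 hRR
    have hδ1 := hδ.density
    have hp1 := p1_eq_mul_velocity hℓ ha r (hα.trans_le hqi.1) hi
    have hp2 := p1_eq_mul_velocity hℓ ha (m (n + 1)) (hα.trans_le hRi.1) hi
    have hw0 := hF.wmax_pos
    rw [p0_eq hℓ _ hi] at h4 h5 h6
    have key := H ε γ a t (q i) (discreteVelocity a ℓ q r x) (q' i)
      (discreteVelocity a ℓ q' r' x) (R (n + 1) i)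
      (discreteVelocity a ℓ (R (n + 1)) (m (n + 1)) x) (R n i)
      (discreteVelocity a ℓ (R n) (m n) x) (σ (n + 1) i) (fa (n + 1) x) (fb (n + 1) x)
      (f (n + 1) i) (g (n + 1) x) (g n x) hR.eps_nonneg hR.eps_le hR.fric_ge hR.fric_le ha
      hR.inv_area_le ht hqi hRi hqi' hRi' (by linarith [hqi'.1]) h1 (by linarith) hRR h3
      (hS.sigma_nonneg _ hn1 i) h4 h5 h6
    have eΦ : Φ x = (ε ^ 2 * (((discreteVelocity a ℓ q r x
            - discreteVelocity a ℓ (R (n + 1)) (m (n + 1)) x)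
            - (discreteVelocity a ℓ q' r' x - discreteVelocity a ℓ (R n) (m n) x)) / t)
            * (a * (q i * discreteVelocity a ℓ q r x
              - R (n + 1) i * discreteVelocity a ℓ (R (n + 1)) (m (n + 1)) x))
          - (enthalpy P ε (q i) (discreteVelocity a ℓ q r x)
            - enthalpy P ε (R (n + 1) i) (discreteVelocity a ℓ (R (n + 1)) (m (n + 1)) x))
            * (- f (n + 1) i - a * ((q i - R (n + 1) i) - (q' i - R n i)) / t)
          + γ * (|discreteVelocity a ℓ q r x| * discreteVelocity a ℓ q r x
            - |discreteVelocity a ℓ (R (n + 1)) (m (n + 1)) x|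
              * discreteVelocity a ℓ (R (n + 1)) (m (n + 1)) x)
            * (a * (q i * discreteVelocity a ℓ q r x
              - R (n + 1) i * discreteVelocity a ℓ (R (n + 1)) (m (n + 1)) x))
          + (ε ^ 2 * fa (n + 1) x + γ * fb (n + 1) x)
            * (a * (q i * discreteVelocity a ℓ q r x
              - R (n + 1) i * discreteVelocity a ℓ (R (n + 1)) (m (n + 1)) x))
          + g (n + 1) x * (- f (n + 1) i - a * ((q i - R (n + 1) i) - (q' i - R n i)) / t)) := by
      simp only [hΦ, momDensity, p1_sub, p0_eq hℓ _ hi, hslope, hp1, hp2]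
      ring
    rw [← eΦ] at key
    simp only [energyDensity, frictionDensity, errorDensity, p0_eq hℓ _ hi]
    linarith
  have hL : Integrable (fun x => energyDensity P ε a ℓ (g (n + 1)) (R (n + 1)) (m (n + 1)) q r x
        + t * (γmin * (α / 8)) * frictionDensity a ℓ (R (n + 1)) (m (n + 1)) q r x)
      (pipeMeasure ℓ) := (e1.add (ed.const_mul _)).integrable
  have j1 : Integrable (fun x => errorDensity ε a ℓ (R n) (m n) q' r' x
      + errorDensity ε a ℓ (R (n + 1)) (m (n + 1)) q r x) (pipeMeasure ℓ) := (es0.add es1).integrable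
  have j2 : Integrable (fun x => errorDensity ε a ℓ (R n) (m n) q' r' x
      + errorDensity ε a ℓ (R (n + 1)) (m (n + 1)) q r x + fa (n + 1) x ^ 2) (pipeMeasure ℓ) :=
    j1.add hfa2
  have j3 : Integrable (fun x => p0 ℓ (f (n + 1)) x ^ 2 + p0 ℓ (σ (n + 1)) x ^ 2) (pipeMeasure ℓ) :=
    (ef.add eσ).integrable
  have j4 : Integrable (fun x => p0 ℓ (f (n + 1)) x ^ 2 + p0 ℓ (σ (n + 1)) x ^ 2 + t ^ 2)
      (pipeMeasure ℓ) := j3.add (integrable_const _)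
  have j5 : Integrable (fun x => errorDensity ε a ℓ (R n) (m n) q' r' x
          + errorDensity ε a ℓ (R (n + 1)) (m (n + 1)) q r x
          + fa (n + 1) x ^ 2 + (p0 ℓ (f (n + 1)) x ^ 2 + p0 ℓ (σ (n + 1)) x ^ 2 + t ^ 2))
      (pipeMeasure ℓ) := j2.add j4
  have j6 : Integrable (fun x => energyDensity P ε a ℓ (g n) (R n) (m n) q' r' x + t / a * Φ x)
      (pipeMeasure ℓ) := e0.integrable.add (iΦ.const_mul _)
  have hint := integral_mono_ae hL (j6.add (j5.const_mul (C * t))) hpt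
  simp only [Pi.add_apply] at hint
  rw [integral_add e1.integrable (ed.const_mul _).integrable, integral_const_mul,
    integral_add j6 (j5.const_mul _), integral_add e0.integrable (iΦ.const_mul _),
    integral_const_mul, integral_const_mul, integral_add j2 j4, integral_add j1 hfa2,
    integral_add es0.integrable es1.integrable, integral_add j3 (integrable_const _),
    integral_add ef.integrable eσ.integrable, integral_p0_sq hℓ hM, integral_p0_sq hℓ hM] at hint
  have hc : ∫ _x, t ^ 2 ∂(pipeMeasure ℓ) = ℓ * t ^ 2 := by
    simp [Real.volume_real_Ioo_of_le hℓ.le]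
  rw [hc] at hint
  refine hint.trans ?_
  have k1 : t / a * ∫ x, Φ x ∂(pipeMeasure ℓ) ≤ 0 :=
    mul_nonpos_of_nonneg_of_nonpos (by positivity) hΦ0
  have k2 := hS.fa_sq n hn
  have k3 := hS.f_sq n hn
  have k4 := hS.sigma_sq (n + 1) hn1
  have k5 : ℓ * t ^ 2 ≤ ℓ * (t ^ 2 + (ℓ / M) ^ 2) := by
    have := sq_nonneg (ℓ / (M : ℝ))
    gcongr; linarith
  have hCt : 0 ≤ C * t := by positivity
  have k6 : C * t * ((∫ x, errorDensity ε a ℓ (R n) (m n) q' r' x ∂(pipeMeasure ℓ))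
          + (∫ x, errorDensity ε a ℓ (R (n + 1)) (m (n + 1)) q r x ∂(pipeMeasure ℓ))
          + (∫ x, fa (n + 1) x ^ 2 ∂(pipeMeasure ℓ))
          + (ℓ / M * ∑ i, f (n + 1) i ^ 2 + ℓ / M * ∑ i, σ (n + 1) i ^ 2 + ℓ * t ^ 2)) ≤
      C * t * ((∫ x, errorDensity ε a ℓ (R n) (m n) q' r' x ∂(pipeMeasure ℓ))
          + (∫ x, errorDensity ε a ℓ (R (n + 1)) (m (n + 1)) q r x ∂(pipeMeasure ℓ))
          + (3 * B + ℓ) * (t ^ 2 + (ℓ / M) ^ 2)) := by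
    refine mul_le_mul_of_nonneg_left ?_ hCt
    linarith
  linarith

/-- Coercivity of the modified relative energy. -/
lemma FlowBounds.errorDensity_le (hF : FlowBounds P α β κ L εmax wmax γmin B)
    (hR : ParamRange εmax γmin B ε γ a) (hℓ : 0 < ℓ) (hM : 0 < M)
    (hδ : RadiusBounds α wmax B δ)
    (hS : ReferenceStates P α β wmax B ε γ a ℓ t M N bL bR R m σ f fa fb g)
    {n : ℕ} (hn : n ≤ N) {q : Fin M → ℝ} {r : Fin (M + 1) → ℝ} (h : Near δ (R n) (m n) q r) :
    min (κ / (5 * β)) (α / 8) / 2 * (∫ x, errorDensity ε a ℓ (R n) (m n) q r x ∂(pipeMeasure ℓ)) ≤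
      (∫ x, energyDensity P ε a ℓ (g n) (R n) (m n) q r x ∂(pipeMeasure ℓ))
        + B ^ 3 / (2 * min (κ / (5 * β)) (α / 8)) * (t ^ 2 + (ℓ / M) ^ 2) := by
  set c := min (κ / (5 * β)) (α / 8) with hc
  have hβ : 0 < β := hF.law.pos.trans_le hF.law.le
  have hc0 : 0 < c := by
    have := hF.law.kappa_pos
    have := hF.law.pos
    rw [hc]; positivity
  have e1 := essBdd_energyDensity (P := P) (ε := ε) (a := a) hℓ hM (hS.g_bdd _ hn) (R n)
    (m n) q r
  have es := essBdd_errorDensity (ε := ε) (a := a) hℓ hM (R n) (m n) q r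
  have eσ := (EssBdd.p0 (ℓ := ℓ) (σ n)).pow 2
  have hpt : ∀ᵐ x ∂(pipeMeasure ℓ), c / 2 * errorDensity ε a ℓ (R n) (m n) q r x ≤
      energyDensity P ε a ℓ (g n) (R n) (m n) q r x + B ^ 2 / (2 * c) * p0 ℓ (σ n) x ^ 2 := by
    filter_upwards [ae_mem_cell hℓ hM, (hS.inner n hn).velocity, hS.g_le n hn]
      with x ⟨i, hi⟩ h1 h2
    have hqi := h.density_mem hF hδ (hS.inner n hn) i
    have hRi := (hS.inner n hn).density_mem hF i
    have hd1 := abs_le.1 (h.1 i)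
    have := hδ.density
    have key := hF.law.relEnergy_coercive hF.kappa_eq hR.eps_nonneg hR.eps_le hqi hRi
      (w := discreteVelocity a ℓ q r x) (by linarith [hqi.1]) h1
    rw [← hc] at key
    simp only [energyDensity, errorDensity, p0_eq hℓ _ hi] at h2 ⊢
    -- The modification of the energy is absorbed: half of the coercivity constant pays for the
    -- density error and the rest is of order `σ²`.
    have hg : g n x * (q i - R n i) ≤ c / 2 * (q i - R n i) ^ 2 + B ^ 2 / (2 * c) * σ n i ^ 2 := by
      refine (le_abs_self _).trans ?_
      rw [abs_mul, ← sq_abs (q i - R n i)]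
      have h0 : 0 ≤ (c * |q i - R n i| - B * σ n i) ^ 2 / (2 * c) := by positivity
      have e : (c * |q i - R n i| - B * σ n i) ^ 2 / (2 * c) =
          c / 2 * |q i - R n i| ^ 2 + B ^ 2 / (2 * c) * σ n i ^ 2
            - B * σ n i * |q i - R n i| := by
        field_simp; ring
      have : |g n x| * |q i - R n i| ≤ B * σ n i * |q i - R n i| := by gcongr
      linarith
    have hp : 0 ≤ c / 2 * (ε ^ 2 * (discreteVelocity a ℓ q r x
      - discreteVelocity a ℓ (R n) (m n) x) ^ 2) := by positivity
    linarith
  have hint := integral_mono_ae (es.const_mul _).integrable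
    (e1.add (eσ.const_mul _)).integrable hpt
  rw [integral_const_mul, integral_add e1.integrable (eσ.const_mul _).integrable,
    integral_const_mul, integral_p0_sq hℓ hM] at hint
  refine hint.trans ?_
  have : B ^ 2 / (2 * c) * (ℓ / M * ∑ i, σ n i ^ 2) ≤
      B ^ 2 / (2 * c) * (B * (t ^ 2 + (ℓ / M) ^ 2)) := by
    have := hS.sigma_sq n hn
    gcongr
  have e : B ^ 2 / (2 * c) * (B * (t ^ 2 + (ℓ / M) ^ 2)) =
      B ^ 3 / (2 * c) * (t ^ 2 + (ℓ / M) ^ 2) := by ring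
  linarith

end

/-- A discrete Gronwall inequality. -/
lemma discrete_gronwall {y d : ℕ → ℝ} {k Θ : ℝ} {N : ℕ} (hk : 0 ≤ k) (hk2 : k ≤ 1 / 2)
    (hΘ : 0 ≤ Θ) (hy : ∀ n ≤ N, 0 ≤ y n) (hd : ∀ n, 0 ≤ d n)
    (h : ∀ n < N, y (n + 1) + d (n + 1) ≤ y n + k * (y n + y (n + 1) + Θ)) :
    ∀ n ≤ N, y n + ∑ j ∈ Finset.range n, d (j + 1) ≤ (1 + 4 * k) ^ n * (y 0 + Θ) := by
  -- Carrying `Θ` on the left turns the inhomogeneous recursion into a pure multiplication by `1 + 4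
  -- k`.
  have key : ∀ n ≤ N, y n + ∑ j ∈ Finset.range n, d (j + 1) + Θ ≤ (1 + 4 * k) ^ n * (y 0 + Θ) := by
    intro n
    induction n with
    | zero => intro _; simp
    | succ n ih =>
      intro hn
      have ih := ih (by omega)
      have h1 := h n (by omega)
      have hyn := hy n (by omega)
      have hyn1 := hy (n + 1) hn
      have hs : 0 ≤ ∑ j ∈ Finset.range n, d (j + 1) := Finset.sum_nonneg fun j _ => hd _
      -- For `k ≤ 1 / 2` one has `1 + k ≤ (1 - k) (1 + 4 k)`.
      have h2 : y (n + 1) + d (n + 1) ≤ (1 + 4 * k) * y n + 4 * k * Θ := by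
        have hk1 : 0 < 1 - k := by linarith
        have hkk : 0 ≤ k * (1 - 2 * k) := mul_nonneg hk (by linarith)
        have h3 : (1 - k) * (y (n + 1) + d (n + 1)) ≤
            (1 - k) * ((1 + 4 * k) * y n + 4 * k * Θ) := by
          have a1 := mul_nonneg hk (hd (n + 1))
          have a2 := mul_nonneg hkk hyn
          have a3 := mul_nonneg hkk hΘ
          have a4 := mul_nonneg hk hΘ
          linarith
        exact le_of_mul_le_mul_left h3 hk1
      rw [Finset.sum_range_succ, pow_succ]
      have h4 := mul_le_mul_of_nonneg_right ih (by positivity : 0 ≤ 1 + 4 * k)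
      have h5 := mul_nonneg hk hs
      linarith
  intro n hn
  linarith [key n hn]


/-! ## Existence of discrete solutions near the reference states -/

/-- A piecewise linear function with bounded slopes that is large at a node has a large norm. -/
lemma le_integral_cube_of_node {ℓ A δ : ℝ} {M : ℕ} (hℓ : 0 < ℓ) (hM : 0 < M) (hA : 0 < A)
    (hδ : 0 < δ) {e : Fin (M + 1) → ℝ} (hs : ℓ / M * ∑ i, slopes ℓ e i ^ 2 ≤ A)
    {j : Fin (M + 1)} (hj : δ ≤ |e j|) :
    (δ / 2) ^ 3 * min (ℓ / 2) (δ ^ 2 / (4 * A)) ≤ ∫ x, |p1 ℓ e x| ^ 3 ∂(pipeMeasure ℓ) := by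
  -- By Cauchy–Schwarz the function varies by at most `δ / 2` over the distance `d`, since `d A ≤ (δ
  -- / 2)²`; the bound `ℓ / 2` leaves room on one side of any node.
  set d := min (ℓ / 2) (δ ^ 2 / (4 * A)) with hd
  have hd0 : 0 < d := by rw [hd]; positivity
  have hdl : d ≤ ℓ / 2 := min_le_left _ _
  have hdA : d * A ≤ (δ / 2) ^ 2 := by
    have : d ≤ δ ^ 2 / (4 * A) := min_le_right _ _
    rw [le_div_iff₀ (by positivity)] at this
    nlinarith
  have hx0 := node_mem_Icc hℓ hM (Nat.lt_succ_iff.1 j.2)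
  set x0 := node ℓ M j with hx0d
  have hD : Integrable (fun x => deriv (p1 ℓ e) x) (pipeMeasure ℓ) :=
    (EssBdd.deriv_p1 hℓ hM e).integrable
  have hD2 : Integrable (fun x => deriv (p1 ℓ e) x ^ 2) (pipeMeasure ℓ) :=
    ((EssBdd.deriv_p1 hℓ hM e).pow 2).integrable
  have hDA : ∫ x, deriv (p1 ℓ e) x ^ 2 ∂(pipeMeasure ℓ) ≤ A := by
    refine (le_of_eq ?_).trans hs
    rw [← integral_p0_sq hℓ hM]
    refine integral_congr_ae ?_
    filter_upwards [deriv_p1_ae hℓ hM e] with x hx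
    rw [hx]
  have sub : ∀ u v : ℝ, 0 ≤ u → v ≤ ℓ → Ioc u v ⊆ Ioc 0 ℓ := fun u v hu hv =>
    Ioc_subset_Ioc hu hv
  have hii : ∀ (φ : ℝ → ℝ), Integrable φ (pipeMeasure ℓ) → ∀ u v : ℝ, 0 ≤ u → u ≤ v → v ≤ ℓ →
      IntervalIntegrable φ volume u v := by
    intro φ hφ u v hu huv hv
    rw [intervalIntegrable_iff_integrableOn_Ioc_of_le huv]
    have : IntegrableOn φ (Ioc 0 ℓ) := by rw [integrableOn_Ioc_iff_integrableOn_Ioo]; exact hφ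
    exact this.mono_set (sub u v hu hv)
  have hosc : ∀ u v : ℝ, 0 ≤ u → u ≤ v → v ≤ ℓ → v - u ≤ d →
      |p1 ℓ e v - p1 ℓ e u| ≤ δ / 2 := by
    intro u v hu huv hv hdv
    have h1 := (absolutelyContinuous_p1 (ℓ := ℓ) e u v).integral_deriv_eq_sub
    rw [← h1]
    have h2 := sq_intervalIntegral_le huv (hii _ hD u v hu huv hv) (hii _ hD2 u v hu huv hv)
    have h3 : ∫ x in u..v, deriv (p1 ℓ e) x ^ 2 ≤ A := by
      refine le_trans ?_ hDA
      rw [intervalIntegral.integral_of_le huv, ← integral_Ioc_eq_integral_Ioo]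
      refine setIntegral_mono_set ?_ (Filter.Eventually.of_forall fun x => sq_nonneg _)
        (sub u v hu hv).eventuallyLE
      rw [integrableOn_Ioc_iff_integrableOn_Ioo]; exact hD2
    refine abs_le.2 (abs_le_of_sq_le_sq' ?_ (by positivity))
    have : (v - u) * ∫ x in u..v, deriv (p1 ℓ e) x ^ 2 ≤ d * A := by
      have h0 : 0 ≤ ∫ x in u..v, deriv (p1 ℓ e) x ^ 2 :=
        intervalIntegral.integral_nonneg huv fun _ _ => sq_nonneg _
      exact mul_le_mul hdv h3 h0 hd0.le
    linarith
  have hp : |p1 ℓ e x0| = |e j| := by rw [hx0d, p1_node hℓ hM e j]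
  have hI : IntegrableOn (fun x => |p1 ℓ e x| ^ 3) (Ioc 0 ℓ) := by
    rw [integrableOn_Ioc_iff_integrableOn_Ioo]
    exact ((EssBdd.p1 (ℓ := ℓ) e).abs.pow 3).integrable
  have fin : ∀ u : ℝ, 0 ≤ u → u + d ≤ ℓ → (∀ x ∈ Icc u (u + d), δ / 2 ≤ |p1 ℓ e x|) →
      (δ / 2) ^ 3 * d ≤ ∫ x, |p1 ℓ e x| ^ 3 ∂(pipeMeasure ℓ) := by
    intro u hu hv hb
    have h1 : ∫ x in Ioc u (u + d), (δ / 2) ^ 3 = (δ / 2) ^ 3 * d := by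
      simp [hd0.le, mul_comm]
    rw [← h1, ← integral_Ioc_eq_integral_Ioo]
    refine le_trans (setIntegral_mono_on (by simp) (hI.mono_set (sub u _ hu hv))
      measurableSet_Ioc ?_) (setIntegral_mono_set hI (Filter.Eventually.of_forall fun x => by
        positivity) (sub u _ hu hv).eventuallyLE)
    intro x hx
    have := hb x (Ioc_subset_Icc_self hx)
    gcongr
  -- Go to the right of a node in the left half of the pipe, and to the left otherwise.
  rcases le_total x0 (ℓ / 2) with h | h
  · refine fin x0 hx0.1 (by linarith) fun x hx => ?_
    have := hosc x0 x hx0.1 hx.1 (by linarith [hx.2]) (by linarith [hx.2])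
    have h2 := abs_sub_abs_le_abs_sub (p1 ℓ e x0) (p1 ℓ e x)
    rw [abs_sub_comm] at this
    linarith
  · refine fin (x0 - d) (by linarith) (by linarith [hx0.2]) fun x hx => ?_
    have := hosc x x0 (by linarith [hx.1]) (by linarith [hx.2]) hx0.2 (by linarith [hx.1])
    have h2 := abs_sub_abs_le_abs_sub (p1 ℓ e x0) (p1 ℓ e x)
    linarith

/-- The integrated squared error. -/
noncomputable def squaredError (ε a ℓ : ℝ) {M : ℕ} (R : Fin M → ℝ)
    (m : Fin (M + 1) → ℝ) (q : Fin M → ℝ) (r : Fin (M + 1) → ℝ) : ℝ :=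
  ∫ x, errorDensity ε a ℓ R m q r x ∂(pipeMeasure ℓ)

/-- The integrated friction dissipation of the error. -/
noncomputable def frictionError (a ℓ : ℝ) {M : ℕ} (R : Fin M → ℝ)
    (m : Fin (M + 1) → ℝ) (q : Fin M → ℝ) (r : Fin (M + 1) → ℝ) : ℝ :=
  ∫ x, frictionDensity a ℓ R m q r x ∂(pipeMeasure ℓ)

/-- Discrete states near the reference states that satisfy the first `n` steps of the scheme, the
momentum balance being replaced by an inequality in the direction of the error. -/
structure StepInequalities (P : ℝ → ℝ) (ε γ a ℓ t δ : ℝ) {M : ℕ} (bL bR : ℕ → ℝ)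
    (R : ℕ → Fin M → ℝ) (m : ℕ → Fin (M + 1) → ℝ) (n : ℕ) (q : ℕ → Fin M → ℝ)
    (r : ℕ → Fin (M + 1) → ℝ) : Prop where
  init_density : q 0 = R 0
  init_flux : r 0 = m 0
  near : ∀ k ≤ n, Near δ (R k) (m k) (q k) (r k)
  mass : ∀ k < n, q (k + 1) = massUpdate a ℓ t (q k) (r (k + 1))
  momentum : ∀ k < n, momRes P ε γ a ℓ t (bL (k + 1)) (bR (k + 1)) (q k) (r k) (q (k + 1))
    (r (k + 1)) (r (k + 1) - m (k + 1)) ≤ 0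

section

variable {P : ℝ → ℝ} {α β κ L εmax wmax γmin B ε γ a ℓ t δ : ℝ} {M N : ℕ} {bL bR : ℕ → ℝ}
  {R : ℕ → Fin M → ℝ} {m : ℕ → Fin (M + 1) → ℝ} {σ f : ℕ → Fin M → ℝ} {fa fb g : ℕ → ℝ → ℝ}

lemma squaredError_nonneg (R : Fin M → ℝ) (m : Fin (M + 1) → ℝ) (q : Fin M → ℝ)
    (r : Fin (M + 1) → ℝ) : 0 ≤ squaredError ε a ℓ R m q r :=
  integral_nonneg fun x => by simp only [errorDensity, Pi.zero_apply]; positivity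

lemma frictionError_nonneg (R : Fin M → ℝ) (m : Fin (M + 1) → ℝ) (q : Fin M → ℝ)
    (r : Fin (M + 1) → ℝ) : 0 ≤ frictionError a ℓ R m q r :=
  integral_nonneg fun x => by simp only [frictionDensity, Pi.zero_apply]; positivity

/-- The a priori error bound. -/
lemma FlowBounds.error_bound (hF : FlowBounds P α β κ L εmax wmax γmin B) (hℓ : 0 < ℓ) (T : ℝ) :
    ∃ G > 0, ∃ t₀ > 0, ∀ (ε γ a t δ : ℝ) (M N : ℕ) (bL bR : ℕ → ℝ) (R : ℕ → Fin M → ℝ)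
      (m : ℕ → Fin (M + 1) → ℝ) (σ f : ℕ → Fin M → ℝ) (fa fb g : ℕ → ℝ → ℝ),
      ParamRange εmax γmin B ε γ a → 0 < M → 0 < t → t ≤ t₀ → N * t ≤ T →
      RadiusBounds α wmax B δ →
      ReferenceStates P α β wmax B ε γ a ℓ t M N bL bR R m σ f fa fb g →
      ∀ n ≤ N, ∀ (q : ℕ → Fin M → ℝ) (r : ℕ → Fin (M + 1) → ℝ),
      StepInequalities P ε γ a ℓ t δ bL bR R m n q r → ∀ k ≤ n,
      squaredError ε a ℓ (R k) (m k) (q k) (r k)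
        + ∑ j ∈ Finset.range k, t * frictionError a ℓ (R (j + 1)) (m (j + 1)) (q (j + 1)) (r (j + 1))
        ≤ G * (t ^ 2 + (ℓ / M) ^ 2) := by
  obtain ⟨C, hC, H⟩ := hF.energy_step hℓ
  have hα := hF.law.pos
  have hβ : 0 < β := hα.trans_le hF.law.le
  have hκ := hF.law.kappa_pos
  have hB : 0 < B := one_pos.trans_le hF.one_le
  have hγ := hF.fric_pos
  set c := min (κ / (5 * β)) (α / 8) with hc
  have hc0 : 0 < c := by rw [hc]; positivity
  set K := B ^ 3 / (2 * c) with hK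
  have hK0 : 0 < K := by positivity
  set C1 := C * (2 / c + 3 * B + ℓ) with hC1
  have hC10 : 0 < C1 := by positivity
  set G0 := Real.exp (4 * C1 * T) * (K + 1) with hG0
  have hG00 : 0 < G0 := by positivity
  set b := γmin * (α / 8) with hb
  have hb0 : 0 < b := by positivity
  -- The two summands serve the squared error and the friction sum. The first bound on `t` makes the
  -- Gronwall constant at most `1 / 2`, the second keeps densities of consecutive levels comparable.
  refine ⟨2 / c * G0 + G0 / b, by positivity, min (1 / (2 * C1)) (α / (16 * B)), by positivity, ?_⟩
  intro ε γ a t δ M N bL bR R m σ f fa fb g hR hM ht htt hNt hδ hS n hn q r hI k hk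
  have ht1 : C1 * t ≤ 1 / 2 := by
    have := htt.trans (min_le_left _ _)
    rw [le_div_iff₀ (by positivity)] at this
    linarith
  have ht2 : B * t ≤ α / 16 := by
    have := htt.trans (min_le_right _ _)
    rw [le_div_iff₀ (by positivity)] at this
    linarith
  set Θ := t ^ 2 + (ℓ / M) ^ 2 with hΘ
  have hΘ0 : 0 ≤ Θ := by positivity
  set F : ℕ → ℝ := fun j => ∫ x, energyDensity P ε a ℓ (g j) (R j) (m j) (q j) (r j) x
    ∂(pipeMeasure ℓ) with hFd
  have hSy : ∀ j ≤ n, squaredError ε a ℓ (R j) (m j) (q j) (r j) ≤ 2 / c * (F j + K * Θ) := by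
    intro j hj
    have := hF.errorDensity_le hR hℓ hM hδ hS (hj.trans hn) (hI.near j hj)
    rw [← hc, ← hK, ← hΘ] at this
    rw [div_mul_eq_mul_div, le_div_iff₀ hc0]
    simp only [squaredError]
    linarith
  -- The modified energy may be negative, so Gronwall's inequality is applied to its shift by `K Θ`.
  have hy0 : ∀ j ≤ n, 0 ≤ F j + K * Θ := by
    intro j hj
    have := (squaredError_nonneg (R j) (m j) (q j) (r j)).trans (hSy j hj)
    exact nonneg_of_mul_nonneg_right this (by positivity)
  -- The discrete initial values coincide with the reference state, so the modified energy starts at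
  -- zero.
  have hF0 : F 0 = 0 := by
    simp [hFd, hI.init_density, hI.init_flux, energyDensity, relEnergy]
  have hg := discrete_gronwall (y := fun j => F j + K * Θ)
    (d := fun j => t * b * frictionError a ℓ (R j) (m j) (q j) (r j)) (k := C1 * t) (Θ := Θ)
    (N := n) (by positivity) ht1 hΘ0 hy0
    (fun j => mul_nonneg (by positivity) (frictionError_nonneg _ _ _ _)) (by
      intro j hj
      have h1 := H ε γ a t δ M N bL bR R m σ f fa fb g hR hM ht ht2 hδ hS j (hj.trans_le hn)
        (q j) (r j) (r (j + 1)) (hI.near j hj.le) (by rw [← hI.mass j hj]; exact hI.near (j + 1) hj)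
        (by rw [← hI.mass j hj]; exact hI.momentum j hj)
      rw [← hI.mass j hj, ← hΘ] at h1
      have s0 := hSy j hj.le
      have s1 := hSy (j + 1) hj
      have y0 := hy0 j hj.le
      have y1 := hy0 (j + 1) hj
      simp only [squaredError, frictionError, hFd] at h1 s0 s1 y0 y1 ⊢
      have hX : ∀ X Y : ℝ, 0 ≤ X → 0 ≤ Y → C * t * (2 / c * X + 2 / c * Y + (3 * B + ℓ) * Θ) ≤
          C1 * t * (X + Y + Θ) := by
        intro X Y hX hY
        have e : C1 * t * (X + Y + Θ) - C * t * (2 / c * X + 2 / c * Y + (3 * B + ℓ) * Θ) =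
          C * t * ((3 * B + ℓ) * (X + Y) + 2 / c * Θ) := by rw [hC1]; ring
        have : 0 ≤ C * t * ((3 * B + ℓ) * (X + Y) + 2 / c * Θ) := by positivity
        linarith
      have h2 := hX _ _ y0 y1
      have h3 := mul_le_mul_of_nonneg_left (add_le_add_left (add_le_add s0 s1) ((3 * B + ℓ) * Θ))
        (by positivity : 0 ≤ C * t)
      linarith) k hk
  have hexp : (1 + 4 * (C1 * t)) ^ k ≤ Real.exp (4 * C1 * T) := by
    have h1 : 1 + 4 * (C1 * t) ≤ Real.exp (4 * (C1 * t)) := by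
      rw [add_comm]; exact Real.add_one_le_exp _
    calc (1 + 4 * (C1 * t)) ^ k ≤ Real.exp (4 * (C1 * t)) ^ k := by gcongr
      _ = Real.exp (4 * C1 * (k * t)) := by rw [← Real.exp_nat_mul]; ring_nf
      _ ≤ _ := by
        have : (k : ℝ) * t ≤ N * t := by
          have : (k : ℝ) ≤ N := by exact_mod_cast hk.trans hn
          gcongr
        gcongr; linarith
  have hbd : F k + K * Θ + ∑ j ∈ Finset.range k, t * b * frictionError a ℓ (R (j + 1)) (m (j + 1))
      (q (j + 1)) (r (j + 1)) ≤ G0 * Θ := by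
    refine hg.trans ?_
    have e : F 0 + K * Θ + Θ = (K + 1) * Θ := by rw [hF0]; ring
    simp only [e]
    calc _ ≤ Real.exp (4 * C1 * T) * ((K + 1) * Θ) := by gcongr
      _ = _ := by rw [hG0]; ring
  have hs0 : 0 ≤ ∑ j ∈ Finset.range k, t * b * frictionError a ℓ (R (j + 1)) (m (j + 1))
      (q (j + 1)) (r (j + 1)) :=
    Finset.sum_nonneg fun j _ => mul_nonneg (by positivity) (frictionError_nonneg _ _ _ _)
  have hyk := hy0 k hk
  rw [add_mul]
  refine add_le_add ((hSy k hk).trans ?_) ?_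
  · rw [mul_assoc]; gcongr; linarith
  · rw [div_mul_eq_mul_div, le_div_iff₀ hb0, Finset.sum_mul]
    refine le_trans (le_of_eq (Finset.sum_congr rfl fun j _ => ?_)) (le_trans (le_add_of_nonneg_left hyk) hbd)
    ring

/-- The error of the flux in terms of the errors of density and velocity. -/
lemma FlowBounds.flux_cubed_le (hF : FlowBounds P α β κ L εmax wmax γmin B)
    (hR : ParamRange εmax γmin B ε γ a) (hℓ : 0 < ℓ) (hM : 0 < M) {R : Fin M → ℝ}
    {m : Fin (M + 1) → ℝ} {q : Fin M → ℝ} {r : Fin (M + 1) → ℝ}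
    (hS : AdmState a ℓ α β (3 * wmax / 2) R m) (h : AdmState a ℓ α β (3 * wmax / 2) q r) :
    ∫ x, |p1 ℓ (r - m) x| ^ 3 ∂(pipeMeasure ℓ) ≤
      4 * B ^ 7 * (squaredError 0 a ℓ R m q r + frictionError a ℓ R m q r) := by
  have hB1 := hF.one_le
  have hB : 0 < B := one_pos.trans_le hF.one_le
  have ha := hR.area_pos
  have hα := hF.law.pos
  have es := essBdd_errorDensity (ε := 0) (a := a) hℓ hM R m q r
  have ed := essBdd_frictionDensity (a := a) hℓ hM R m q r
  have hpt : ∀ᵐ x ∂(pipeMeasure ℓ), |p1 ℓ (r - m) x| ^ 3 ≤ 4 * B ^ 7 *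
      (errorDensity 0 a ℓ R m q r x + frictionDensity a ℓ R m q r x) := by
    filter_upwards [ae_mem_cell hℓ hM, hS.2, h.2] with x ⟨i, hi⟩ h1 h2
    have hq := h.1 i
    have hRi := hS.1 i
    rw [p1_sub, p1_eq_mul_velocity hℓ ha r (hα.trans_le hq.1) hi,
      p1_eq_mul_velocity hℓ ha m (hα.trans_le hRi.1) hi]
    simp only [errorDensity, frictionDensity, p0_eq hℓ _ hi]
    set w := discreteVelocity a ℓ q r x
    set W := discreteVelocity a ℓ R m x
    have hβ := hF.beta_le
    have hqB : |q i| ≤ B := abs_le.2 ⟨by linarith [hq.1], by linarith [hq.2]⟩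
    have hWB : |W| ≤ B := h1.trans hF.vel_le
    have hd : |q i - R i| ≤ B := abs_le.2 ⟨by linarith [hq.1, hRi.2], by linarith [hq.2, hRi.1]⟩
    have e1 : |a * (q i * w) - a * (R i * W)| ≤ B ^ 2 * |w - W| + B ^ 2 * |q i - R i| := by
      have e : a * (q i * w) - a * (R i * W) = a * (q i * (w - W)) + a * (W * (q i - R i)) := by
        ring
      rw [e]
      refine (abs_add_le _ _).trans ?_
      rw [abs_mul, abs_mul, abs_mul, abs_mul, abs_of_pos ha, sq, mul_assoc, mul_assoc]
      have := hR.area_le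
      gcongr
    have e2 : (B ^ 2 * |w - W| + B ^ 2 * |q i - R i|) ^ 3 ≤
        4 * B ^ 6 * (|w - W| ^ 3 + |q i - R i| ^ 3) := by
      have := add_pow_le (abs_nonneg (w - W)) (abs_nonneg (q i - R i)) 3
      norm_num at this
      calc _ = B ^ 6 * (|w - W| + |q i - R i|) ^ 3 := by ring
        _ ≤ B ^ 6 * (4 * (|w - W| ^ 3 + |q i - R i| ^ 3)) := by gcongr
        _ = _ := by ring
    -- One factor `|w - W|` is at most `|w| + |W|`: here the degenerate quadratic dissipation bounds
    -- a cube.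
    have e3 : |w - W| ^ 3 ≤ (|w| + |W|) * (w - W) ^ 2 := by
      rw [← sq_abs (w - W), pow_succ']
      gcongr; exact abs_sub _ _
    have e4 : |q i - R i| ^ 3 ≤ B * (q i - R i) ^ 2 := by
      rw [← sq_abs (q i - R i), pow_succ']
      gcongr
    have e5 : 0 ≤ (|w| + |W|) * (w - W) ^ 2 := by positivity
    calc _ ≤ (B ^ 2 * |w - W| + B ^ 2 * |q i - R i|) ^ 3 := by gcongr
      _ ≤ 4 * B ^ 6 * (|w - W| ^ 3 + |q i - R i| ^ 3) := e2
      _ ≤ 4 * B ^ 6 * (B * ((|w| + |W|) * (w - W) ^ 2) + B * (q i - R i) ^ 2) := by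
        gcongr
        exact e3.trans (le_mul_of_one_le_left e5 hB1)
      _ = _ := by ring
  have := integral_mono_ae (((EssBdd.p1 (ℓ := ℓ) (r - m)).abs.pow 3).integrable)
    ((es.add ed).const_mul _).integrable hpt
  rwa [integral_const_mul, integral_add es.integrable ed.integrable] at this

/-- With `ε = 0` only the density error remains; it is controlled uniformly in `ε`. -/
lemma squaredError_zero_le (hℓ : 0 < ℓ) (hM : 0 < M) (R : Fin M → ℝ) (m : Fin (M + 1) → ℝ)
    (q : Fin M → ℝ) (r : Fin (M + 1) → ℝ) :
    squaredError 0 a ℓ R m q r ≤ squaredError ε a ℓ R m q r := by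
  refine integral_mono (essBdd_errorDensity hℓ hM R m q r).integrable
    (essBdd_errorDensity hℓ hM R m q r).integrable fun x => ?_
  simp only [errorDensity]
  have : 0 ≤ ε ^ 2 * (discreteVelocity a ℓ q r x - discreteVelocity a ℓ R m x) ^ 2 := by positivity
  nlinarith

lemma squaredError_zero_eq (hℓ : 0 < ℓ) (hM : 0 < M) (R : Fin M → ℝ) (m : Fin (M + 1) → ℝ)
    (q : Fin M → ℝ) (r : Fin (M + 1) → ℝ) :
    squaredError 0 a ℓ R m q r = ℓ / M * ∑ i, (q i - R i) ^ 2 := by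
  rw [← integral_p0_sq hℓ hM, squaredError]
  refine integral_congr_ae ?_
  filter_upwards [ae_mem_cell hℓ hM] with x ⟨i, hi⟩
  simp [errorDensity, p0_eq hℓ _ hi]

/-- An inverse inequality: a single cell value is bounded by the mesh sum over `h`, and `h` is at
least `c₁ t`. The surviving factor `t` makes it small. -/
lemma sq_le_of_mesh_sum {h c₁ A : ℝ} (hc₁ : 0 < c₁) (ht : 0 < t) (hh : c₁ * t ≤ h) {v : Fin M → ℝ}
    (hv : h * ∑ i, v i ^ 2 ≤ A * t ^ 2) (i : Fin M) : v i ^ 2 ≤ A / c₁ * t := by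
  have h1 : v i ^ 2 ≤ ∑ i, v i ^ 2 :=
    Finset.single_le_sum (f := fun i => v i ^ 2) (fun _ _ => sq_nonneg _) (Finset.mem_univ i)
  have h2 : c₁ * t * v i ^ 2 ≤ A * t ^ 2 := by
    refine le_trans ?_ hv
    gcongr
    exact (by positivity : 0 ≤ c₁ * t).trans hh
  rw [div_mul_eq_mul_div, le_div_iff₀ hc₁]
  have : t * (v i ^ 2 * c₁) ≤ t * (A * t) := by nlinarith
  exact le_of_mul_le_mul_left this ht

lemma sq_neg_sub_add_le (x y z : ℝ) : (-x - y + z) ^ 2 ≤ 3 * x ^ 2 + 3 * y ^ 2 + 3 * z ^ 2 := by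
  nlinarith [sq_nonneg (x - y), sq_nonneg (x + z), sq_nonneg (y + z)]

lemma eventually_mul_lt (K : ℝ) {e : ℝ} (he : 0 < e) :
    ∀ᶠ t in nhdsWithin (0 : ℝ) (Ioi 0), K * t < e := by
  have hc : ContinuousAt (fun t : ℝ => K * t) 0 := by fun_prop
  exact nhdsWithin_le_nhds (hc.eventually_lt_const (by simpa using he))

set_option maxHeartbeats 800000 in
/-- Existence of discrete solutions near the reference states. -/
theorem FlowBounds.exists_discrete (hF : FlowBounds P α β κ L εmax wmax γmin B) (hℓ : 0 < ℓ)
    (T : ℝ) {c₁ c₂ : ℝ} (hc₁ : 0 < c₁) :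
    ∃ C > 0, ∃ t₀ > 0, ∀ (ε γ a t : ℝ) (M N : ℕ) (bL bR : ℕ → ℝ) (R : ℕ → Fin M → ℝ)
      (m : ℕ → Fin (M + 1) → ℝ) (σ f : ℕ → Fin M → ℝ) (fa fb g : ℕ → ℝ → ℝ),
      ParamRange εmax γmin B ε γ a → 0 < M → 0 < t → t ≤ t₀ → N * t ≤ T →
      c₁ * t ≤ ℓ / M → ℓ / M ≤ c₂ * t →
      ReferenceStates P α β wmax B ε γ a ℓ t M N bL bR R m σ f fa fb g →
      ∃ (q : ℕ → Fin M → ℝ) (r : ℕ → Fin (M + 1) → ℝ), q 0 = R 0 ∧ r 0 = m 0 ∧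
        (∀ n < N, q (n + 1) = massUpdate a ℓ t (q n) (r (n + 1)) ∧
          ∀ s, momRes P ε γ a ℓ t (bL (n + 1)) (bR (n + 1)) (q n) (r n) (q (n + 1)) (r (n + 1)) s
            = 0) ∧
        (∀ n ≤ N, AdmState a ℓ α β (3 * wmax / 2) (q n) (r n)) ∧
        ∀ n ≤ N, squaredError ε a ℓ (R n) (m n) (q n) (r n)
          + ∑ j ∈ Finset.range n,
              t * frictionError a ℓ (R (j + 1)) (m (j + 1)) (q (j + 1)) (r (j + 1))
          ≤ C * (t ^ 2 + (ℓ / M) ^ 2) := by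
  obtain ⟨G, hG, t1, ht1, HG⟩ := hF.error_bound hℓ T
  have hα := hF.law.pos
  have hβ : 0 < β := hα.trans_le hF.law.le
  have hκ := hF.law.kappa_pos
  have hB1 := hF.one_le
  have hB : 0 < B := one_pos.trans_le hF.one_le
  have hw := hF.wmax_pos
  -- The largest radius allowed by `RadiusBounds`; it depends on the data only.
  set δ := min (α / 16) (wmax * α / (8 * B)) with hδd
  have hδ0 : 0 < δ := by rw [hδd]; positivity
  have hδ : RadiusBounds α wmax B δ := by
    refine ⟨hδ0, min_le_left _ _, ?_⟩
    have : δ ≤ wmax * α / (8 * B) := min_le_right _ _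
    rw [le_div_iff₀ (by positivity)] at this
    rw [div_le_iff₀ hα]; linarith
  set E := 1 + c₂ ^ 2 with hE
  have hE0 : 0 < E := by positivity
  -- Bound for the squared `L²` norm of the slopes of the flux error: a residual part, and two
  -- density errors of order `t` multiplied by `a / t`.
  set A := 3 * (B * E) + 6 * (B ^ 2 * (G * E)) with hA
  have hA0 : 0 < A := by positivity
  have hmin : 0 < (δ / 2) ^ 3 * min (ℓ / 2) (δ ^ 2 / (4 * A)) := by positivity
  -- Smallness of `t` for: the error bound, `t < 1`, monotonicity, the density error below `δ / 2`,
  -- the mass residual below `δ / 2`, and the contradiction for nodal fluxes.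
  have hev := (eventually_mul_lt 1 ht1).and ((eventually_mul_lt 1 one_pos).and
    ((eventually_mul_lt (B * (2 * B ^ 3 / α)) (by positivity : 0 < 7 / 32 * (κ / β))).and
    ((eventually_mul_lt (G * E / c₁) (by positivity : 0 < (δ / 2) ^ 2)).and
    ((eventually_mul_lt (B ^ 2 * (B * E / c₁)) (by positivity : 0 < (δ / 2) ^ 2)).and
    (eventually_mul_lt (4 * B ^ 7 * (2 * (G * E))) hmin)))))
  obtain ⟨u, hu, hsub⟩ := mem_nhdsGT_iff_exists_Ioo_subset.1 hev
  have hu : 0 < u := hu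
  refine ⟨G, hG, u / 2, by positivity, ?_⟩
  intro ε γ a t M N bL bR R m σ f fa fb g hR hM ht htt hNt hh1 hh2 hS
  obtain ⟨k1, k2, k3, k4, k5, k6⟩ := hsub (show t ∈ Ioo 0 u from ⟨ht, by linarith⟩)
  rw [one_mul] at k1 k2
  have ha := hR.area_pos
  have haB := hR.area_le
  have hh := meshSize_pos hℓ hM
  set Θ := t ^ 2 + (ℓ / M) ^ 2 with hΘ
  have hΘE : Θ ≤ E * t ^ 2 := by
    have : (ℓ / M) ^ 2 ≤ (c₂ * t) ^ 2 := by gcongr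
    rw [hΘ, hE]; nlinarith
  have htA : ∀ x : ℝ, 0 ≤ x → x * Θ ≤ x * E * t ^ 2 := fun x hx => by
    rw [mul_assoc]; gcongr
  have bound := HG ε γ a t δ M N bL bR R m σ f fa fb g hR hM ht k1.le hNt hδ hS
  have bound1 : ∀ n ≤ N, ∀ (q : ℕ → Fin M → ℝ) (r : ℕ → Fin (M + 1) → ℝ),
      StepInequalities P ε γ a ℓ t δ bL bR R m n q r → ∀ k ≤ n,
      squaredError ε a ℓ (R k) (m k) (q k) (r k) ≤ G * E * t ^ 2 := by
    intro n hn q r hI k hk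
    have h1 := bound n hn q r hI k hk
    have : 0 ≤ ∑ j ∈ Finset.range k,
        t * frictionError a ℓ (R (j + 1)) (m (j + 1)) (q (j + 1)) (r (j + 1)) :=
      Finset.sum_nonneg fun j _ => mul_nonneg ht.le (frictionError_nonneg _ _ _ _)
    linarith [htA G hG.le]
  -- A single term of the weighted sum is of order `t²`; dividing by its weight `t` still leaves a
  -- small quantity.
  have bound2 : ∀ n < N, ∀ (q : ℕ → Fin M → ℝ) (r : ℕ → Fin (M + 1) → ℝ),
      StepInequalities P ε γ a ℓ t δ bL bR R m (n + 1) q r →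
      frictionError a ℓ (R (n + 1)) (m (n + 1)) (q (n + 1)) (r (n + 1)) ≤ G * E * t := by
    intro n hn q r hI
    have h1 := bound (n + 1) hn q r hI (n + 1) le_rfl
    rw [Finset.sum_range_succ] at h1
    have : 0 ≤ ∑ j ∈ Finset.range n,
        t * frictionError a ℓ (R (j + 1)) (m (j + 1)) (q (j + 1)) (r (j + 1)) :=
      Finset.sum_nonneg fun j _ => mul_nonneg ht.le (frictionError_nonneg _ _ _ _)
    have h2 := squaredError_nonneg (ε := ε) (a := a) (ℓ := ℓ) (R (n + 1)) (m (n + 1))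
      (q (n + 1)) (r (n + 1))
    have h3 : t * frictionError a ℓ (R (n + 1)) (m (n + 1)) (q (n + 1)) (r (n + 1)) ≤
        t * (G * E * t) := by
      have := htA G hG.le
      nlinarith
    exact le_of_mul_le_mul_left h3 ht
  have dens : ∀ n ≤ N, ∀ (q : ℕ → Fin M → ℝ) (r : ℕ → Fin (M + 1) → ℝ),
      StepInequalities P ε γ a ℓ t δ bL bR R m n q r → ∀ k ≤ n,
      ℓ / M * ∑ i, (q k i - R k i) ^ 2 ≤ G * E * t ^ 2 := by
    intro n hn q r hI k hk
    rw [← squaredError_zero_eq (a := a) hℓ hM (R k) (m k) (q k) (r k)]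
    exact (squaredError_zero_le (ε := ε) hℓ hM _ _ _ _).trans (bound1 n hn q r hI k hk)
  have dens2 : ∀ n ≤ N, ∀ (q : ℕ → Fin M → ℝ) (r : ℕ → Fin (M + 1) → ℝ),
      StepInequalities P ε γ a ℓ t δ bL bR R m n q r → ∀ k ≤ n, ∀ i,
      |q k i - R k i| ≤ δ / 2 := by
    intro n hn q r hI k hk i
    have h1 := sq_le_of_mesh_sum (v := fun i => q k i - R k i) hc₁ ht hh1 (dens n hn q r hI k hk) i
    exact abs_le.2 (abs_le_of_sq_le_sq' (h1.trans k4.le) (by positivity))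
  have fsum : ∀ n < N, ℓ / M * ∑ i, f (n + 1) i ^ 2 ≤ B * E * t ^ 2 := fun n hn =>
    (hS.f_sq n hn).trans (htA B hB.le)
  have hf : ∀ n < N, ∀ i, |t / a * f (n + 1) i| ≤ δ / 2 := by
    intro n hn i
    refine abs_le.2 (abs_le_of_sq_le_sq' ?_ (by positivity))
    have h1 := sq_le_of_mesh_sum hc₁ ht hh1 (fsum n hn) i
    refine le_trans ?_ k5.le
    have h2 : (t / a) ^ 2 ≤ B ^ 2 := by
      have : t / a ≤ B := by
        have h3 := hR.inv_area_le
        calc t / a ≤ 1 / a := by gcongr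
          _ ≤ B := h3
      gcongr
    rw [mul_pow, mul_assoc]
    exact mul_le_mul h2 h1 (sq_nonneg _) (by positivity)
  -- Induction over time levels. The error bound is applied to the whole history including the new
  -- level, at which only the inequality is known so far.
  have main : ∀ n ≤ N, ∃ (q : ℕ → Fin M → ℝ) (r : ℕ → Fin (M + 1) → ℝ),
      StepInequalities P ε γ a ℓ t δ bL bR R m n q r ∧ ∀ k < n, ∀ s,
        momRes P ε γ a ℓ t (bL (k + 1)) (bR (k + 1)) (q k) (r k) (q (k + 1)) (r (k + 1)) s = 0 := by
    intro n
    induction n with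
    | zero =>
      intro _
      refine ⟨R, m, ⟨rfl, rfl, fun k _ => ⟨fun i => ?_, fun j => ?_⟩, fun k hk => ?_, fun k hk => ?_⟩,
        fun k hk => ?_⟩
      · simp [hδ0.le]
      · simp [hδ0.le]
      all_goals omega
    | succ n ih =>
      intro hn
      have hnN : n < N := hn
      obtain ⟨q, r, hI, heq⟩ := ih hnN.le
      have hmass := hS.mass n hnN
      -- The reference flux belongs to the constraint set: its density update is off by the old
      -- density error and the mass residual, each at most `δ / 2`. It serves both as proof of
      -- nonemptiness and as test function.
      have hmu : ∀ i, |massUpdate a ℓ t (q n) (m (n + 1)) i - R (n + 1) i| ≤ δ := by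
        intro i
        have e : massUpdate a ℓ t (q n) (m (n + 1)) i - R (n + 1) i =
            (q n i - R n i) - t / a * f (n + 1) i := by
          rw [← hmass i, massUpdate]; field_simp; ring
        rw [e]
        refine (abs_sub _ _).trans ?_
        linarith [dens2 n hnN.le q r hI n le_rfl i, hf n hnN i]
      obtain ⟨v, hv, hvi⟩ := hF.exists_step_inequality (bL := bL (n + 1)) (bR := bR (n + 1)) hR hℓ hM ht
        (by rw [mul_comm]; exact k3.le) hδ (hS.inner (n + 1) hn) (q n) (r n) hmu
      have hneg : momRes P ε γ a ℓ t (bL (n + 1)) (bR (n + 1)) (q n) (r n)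
          (massUpdate a ℓ t (q n) v) v (v - m (n + 1)) ≤ 0 := by
        have h1 := hvi (m (n + 1)) ⟨hmu, fun j => by simp [hδ0.le]⟩
        have h2 := (momResₗ P ε γ a ℓ t (bL (n + 1)) (bR (n + 1)) hℓ hM (q n) (r n)
          (massUpdate a ℓ t (q n) v) v).map_neg (v - m (n + 1))
        rw [neg_sub] at h2
        have h3 : momRes P ε γ a ℓ t (bL (n + 1)) (bR (n + 1)) (q n) (r n)
          (massUpdate a ℓ t (q n) v) v (m (n + 1) - v) = - momRes P ε γ a ℓ t (bL (n + 1))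
          (bR (n + 1)) (q n) (r n) (massUpdate a ℓ t (q n) v) v (v - m (n + 1)) := h2
        linarith
      -- The old history extended by the new level, constantly from there on.
      set q2 : ℕ → Fin M → ℝ := fun k => if k ≤ n then q k else massUpdate a ℓ t (q n) v with hq2
      set r2 : ℕ → Fin (M + 1) → ℝ := fun k => if k ≤ n then r k else v with hr2
      have q2o : ∀ k ≤ n, q2 k = q k := fun k hk => by simp [hq2, hk]
      have r2o : ∀ k ≤ n, r2 k = r k := fun k hk => by simp [hr2, hk]
      have q2n : q2 (n + 1) = massUpdate a ℓ t (q n) v := by simp [hq2]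
      have r2n : r2 (n + 1) = v := by simp [hr2]
      have hI2 : StepInequalities P ε γ a ℓ t δ bL bR R m (n + 1) q2 r2 := by
        refine ⟨by rw [q2o 0 (Nat.zero_le n)]; exact hI.init_density,
          by rw [r2o 0 (Nat.zero_le n)]; exact hI.init_flux, fun k hk => ?_, fun k hk => ?_,
          fun k hk => ?_⟩
        · rcases Nat.le_succ_iff.1 hk with hk | rfl
          · rw [q2o k hk, r2o k hk]; exact hI.near k hk
          · rw [q2n, r2n]; exact hv
        · rcases Nat.lt_succ_iff_lt_or_eq.1 hk with hk | rfl
          · rw [q2o k hk.le, r2o (k + 1) hk, q2o (k + 1) hk]; exact hI.mass k hk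
          · rw [q2n, r2n, q2o k le_rfl]
        · rcases Nat.lt_succ_iff_lt_or_eq.1 hk with hk | rfl
          · rw [q2o k hk.le, r2o k hk.le, r2o (k + 1) hk, q2o (k + 1) hk]; exact hI.momentum k hk
          · rw [q2n, r2n, q2o k le_rfl, r2o k le_rfl]; exact hneg
      refine ⟨q2, r2, hI2, fun k hk => ?_⟩
      rcases Nat.lt_succ_iff_lt_or_eq.1 hk with hk | rfl
      · rw [q2o k hk.le, r2o k hk.le, r2o (k + 1) hk, q2o (k + 1) hk]; exact heq k hk
      rw [q2n, r2n, q2o k le_rfl, r2o k le_rfl]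
      have d0 := dens (k + 1) hn q2 r2 hI2 k (Nat.le_succ k)
      have d1 := dens (k + 1) hn q2 r2 hI2 (k + 1) le_rfl
      have dd := dens2 (k + 1) hn q2 r2 hI2 (k + 1) le_rfl
      have b1 := bound1 (k + 1) hn q2 r2 hI2 (k + 1) le_rfl
      have b2 := bound2 k hnN q2 r2 hI2
      rw [q2n, r2n] at b1 b2
      rw [q2n] at d1 dd
      rw [q2o k le_rfl] at d0
      refine momRes_eq_zero_of_interior hℓ hM (q k) (r k) (fun i => ?_) (fun j => ?_) hvi
      · linarith [dd i]
      -- A nodal error of size `δ` and the slope bound `A` force a fixed positive `L³` norm, whereas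
      -- the friction error makes that norm small with `t`.
      by_contra hcon
      rw [not_lt] at hcon
      have hslope : ∀ i, slopes ℓ (v - m (k + 1)) i = - f (k + 1) i
          - a / t * (massUpdate a ℓ t (q k) v i - R (k + 1) i) + a / t * (q k i - R k i) := by
        intro i
        rw [slopes_sub, ← hmass i]
        simp only [massUpdate]
        field_simp; ring
      have hsum : ℓ / M * ∑ i, slopes ℓ (v - m (k + 1)) i ^ 2 ≤ A := by
        have hab : ∀ i, slopes ℓ (v - m (k + 1)) i ^ 2 ≤ 3 * f (k + 1) i ^ 2
            + 3 * (a / t) ^ 2 * (massUpdate a ℓ t (q k) v i - R (k + 1) i) ^ 2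
            + 3 * (a / t) ^ 2 * (q k i - R k i) ^ 2 := by
          intro i
          rw [hslope]
          refine (sq_neg_sub_add_le _ _ _).trans (le_of_eq ?_)
          ring
        have h1 := mul_le_mul_of_nonneg_left (Finset.sum_le_sum fun i (_ : i ∈ Finset.univ) => hab i)
          hh.le
        rw [Finset.sum_add_distrib, Finset.sum_add_distrib, ← Finset.mul_sum, ← Finset.mul_sum,
          ← Finset.mul_sum] at h1
        have hat : (a / t) ^ 2 * t ^ 2 ≤ B ^ 2 := by
          rw [← mul_pow, div_mul_cancel₀ _ ht.ne']; gcongr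
        have h2 := fsum k hnN
        have h3 : B * E * t ^ 2 ≤ B * E := mul_le_of_le_one_right (by positivity)
          (pow_le_one₀ ht.le k2.le)
        have h4 := mul_le_mul_of_nonneg_left d1 (sq_nonneg (a / t))
        have h5 := mul_le_mul_of_nonneg_left d0 (sq_nonneg (a / t))
        have h6 := mul_le_mul_of_nonneg_right hat (by positivity : 0 ≤ G * E)
        rw [hA]
        linarith
      have hlow := le_integral_cube_of_node hℓ hM hA0 hδ0 hsum (j := j) (by simpa using hcon)
      have hup := hF.flux_cubed_le hR hℓ hM
        (R := R (k + 1)) (m := m (k + 1)) (q := massUpdate a ℓ t (q k) v) (r := v)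
        (by
          have : Near δ (R (k + 1)) (m (k + 1)) (R (k + 1)) (m (k + 1)) :=
            ⟨fun i => by simp [hδ0.le], fun j => by simp [hδ0.le]⟩
          exact this.admissible hF hR hℓ hM hδ (hS.inner (k + 1) hn))
        (hv.admissible hF hR hℓ hM hδ (hS.inner (k + 1) hn))
      have hz := squaredError_zero_le (ε := ε) (a := a) hℓ hM (R (k + 1)) (m (k + 1))
        (massUpdate a ℓ t (q k) v) v
      have ht2 : G * E * t ^ 2 ≤ G * E * t := by
        have : t ^ 2 ≤ t := by nlinarith
        gcongr
      have hfin := mul_le_mul_of_nonneg_left (add_le_add ((hz.trans b1).trans ht2) b2)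
        (by positivity : 0 ≤ 4 * B ^ 7)
      linarith
  obtain ⟨q, r, hI, heq⟩ := main N le_rfl
  exact ⟨q, r, hI.init_density, hI.init_flux, fun n hn => ⟨hI.mass n hn, heq n hn⟩,
    fun n hn => (hI.near n hn).admissible hF hR hℓ hM hδ (hS.inner n hn),
    fun n hn => bound N le_rfl q r hI n hn⟩

end


/-! ## Approximation on one cell -/

/-- `v` and `v'` approximate `u` and `u'` up to `s`, where the primed quantities belong to another
point in time, at distance `t`; the errors differ by at most `t * s`, up to the constant `K`. -/
structure Close (K t s u u' v v' : ℝ) : Prop where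
  abs_left : |u| ≤ K
  abs_left' : |u'| ≤ K
  abs_right : |v| ≤ K
  abs_right' : |v'| ≤ K
  time_left : |u - u'| ≤ K * t
  time_right : |v - v'| ≤ K * t
  space : |u - v| ≤ K * s
  space' : |u' - v'| ≤ K * s
  mixed : |(u - v) - (u' - v')| ≤ K * (t * s)

section Close

variable {K K₁ K₂ t s u u' v v' p p' q q' : ℝ}

lemma Close.nonneg (h : Close K t s u u' v v') : 0 ≤ K := (abs_nonneg _).trans h.abs_left

lemma Close.mono (h : Close K₁ t s u u' v v') (hK : K₁ ≤ K₂) (ht : 0 ≤ t) (hs : 0 ≤ s) :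
    Close K₂ t s u u' v v' where
  abs_left := h.abs_left.trans hK
  abs_left' := h.abs_left'.trans hK
  abs_right := h.abs_right.trans hK
  abs_right' := h.abs_right'.trans hK
  time_left := h.time_left.trans (by gcongr)
  time_right := h.time_right.trans (by gcongr)
  space := h.space.trans (by gcongr)
  space' := h.space'.trans (by gcongr)
  mixed := h.mixed.trans (by gcongr)

lemma Close.add (h : Close K₁ t s u u' v v') (k : Close K₂ t s p p' q q') :
    Close (K₁ + K₂) t s (u + p) (u' + p') (v + q) (v' + q') := by
  have key : ∀ {x y c d : ℝ} (z : ℝ), |x| ≤ c → |y| ≤ d → z = x + y → |z| ≤ c + d := by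
    intro x y c d z hx hy hz
    rw [hz]; exact (abs_add_le _ _).trans (add_le_add hx hy)
  constructor
  · exact key _ h.abs_left k.abs_left rfl
  · exact key _ h.abs_left' k.abs_left' rfl
  · exact key _ h.abs_right k.abs_right rfl
  · exact key _ h.abs_right' k.abs_right' rfl
  · rw [add_mul]; exact key _ h.time_left k.time_left (by ring)
  · rw [add_mul]; exact key _ h.time_right k.time_right (by ring)
  · rw [add_mul]; exact key _ h.space k.space (by ring)
  · rw [add_mul]; exact key _ h.space' k.space' (by ring)
  · rw [add_mul]; exact key _ h.mixed k.mixed (by ring)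

lemma Close.const_mul (h : Close K t s u u' v v') {c : ℝ} (hc : 0 ≤ c) :
    Close (c * K) t s (c * u) (c * u') (c * v) (c * v') := by
  have key : ∀ {x d : ℝ} (z : ℝ), |x| ≤ d → z = c * x → |z| ≤ c * d := by
    intro x d z hx hz
    rw [hz, abs_mul, abs_of_nonneg hc]; gcongr
  constructor
  · exact key _ h.abs_left rfl
  · exact key _ h.abs_left' rfl
  · exact key _ h.abs_right rfl
  · exact key _ h.abs_right' rfl
  · rw [mul_assoc]; exact key _ h.time_left (by ring)
  · rw [mul_assoc]; exact key _ h.time_right (by ring)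
  · rw [mul_assoc]; exact key _ h.space (by ring)
  · rw [mul_assoc]; exact key _ h.space' (by ring)
  · rw [mul_assoc]; exact key _ h.mixed (by ring)

lemma abs_mul_add_mul_le {x y z w a b c d : ℝ} (hx : |x| ≤ a) (hy : |y| ≤ b) (hz : |z| ≤ c)
    (hw : |w| ≤ d) : |x * y + z * w| ≤ a * b + c * d := by
  refine (abs_add_le _ _).trans ?_
  rw [abs_mul, abs_mul]
  have := (abs_nonneg _).trans hx
  have := (abs_nonneg _).trans hz
  gcongr

/-- Leibniz rule for mixed space-time differences; four terms appear, which gives the constant. -/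
lemma Close.mul (h : Close K₁ t s u u' v v') (k : Close K₂ t s p p' q q') (ht : 0 ≤ t)
    (hs : 0 ≤ s) : Close (4 * (K₁ * K₂)) t s (u * p) (u' * p') (v * q) (v' * q') := by
  have hK : 0 ≤ K₁ * K₂ := mul_nonneg h.nonneg k.nonneg
  have m : ∀ {x y : ℝ}, |x| ≤ K₁ → |y| ≤ K₂ → |x * y| ≤ 4 * (K₁ * K₂) := by
    intro x y hx hy
    rw [abs_mul]
    have : |x| * |y| ≤ K₁ * K₂ := mul_le_mul hx hy (abs_nonneg _) h.nonneg
    linarith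
  have n : ∀ {x x' y y' r : ℝ}, 0 ≤ r → |x - x'| ≤ K₁ * r → |y - y'| ≤ K₂ * r → |x'| ≤ K₁ →
      |y| ≤ K₂ → |x * y - x' * y'| ≤ 4 * (K₁ * K₂) * r := by
    intro x x' y y' r hr hx hy hx' hy'
    have e : x * y - x' * y' = (x - x') * y + x' * (y - y') := by ring
    rw [e]
    refine (abs_mul_add_mul_le hx hy' hx' hy).trans ?_
    have : 0 ≤ K₁ * K₂ * r := mul_nonneg hK hr
    linarith
  refine ⟨m h.abs_left k.abs_left, m h.abs_left' k.abs_left', m h.abs_right k.abs_right,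
    m h.abs_right' k.abs_right', n ht h.time_left k.time_left h.abs_left' k.abs_left,
    n ht h.time_right k.time_right h.abs_right' k.abs_right, n hs h.space k.space h.abs_right
    k.abs_left, n hs h.space' k.space' h.abs_right' k.abs_left', ?_⟩
  have e : u * p - v * q - (u' * p' - v' * q') =
      (((u - v) - (u' - v')) * p + (u' - v') * (p - p'))
        + ((v - v') * (p - q) + v' * ((p - q) - (p' - q'))) := by ring
  rw [e]
  refine (abs_add_le _ _).trans ((add_le_add
    (abs_mul_add_mul_le h.mixed k.abs_left h.space' k.time_left)
    (abs_mul_add_mul_le h.time_right k.space h.abs_right' k.mixed)).trans (le_of_eq ?_))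
  ring

/-- Inside a cell, linear interpolation is a convex combination of nodal values with a weight
independent of time, so mixed differences are preserved. -/
lemma Close.convex {q q' : ℝ} (h : Close K t s u u' v v') (k : Close K t s u u' q q') {θ : ℝ}
    (hθ : θ ∈ Icc (0 : ℝ) 1) :
    Close K t s u u' ((1 - θ) * v + θ * q) ((1 - θ) * v' + θ * q') := by
  have key : ∀ {x y c : ℝ} (z : ℝ), |x| ≤ c → |y| ≤ c → z = (1 - θ) * x + θ * y → |z| ≤ c := by
    intro x y c z hx hy hz
    rw [hz]
    refine (abs_add_le _ _).trans ?_
    rw [abs_mul, abs_mul, abs_of_nonneg hθ.1, abs_of_nonneg (by linarith [hθ.2] : 0 ≤ 1 - θ)]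
    have h1 := mul_le_mul_of_nonneg_left hx (by linarith [hθ.2] : 0 ≤ 1 - θ)
    have h2 := mul_le_mul_of_nonneg_left hy hθ.1
    linarith
  refine ⟨h.abs_left, h.abs_left', key _ h.abs_right k.abs_right rfl,
    key _ h.abs_right' k.abs_right' rfl, h.time_left, key _ h.time_right k.time_right (by ring),
    key _ h.space k.space (by ring), key _ h.space' k.space' (by ring),
    key _ h.mixed k.mixed (by ring)⟩

/-- Bounds of a function and its derivative on an interval. -/
structure SmoothBounds (f f' : ℝ → ℝ) (α β K : ℝ) : Prop where
  hasDerivAt : ∀ x ∈ Icc α β, HasDerivAt f (f' x) x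
  abs_le : ∀ x ∈ Icc α β, |f x| ≤ K
  abs_deriv_le : ∀ x ∈ Icc α β, |f' x| ≤ K
  lipschitz : ∀ x ∈ Icc α β, ∀ y ∈ Icc α β, |f' x - f' y| ≤ K * |x - y|

lemma SmoothBounds.abs_sub_le {f f' : ℝ → ℝ} {α β : ℝ} (hf : SmoothBounds f f' α β K) {x y : ℝ}
    (hx : x ∈ Icc α β) (hy : y ∈ Icc α β) : |f x - f y| ≤ K * |x - y| := by
  have := (convex_Icc α β).norm_image_sub_le_of_norm_hasDerivWithin_le (f := f) (f' := f') (C := K)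
    (fun z hz => (hf.hasDerivAt z hz).hasDerivWithinAt) hf.abs_deriv_le hy hx
  simpa using this

/-- The mixed difference is the increment over `[0, 1]` of the difference of `f` along the two
segments from `v` to `u` and from `v'` to `u'`. Its derivative is of order `t s` since `f'` is
Lipschitz and the segments are `t`-close. -/
lemma Close.comp {f f' : ℝ → ℝ} {α β : ℝ} (h : Close K₁ t s u u' v v')
    (hf : SmoothBounds f f' α β K₂) (ht : 0 ≤ t) (hs : 0 ≤ s) (hu : u ∈ Icc α β)
    (hu' : u' ∈ Icc α β) (hv : v ∈ Icc α β) (hv' : v' ∈ Icc α β) :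
    Close (K₂ * (1 + K₁) ^ 2) t s (f u) (f u') (f v) (f v') := by
  have hK₁ := h.nonneg
  have hK₂ : 0 ≤ K₂ := (abs_nonneg _).trans (hf.abs_le u hu)
  have b1 : K₂ ≤ K₂ * (1 + K₁) ^ 2 := le_mul_of_one_le_right hK₂ (by nlinarith)
  have b2 : ∀ {x y r : ℝ}, 0 ≤ r → |x - y| ≤ K₁ * r → x ∈ Icc α β → y ∈ Icc α β →
      |f x - f y| ≤ K₂ * (1 + K₁) ^ 2 * r := by
    intro x y r hr hxy hx hy
    refine (hf.abs_sub_le hx hy).trans ?_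
    have h1 : K₁ ≤ (1 + K₁) ^ 2 := by nlinarith
    calc K₂ * |x - y| ≤ K₂ * (K₁ * r) := by gcongr
      _ ≤ K₂ * ((1 + K₁) ^ 2 * r) := by gcongr
      _ = _ := by ring
  refine ⟨(hf.abs_le u hu).trans b1, (hf.abs_le u' hu').trans b1, (hf.abs_le v hv).trans b1,
    (hf.abs_le v' hv').trans b1, b2 ht h.time_left hu hu', b2 ht h.time_right hv hv',
    b2 hs h.space hu hv, b2 hs h.space' hu' hv', ?_⟩
  have mem : ∀ {x y : ℝ}, x ∈ Icc α β → y ∈ Icc α β → ∀ θ ∈ Icc (0 : ℝ) 1,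
      y + θ * (x - y) ∈ Icc α β := fun hx hy θ hθ => by
    have := (convex_Icc α β).add_smul_sub_mem hy hx hθ
    simpa using this
  have hd : ∀ {x y : ℝ}, x ∈ Icc α β → y ∈ Icc α β → ∀ θ ∈ Icc (0 : ℝ) 1,
      HasDerivAt (fun θ => f (y + θ * (x - y))) (f' (y + θ * (x - y)) * (x - y)) θ := by
    intro x y hx hy θ hθ
    have h1 : HasDerivAt (fun θ : ℝ => y + θ * (x - y)) (x - y) θ := by
      simpa using ((hasDerivAt_id θ).mul_const (x - y)).const_add y
    exact (hf.hasDerivAt _ (mem hx hy θ hθ)).comp θ h1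
  set F : ℝ → ℝ := fun θ => f (v + θ * (u - v)) - f (v' + θ * (u' - v')) with hF
  have hFd : ∀ θ ∈ Icc (0 : ℝ) 1, HasDerivWithinAt F (f' (v + θ * (u - v)) * (u - v)
      - f' (v' + θ * (u' - v')) * (u' - v')) (Icc 0 1) θ := fun θ hθ =>
    ((hd hu hv θ hθ).sub (hd hu' hv' θ hθ)).hasDerivWithinAt
  have hFb : ∀ θ ∈ Icc (0 : ℝ) 1, ‖f' (v + θ * (u - v)) * (u - v)
      - f' (v' + θ * (u' - v')) * (u' - v')‖ ≤ K₂ * (1 + K₁) ^ 2 * (t * s) := by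
    intro θ hθ
    have e : f' (v + θ * (u - v)) * (u - v) - f' (v' + θ * (u' - v')) * (u' - v') =
        f' (v + θ * (u - v)) * ((u - v) - (u' - v'))
          + (f' (v + θ * (u - v)) - f' (v' + θ * (u' - v'))) * (u' - v') := by ring
    have hl : |f' (v + θ * (u - v)) - f' (v' + θ * (u' - v'))| ≤ K₂ * (K₁ * t) := by
      refine (hf.lipschitz _ (mem hu hv θ hθ) _ (mem hu' hv' θ hθ)).trans ?_
      have e2 : v + θ * (u - v) - (v' + θ * (u' - v')) = (1 - θ) * (v - v') + θ * (u - u') := by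
        ring
      have h1 : |(1 - θ) * (v - v') + θ * (u - u')| ≤ (1 - θ) * (K₁ * t) + θ * (K₁ * t) :=
        abs_mul_add_mul_le (by rw [abs_of_nonneg]; linarith [hθ.2]) h.time_right
          (by rw [abs_of_nonneg hθ.1]) h.time_left
      rw [e2]
      have h2 : (1 - θ) * (K₁ * t) + θ * (K₁ * t) = K₁ * t := by ring
      gcongr
      linarith
    rw [e, Real.norm_eq_abs]
    refine (abs_mul_add_mul_le (hf.abs_deriv_le _ (mem hu hv θ hθ)) h.mixed hl h.space').trans ?_
    have : 0 ≤ K₂ * (1 + K₁) * (t * s) := by positivity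
    nlinarith
  have := (convex_Icc (0 : ℝ) 1).norm_image_sub_le_of_norm_hasDerivWithin_le hFd hFb
    (left_mem_Icc.2 zero_le_one) (right_mem_Icc.2 zero_le_one)
  have e : F 1 - F 0 = f u - f v - (f u' - f v') := by simp [hF]; ring
  rw [e] at this
  simpa using this

end Close

/-- Needed to divide the interpolated flux by the mean density. -/
lemma smoothBounds_inv {α β : ℝ} (hα : 0 < α) :
    SmoothBounds (fun x => x⁻¹) (fun x => -(x ^ 2)⁻¹) α β (1 / α + 1 / α ^ 2 + 2 / α ^ 3) := by
  have hx0 : ∀ x ∈ Icc α β, 0 < x := fun x hx => hα.trans_le hx.1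
  have p1 : 0 < 1 / α := by positivity
  have p2 : 0 < 1 / α ^ 2 := by positivity
  have p3 : 0 < 2 / α ^ 3 := by positivity
  refine ⟨fun x hx => hasDerivAt_inv (hx0 x hx).ne', fun x hx => ?_, fun x hx => ?_,
    fun x hx y hy => ?_⟩
  · have := hx0 x hx
    rw [abs_of_pos (by positivity), ← one_div]
    have : 1 / x ≤ 1 / α := one_div_le_one_div_of_le hα hx.1
    linarith
  · have := hx0 x hx
    rw [abs_neg, abs_of_pos (by positivity), ← one_div]
    have : 1 / x ^ 2 ≤ 1 / α ^ 2 := one_div_le_one_div_of_le (by positivity)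
      (by have := hx.1; gcongr)
    linarith
  · have hx1 := hx0 x hx
    have hy1 := hx0 y hy
    have e : -(x ^ 2)⁻¹ - -(y ^ 2)⁻¹ = (1 / (x * y ^ 2) + 1 / (x ^ 2 * y)) * (x - y) := by
      field_simp; ring
    rw [e, abs_mul, abs_of_pos (by positivity)]
    have b1 : 1 / (x * y ^ 2) ≤ 1 / α ^ 3 := one_div_le_one_div_of_le (by positivity) (by
      have := hx.1; have := hy.1
      calc α ^ 3 = α * α ^ 2 := by ring
        _ ≤ x * y ^ 2 := by gcongr)
    have b2 : 1 / (x ^ 2 * y) ≤ 1 / α ^ 3 := one_div_le_one_div_of_le (by positivity) (by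
      have := hx.1; have := hy.1
      calc α ^ 3 = α ^ 2 * α := by ring
        _ ≤ x ^ 2 * y := by gcongr)
    have e3 : 2 / α ^ 3 = 1 / α ^ 3 + 1 / α ^ 3 := by ring
    exact mul_le_mul_of_nonneg_right (by linarith) (abs_nonneg _)

lemma PressureLaw.smoothBounds {P : ℝ → ℝ} {α β κ L : ℝ} (h : PressureLaw P α β κ L) :
    SmoothBounds (deriv P) (deriv (deriv P)) α β (|deriv P α| + L * (β - α) + L) := by
  have hL := h.L_pos
  have h1 := mul_nonneg hL.le (sub_nonneg.2 h.le)
  have h2 := abs_nonneg (deriv P α)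
  refine ⟨h.hasDerivAt_deriv, fun x hx => ?_, fun x hx => (h.upper x hx).trans (by linarith),
    fun x hx y hy => (h.lipschitz x hx y hy).trans ?_⟩
  · have k := h.deriv_lipschitz hx (left_mem_Icc.2 h.le)
    have k1 : |x - α| ≤ β - α := by
      rw [abs_of_nonneg (by linarith [hx.1])]; linarith [hx.2]
    have k2 := abs_sub_abs_le_abs_sub (deriv P x) (deriv P α)
    have k3 := mul_le_mul_of_nonneg_left k1 hL.le
    linarith
  · gcongr; linarith

/-! ### Cell means and interpolated fluxes of two snapshots -/

/-- The mean value of a function on an interval. -/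
noncomputable def intervalMean (x₀ x₁ : ℝ) (c : ℝ → ℝ) : ℝ := (∫ x in x₀..x₁, c x) / (x₁ - x₀)

section Mean

variable {x₀ x₁ : ℝ} {c d : ℝ → ℝ}

lemma intervalMean_sub (hc : IntervalIntegrable c volume x₀ x₁)
    (hd : IntervalIntegrable d volume x₀ x₁) :
    intervalMean x₀ x₁ (fun x => c x - d x) = intervalMean x₀ x₁ c - intervalMean x₀ x₁ d := by
  rw [intervalMean, intervalIntegral.integral_sub hc hd, sub_div]; rfl

lemma intervalMean_const (h : x₀ < x₁) (z : ℝ) : intervalMean x₀ x₁ (fun _ => z) = z := by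
  have : x₁ - x₀ ≠ 0 := (sub_pos.2 h).ne'
  simp [intervalMean]; field_simp

lemma intervalMean_mono (h : x₀ < x₁) (hc : IntervalIntegrable c volume x₀ x₁)
    (hd : IntervalIntegrable d volume x₀ x₁) (hcd : ∀ x ∈ Icc x₀ x₁, c x ≤ d x) :
    intervalMean x₀ x₁ c ≤ intervalMean x₀ x₁ d :=
  div_le_div_of_nonneg_right (intervalIntegral.integral_mono_on h.le hc hd hcd) (sub_pos.2 h).le

lemma intervalMean_mem (h : x₀ < x₁) (hc : ContinuousOn c (Icc x₀ x₁)) {lo hi : ℝ}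
    (hb : ∀ x ∈ Icc x₀ x₁, c x ∈ Icc lo hi) : intervalMean x₀ x₁ c ∈ Icc lo hi := by
  have hi' := hc.intervalIntegrable_of_Icc (μ := volume) h.le
  constructor
  · rw [← intervalMean_const h lo]
    exact intervalMean_mono h (by simp) hi' fun x hx => (hb x hx).1
  · rw [← intervalMean_const h hi]
    exact intervalMean_mono h hi' (by simp) fun x hx => (hb x hx).2

lemma abs_sub_intervalMean_le (h : x₀ < x₁) (hc : ContinuousOn c (Icc x₀ x₁)) {z s : ℝ}
    (hb : ∀ x ∈ Icc x₀ x₁, |c x - z| ≤ s) : |z - intervalMean x₀ x₁ c| ≤ s := by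
  have := intervalMean_mem (lo := z - s) (hi := z + s) h hc fun x hx => by
    have := abs_le.1 (hb x hx)
    constructor <;> linarith
  exact abs_le.2 ⟨by linarith [this.2], by linarith [this.1]⟩

end Mean

/-- Two snapshots of density and velocity on an interval, at points in time with distance `t`. The
quantity `s` bounds the oscillations, and `t * s` bounds the oscillations of the differences. -/
structure CellPair (ρmin ρmax wmax K t s x₀ x₁ : ℝ) (ρ w ρ' w' : ℝ → ℝ) : Prop where
  cont_density : ContinuousOn ρ (Icc x₀ x₁)
  cont_density' : ContinuousOn ρ' (Icc x₀ x₁)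
  density : ∀ x ∈ Icc x₀ x₁, ρ x ∈ Icc ρmin ρmax
  density' : ∀ x ∈ Icc x₀ x₁, ρ' x ∈ Icc ρmin ρmax
  velocity : ∀ x ∈ Icc x₀ x₁, |w x| ≤ wmax
  velocity' : ∀ x ∈ Icc x₀ x₁, |w' x| ≤ wmax
  density_time : ∀ x ∈ Icc x₀ x₁, |ρ x - ρ' x| ≤ K * t
  velocity_time : ∀ x ∈ Icc x₀ x₁, |w x - w' x| ≤ K * t
  density_osc : ∀ x ∈ Icc x₀ x₁, ∀ y ∈ Icc x₀ x₁, |ρ x - ρ y| ≤ s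
  density_osc' : ∀ x ∈ Icc x₀ x₁, ∀ y ∈ Icc x₀ x₁, |ρ' x - ρ' y| ≤ s
  velocity_osc : ∀ x ∈ Icc x₀ x₁, ∀ y ∈ Icc x₀ x₁, |w x - w y| ≤ s
  velocity_osc' : ∀ x ∈ Icc x₀ x₁, ∀ y ∈ Icc x₀ x₁, |w' x - w' y| ≤ s
  density_mixed : ∀ x ∈ Icc x₀ x₁, ∀ y ∈ Icc x₀ x₁, |(ρ x - ρ' x) - (ρ y - ρ' y)| ≤ t * s
  velocity_mixed : ∀ x ∈ Icc x₀ x₁, ∀ y ∈ Icc x₀ x₁, |(w x - w' x) - (w y - w' y)| ≤ t * s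

/-- The velocity that belongs to the mean density and the interpolated mass flux. -/
noncomputable def starVelocity (x₀ x₁ θ : ℝ) (ρ w : ℝ → ℝ) : ℝ :=
  ((1 - θ) * (ρ x₀ * w x₀) + θ * (ρ x₁ * w x₁)) * (intervalMean x₀ x₁ ρ)⁻¹

section CellPair

variable {ρmin ρmax wmax K t s x₀ x₁ : ℝ} {ρ w ρ' w' : ℝ → ℝ}

lemma CellPair.density_close (h : CellPair ρmin ρmax wmax K t s x₀ x₁ ρ w ρ' w') (hx : x₀ < x₁)
    (hK : 1 ≤ K) (hρ : 0 ≤ ρmin) (hρK : ρmax ≤ K) (ht : 0 ≤ t) (hs : 0 ≤ s) {x : ℝ}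
    (hxx : x ∈ Icc x₀ x₁) :
    Close K t s (ρ x) (ρ' x) (intervalMean x₀ x₁ ρ) (intervalMean x₀ x₁ ρ') := by
  have habs : ∀ {z : ℝ}, z ∈ Icc ρmin ρmax → |z| ≤ K := fun hz =>
    abs_le.2 ⟨by linarith [hz.1], by linarith [hz.2]⟩
  have i1 := h.cont_density.intervalIntegrable_of_Icc (μ := volume) hx.le
  have i2 := h.cont_density'.intervalIntegrable_of_Icc (μ := volume) hx.le
  have hdc : ContinuousOn (fun x => ρ x - ρ' x) (Icc x₀ x₁) := h.cont_density.sub h.cont_density'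
  have hK' : ∀ {r : ℝ}, 0 ≤ r → r ≤ K * r := fun hr => le_mul_of_one_le_left hr hK
  refine ⟨habs (h.density x hxx), habs (h.density' x hxx),
    habs (intervalMean_mem hx h.cont_density h.density),
    habs (intervalMean_mem hx h.cont_density' h.density'), h.density_time x hxx, ?_,
    (abs_sub_intervalMean_le hx h.cont_density fun y hy => h.density_osc y hy x hxx).trans (hK' hs),
    (abs_sub_intervalMean_le hx h.cont_density' fun y hy => h.density_osc' y hy x hxx).trans
      (hK' hs), ?_⟩
  · rw [← intervalMean_sub i1 i2]
    have := intervalMean_mem (lo := -(K * t)) (hi := K * t) hx hdc fun x hx =>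
      abs_le.1 (h.density_time x hx)
    exact abs_le.2 this
  · have := abs_sub_intervalMean_le hx hdc (z := ρ x - ρ' x) fun y hy => h.density_mixed y hy x hxx
    rw [intervalMean_sub i1 i2] at this
    refine le_trans (le_of_eq ?_) (this.trans (hK' (mul_nonneg ht hs)))
    congr 1; ring

lemma CellPair.density_close_point (h : CellPair ρmin ρmax wmax K t s x₀ x₁ ρ w ρ' w')
    (hK : 1 ≤ K) (hρ : 0 ≤ ρmin) (hρK : ρmax ≤ K) (ht : 0 ≤ t) (hs : 0 ≤ s) {x y : ℝ}
    (hx : x ∈ Icc x₀ x₁) (hy : y ∈ Icc x₀ x₁) : Close K t s (ρ x) (ρ' x) (ρ y) (ρ' y) := by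
  have habs : ∀ {z : ℝ}, z ∈ Icc ρmin ρmax → |z| ≤ K := fun hz =>
    abs_le.2 ⟨by linarith [hz.1], by linarith [hz.2]⟩
  have hK' : ∀ {r : ℝ}, 0 ≤ r → r ≤ K * r := fun hr => le_mul_of_one_le_left hr hK
  refine ⟨habs (h.density x hx), habs (h.density' x hx), habs (h.density y hy),
    habs (h.density' y hy), h.density_time x hx, h.density_time y hy,
    (h.density_osc x hx y hy).trans (hK' hs), (h.density_osc' x hx y hy).trans (hK' hs), ?_⟩
  refine le_trans (le_of_eq ?_) ((h.density_mixed x hx y hy).trans (hK' (mul_nonneg ht hs)))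
  congr 1; ring

lemma CellPair.velocity_close_point (h : CellPair ρmin ρmax wmax K t s x₀ x₁ ρ w ρ' w')
    (hK : 1 ≤ K) (hwK : wmax ≤ K) (ht : 0 ≤ t) (hs : 0 ≤ s) {x y : ℝ}
    (hx : x ∈ Icc x₀ x₁) (hy : y ∈ Icc x₀ x₁) : Close K t s (w x) (w' x) (w y) (w' y) := by
  have hK' : ∀ {r : ℝ}, 0 ≤ r → r ≤ K * r := fun hr => le_mul_of_one_le_left hr hK
  refine ⟨(h.velocity x hx).trans hwK, (h.velocity' x hx).trans hwK, (h.velocity y hy).trans hwK,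
    (h.velocity' y hy).trans hwK, h.velocity_time x hx, h.velocity_time y hy,
    (h.velocity_osc x hx y hy).trans (hK' hs), (h.velocity_osc' x hx y hy).trans (hK' hs), ?_⟩
  refine le_trans (le_of_eq ?_) ((h.velocity_mixed x hx y hy).trans (hK' (mul_nonneg ht hs)))
  congr 1; ring

/-- The exact velocity is `(ρ w) ρ⁻¹`, and the reference velocity is the same expression with
interpolated flux and mean density. The rules for convex combinations, products and compositions
then apply. -/
lemma CellPair.velocity_close {α β : ℝ} (h : CellPair ρmin ρmax wmax K t s x₀ x₁ ρ w ρ' w')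
    (hx : x₀ < x₁) (hK : 1 ≤ K) (hα : 0 < α) (hαρ : α ≤ ρmin) (hβ : ρmax ≤ β) (hρK : ρmax ≤ K)
    (hwK : wmax ≤ K) (ht : 0 ≤ t) (hs : 0 ≤ s) {x : ℝ} (hxx : x ∈ Icc x₀ x₁) {θ : ℝ}
    (hθ : θ ∈ Icc (0 : ℝ) 1) :
    Close (4 * (4 * (K * K) * ((1 / α + 1 / α ^ 2 + 2 / α ^ 3) * (1 + K) ^ 2))) t s (w x) (w' x)
      (starVelocity x₀ x₁ θ ρ w) (starVelocity x₀ x₁ θ ρ' w') := by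
  have hρ0 : 0 ≤ ρmin := hα.le.trans hαρ
  have sub : Icc ρmin ρmax ⊆ Icc α β := Icc_subset_Icc hαρ hβ
  have hl := left_mem_Icc.2 hx.le
  have hr := right_mem_Icc.2 hx.le
  have c1 := (h.density_close_point hK hρ0 hρK ht hs hxx hl).mul
    (h.velocity_close_point hK hwK ht hs hxx hl) ht hs
  have c2 := (h.density_close_point hK hρ0 hρK ht hs hxx hr).mul
    (h.velocity_close_point hK hwK ht hs hxx hr) ht hs
  have c3 := (h.density_close hx hK hρ0 hρK ht hs hxx).comp (smoothBounds_inv (β := β) hα) ht hs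
    (sub (h.density x hxx)) (sub (h.density' x hxx))
    (sub (intervalMean_mem hx h.cont_density h.density))
    (sub (intervalMean_mem hx h.cont_density' h.density'))
  have c4 := (c1.convex c2 hθ).mul c3 ht hs
  have e : ∀ {z v : ℝ}, z ∈ Icc ρmin ρmax → z * v * z⁻¹ = v := fun {z v} hz => by
    rw [mul_comm _ v, mul_assoc, mul_inv_cancel₀ (hα.trans_le (hαρ.trans hz.1)).ne', mul_one]
  rw [e (h.density x hxx), e (h.density' x hxx)] at c4
  exact c4

/-- The constant contains `εmax` and not `ε`, which keeps the residual `g` under uniform control. -/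
lemma Close.enthalpy_close {P : ℝ → ℝ} {α β κ L K₁ t s ε εmax r r' v v' R R' V V' : ℝ}
    (hP : PressureLaw P α β κ L) (hε : 0 ≤ ε) (hε' : ε ≤ εmax) (ht : 0 ≤ t) (hs : 0 ≤ s)
    (h : Close K₁ t s r r' R R') (k : Close K₁ t s v v' V V') (hr : r ∈ Icc α β)
    (hr' : r' ∈ Icc α β) (hR : R ∈ Icc α β) (hR' : R' ∈ Icc α β) :
    Close (εmax ^ 2 / 2 * (4 * (K₁ * K₁))
        + (|deriv P α| + L * (β - α) + L) * (1 + K₁) ^ 2) t s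
      (enthalpy P ε r v) (enthalpy P ε r' v') (enthalpy P ε R V) (enthalpy P ε R' V') := by
  have c := ((k.mul k ht hs).const_mul (by positivity : 0 ≤ ε ^ 2 / 2)).add
    (h.comp hP.smoothBounds ht hs hr hr' hR hR')
  have hK := h.nonneg
  have e : ∀ r v : ℝ, enthalpy P ε r v = ε ^ 2 / 2 * (v * v) + deriv P r := fun r v => by
    rw [enthalpy]; ring
  simp only [e]
  exact c.mono (by gcongr) ht hs

end CellPair


/-! ## Reference states from snapshots of a solution -/

/-- Integration by parts against piecewise linear functions. -/
lemma integral_mul_p0_slopes {ℓ : ℝ} {M : ℕ} (hℓ : 0 < ℓ) (hM : 0 < M) {η ψ : ℝ → ℝ}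
    (hψ : Integrable ψ (pipeMeasure ℓ)) (h : ∀ x ∈ Icc 0 ℓ, η x - η 0 = ∫ y in (0 : ℝ)..x, ψ y)
    (s : Fin (M + 1) → ℝ) :
    ∫ x, η x * p0 ℓ (slopes ℓ s) x ∂(pipeMeasure ℓ) =
      η ℓ * s (Fin.last M) - η 0 * s 0 - ∫ x, ψ x * p1 ℓ s x ∂(pipeMeasure ℓ) := by
  have hψi : IntervalIntegrable ψ volume 0 ℓ := by
    rw [intervalIntegrable_iff_integrableOn_Ioo_of_le hℓ.le]; exact hψ
  set F : ℝ → ℝ := fun x => η 0 + ∫ y in (0 : ℝ)..x, ψ y with hF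
  have hFη : ∀ x ∈ Icc 0 ℓ, F x = η x := fun x hx => by rw [hF]; linarith [h x hx]
  have hAC : AbsolutelyContinuousOnInterval F 0 ℓ :=
    AbsolutelyContinuousOnInterval.add
      (LipschitzOnWith.absolutelyContinuousOnInterval (K := 0) (LipschitzWith.const (η 0)).lipschitzOnWith)
      (hψi.absolutelyContinuousOnInterval_intervalIntegral left_mem_uIcc)
  have key := hAC.integral_mul_deriv_eq_deriv_mul (absolutelyContinuous_p1 (ℓ := ℓ) s 0 ℓ)
  rw [p1_zero hℓ hM, p1_right hℓ hM, hFη 0 (left_mem_Icc.2 hℓ.le), hFη ℓ (right_mem_Icc.2 hℓ.le),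
    intervalIntegral_eq_pipe hℓ, intervalIntegral_eq_pipe hℓ] at key
  have e1 : ∫ x, F x * deriv (p1 ℓ s) x ∂(pipeMeasure ℓ) =
      ∫ x, η x * p0 ℓ (slopes ℓ s) x ∂(pipeMeasure ℓ) := by
    refine integral_congr_ae ?_
    filter_upwards [deriv_p1_ae hℓ hM s, ae_restrict_mem measurableSet_Ioo] with x hx hxm
    rw [hx, hFη x (Ioo_subset_Icc_self hxm)]
  have e2 : ∫ x, deriv F x * p1 ℓ s x ∂(pipeMeasure ℓ) = ∫ x, ψ x * p1 ℓ s x ∂(pipeMeasure ℓ) := by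
    refine integral_congr_ae ?_
    filter_upwards [ae_restrict_of_ae hψi.ae_hasDerivAt_integral, ae_restrict_mem measurableSet_Ioo]
      with x hx hxm
    have := hx (by rw [uIcc_of_le hℓ.le]; exact Ioo_subset_Icc_self hxm) 0 left_mem_uIcc
    rw [(this.const_add (η 0)).deriv]
  rw [← e1, key, e2]

/-- Snapshots `(ρ n, w n)` of a solution of the flow equations at the times `n t`, with time
derivatives `(ρt n, wt n)`. The numbers `σ n i` bound the oscillations on the cells. -/
structure Snapshots (P : ℝ → ℝ) (ρmin ρmax wmax K ε γ a ℓ t : ℝ) (M N : ℕ) (bL bR : ℕ → ℝ)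
    (ρ w ρt wt : ℕ → ℝ → ℝ) (σ : ℕ → Fin M → ℝ) : Prop where
  init : ∀ i : Fin M, CellPair ρmin ρmax wmax K t (σ 0 i) (node ℓ M i) (node ℓ M (i + 1))
    (ρ 0) (w 0) (ρ 0) (w 0)
  pair : ∀ n < N, ∀ i : Fin M, CellPair ρmin ρmax wmax K t (σ (n + 1) i) (node ℓ M i)
    (node ℓ M (i + 1)) (ρ (n + 1)) (w (n + 1)) (ρ n) (w n)
  cont_density : ∀ n ≤ N, ContinuousOn (ρ n) (Icc 0 ℓ)
  cont_velocity : ∀ n ≤ N, ContinuousOn (w n) (Icc 0 ℓ)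
  density : ∀ n ≤ N, ∀ x ∈ Icc 0 ℓ, ρ n x ∈ Icc ρmin ρmax
  sigma_nonneg : ∀ n ≤ N, ∀ i, 0 ≤ σ n i
  sigma_sq : ∀ n ≤ N, ℓ / M * ∑ i, σ n i ^ 2 ≤ K * (ℓ / M) ^ 2
  sigma_small : ∀ n ≤ N, ∀ i, σ n i ^ 2 ≤ K * (ℓ / M)
  density_memLp : ∀ n < N, MemLp (ρt (n + 1)) 2 (pipeMeasure ℓ)
  velocity_memLp : ∀ n < N, MemLp (wt (n + 1)) 2 (pipeMeasure ℓ)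
  density_deriv : ∀ n < N,
    ∫ x, ((ρ (n + 1) x - ρ n x) / t - ρt (n + 1) x) ^ 2 ∂(pipeMeasure ℓ) ≤ K * t ^ 2
  velocity_deriv : ∀ n < N,
    ∫ x, ((w (n + 1) x - w n x) / t - wt (n + 1) x) ^ 2 ∂(pipeMeasure ℓ) ≤ K * t ^ 2
  mass : ∀ n < N, ∀ x ∈ Icc 0 ℓ, ∀ y ∈ Icc 0 ℓ,
    massFlux a (ρ (n + 1) y) (w (n + 1) y) - massFlux a (ρ (n + 1) x) (w (n + 1) x)
      = ∫ z in x..y, -(a * ρt (n + 1) z)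
  momentum : ∀ n < N, ∀ x ∈ Icc 0 ℓ,
    enthalpy P ε (ρ (n + 1) x) (w (n + 1) x) - enthalpy P ε (ρ (n + 1) 0) (w (n + 1) 0)
      = ∫ z in (0 : ℝ)..x, -(ε ^ 2 * wt (n + 1) z + γ * (|w (n + 1) z| * w (n + 1) z))
  left : ∀ n < N, enthalpy P ε (ρ (n + 1) 0) (w (n + 1) 0) = bL (n + 1)
  right : ∀ n < N, enthalpy P ε (ρ (n + 1) ℓ) (w (n + 1) ℓ) = bR (n + 1)

/-- Cell means. -/
noncomputable def cellMeans (ℓ : ℝ) (M : ℕ) (c : ℝ → ℝ) (i : Fin M) : ℝ :=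
  intervalMean (node ℓ M i) (node ℓ M (i + 1)) c

/-- Nodal values of the mass flux. -/
noncomputable def nodalFlux (a ℓ : ℝ) (M : ℕ) (r v : ℝ → ℝ) (j : Fin (M + 1)) : ℝ :=
  massFlux a (r (node ℓ M j)) (v (node ℓ M j))

/-- The constant in the estimate of the velocity of the reference states. -/
noncomputable def velocityConst (α K : ℝ) : ℝ :=
  4 * (4 * (K * K) * ((1 / α + 1 / α ^ 2 + 2 / α ^ 3) * (1 + K) ^ 2))

section Snapshots

variable {P : ℝ → ℝ} {α β κ L ρmin ρmax wmax K ε εmax γ a ℓ t B : ℝ} {M N : ℕ} {bL bR : ℕ → ℝ}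
  {ρ w ρt wt : ℕ → ℝ → ℝ} {σ : ℕ → Fin M → ℝ}

lemma node_lt_succ (hℓ : 0 < ℓ) (hM : 0 < M) (i : ℕ) : node ℓ M i < node ℓ M (i + 1) := by
  rw [node_succ]; linarith [meshSize_pos hℓ hM]

lemma le_velocityConst (hα : 0 < α) (hα1 : α ≤ K) (hK : 1 ≤ K) : K ≤ velocityConst α K := by
  have h1 : 1 / K ≤ 1 / α := one_div_le_one_div_of_le hα hα1
  have h2 : 0 < 1 / α ^ 2 := by positivity
  have h3 : 0 < 2 / α ^ 3 := by positivity
  have h4 : 1 ≤ (1 + K) ^ 2 := by nlinarith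
  have h5 : 1 / K ≤ (1 / α + 1 / α ^ 2 + 2 / α ^ 3) * (1 + K) ^ 2 := by
    have : 1 / K ≤ 1 / α + 1 / α ^ 2 + 2 / α ^ 3 := by linarith
    exact this.trans (le_mul_of_one_le_right (by positivity) h4)
  have h6 : K * K * (1 / K) = K := by field_simp
  have h7 := mul_le_mul_of_nonneg_left h5 (by positivity : 0 ≤ K * K)
  rw [velocityConst]
  nlinarith

lemma discreteVelocity_eq_star (hℓ : 0 < ℓ) (ha : 0 < a) {i : Fin M} {x θ : ℝ}
    (hx : x ∈ cell ℓ M i)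
    (hθ : ∀ r : Fin (M + 1) → ℝ, p1 ℓ r x = (1 - θ) * r i.castSucc + θ * r i.succ)
    (r v : ℝ → ℝ) :
    discreteVelocity a ℓ (cellMeans ℓ M r) (nodalFlux a ℓ M r v) x =
      starVelocity (node ℓ M i) (node ℓ M (i + 1)) θ r v := by
  rw [discreteVelocity, p0_eq hℓ _ hx, hθ]
  simp only [nodalFlux, massFlux, cellMeans, starVelocity, Fin.val_castSucc, Fin.val_succ]
  rw [div_eq_mul_inv, mul_inv, ← mul_assoc]
  congr 1
  field_simp

/-- The constant in the estimate of the enthalpy of the reference states. -/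
noncomputable def enthalpyConst (P : ℝ → ℝ) (α β L εmax K : ℝ) : ℝ :=
  εmax ^ 2 / 2 * (4 * (K * K)) + (|deriv P α| + L * (β - α) + L) * (1 + K) ^ 2

/-- The bounds on the data that enter the estimates of the reference states. -/
structure SnapshotBounds (P : ℝ → ℝ) (α β κ L ρmin ρmax wmax εmax K : ℝ) : Prop where
  law : PressureLaw P α β κ L
  min : 3 * α / 2 ≤ ρmin
  max : ρmax ≤ 2 * β / 3
  one_le : 1 ≤ K
  beta_le : β ≤ K
  wmax_pos : 0 < wmax
  wmax_le : wmax ≤ K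

lemma CellPair.star_close (hb : SnapshotBounds P α β κ L ρmin ρmax wmax εmax K)
    (ha : 0 < a) (hε : 0 ≤ ε) (hε' : ε ≤ εmax) (hℓ : 0 < ℓ) (hM : 0 < M) (ht : 0 ≤ t) {s : ℝ}
    (hs : 0 ≤ s) {r v r' v' : ℝ → ℝ} {i : Fin M}
    (h : CellPair ρmin ρmax wmax K t s (node ℓ M i) (node ℓ M (i + 1)) r v r' v') {x : ℝ}
    (hx : x ∈ cell ℓ M i) :
    Close K t s (r x) (r' x) (cellMeans ℓ M r i) (cellMeans ℓ M r' i) ∧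
    Close (velocityConst α K) t s (v x) (v' x)
      (discreteVelocity a ℓ (cellMeans ℓ M r) (nodalFlux a ℓ M r v) x)
      (discreteVelocity a ℓ (cellMeans ℓ M r') (nodalFlux a ℓ M r' v') x) ∧
    Close (enthalpyConst P α β L εmax (velocityConst α K)) t s (enthalpy P ε (r x) (v x))
      (enthalpy P ε (r' x) (v' x))
      (enthalpy P ε (cellMeans ℓ M r i)
        (discreteVelocity a ℓ (cellMeans ℓ M r) (nodalFlux a ℓ M r v) x))
      (enthalpy P ε (cellMeans ℓ M r' i)
        (discreteVelocity a ℓ (cellMeans ℓ M r') (nodalFlux a ℓ M r' v') x)) := by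
  have hα := hb.law.pos
  have hle := hb.law.le
  have h1 := hb.min
  have h2 := hb.max
  have h3 := hb.beta_le
  have hlt := node_lt_succ hℓ hM (i : ℕ)
  have hxI : x ∈ Icc (node ℓ M i) (node ℓ M (i + 1)) := Ioo_subset_Icc_self hx
  obtain ⟨θ, hθ, hp⟩ := p1_convex hℓ hM hxI
  have c1 := h.density_close hlt hb.one_le (by linarith) (by linarith) ht hs hxI
  have c2 := h.velocity_close (β := β) hlt hb.one_le hα (by linarith) (by linarith) (by linarith)
    hb.wmax_le ht hs hxI hθ
  rw [← discreteVelocity_eq_star hℓ ha hx hp, ← discreteVelocity_eq_star hℓ ha hx hp] at c2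
  have sub : Icc ρmin ρmax ⊆ Icc α β := Icc_subset_Icc (by linarith) (by linarith)
  refine ⟨c1, c2, ?_⟩
  exact (c1.mono (le_velocityConst hα (by linarith) hb.one_le) ht hs).enthalpy_close hb.law hε hε'
    ht hs c2 (sub (h.density x hxI)) (sub (h.density' x hxI))
    (sub (intervalMean_mem hlt h.cont_density h.density))
    (sub (intervalMean_mem hlt h.cont_density' h.density'))

/-- The cellwise oscillation is of order `√h`, so for small `h` the reference velocity exceeds the
exact bound by at most `wmax / 4`. -/
lemma Snapshots.inner_state (hS : Snapshots P ρmin ρmax wmax K ε γ a ℓ t M N bL bR ρ w ρt wt σ)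
    (hb : SnapshotBounds P α β κ L ρmin ρmax wmax εmax K)
    (ha : 0 < a) (hε : 0 ≤ ε) (hε' : ε ≤ εmax) (hℓ : 0 < ℓ) (hM : 0 < M) (ht : 0 ≤ t)
    (hsmall : velocityConst α K ^ 2 * (K * (ℓ / M)) ≤ (wmax / 4) ^ 2) {n : ℕ} (hn : n ≤ N) :
    InnerState a ℓ α β wmax (cellMeans ℓ M (ρ n)) (nodalFlux a ℓ M (ρ n) (w n)) := by
  have hw := hb.wmax_pos
  constructor
  · intro i
    refine Icc_subset_Icc hb.min hb.max ?_
    exact intervalMean_mem (node_lt_succ hℓ hM i)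
      ((hS.cont_density n hn).mono (Icc_node_subset hℓ hM i))
      fun x hx => hS.density n hn x (Icc_node_subset hℓ hM i hx)
  · filter_upwards [ae_mem_cell hℓ hM] with x ⟨i, hi⟩
    have hxI : x ∈ Icc (node ℓ M i) (node ℓ M (i + 1)) := Ioo_subset_Icc_self hi
    have hsn := hS.sigma_nonneg n hn i
    obtain ⟨h1, h2⟩ : |w n x| ≤ wmax ∧ |w n x - discreteVelocity a ℓ (cellMeans ℓ M (ρ n))
        (nodalFlux a ℓ M (ρ n) (w n)) x| ≤ velocityConst α K * σ n i := by
      rcases n with _ | n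
      · have hc := hS.init i
        exact ⟨hc.velocity x hxI, (hc.star_close hb ha hε hε' hℓ hM ht hsn hi).2.1.space⟩
      · have hc := hS.pair n hn i
        exact ⟨hc.velocity x hxI, (hc.star_close hb ha hε hε' hℓ hM ht hsn hi).2.1.space⟩
    have h3 : velocityConst α K * σ n i ≤ wmax / 4 := by
      refine le_of_sq_le_sq ?_ (by positivity)
      rw [mul_pow]
      refine le_trans ?_ hsmall
      have := hS.sigma_small n hn i
      gcongr
    have h4 := abs_sub_abs_le_abs_sub (discreteVelocity a ℓ (cellMeans ℓ M (ρ n))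
        (nodalFlux a ℓ M (ρ n) (w n)) x) (w n x)
    rw [abs_sub_comm] at h4
    linarith

/-- The defect in the mass balance of the reference states. -/
lemma Snapshots.mass_defect (hS : Snapshots P ρmin ρmax wmax K ε γ a ℓ t M N bL bR ρ w ρt wt σ)
    (hℓ : 0 < ℓ) (hM : 0 < M) {n : ℕ} (hn : n < N) (i : Fin M) :
    a * (cellMeans ℓ M (ρ (n + 1)) i - cellMeans ℓ M (ρ n) i) / t
        + slopes ℓ (nodalFlux a ℓ M (ρ (n + 1)) (w (n + 1))) i =
      (∫ x in node ℓ M i..node ℓ M (i + 1), a * ((ρ (n + 1) x - ρ n x) / t - ρt (n + 1) x))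
        / (ℓ / M) := by
  have hlt := node_lt_succ hℓ hM (i : ℕ)
  have hsub := Icc_node_subset hℓ hM i
  have c1 := ((hS.cont_density (n + 1) hn).mono hsub).intervalIntegrable_of_Icc (μ := volume) hlt.le
  have c0 := ((hS.cont_density n hn.le).mono hsub).intervalIntegrable_of_Icc (μ := volume) hlt.le
  have c2 : IntervalIntegrable (ρt (n + 1)) volume (node ℓ M i) (node ℓ M (i + 1)) := by
    rw [intervalIntegrable_iff_integrableOn_Ioo_of_le hlt.le]
    exact IntegrableOn.mono_set ((hS.density_memLp n hn).integrable (by norm_num))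
      (cell_subset hℓ hM i)
  have hm := hS.mass n hn _ (hsub (left_mem_Icc.2 hlt.le)) _ (hsub (right_mem_Icc.2 hlt.le))
  have hh : node ℓ M (i + 1) - node ℓ M i = ℓ / M := by rw [node_succ]; ring
  have hs : slopes ℓ (nodalFlux a ℓ M (ρ (n + 1)) (w (n + 1))) i =
      (∫ z in node ℓ M i..node ℓ M (i + 1), -(a * ρt (n + 1) z)) / (ℓ / M) := by
    rw [← hm]; rfl
  rw [hs, cellMeans, cellMeans, intervalMean, intervalMean, hh, intervalIntegral.integral_const_mul,
    intervalIntegral.integral_sub ((c1.sub c0).div_const t) c2,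
    intervalIntegral.integral_div, intervalIntegral.integral_sub c1 c0,
    intervalIntegral.integral_neg, intervalIntegral.integral_const_mul]
  ring

lemma EssBdd.memLp {φ : ℝ → ℝ} (h : EssBdd ℓ φ) : MemLp φ 2 (pipeMeasure ℓ) := by
  obtain ⟨C, hC⟩ := h.2
  exact MemLp.of_bound h.1 C hC

/-- Snapshots of a solution give rise to reference states. -/
theorem Snapshots.referenceStates
    (hS : Snapshots P ρmin ρmax wmax K ε γ a ℓ t M N bL bR ρ w ρt wt σ)
    (hb : SnapshotBounds P α β κ L ρmin ρmax wmax εmax K)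
    (ha : 0 < a) (haK : a ≤ K) (hε : 0 ≤ ε) (hε' : ε ≤ εmax) (hℓ : 0 < ℓ) (hM : 0 < M) (ht : 0 < t)
    (hsmall : velocityConst α K ^ 2 * (K * (ℓ / M)) ≤ (wmax / 4) ^ 2)
    (hB1 : velocityConst α K ≤ B) (hB2 : enthalpyConst P α β L εmax (velocityConst α K) ≤ B)
    (hB3 : K ^ 3 ≤ B) (hB4 : 2 * velocityConst α K ^ 2 * K + 2 * K ≤ B) :
    ∃ (f : ℕ → Fin M → ℝ) (fa fb g : ℕ → ℝ → ℝ),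
      ReferenceStates P α β wmax B ε γ a ℓ t M N bL bR (fun n => cellMeans ℓ M (ρ n))
        (fun n => nodalFlux a ℓ M (ρ n) (w n)) σ f fa fb g := by
  have hα := hb.law.pos
  have hK1 := hb.one_le
  have hK0 : 0 < K := one_pos.trans_le hK1
  have hαK : α ≤ K := hb.law.le.trans hb.beta_le
  set V := velocityConst α K with hV
  have hKV : K ≤ V := le_velocityConst hα hαK hK1
  have hV0 : 0 < V := hK0.trans_le hKV
  have hB0 : 0 < B := hV0.trans_le hB1
  have hh := meshSize_pos hℓ hM
  set W : ℕ → ℝ → ℝ := fun n x =>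
    discreteVelocity a ℓ (cellMeans ℓ M (ρ n)) (nodalFlux a ℓ M (ρ n) (w n)) x with hW
  have hWb : ∀ n, EssBdd ℓ (W n) := fun n => EssBdd.discreteVelocity hℓ hM a _ _
  have hwb : ∀ n ≤ N, EssBdd ℓ (w n) := fun n hn => EssBdd.of_continuousOn (hS.cont_velocity n hn)
  have hρb : ∀ n ≤ N, EssBdd ℓ (ρ n) := fun n hn => EssBdd.of_continuousOn (hS.cont_density n hn)
  have hηb : ∀ n ≤ N, EssBdd ℓ fun x => enthalpy P ε (ρ n x) (w n x) := by
    intro n hn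
    refine EssBdd.of_continuousOn ?_
    have h1 : ContinuousOn (deriv P) (Icc α β) := fun x hx =>
      (hb.law.hasDerivAt_deriv x hx).continuousAt.continuousWithinAt
    have hm : MapsTo (ρ n) (Icc 0 ℓ) (Icc α β) := fun x hx => by
      have := hS.density n hn x hx
      have h2 := hb.min
      have h3 := hb.max
      have h4 := hb.law.le
      exact ⟨by linarith [this.1], by linarith [this.2]⟩
    have h2 := h1.comp (hS.cont_density n hn) hm
    have h3 := hS.cont_velocity n hn
    unfold enthalpy
    exact ((continuousOn_const.mul (h3.pow 2)).div_const 2).add h2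
  have step : ∀ n < N, ∀ᵐ x ∂(pipeMeasure ℓ), ∃ i : Fin M, x ∈ cell ℓ M i ∧
      Close V t (σ (n + 1) i) (w (n + 1) x) (w n x) (W (n + 1) x) (W n x) ∧
      Close B t (σ (n + 1) i) (enthalpy P ε (ρ (n + 1) x) (w (n + 1) x))
        (enthalpy P ε (ρ n x) (w n x))
        (enthalpy P ε (cellMeans ℓ M (ρ (n + 1)) i) (W (n + 1) x))
        (enthalpy P ε (cellMeans ℓ M (ρ n) i) (W n x)) := by
    intro n hn
    filter_upwards [ae_mem_cell hℓ hM] with x ⟨i, hi⟩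
    have hs := hS.sigma_nonneg (n + 1) hn i
    obtain ⟨_, h2, h3⟩ := (hS.pair n hn i).star_close hb ha hε hε' hℓ hM ht.le hs hi
    exact ⟨i, hi, h2, h3.mono hB2 ht.le hs⟩
  -- The residuals are defined as exactly what is left over. The truncated `n - 1` is immaterial,
  -- since only indices `n + 1` are used for the residuals with a time difference.
  refine ⟨fun n i => a * (cellMeans ℓ M (ρ n) i - cellMeans ℓ M (ρ (n - 1)) i) / t
      + slopes ℓ (nodalFlux a ℓ M (ρ n) (w n)) i,
    fun n x => (W n x - W (n - 1) x) / t - wt n x,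
    fun n x => |W n x| * W n x - |w n x| * w n x,
    fun n x => enthalpy P ε (ρ n x) (w n x) - enthalpy P ε (p0 ℓ (cellMeans ℓ M (ρ n)) x) (W n x),
    ?_⟩
  constructor
  case inner => exact fun n hn => hS.inner_state hb ha hε hε' hℓ hM ht.le hsmall hn
  case density_sub =>
    intro n hn i
    have hs := hS.sigma_nonneg (n + 1) hn i
    -- Cell means do not depend on the point; any point of the cell may be inserted.
    have hmid : (node ℓ M i + node ℓ M (i + 1)) / 2 ∈ cell ℓ M i := by
      have := node_lt_succ hℓ hM (i : ℕ)
      constructor <;> linarith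
    have := ((hS.pair n hn i).star_close hb ha hε hε' hℓ hM ht.le hs hmid).1.time_right
    exact this.trans (by gcongr; exact hKV.trans hB1)
  case velocity_sub =>
    intro n hn
    filter_upwards [step n hn] with x ⟨i, hi, h1, _⟩
    exact h1.time_right.trans (by gcongr)
  case sigma_nonneg => exact hS.sigma_nonneg
  case g_bdd => exact fun n hn => (hηb n hn).sub (essBdd_enthalpy hℓ hM _ _)
  case g_le =>
    intro n hn
    filter_upwards [ae_mem_cell hℓ hM] with x ⟨i, hi⟩
    have hs := hS.sigma_nonneg n hn i
    rw [p0_eq hℓ _ hi, p0_eq hℓ _ hi]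
    refine le_trans ?_ (mul_le_mul_of_nonneg_right hB2 hs)
    rcases n with _ | n
    · exact ((hS.init i).star_close hb ha hε hε' hℓ hM ht.le hs hi).2.2.space
    · exact ((hS.pair n hn i).star_close hb ha hε hε' hℓ hM ht.le hs hi).2.2.space
  case g_sub =>
    intro n hn
    filter_upwards [step n hn] with x ⟨i, hi, _, h2⟩
    rw [p0_eq hℓ _ hi, p0_eq hℓ _ hi, p0_eq hℓ _ hi, mul_assoc]
    exact h2.mixed
  case fb_bdd =>
    intro n hn
    exact ((hWb _).abs.mul (hWb _)).sub ((hwb _ hn).abs.mul (hwb _ hn))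
  case fb_le =>
    intro n hn
    filter_upwards [step n hn] with x ⟨i, hi, h1, _⟩
    have hs := hS.sigma_nonneg (n + 1) hn i
    rw [p0_eq hℓ _ hi]
    have h2 : |W (n + 1) x - w (n + 1) x| ≤ B * σ (n + 1) i := by
      rw [abs_sub_comm]; exact h1.space.trans (by gcongr)
    have h3 := abs_sub_abs_le_abs_sub (w (n + 1) x) (W (n + 1) x)
    rw [abs_sub_comm] at h3
    refine (abs_mul_self_sub_le _ _).trans ?_
    refine mul_le_mul ?_ h2 (abs_nonneg _) (by positivity)
    change _ ≤ 2 * |W (n + 1) x| + _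
    linarith
  case fa_memLp =>
    intro n hn
    exact MemLp.sub (((hWb (n + 1)).sub (hWb n)).div_const t).memLp (hS.velocity_memLp n hn)
  case mass => exact fun n hn i => rfl
  case momentum =>
    intro n hn s
    have hψ : Integrable (fun z => -(ε ^ 2 * wt (n + 1) z
        + γ * (|w (n + 1) z| * w (n + 1) z))) (pipeMeasure ℓ) :=
      ((((hS.velocity_memLp n hn).integrable (by norm_num)).const_mul _).add
        (((hwb _ hn).abs.mul (hwb _ hn)).const_mul _).integrable).neg
    have hibp := integral_mul_p0_slopes hℓ hM hψ
      (η := fun x => enthalpy P ε (ρ (n + 1) x) (w (n + 1) x)) (hS.momentum n hn) s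
    simp only [hS.left n hn, hS.right n hn] at hibp
    rw [momRes_eq hℓ hM]
    have i1 : Integrable (fun x => enthalpy P ε (ρ (n + 1) x) (w (n + 1) x) * p0 ℓ (slopes ℓ s) x)
      (pipeMeasure ℓ) := ((hηb _ hn).mul (EssBdd.p0 _)).integrable
    have i2 : Integrable (fun x => -(ε ^ 2 * wt (n + 1) x
        + γ * (|w (n + 1) x| * w (n + 1) x)) * p1 ℓ s x) (pipeMeasure ℓ) := by
      have := (EssBdd.p1 (ℓ := ℓ) s).mul_integrable hψ
      refine this.congr (Filter.Eventually.of_forall fun x => ?_)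
      simp only; ring
    have e : bR (n + 1) * s (Fin.last M) - bL (n + 1) * s 0 =
        ∫ x, (enthalpy P ε (ρ (n + 1) x) (w (n + 1) x) * p0 ℓ (slopes ℓ s) x
          + -(ε ^ 2 * wt (n + 1) x + γ * (|w (n + 1) x| * w (n + 1) x)) * p1 ℓ s x)
          ∂(pipeMeasure ℓ) := by
      rw [integral_add i1 i2]; linarith
    have i3 : Integrable (fun x => enthalpy P ε (ρ (n + 1) x) (w (n + 1) x) * p0 ℓ (slopes ℓ s) x
          + -(ε ^ 2 * wt (n + 1) x + γ * (|w (n + 1) x| * w (n + 1) x)) * p1 ℓ s x)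
          (pipeMeasure ℓ) := i1.add i2
    rw [e, ← integral_add (essBdd_momDensity hℓ hM _ _ _ _ _).integrable i3]
    refine integral_congr_ae (Filter.Eventually.of_forall fun x => ?_)
    simp only [momDensity, hW, Nat.add_sub_cancel]
    ring
  case sigma_sq =>
    intro n hn
    refine (hS.sigma_sq n hn).trans ?_
    have := sq_nonneg t
    have h1 : K ≤ B := hKV.trans hB1
    calc K * (ℓ / M) ^ 2 ≤ B * (ℓ / M) ^ 2 := by gcongr
      _ ≤ _ := by gcongr; linarith
  case f_sq =>
    intro n hn
    -- The mass residual is the cell mean of the error of the backward difference quotient, so by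
    -- Cauchy–Schwarz its norm is at most that of `φ`.
    set φ : ℝ → ℝ := fun x => a * ((ρ (n + 1) x - ρ n x) / t - ρt (n + 1) x) with hφ
    have hφm : MemLp φ 2 (pipeMeasure ℓ) :=
      (MemLp.sub (((hρb (n + 1) hn).sub (hρb n hn.le)).div_const t).memLp
        (hS.density_memLp n hn)).const_mul a
    have hφi : Integrable φ (pipeMeasure ℓ) := hφm.integrable (by norm_num)
    have hφ2 : Integrable (fun x => φ x ^ 2) (pipeMeasure ℓ) := hφm.integrable_sq
    have hii : ∀ (ψ : ℝ → ℝ), Integrable ψ (pipeMeasure ℓ) → ∀ i : Fin M,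
        IntervalIntegrable ψ volume (node ℓ M i) (node ℓ M (i + 1)) := by
      intro ψ hψ i
      rw [intervalIntegrable_iff_integrableOn_Ioo_of_le (node_lt_succ hℓ hM i).le]
      exact IntegrableOn.mono_set hψ (cell_subset hℓ hM i)
    have h1 : ∀ i : Fin M, ℓ / M * (a * (cellMeans ℓ M (ρ (n + 1)) i - cellMeans ℓ M (ρ n) i) / t
        + slopes ℓ (nodalFlux a ℓ M (ρ (n + 1)) (w (n + 1))) i) ^ 2 ≤
        ∫ x in node ℓ M i..node ℓ M (i + 1), φ x ^ 2 := by
      intro i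
      rw [hS.mass_defect hℓ hM hn i]
      have := sq_intervalIntegral_le (node_lt_succ hℓ hM i).le (hii _ hφi i) (hii _ hφ2 i)
      have hd : node ℓ M (i + 1) - node ℓ M i = ℓ / M := by rw [node_succ]; ring
      rw [hd] at this
      have e : ∀ J : ℝ, ℓ / M * (J / (ℓ / M)) ^ 2 = J ^ 2 / (ℓ / M) := fun J => by field_simp
      rw [e, div_le_iff₀ hh]
      linarith
    have h2 := Finset.sum_le_sum fun i (_ : i ∈ Finset.univ) => h1 i
    rw [← Finset.mul_sum, setIntegral_cell hℓ hM hφ2] at h2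
    refine h2.trans ?_
    have e : ∫ x, φ x ^ 2 ∂(pipeMeasure ℓ) =
        a ^ 2 * ∫ x, ((ρ (n + 1) x - ρ n x) / t - ρt (n + 1) x) ^ 2 ∂(pipeMeasure ℓ) := by
      simp only [hφ, mul_pow, integral_const_mul]
    rw [e]
    have h3 := hS.density_deriv n hn
    have h4 : 0 ≤ (ℓ / (M : ℝ)) ^ 2 := sq_nonneg _
    calc _ ≤ K ^ 2 * (K * t ^ 2) := by gcongr
      _ = K ^ 3 * t ^ 2 := by ring
      _ ≤ B * (t ^ 2 + (ℓ / M) ^ 2) := by gcongr; linarith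
  case fa_sq =>
    intro n hn
    set φ : ℝ → ℝ := fun x => (w (n + 1) x - w n x) / t - wt (n + 1) x with hφ
    have hφm : MemLp φ 2 (pipeMeasure ℓ) :=
      MemLp.sub (((hwb (n + 1) hn).sub (hwb n hn.le)).div_const t).memLp
        (hS.velocity_memLp n hn)
    have hφ2 : Integrable (fun x => φ x ^ 2) (pipeMeasure ℓ) := hφm.integrable_sq
    have hfa : MemLp (fun x => (W (n + 1) x - W n x) / t - wt (n + 1) x) 2 (pipeMeasure ℓ) :=
      MemLp.sub (((hWb (n + 1)).sub (hWb n)).div_const t).memLp (hS.velocity_memLp n hn)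
    have eσ := (EssBdd.p0 (ℓ := ℓ) (σ (n + 1))).pow 2
    have hpt : ∀ᵐ x ∂(pipeMeasure ℓ), ((W (n + 1) x - W n x) / t - wt (n + 1) x) ^ 2 ≤
        2 * V ^ 2 * p0 ℓ (σ (n + 1)) x ^ 2 + 2 * φ x ^ 2 := by
      filter_upwards [step n hn] with x ⟨i, hi, h1, _⟩
      rw [p0_eq hℓ _ hi]
      have h2 : (((w (n + 1) x - W (n + 1) x) - (w n x - W n x)) / t) ^ 2 ≤
          (V * σ (n + 1) i) ^ 2 := by
        refine sq_le_sq' ?_ ?_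
        · have := (abs_le.1 h1.mixed).1
          rw [le_div_iff₀ ht]; linarith
        · have := (abs_le.1 h1.mixed).2
          rw [div_le_iff₀ ht]; linarith
      -- The time discretization error of the exact velocity minus a difference quotient of the
      -- interpolation error; the mixed bound cancels the factor `1 / t`.
      have e : (W (n + 1) x - W n x) / t - wt (n + 1) x =
          φ x - ((w (n + 1) x - W (n + 1) x) - (w n x - W n x)) / t := by
        simp only [hφ]; field_simp; ring
      rw [e]
      have := sq_nonneg (φ x + ((w (n + 1) x - W (n + 1) x) - (w n x - W n x)) / t)
      nlinarith
    have hint := integral_mono_ae hfa.integrable_sq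
      ((eσ.const_mul (2 * V ^ 2)).integrable.add (hφ2.const_mul 2)) hpt
    simp only [Pi.add_apply] at hint
    rw [integral_add (eσ.const_mul (2 * V ^ 2)).integrable (hφ2.const_mul 2), integral_const_mul,
      integral_const_mul, integral_p0_sq hℓ hM] at hint
    refine hint.trans ?_
    have h1 := hS.sigma_sq (n + 1) hn
    have h2 := hS.velocity_deriv n hn
    have h3 : 0 ≤ K * t ^ 2 := by positivity
    have h4 : 0 ≤ K * (ℓ / M) ^ 2 := by positivity
    calc _ ≤ 2 * V ^ 2 * (K * (ℓ / M) ^ 2) + 2 * (K * t ^ 2) := by gcongr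
      _ ≤ (2 * V ^ 2 * K + 2 * K) * (t ^ 2 + (ℓ / M) ^ 2) := by
        have : 0 ≤ 2 * V ^ 2 * (K * t ^ 2) := by positivity
        linarith
      _ ≤ _ := by gcongr

end Snapshots


/-! ## Regularity in time -/

/-- The continuous functions `max f C` and `C` agree almost everywhere, hence everywhere on the
closed interval. -/
lemma le_of_ae_le_Icc {f : ℝ → ℝ} {x₀ x₁ C : ℝ} (h : x₀ < x₁) (hf : ContinuousOn f (Icc x₀ x₁))
    (hC : ∀ᵐ x ∂(volume.restrict (Ioo x₀ x₁)), f x ≤ C) {x : ℝ} (hx : x ∈ Icc x₀ x₁) :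
    f x ≤ C := by
  have h1 : (fun x => max (f x) C) =ᵐ[volume.restrict (Icc x₀ x₁)] fun _ => C := by
    rw [← restrict_Ioo_eq_restrict_Icc]
    filter_upwards [hC] with x hx using max_eq_right hx
  have := Measure.eqOn_Icc_of_ae_eq volume h.ne h1 (hf.sup continuousOn_const)
    continuousOn_const hx
  exact max_eq_right_iff.1 this

lemma HasWeakDerivOn.congr {α β : ℝ} {u v u₂ v₂ : ℝ → ℝ} (h : HasWeakDerivOn α β u v)
    (hu : ∀ᵐ t ∂(volume.restrict (Ioo α β)), u t = u₂ t)
    (hv : ∀ᵐ t ∂(volume.restrict (Ioo α β)), v t = v₂ t) : HasWeakDerivOn α β u₂ v₂ := by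
  have key : ∀ {f g : ℝ → ℝ}, LocallyIntegrableOn f (Ioo α β) →
      (∀ᵐ t ∂(volume.restrict (Ioo α β)), f t = g t) → LocallyIntegrableOn g (Ioo α β) := by
    intro f g hf hfg x hx
    obtain ⟨s, hs, hi⟩ := hf x hx
    refine ⟨s ∩ Ioo α β, Filter.inter_mem hs self_mem_nhdsWithin, ?_⟩
    exact (hi.mono_set inter_subset_left).congr
      (ae_mono (Measure.restrict_mono inter_subset_right le_rfl) hfg)
  refine ⟨key h.1 hu, key h.2.1 hv, fun φ h1 h2 h3 => ?_⟩
  have e1 : ∫ t in Ioo α β, deriv φ t • u₂ t = ∫ t in Ioo α β, deriv φ t • u t :=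
    integral_congr_ae (by filter_upwards [hu] with t ht; rw [ht])
  have e2 : ∫ t in Ioo α β, φ t • v₂ t = ∫ t in Ioo α β, φ t • v t :=
    integral_congr_ae (by filter_upwards [hv] with t ht; rw [ht])
  rw [e1, e2]
  exact h.2.2 φ h1 h2 h3

lemma HasWeakDerivOn.abs_sub_le {T C : ℝ} {u v : ℝ → ℝ} (h : HasWeakDerivOn 0 T u v)
    (hv : AEStronglyMeasurable v (volume.restrict (Ioo 0 T)))
    (hb : ∀ᵐ t ∂(volume.restrict (Ioo 0 T)), ‖v t‖ ≤ C) (hu : ContinuousOn u (Icc 0 T)) {x y : ℝ}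
    (hx : x ∈ Icc 0 T) (hy : y ∈ Icc 0 T) : |u y - u x| ≤ C * |y - x| := by
  have hvi : IntegrableOn v (Ioo 0 T) := Integrable.of_bound hv C hb
  rw [h.sub_eq_integral hvi hu hx hy, ← Real.norm_eq_abs]
  refine intervalIntegral.norm_integral_le_of_norm_le_const_ae ?_
  have hb' : ∀ᵐ t ∂(volume.restrict (Ioc 0 T)), ‖v t‖ ≤ C := by
    rw [← restrict_Ioo_eq_restrict_Ioc]; exact hb
  rw [ae_restrict_iff' measurableSet_Ioc] at hb'
  filter_upwards [hb'] with t ht hmem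
  refine ht ⟨?_, ?_⟩
  · exact (le_min hx.1 hy.1).trans_lt hmem.1
  · exact hmem.2.trans (max_le hx.2 hy.2)

section Time

variable {X : Type*} [NormedAddCommGroup X] [NormedSpace ℝ X] {T C : ℝ} {u : ℝ → X}

lemma norm_apply_le_of_norm_le {f : StrongDual ℝ X} (hf : ‖f‖ ≤ 1) {x : X} (hx : ‖x‖ ≤ C) :
    ‖f x‖ ≤ C :=
  (f.le_opNorm x).trans ((mul_le_of_le_one_left (norm_nonneg _) hf).trans hx)

lemma BoundedInWkInfty.norm_le {k : ℕ} (hT : 0 < T) (h : BoundedInWkInfty k T C u)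
    (hu : ContinuousOn u (Icc 0 T)) {x : ℝ} (hx : x ∈ Icc 0 T) : ‖u x‖ ≤ C := by
  obtain ⟨d, rfl, _, hb⟩ := h
  exact le_of_ae_le_Icc hT hu.norm (hb 0 (Nat.zero_le _)).2 hx

variable [CompleteSpace X]

/-- A norming functional of the increment reduces the claim to a scalar Lipschitz bound. -/
lemma BoundedInWkInfty.norm_sub_le (h : BoundedInWkInfty 1 T C u) (hu : ContinuousOn u (Icc 0 T))
    {x y : ℝ} (hx : x ∈ Icc 0 T) (hy : y ∈ Icc 0 T) : ‖u y - u x‖ ≤ C * |y - x| := by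
  obtain ⟨d, rfl, hw, hb⟩ := h
  obtain ⟨f, hf, hfx⟩ := exists_dual_vector'' ℝ (d 0 y - d 0 x)
  have h1 := ((hw 0 one_pos).clm_comp f).abs_sub_le (C := C)
    (f.continuous.comp_aestronglyMeasurable (hb 1 le_rfl).1)
    (by filter_upwards [(hb 1 le_rfl).2] with t ht using norm_apply_le_of_norm_le hf ht)
    (f.continuous.comp_continuousOn hu) hx hy
  rw [← map_sub, hfx] at h1
  simpa using h1

/-- The derivative of a `C¹` curve in `W^{2,∞}` is Lipschitz continuous. -/
lemma BoundedInWkInfty.norm_derivWithin_sub_le (hT : 0 < T) (h : BoundedInWkInfty 2 T C u)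
    (hu : ContDiffOn ℝ 1 u (Icc 0 T)) {x y : ℝ} (hx : x ∈ Icc 0 T) (hy : y ∈ Icc 0 T) :
    ‖derivWithin u (Icc 0 T) y - derivWithin u (Icc 0 T) x‖ ≤ C * |y - x| := by
  obtain ⟨d, rfl, hw, hb⟩ := h
  set u' := derivWithin (d 0) (Icc 0 T) with hu'
  have hu'c : ContinuousOn u' (Icc 0 T) :=
    hu.continuousOn_derivWithin (uniqueDiffOn_Icc hT) le_rfl
  obtain ⟨f, hf, hfx⟩ := exists_dual_vector'' ℝ (u' y - u' x)
  have hb1 := hb 1 one_le_two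
  have hfi : IntegrableOn (fun t => f (d 1 t)) (Ioo 0 T) :=
    Integrable.of_bound (f.continuous.comp_aestronglyMeasurable hb1.1) C
      (by filter_upwards [hb1.2] with t ht using norm_apply_le_of_norm_le hf ht)
  have hfii : IntervalIntegrable (fun t => f (d 1 t)) volume 0 T := by
    rw [intervalIntegrable_iff_integrableOn_Ioo_of_le hT.le]; exact hfi
  -- The weak derivative agrees almost everywhere with the classical one, so the continuous
  -- representative `u'` inherits the second weak derivative.
  have hae : ∀ᵐ t ∂(volume.restrict (Ioo 0 T)), f (d 1 t) = f (u' t) := by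
    filter_upwards [ae_restrict_of_ae hfii.ae_hasDerivAt_integral, ae_restrict_mem measurableSet_Ioo]
      with t ht htm
    have hI := Ioo_subset_Icc_self htm
    have h1 := ht (by rwa [uIcc_of_le hT.le]) 0 left_mem_uIcc
    have h2 : HasDerivAt (fun s => f (d 0 s)) (f (u' t)) t := by
      have h3 : HasDerivWithinAt (d 0) (u' t) (Icc 0 T) t :=
        ((hu.differentiableOn (by simp)) t hI).hasDerivWithinAt
      exact f.hasFDerivAt.comp_hasDerivAt t (h3.hasDerivAt (Icc_mem_nhds htm.1 htm.2))
    have h4 : HasDerivAt (fun s => f (d 0 s)) (f (d 1 t)) t := by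
      refine (h1.const_add (f (d 0 0))).congr_of_eventuallyEq ?_
      filter_upwards [isOpen_Ioo.mem_nhds htm] with s hs
      have := ((hw 0 two_pos).clm_comp f).sub_eq_integral hfi
        (f.continuous.comp_continuousOn hu.continuousOn) (left_mem_Icc.2 hT.le)
        (Ioo_subset_Icc_self hs)
      linarith
    exact h4.unique h2
  have hb2 := hb 2 le_rfl
  have h1 := (((hw 1 one_lt_two).clm_comp f).congr hae
      (Filter.Eventually.of_forall fun t => rfl)).abs_sub_le (C := C)
    (f.continuous.comp_aestronglyMeasurable hb2.1)
    (by filter_upwards [hb2.2] with t ht using norm_apply_le_of_norm_le hf ht)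
    (f.continuous.comp_continuousOn hu'c) hx hy
  rw [← map_sub, hfx] at h1
  simpa using h1

/-- Mean value inequality for `u` minus the linear function with slope `u'(y)`; the expansion point
is the right end, as for a backward difference. -/
lemma BoundedInWkInfty.norm_taylor_le (hT : 0 < T) (h : BoundedInWkInfty 2 T C u)
    (hu : ContDiffOn ℝ 1 u (Icc 0 T)) {x y : ℝ} (hx : x ∈ Icc 0 T) (hy : y ∈ Icc 0 T)
    (hxy : x ≤ y) (hC : 0 ≤ C) :
    ‖u y - u x - (y - x) • derivWithin u (Icc 0 T) y‖ ≤ C * (y - x) * (y - x) := by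
  have hsub : Icc x y ⊆ Icc 0 T := Icc_subset_Icc hx.1 hy.2
  have hd : ∀ s ∈ Icc x y, HasDerivWithinAt (fun s => u s - s • derivWithin u (Icc 0 T) y)
      (derivWithin u (Icc 0 T) s - derivWithin u (Icc 0 T) y) (Icc x y) s := by
    intro s hs
    have h1 : HasDerivWithinAt u (derivWithin u (Icc 0 T) s) (Icc x y) s :=
      (((hu.differentiableOn (by simp)) s (hsub hs)).hasDerivWithinAt).mono hsub
    have h2 := ((hasDerivWithinAt_id s (Icc x y)).smul_const (derivWithin u (Icc 0 T) y))
    rw [one_smul] at h2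
    exact h1.sub h2
  have := (convex_Icc x y).norm_image_sub_le_of_norm_hasDerivWithin_le (C := C * (y - x)) hd
    (fun s hs => by
      refine (h.norm_derivWithin_sub_le hT hu hy (hsub hs)).trans ?_
      rw [abs_sub_comm, abs_of_nonneg (by linarith [hs.2])]
      have := hs.1
      gcongr)
    (left_mem_Icc.2 hxy) (right_mem_Icc.2 hxy)
  rw [Real.norm_of_nonneg (by linarith : 0 ≤ y - x)] at this
  convert this using 2
  rw [sub_smul]; abel

end Time

/-! ## Functions in `H¹` -/

section H1

variable {ℓ : ℝ} {u v : H1 ℓ} {c d : ℝ → ℝ}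

/-- The square of the weak derivative. -/
noncomputable def derivSq (u : H1 ℓ) (x : ℝ) : ℝ := (u : WithLp 2 (L2 ℓ × L2 ℓ)).snd x ^ 2

lemma integral_L2_sq (f : L2 ℓ) : ∫ x, f x ^ 2 ∂(pipeMeasure ℓ) = ‖f‖ ^ 2 := by
  rw [← real_inner_self_eq_norm_sq, L2.inner_def]
  refine integral_congr_ae (Filter.Eventually.of_forall fun x => ?_)
  simp [sq]

lemma H1.norm_sq (u : H1 ℓ) : ‖u‖ ^ 2 = ‖toL2 u‖ ^ 2
    + ‖(u : WithLp 2 (L2 ℓ × L2 ℓ)).snd‖ ^ 2 :=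
  WithLp.prod_norm_sq_eq_of_L2 _

lemma integrable_derivSq (u : H1 ℓ) : Integrable (derivSq u) (pipeMeasure ℓ) :=
  (Lp.memLp _).integrable_sq

lemma derivSq_nonneg (u : H1 ℓ) (x : ℝ) : 0 ≤ derivSq u x := sq_nonneg _

lemma integral_derivSq_le (u : H1 ℓ) : ∫ x, derivSq u x ∂(pipeMeasure ℓ) ≤ ‖u‖ ^ 2 := by
  rw [H1.norm_sq]
  have := sq_nonneg ‖toL2 u‖
  have e : ∫ x, derivSq u x ∂(pipeMeasure ℓ) = _ :=
    integral_L2_sq (u : WithLp 2 (L2 ℓ × L2 ℓ)).snd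
  linarith

lemma IsH1Rep.sub (hu : IsH1Rep u c) (hv : IsH1Rep v d) :
    IsH1Rep (u - v) fun x => c x - d x := by
  refine ⟨hu.1.sub hv.1, ?_⟩
  filter_upwards [hu.2, hv.2, Lp.coeFn_sub (toL2 u) (toL2 v)] with x h1 h2 h3
  rw [← h1, ← h2]
  exact h3

lemma IsH1Rep.smul (hu : IsH1Rep u c) (k : ℝ) : IsH1Rep (k • u) fun x => k * c x := by
  refine ⟨continuousOn_const.mul hu.1, ?_⟩
  filter_upwards [hu.2, Lp.coeFn_smul k (toL2 u)] with x h1 h2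
  rw [← h1]
  exact h2

lemma IsH1Rep.sub_eq_integral (hu : IsH1Rep u c) {x y : ℝ} (hx : x ∈ Icc 0 ℓ) (hy : y ∈ Icc 0 ℓ) :
    c y - c x = ∫ z in x..y, (u : WithLp 2 (L2 ℓ × L2 ℓ)).snd z := by
  have h : HasWeakDerivOn 0 ℓ (toL2 u) (u : WithLp 2 (L2 ℓ × L2 ℓ)).snd := u.2
  exact (h.congr hu.2 (Filter.Eventually.of_forall fun _ => rfl)).sub_eq_integral
    ((Lp.memLp _).integrable (by norm_num)) hu.1 hx hy

/-- Cauchy–Schwarz on a subinterval. Keeping the local integral of the squared derivative makes the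
squared oscillations summable over the cells. -/
lemma IsH1Rep.sq_sub_le (hu : IsH1Rep u c) {x₀ x₁ : ℝ} (h : x₀ ≤ x₁)
    (hI : Icc x₀ x₁ ⊆ Icc 0 ℓ) {x y : ℝ}
    (hx : x ∈ Icc x₀ x₁) (hy : y ∈ Icc x₀ x₁) :
    (c x - c y) ^ 2 ≤ (x₁ - x₀) * ∫ z in x₀..x₁, derivSq u z := by
  wlog hxy : y ≤ x generalizing x y
  · rw [← neg_sub, neg_sq]; exact this hy hx (le_of_not_ge hxy)
  have hx0 := (hI (left_mem_Icc.2 h)).1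
  have hx1 := (hI (right_mem_Icc.2 h)).2
  have hii : ∀ (ψ : ℝ → ℝ), Integrable ψ (pipeMeasure ℓ) → ∀ a b : ℝ, 0 ≤ a → a ≤ b → b ≤ ℓ →
      IntervalIntegrable ψ volume a b := by
    intro ψ hψ a b ha hab hb
    rw [intervalIntegrable_iff_integrableOn_Ioo_of_le hab]
    exact IntegrableOn.mono_set hψ (Ioo_subset_Ioo ha hb)
  have hs : Integrable (fun z => (u : WithLp 2 (L2 ℓ × L2 ℓ)).snd z) (pipeMeasure ℓ) :=
    (Lp.memLp _).integrable (by norm_num)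
  rw [hu.sub_eq_integral (hI hy) (hI hx)]
  have hy0 : 0 ≤ y := hx0.trans hy.1
  have hx1' : x ≤ ℓ := hx.2.trans hx1
  refine (sq_intervalIntegral_le hxy (hii _ hs y x hy0 hxy hx1')
    (hii _ (integrable_derivSq u) y x hy0 hxy hx1')).trans ?_
  have h1 : ∫ z in y..x, derivSq u z ≤ ∫ z in x₀..x₁, derivSq u z :=
    intervalIntegral.integral_mono_interval hy.1 hxy hx.2
      (Filter.Eventually.of_forall fun z => derivSq_nonneg u z)
      (hii _ (integrable_derivSq u) x₀ x₁ hx0 h hx1)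
  have h2 : 0 ≤ ∫ z in y..x, derivSq u z :=
    intervalIntegral.integral_nonneg hxy fun z _ => derivSq_nonneg u z
  exact mul_le_mul (by linarith [hy.1, hx.2]) h1 h2 (by linarith)

/-- The embedding of `H¹` into the space of continuous functions. -/
lemma IsH1Rep.abs_le (hℓ : 0 < ℓ) (hu : IsH1Rep u c) {x : ℝ} (hx : x ∈ Icc 0 ℓ) :
    |c x| ≤ √(2 / ℓ + 2 * ℓ) * ‖u‖ := by
  -- Compare the value at `x` with the value at a variable `y`; integration over `y` yields the full
  -- norm.
  have h1 : ∀ᵐ y ∂(pipeMeasure ℓ), c x ^ 2 ≤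
      2 * (toL2 u y) ^ 2 + 2 * (ℓ * ∫ z, derivSq u z ∂(pipeMeasure ℓ)) := by
    filter_upwards [hu.2, ae_restrict_mem measurableSet_Ioo] with y hy hym
    rw [hy]
    have := hu.sq_sub_le hℓ.le subset_rfl hx (Ioo_subset_Icc_self hym)
    rw [intervalIntegral_eq_pipe hℓ, sub_zero] at this
    nlinarith [sq_nonneg (c x - c y - c y)]
  have hL2 : Integrable (fun y => (toL2 u y) ^ 2) (pipeMeasure ℓ) := (Lp.memLp _).integrable_sq
  have h2 := integral_mono_ae (integrable_const _) ((hL2.const_mul 2).add (integrable_const _)) h1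
  simp only [Pi.add_apply] at h2
  rw [integral_add (hL2.const_mul 2) (integrable_const _), integral_const_mul, integral_L2_sq] at h2
  simp only [integral_const, MeasurableSet.univ, measureReal_restrict_apply, univ_inter,
    Real.volume_real_Ioo_of_le hℓ.le, sub_zero, smul_eq_mul] at h2
  have h3 := integral_derivSq_le u
  have h4 : ‖toL2 u‖ ^ 2 ≤ ‖u‖ ^ 2 := by
    rw [H1.norm_sq]
    have := sq_nonneg ‖(u : WithLp 2 (L2 ℓ × L2 ℓ)).snd‖
    linarith
  have h5 : c x ^ 2 ≤ (2 / ℓ + 2 * ℓ) * ‖u‖ ^ 2 := by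
    have h6 : ℓ * c x ^ 2 ≤ ℓ * ((2 / ℓ + 2 * ℓ) * ‖u‖ ^ 2) := by
      have e : ℓ * ((2 / ℓ + 2 * ℓ) * ‖u‖ ^ 2) = 2 * ‖u‖ ^ 2 + 2 * (ℓ * ℓ) * ‖u‖ ^ 2 := by
        field_simp
      have h7 := mul_le_mul_of_nonneg_left h3 (by positivity : 0 ≤ 2 * (ℓ * ℓ))
      rw [e]
      nlinarith
    exact le_of_mul_le_mul_left h6 hℓ
  refine abs_le_of_sq_le_sq ?_ (by positivity)
  rw [mul_pow, Real.sq_sqrt (by positivity)]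
  exact h5

end H1


/-! ## Snapshots of a classical solution -/

section Oscillation

variable {ℓ t : ℝ} {M : ℕ}

/-- The sum of the squared spatial derivatives of two states and of their difference quotients. -/
noncomputable def pairGradient (t : ℝ) (R W R' W' : H1 ℓ) (x : ℝ) : ℝ :=
  derivSq R x + derivSq W x + derivSq R' x + derivSq W' x
    + derivSq (t⁻¹ • (R - R')) x + derivSq (t⁻¹ • (W - W')) x

/-- A bound for the oscillations on one cell. -/
noncomputable def cellOscillation (M : ℕ) (t : ℝ) (R W R' W' : H1 ℓ) (i : ℕ) : ℝ :=
  √(ℓ / M * ∫ x in node ℓ M i..node ℓ M (i + 1), pairGradient t R W R' W' x)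

lemma pairGradient_nonneg (R W R' W' : H1 ℓ) (x : ℝ) : 0 ≤ pairGradient t R W R' W' x := by
  have := derivSq_nonneg R x
  have := derivSq_nonneg W x
  have := derivSq_nonneg R' x
  have := derivSq_nonneg W' x
  have := derivSq_nonneg (t⁻¹ • (R - R')) x
  have := derivSq_nonneg (t⁻¹ • (W - W')) x
  unfold pairGradient; positivity

lemma integrable_pairGradient (R W R' W' : H1 ℓ) :
    Integrable (pairGradient t R W R' W') (pipeMeasure ℓ) :=
  (((((integrable_derivSq R).add (integrable_derivSq W)).add (integrable_derivSq R')).add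
    (integrable_derivSq W')).add (integrable_derivSq _)).add (integrable_derivSq _)

lemma integral_pairGradient_le {C : ℝ} (ht : 0 < t) {R W R' W' : H1 ℓ} (hR : ‖R‖ ≤ C)
    (hW : ‖W‖ ≤ C) (hR' : ‖R'‖ ≤ C) (hW' : ‖W'‖ ≤ C) (hRR : ‖R - R'‖ ≤ C * t)
    (hWW : ‖W - W'‖ ≤ C * t) :
    ∫ x, pairGradient t R W R' W' x ∂(pipeMeasure ℓ) ≤ 6 * C ^ 2 := by
  have key : ∀ u : H1 ℓ, ‖u‖ ≤ C → ∫ x, derivSq u x ∂(pipeMeasure ℓ) ≤ C ^ 2 := fun u hu =>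
    (integral_derivSq_le u).trans (by gcongr)
  have hq : ∀ u : H1 ℓ, ‖u‖ ≤ C * t → ‖t⁻¹ • u‖ ≤ C := by
    intro u hu
    rw [norm_smul, norm_inv, Real.norm_of_nonneg ht.le, inv_mul_le_iff₀ ht]
    linarith
  have i1 := integrable_derivSq R
  have i2 := i1.add (integrable_derivSq W)
  have i3 := i2.add (integrable_derivSq R')
  have i4 := i3.add (integrable_derivSq W')
  have i5 := i4.add (integrable_derivSq (t⁻¹ • (R - R')))
  have e : ∫ x, pairGradient t R W R' W' x ∂(pipeMeasure ℓ) =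
      ∫ x, derivSq R x ∂(pipeMeasure ℓ) + ∫ x, derivSq W x ∂(pipeMeasure ℓ)
      + ∫ x, derivSq R' x ∂(pipeMeasure ℓ) + ∫ x, derivSq W' x ∂(pipeMeasure ℓ)
      + ∫ x, derivSq (t⁻¹ • (R - R')) x ∂(pipeMeasure ℓ)
      + ∫ x, derivSq (t⁻¹ • (W - W')) x ∂(pipeMeasure ℓ) := by
    rw [← integral_add' i1 (integrable_derivSq W), ← integral_add' i2 (integrable_derivSq R'),
      ← integral_add' i3 (integrable_derivSq W'), ← integral_add' i4 (integrable_derivSq _),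
      ← integral_add' i5 (integrable_derivSq _)]
    rfl
  rw [e]
  linarith [key R hR, key W hW, key R' hR', key W' hW', key _ (hq _ hRR), key _ (hq _ hWW)]

lemma cellOscillation_nonneg (R W R' W' : H1 ℓ) (i : ℕ) : 0 ≤ cellOscillation M t R W R' W' i :=
  Real.sqrt_nonneg _

lemma cellOscillation_sq (hℓ : 0 < ℓ) (R W R' W' : H1 ℓ) (i : ℕ) :
    cellOscillation M t R W R' W' i ^ 2 =
      ℓ / M * ∫ x in node ℓ M i..node ℓ M (i + 1), pairGradient t R W R' W' x :=
  Real.sq_sqrt (mul_nonneg (by positivity)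
    (intervalIntegral.integral_nonneg (node_mono hℓ (Nat.le_succ i))
      fun x _ => pairGradient_nonneg R W R' W' x))

lemma intervalIntegrable_cell (hℓ : 0 < ℓ) (hM : 0 < M) {ψ : ℝ → ℝ}
    (hψ : Integrable ψ (pipeMeasure ℓ)) (i : Fin M) :
    IntervalIntegrable ψ volume (node ℓ M i) (node ℓ M (i + 1)) := by
  rw [intervalIntegrable_iff_integrableOn_Ioo_of_le (node_lt_succ hℓ hM i).le]
  exact IntegrableOn.mono_set hψ (cell_subset hℓ hM i)

lemma cellOscillation_sq_le (hℓ : 0 < ℓ) (hM : 0 < M) {C : ℝ} {R W R' W' : H1 ℓ}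
    (h : ∫ x, pairGradient t R W R' W' x ∂(pipeMeasure ℓ) ≤ C) (i : Fin M) :
    cellOscillation M t R W R' W' i ^ 2 ≤ C * (ℓ / M) := by
  have hh := meshSize_pos hℓ hM
  rw [cellOscillation_sq hℓ, mul_comm C]
  refine mul_le_mul_of_nonneg_left (le_trans ?_ h) hh.le
  rw [← setIntegral_cell hℓ hM (integrable_pairGradient R W R' W')]
  exact Finset.single_le_sum
    (f := fun i : Fin M => ∫ x in node ℓ M i..node ℓ M (i + 1), pairGradient t R W R' W' x)
    (fun i _ => intervalIntegral.integral_nonneg (node_mono hℓ (Nat.le_succ i))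
      fun x _ => pairGradient_nonneg R W R' W' x) (Finset.mem_univ i)

lemma sum_cellOscillation_sq_le (hℓ : 0 < ℓ) (hM : 0 < M) {C : ℝ} {R W R' W' : H1 ℓ}
    (h : ∫ x, pairGradient t R W R' W' x ∂(pipeMeasure ℓ) ≤ C) :
    ℓ / M * ∑ i : Fin M, cellOscillation M t R W R' W' i ^ 2 ≤ C * (ℓ / M) ^ 2 := by
  have hh := meshSize_pos hℓ hM
  simp only [cellOscillation_sq hℓ]
  rw [← Finset.mul_sum, setIntegral_cell hℓ hM (integrable_pairGradient R W R' W')]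
  have := mul_le_mul_of_nonneg_left h (sq_nonneg (ℓ / (M : ℝ)))
  linarith

/-- One cell quantity dominates the oscillations of both states at both levels and of their
difference quotients, because `pairGradient` is the sum of all six squared derivatives. -/
lemma IsH1Rep.osc_le (hℓ : 0 < ℓ) (hM : 0 < M) {R W R' W' u : H1 ℓ} {c : ℝ → ℝ}
    (hu : IsH1Rep u c) (h : ∀ x, derivSq u x ≤ pairGradient t R W R' W' x) (i : Fin M) {x y : ℝ}
    (hx : x ∈ Icc (node ℓ M i) (node ℓ M (i + 1))) (hy : y ∈ Icc (node ℓ M i) (node ℓ M (i + 1))) :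
    |c x - c y| ≤ cellOscillation M t R W R' W' i := by
  have hlt := node_lt_succ hℓ hM (i : ℕ)
  refine abs_le_of_sq_le_sq ?_ (cellOscillation_nonneg _ _ _ _ _)
  rw [cellOscillation_sq hℓ]
  refine (hu.sq_sub_le hlt.le (Icc_node_subset hℓ hM i) hx hy).trans ?_
  have e : node ℓ M (i + 1) - node ℓ M i = ℓ / M := by rw [node_succ]; ring
  rw [e]
  refine mul_le_mul_of_nonneg_left ?_ (meshSize_pos hℓ hM).le
  exact intervalIntegral.integral_mono_on hlt.le
    (intervalIntegrable_cell hℓ hM (integrable_derivSq u) i)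
    (intervalIntegrable_cell hℓ hM (integrable_pairGradient R W R' W') i) fun z _ => h z

/-- Two states in `H¹`, together with their difference quotients, form a pair of snapshots on every
cell. -/
lemma cellPair_of_isH1Rep (hℓ : 0 < ℓ) (hM : 0 < M) (ht : 0 < t) {ρmin ρmax wmax C K : ℝ}
    (hK : √(2 / ℓ + 2 * ℓ) * C ≤ K) {R W R' W' : H1 ℓ} {ρ w ρ' w' : ℝ → ℝ}
    (hR : IsH1Rep R ρ) (hW : IsH1Rep W w) (hR' : IsH1Rep R' ρ') (hW' : IsH1Rep W' w')
    (hb : ∀ x ∈ Icc 0 ℓ, ρ x ∈ Icc ρmin ρmax ∧ |w x| ≤ wmax)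
    (hb' : ∀ x ∈ Icc 0 ℓ, ρ' x ∈ Icc ρmin ρmax ∧ |w' x| ≤ wmax)
    (hRR : ‖R - R'‖ ≤ C * t) (hWW : ‖W - W'‖ ≤ C * t) (i : Fin M) :
    CellPair ρmin ρmax wmax K t (cellOscillation M t R W R' W' i) (node ℓ M i)
      (node ℓ M (i + 1)) ρ w ρ' w' := by
  have hI := Icc_node_subset hℓ hM i
  have time : ∀ {u u' : H1 ℓ} {c c' : ℝ → ℝ}, IsH1Rep u c → IsH1Rep u' c' → ‖u - u'‖ ≤ C * t →
      ∀ x ∈ Icc (node ℓ M i) (node ℓ M (i + 1)), |c x - c' x| ≤ K * t := by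
    intro u u' c c' hu hu' hn x hx
    refine ((hu.sub hu').abs_le hℓ (hI hx)).trans ?_
    calc √(2 / ℓ + 2 * ℓ) * ‖u - u'‖ ≤ √(2 / ℓ + 2 * ℓ) * (C * t) := by gcongr
      _ = √(2 / ℓ + 2 * ℓ) * C * t := by ring
      _ ≤ K * t := by gcongr
  have n1 := derivSq_nonneg R
  have n2 := derivSq_nonneg W
  have n3 := derivSq_nonneg R'
  have n4 := derivSq_nonneg W'
  have n5 := derivSq_nonneg (t⁻¹ • (R - R'))
  have n6 := derivSq_nonneg (t⁻¹ • (W - W'))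
  have mixed : ∀ {u u' : H1 ℓ} {c c' : ℝ → ℝ}, IsH1Rep u c → IsH1Rep u' c' →
      (∀ x, derivSq (t⁻¹ • (u - u')) x ≤ pairGradient t R W R' W' x) →
      ∀ x ∈ Icc (node ℓ M i) (node ℓ M (i + 1)), ∀ y ∈ Icc (node ℓ M i) (node ℓ M (i + 1)),
      |(c x - c' x) - (c y - c' y)| ≤ t * cellOscillation M t R W R' W' i := by
    intro u u' c c' hu hu' hd x hx y hy
    have := ((hu.sub hu').smul t⁻¹).osc_le hℓ hM hd i hx hy
    rw [← mul_sub, abs_mul, abs_inv, abs_of_pos ht, inv_mul_le_iff₀ ht] at this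
    exact this
  exact {
    cont_density := hR.1.mono hI
    cont_density' := hR'.1.mono hI
    density := fun x hx => (hb x (hI hx)).1
    density' := fun x hx => (hb' x (hI hx)).1
    velocity := fun x hx => (hb x (hI hx)).2
    velocity' := fun x hx => (hb' x (hI hx)).2
    density_time := time hR hR' hRR
    velocity_time := time hW hW' hWW
    density_osc := fun x hx y hy => hR.osc_le hℓ hM
      (fun z => by unfold pairGradient; linarith [n1 z, n2 z, n3 z, n4 z, n5 z, n6 z]) i hx hy
    density_osc' := fun x hx y hy => hR'.osc_le hℓ hM
      (fun z => by unfold pairGradient; linarith [n1 z, n2 z, n3 z, n4 z, n5 z, n6 z]) i hx hy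
    velocity_osc := fun x hx y hy => hW.osc_le hℓ hM
      (fun z => by unfold pairGradient; linarith [n1 z, n2 z, n3 z, n4 z, n5 z, n6 z]) i hx hy
    velocity_osc' := fun x hx y hy => hW'.osc_le hℓ hM
      (fun z => by unfold pairGradient; linarith [n1 z, n2 z, n3 z, n4 z, n5 z, n6 z]) i hx hy
    density_mixed := mixed hR hR'
      (fun z => by unfold pairGradient; linarith [n1 z, n2 z, n3 z, n4 z, n5 z, n6 z])
    velocity_mixed := mixed hW hW'
      (fun z => by unfold pairGradient; linarith [n1 z, n2 z, n3 z, n4 z, n5 z, n6 z]) }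

end Oscillation

/-- The error of the backward difference quotient in the norm of `L²`. -/
lemma integral_diffQuotient_sub_sq_le {ℓ T C t τ : ℝ} (hT : 0 < T) (hC : 0 ≤ C) (ht : 0 < t)
    {U : ℝ → H1 ℓ} (hU : ContDiffOn ℝ 1 (fun τ => toL2 (U τ)) (Icc 0 T))
    (hB : BoundedInWkInfty 2 T C fun τ => toL2 (U τ)) {c c' : ℝ → ℝ} (h : IsH1Rep (U (τ + t)) c)
    (h' : IsH1Rep (U τ) c') (h1 : τ ∈ Icc 0 T) (h2 : τ + t ∈ Icc 0 T) :
    ∫ x, ((c x - c' x) / t - derivWithin (fun s => toL2 (U s)) (Icc 0 T) (τ + t) x) ^ 2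
      ∂(pipeMeasure ℓ) ≤ C ^ 2 * t ^ 2 := by
  set D := derivWithin (fun s => toL2 (U s)) (Icc 0 T) (τ + t) with hD
  have htay := hB.norm_taylor_le hT hU h1 h2 (by linarith) hC
  rw [← hD, add_sub_cancel_left] at htay
  have hn : ‖t⁻¹ • (toL2 (U (τ + t)) - toL2 (U τ) - t • D)‖ ≤ C * t := by
    rw [norm_smul, norm_inv, Real.norm_of_nonneg ht.le, inv_mul_le_iff₀ ht]
    linarith
  have e : ∫ x, ((c x - c' x) / t - D x) ^ 2 ∂(pipeMeasure ℓ) =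
      ‖t⁻¹ • (toL2 (U (τ + t)) - toL2 (U τ) - t • D)‖ ^ 2 := by
    rw [← integral_L2_sq]
    refine integral_congr_ae ?_
    filter_upwards [h.2, h'.2, Lp.coeFn_smul t⁻¹ (toL2 (U (τ + t)) - toL2 (U τ) - t • D),
      Lp.coeFn_sub (toL2 (U (τ + t)) - toL2 (U τ)) (t • D),
      Lp.coeFn_sub (toL2 (U (τ + t))) (toL2 (U τ)), Lp.coeFn_smul t D] with x a1 a2 a3 a4 a5 a6
    rw [a3, Pi.smul_apply, a4, Pi.sub_apply, a5, Pi.sub_apply, a6, Pi.smul_apply, a1, a2]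
    simp only [smul_eq_mul]
    field_simp
  rw [e, ← mul_pow]
  gcongr

section Solution

variable {P : ℝ → ℝ} {ε γ a ℓ T ρmin ρmax wmax C K : ℝ} {hL hR : ℝ → ℝ} {ρ w : ℝ → ℝ → ℝ}
  {R W : ℝ → H1 ℓ}

lemma pointwise_bounds {u : H1 ℓ} {v : H1 ℓ} {r s : ℝ → ℝ} (hℓ : 0 < ℓ) (hu : IsH1Rep u r)
    (hv : IsH1Rep v s)
    (h : ∀ᵐ x ∂(pipeMeasure ℓ), ρmin ≤ r x ∧ r x ≤ ρmax ∧ -wmax ≤ s x ∧ s x ≤ wmax) {x : ℝ}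
    (hx : x ∈ Icc 0 ℓ) : r x ∈ Icc ρmin ρmax ∧ |s x| ≤ wmax := by
  refine ⟨⟨?_, ?_⟩, abs_le.2 ⟨?_, ?_⟩⟩
  · have := le_of_ae_le_Icc hℓ hu.1.neg (C := -ρmin)
      (by filter_upwards [h] with x hx; simpa using hx.1) hx
    simpa using this
  · exact le_of_ae_le_Icc hℓ hu.1 (by filter_upwards [h] with x hx using hx.2.1) hx
  · have := le_of_ae_le_Icc hℓ hv.1.neg (C := wmax)
      (by filter_upwards [h] with x hx; simp only [Pi.neg_apply]; linarith [hx.2.2.1]) hx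
    simp only [Pi.neg_apply] at this
    linarith
  · exact le_of_ae_le_Icc hℓ hv.1 (by filter_upwards [h] with x hx using hx.2.2.2) hx

/-- The `H¹` Lipschitz bound in time gives the mixed space-time oscillations, and the second time
derivative in `L²` gives the consistency of the difference quotients. Mass and momentum balances are
used in integrated form, which follows from the continuity of flux and enthalpy. -/
theorem IsClassicalSolution.snapshots (hs : IsClassicalSolution P ε γ a ℓ T hL hR ρ w R W)
    (hℓ : 0 < ℓ) (hT : 0 < T) (hP : ContinuousOn (deriv P) (Icc ρmin ρmax))
    (hb : ∀ τ ∈ Icc 0 T, ∀ᵐ x ∂(pipeMeasure ℓ),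
      ρmin ≤ ρ τ x ∧ ρ τ x ≤ ρmax ∧ -wmax ≤ w τ x ∧ w τ x ≤ wmax)
    (hC : 0 ≤ C) (hR2 : BoundedInWkInfty 2 T C fun τ => toL2 (R τ)) (hR1 : BoundedInWkInfty 1 T C R)
    (hW2 : BoundedInWkInfty 2 T C fun τ => toL2 (W τ)) (hW1 : BoundedInWkInfty 1 T C W)
    (hK : √(2 / ℓ + 2 * ℓ) * C ≤ K) (hK6 : 6 * C ^ 2 ≤ K) {M N : ℕ} (hM : 0 < M) (hN : 0 < N) :
    ∃ (ρt wt : ℕ → ℝ → ℝ) (σ : ℕ → Fin M → ℝ), Snapshots P ρmin ρmax wmax K ε γ a ℓ (T / N) M N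
      (fun k => hL (k * (T / N))) (fun k => hR (k * (T / N))) (fun n => ρ (n * (T / N)))
      (fun n => w (n * (T / N))) ρt wt σ := by
  set t := T / N with ht_def
  have ht : 0 < t := by positivity
  have hmem : ∀ n ≤ N, (n : ℝ) * t ∈ Icc 0 T := by
    intro n hn
    refine ⟨by positivity, ?_⟩
    have h1 : (n : ℝ) ≤ N := by exact_mod_cast hn
    calc (n : ℝ) * t ≤ N * t := by gcongr
      _ = T := by rw [ht_def]; field_simp
  have hpos : ∀ n < N, ((n + 1 : ℕ) : ℝ) * t ∈ Ioc 0 T := fun n hn =>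
    ⟨by positivity, (hmem (n + 1) hn).2⟩
  have hsucc : ∀ n : ℕ, ((n + 1 : ℕ) : ℝ) * t = n * t + t := fun n => by push_cast; ring
  have hpt : ∀ n ≤ N, ∀ x ∈ Icc 0 ℓ, ρ (n * t) x ∈ Icc ρmin ρmax ∧ |w (n * t) x| ≤ wmax :=
    fun n hn x hx => pointwise_bounds hℓ (hs.rep_density _ (hmem n hn))
      (hs.rep_velocity _ (hmem n hn)) (hb _ (hmem n hn)) hx
  have hRn : ∀ n ≤ N, ‖R (n * t)‖ ≤ C := fun n hn =>
    hR1.norm_le hT hs.continuous_density (hmem n hn)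
  have hWn : ∀ n ≤ N, ‖W (n * t)‖ ≤ C := fun n hn =>
    hW1.norm_le hT hs.continuous_velocity (hmem n hn)
  have hRd : ∀ n < N, ‖R ((n + 1 : ℕ) * t) - R (n * t)‖ ≤ C * t := by
    intro n hn
    have := hR1.norm_sub_le hs.continuous_density (hmem n hn.le) (hmem (n + 1) hn)
    rwa [hsucc, add_sub_cancel_left, abs_of_pos ht, ← hsucc] at this
  have hWd : ∀ n < N, ‖W ((n + 1 : ℕ) * t) - W (n * t)‖ ≤ C * t := by
    intro n hn
    have := hW1.norm_sub_le hs.continuous_velocity (hmem n hn.le) (hmem (n + 1) hn)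
    rwa [hsucc, add_sub_cancel_left, abs_of_pos ht, ← hsucc] at this
  -- For `n = 0` truncated subtraction pairs the initial state with itself; the difference quotients
  -- vanish and the bound persists.
  have hgrad : ∀ n ≤ N, ∫ x, pairGradient t (R (n * t)) (W (n * t)) (R ((n - 1 : ℕ) * t))
      (W ((n - 1 : ℕ) * t)) x ∂(pipeMeasure ℓ) ≤ K := by
    intro n hn
    refine le_trans ?_ hK6
    have hn' : n - 1 ≤ N := (Nat.sub_le n 1).trans hn
    refine integral_pairGradient_le ht (hRn n hn) (hWn n hn) (hRn _ hn') (hWn _ hn') ?_ ?_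
    · rcases n with _ | n
      · simp; positivity
      · exact hRd n hn
    · rcases n with _ | n
      · simp; positivity
      · exact hWd n hn
  have hvc : ∀ n ≤ N, ContinuousOn (w (n * t)) (Icc 0 ℓ) := fun n hn =>
    (hs.rep_velocity _ (hmem n hn)).1
  have hdc : ∀ n ≤ N, ContinuousOn (ρ (n * t)) (Icc 0 ℓ) := fun n hn =>
    (hs.rep_density _ (hmem n hn)).1
  refine ⟨fun n x => derivWithin (fun s => toL2 (R s)) (Icc 0 T) (n * t) x,
    fun n x => derivWithin (fun s => toL2 (W s)) (Icc 0 T) (n * t) x,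
    fun n i => cellOscillation M t (R (n * t)) (W (n * t)) (R ((n - 1 : ℕ) * t))
      (W ((n - 1 : ℕ) * t)) i, ?_⟩
  constructor
  case init =>
    intro i
    have h0 := hmem 0 (Nat.zero_le _)
    exact cellPair_of_isH1Rep hℓ hM ht hK (hs.rep_density _ h0) (hs.rep_velocity _ h0)
      (hs.rep_density _ h0) (hs.rep_velocity _ h0) (hpt 0 (Nat.zero_le _)) (hpt 0 (Nat.zero_le _))
      (by rw [sub_self, norm_zero]; positivity) (by rw [sub_self, norm_zero]; positivity) i
  case pair =>
    intro n hn i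
    have h0 := hmem n hn.le
    have h1 := hmem (n + 1) hn
    exact cellPair_of_isH1Rep hℓ hM ht hK (hs.rep_density _ h1) (hs.rep_velocity _ h1)
      (hs.rep_density _ h0) (hs.rep_velocity _ h0) (hpt (n + 1) hn) (hpt n hn.le)
      (hRd n hn) (hWd n hn) i
  case cont_density => exact hdc
  case cont_velocity => exact hvc
  case density => exact fun n hn x hx => (hpt n hn x hx).1
  case sigma_nonneg => exact fun n _ i => cellOscillation_nonneg _ _ _ _ _
  case sigma_sq => exact fun n hn => sum_cellOscillation_sq_le hℓ hM (hgrad n hn)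
  case sigma_small => exact fun n hn i => cellOscillation_sq_le hℓ hM (hgrad n hn) i
  case density_memLp => exact fun n _ => Lp.memLp _
  case velocity_memLp => exact fun n _ => Lp.memLp _
  case density_deriv =>
    intro n hn
    have h0 := hmem n hn.le
    have h1 := hmem (n + 1) hn
    have r0 := hs.rep_density _ h0
    have r1 := hs.rep_density _ h1
    simp only [hsucc] at h1 r1 ⊢
    refine (integral_diffQuotient_sub_sq_le hT hC ht hs.contDiff_density hR2 r1 r0 h0 h1).trans ?_
    gcongr
    nlinarith [sq_nonneg C]
  case velocity_deriv =>
    intro n hn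
    have h0 := hmem n hn.le
    have h1 := hmem (n + 1) hn
    have r0 := hs.rep_velocity _ h0
    have r1 := hs.rep_velocity _ h1
    simp only [hsucc] at h1 r1 ⊢
    refine (integral_diffQuotient_sub_sq_le hT hC ht hs.contDiff_velocity hW2 r1 r0 h0 h1).trans ?_
    gcongr
    nlinarith [sq_nonneg C]
  case mass =>
    intro n hn x hx y hy
    obtain ⟨mx, h1, h2⟩ := hs.mass _ (hpos n hn)
    have h3 := h1.congr (Filter.Eventually.of_forall fun _ => rfl)
      (v₂ := fun z => -(a * derivWithin (fun s => toL2 (R s)) (Icc 0 T) ((n + 1 : ℕ) * t) z))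
      (by filter_upwards [h2] with z hz; linarith)
    refine h3.sub_eq_integral ?_ ?_ hx hy
    · exact (((Lp.memLp _).integrable (by norm_num)).const_mul a).neg
    · exact (continuousOn_const.mul (hdc (n + 1) hn)).mul (hvc (n + 1) hn)
  case momentum =>
    intro n hn x hx
    obtain ⟨hx', h1, h2⟩ := hs.momentum _ (hpos n hn)
    have h3 := h1.congr (Filter.Eventually.of_forall fun _ => rfl)
      (v₂ := fun z => -(ε ^ 2 * derivWithin (fun s => toL2 (W s)) (Icc 0 T) ((n + 1 : ℕ) * t) z
        + γ * (|w ((n + 1 : ℕ) * t) z| * w ((n + 1 : ℕ) * t) z)))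
      (by filter_upwards [h2] with z hz; linarith)
    refine h3.sub_eq_integral ?_ ?_ (left_mem_Icc.2 hℓ.le) hx
    · have hv := EssBdd.of_continuousOn (hvc (n + 1) hn)
      exact ((((Lp.memLp _).integrable (by norm_num)).const_mul _).add
        ((hv.abs.mul hv).const_mul γ).integrable).neg
    · have hm : MapsTo (ρ ((n + 1 : ℕ) * t)) (Icc 0 ℓ) (Icc ρmin ρmax) := fun z hz =>
        (hpt (n + 1) hn z hz).1
      unfold enthalpy
      exact ((continuousOn_const.mul ((hvc (n + 1) hn).pow 2)).div_const 2).add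
        (hP.comp (hdc (n + 1) hn) hm)
  case left => exact fun n hn => hs.boundary_left _ (hpos n hn)
  case right => exact fun n hn => hs.boundary_right _ (hpos n hn)

end Solution


/-! ## Discrete solutions -/

section Discrete

variable {P : ℝ → ℝ} {α β κ L εmax wmax γmin B ε γ a ℓ T ρmin ρmax : ℝ} {hL hR ρ0 m0 : ℝ → ℝ}
  {M N : ℕ}

lemma integral_mul_p0 (hℓ : 0 < ℓ) (hM : 0 < M) {c : ℝ → ℝ} (hc : ContinuousOn c (Icc 0 ℓ))
    (q : Fin M → ℝ) :
    ∫ x, c x * p0 ℓ q x ∂(pipeMeasure ℓ) = ℓ / M * ∑ i, cellMeans ℓ M c i * q i := by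
  have hh := meshSize_pos hℓ hM
  have hi : Integrable (fun x => c x * p0 ℓ q x) (pipeMeasure ℓ) :=
    ((EssBdd.of_continuousOn hc).mul (EssBdd.p0 q)).integrable
  rw [← setIntegral_cell hℓ hM hi, Finset.mul_sum]
  refine Finset.sum_congr rfl fun i _ => ?_
  have hlt := (node_lt_succ hℓ hM (i : ℕ)).le
  have e1 : ∫ x in node ℓ M i..node ℓ M (i + 1), c x * p0 ℓ q x =
      ∫ x in node ℓ M i..node ℓ M (i + 1), c x * q i := by
    rw [intervalIntegral.integral_of_le hlt, intervalIntegral.integral_of_le hlt,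
      integral_Ioc_eq_integral_Ioo, integral_Ioc_eq_integral_Ioo]
    refine setIntegral_congr_fun measurableSet_Ioo fun x hx => ?_
    rw [p0_eq hℓ q hx]
  have e2 : node ℓ M (i + 1) - node ℓ M i = ℓ / M := by rw [node_succ]; ring
  rw [e1, intervalIntegral.integral_mul_const, cellMeans, intervalMean, e2]
  field_simp

/-- Testing with indicators of cells identifies the orthogonal projection with the vector of cell
means. -/
lemma init_density_iff (hℓ : 0 < ℓ) (hM : 0 < M) {c : ℝ → ℝ} (hc : ContinuousOn c (Icc 0 ℓ))
    (r : Fin M → ℝ) :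
    (∀ q : Fin M → ℝ, ∫ x in (0 : ℝ)..ℓ, p0 ℓ r x * p0 ℓ q x = ∫ x in (0 : ℝ)..ℓ, c x * p0 ℓ q x) ↔
      r = cellMeans ℓ M c := by
  have hh := meshSize_pos hℓ hM
  have e : ∀ q : Fin M → ℝ, ∫ x, p0 ℓ r x * p0 ℓ q x ∂(pipeMeasure ℓ) =
      ℓ / M * ∑ i, r i * q i := by
    intro q
    rw [← integral_p0 hℓ hM]
    refine integral_congr_ae ?_
    filter_upwards [ae_mem_cell hℓ hM] with x ⟨i, hi⟩
    rw [p0_eq hℓ _ hi, p0_eq hℓ _ hi, p0_eq hℓ _ hi]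
  simp only [intervalIntegral_eq_pipe hℓ, integral_mul_p0 hℓ hM hc, e]
  constructor
  · intro h
    funext i
    have := h (Pi.single i 1)
    simpa [Pi.single_apply, hh.ne'] using this
  · rintro rfl q; rfl

lemma admState_iff (hℓ : 0 < ℓ) (hM : 0 < M) {V : ℝ} (q : Fin M → ℝ)
    (r : Fin (M + 1) → ℝ) (hV : V = 3 * wmax / 2) :
    IsAdmissibleState ℓ ρmin ρmax wmax (p0 ℓ q) (discreteVelocity a ℓ q r) ↔
      AdmState a ℓ (2 * ρmin / 3) (3 * ρmax / 2) V q r := by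
  constructor
  · intro h
    refine ⟨fun i => ?_, ?_⟩
    · have h1 : ∀ᵐ x ∂(volume.restrict (cell ℓ M i)), q i ∈ Icc (2 * ρmin / 3) (3 * ρmax / 2) := by
        have h2 := ae_mono (Measure.restrict_mono (cell_subset hℓ hM i) le_rfl) h
        filter_upwards [h2, ae_restrict_mem measurableSet_Ioo] with x hx hxm
        rw [p0_eq hℓ q hxm] at hx
        exact ⟨hx.1, hx.2.1⟩
      have hne : (ae (volume.restrict (cell ℓ M i))).NeBot := by
        rw [ae_neBot, Measure.restrict_eq_zero.ne, cell, Real.volume_Ioo]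
        have := node_lt_succ hℓ hM (i : ℕ)
        simpa using this
      exact h1.exists.choose_spec
    · filter_upwards [h] with x hx
      rw [hV]
      exact abs_le.2 ⟨by linarith [hx.2.2.1], hx.2.2.2⟩
  · intro h
    filter_upwards [ae_mem_cell hℓ hM, h.2] with x ⟨i, hi⟩ hx
    rw [p0_eq hℓ q hi]
    rw [hV] at hx
    have := abs_le.1 hx
    exact ⟨(h.1 i).1, (h.1 i).2, by linarith [this.1], this.2⟩

/-- Discrete solutions in terms of the residuals. -/
lemma isDiscreteSolution_iff (hℓ : 0 < ℓ) (hM : 0 < M) (ha : 0 < a) (ht : 0 < T / N)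
    (hρ0 : ContinuousOn ρ0 (Icc 0 ℓ)) (ρh : Fin (N + 1) → Fin M → ℝ)
    (mh : Fin (N + 1) → Fin (M + 1) → ℝ) :
    IsDiscreteSolution P ε γ a ℓ T hL hR ρ0 m0 M N ρh mh ↔
      ρh 0 = cellMeans ℓ M ρ0 ∧ (mh 0 = fun i : Fin (M + 1) => m0 (node ℓ M i)) ∧
      ∀ n : Fin N, ρh n.succ = massUpdate a ℓ (T / N) (ρh n.castSucc) (mh n.succ) ∧
        ∀ s, momRes P ε γ a ℓ (T / N) (hL ((((n : ℕ) : ℝ) + 1) * (T / N)))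
          (hR ((((n : ℕ) : ℝ) + 1) * (T / N))) (ρh n.castSucc) (mh n.castSucc) (ρh n.succ)
          (mh n.succ) s = 0 := by
  constructor
  · intro h
    exact ⟨(init_density_iff hℓ hM hρ0 _).1 h.init_density, funext h.init_flux, fun n =>
      ⟨(massRes_eq_zero_iff hℓ hM ha ht _ _ _).1 (h.mass n), h.momentum n⟩⟩
  · rintro ⟨h1, h2, h3⟩
    exact ⟨(init_density_iff hℓ hM hρ0 _).2 h1, fun i => congrFun h2 i, fun n =>
      (massRes_eq_zero_iff hℓ hM ha ht _ _ _).2 (h3 n).1, fun n => (h3 n).2⟩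

/-- Uniqueness of admissible discrete solutions. -/
theorem FlowBounds.discrete_unique
    (hF : FlowBounds P (2 * ρmin / 3) (3 * ρmax / 2) κ L εmax wmax γmin B)
    (hPR : ParamRange εmax γmin B ε γ a) (hℓ : 0 < ℓ) (hM : 0 < M) (ht : 0 < T / N)
    (hts : T / N * (B * (2 * B ^ 3 / (2 * ρmin / 3))) ≤ 7 / 32 * (κ / (3 * ρmax / 2)))
    (hρ0 : ContinuousOn ρ0 (Icc 0 ℓ)) {ρh ρh' : Fin (N + 1) → Fin M → ℝ}
    {mh mh' : Fin (N + 1) → Fin (M + 1) → ℝ}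
    (h : IsDiscreteSolution P ε γ a ℓ T hL hR ρ0 m0 M N ρh mh)
    (hA : IsAdmissibleDiscrete a ℓ ρmin ρmax wmax ρh mh)
    (h' : IsDiscreteSolution P ε γ a ℓ T hL hR ρ0 m0 M N ρh' mh')
    (hA' : IsAdmissibleDiscrete a ℓ ρmin ρmax wmax ρh' mh') : ρh = ρh' ∧ mh = mh' := by
  rw [isDiscreteSolution_iff hℓ hM hPR.area_pos ht hρ0] at h h'
  obtain ⟨h1, h2, h3⟩ := h
  obtain ⟨k1, k2, k3⟩ := h'
  have key : ∀ n : Fin (N + 1), ρh n = ρh' n ∧ mh n = mh' n := by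
    intro n
    induction n using Fin.induction with
    | zero => exact ⟨h1.trans k1.symm, h2.trans k2.symm⟩
    | succ n ih =>
      obtain ⟨a1, a2⟩ := h3 n
      obtain ⟨b1, b2⟩ := k3 n
      have A1 := (admState_iff hℓ hM _ _ rfl).1 (hA n.succ)
      have A2 := (admState_iff hℓ hM _ _ rfl).1 (hA' n.succ)
      rw [ih.1, ih.2] at a2
      rw [ih.1] at a1
      rw [a1] at A1 a2
      rw [b1] at A2 b2
      -- The previous levels coincide, so both fluxes solve the same one-step problem.
      have := hF.step_unique hPR hℓ hM ht hts A1 A2 (a2 _) (b2 _)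
      exact ⟨by rw [a1, b1, this], this⟩
  exact ⟨funext fun n => (key n).1, funext fun n => (key n).2⟩

end Discrete

/-! ## Comparison with the exact solution -/

/-- The states `(r, v)` are approximated by `(cellMeans r, nodalFlux r v)` up to the cellwise
quantity `σ`. -/
structure InterpolationError (B a ℓ : ℝ) {M : ℕ} (r v : ℝ → ℝ) (σ : Fin M → ℝ) : Prop where
  density : ∀ᵐ x ∂(pipeMeasure ℓ), |r x - p0 ℓ (cellMeans ℓ M r) x| ≤ B * p0 ℓ σ x
  flux : ∀ᵐ x ∂(pipeMeasure ℓ),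
    |massFlux a (r x) (v x) - p1 ℓ (nodalFlux a ℓ M r v) x| ≤ 2 * B ^ 3 * p0 ℓ σ x
  flux_bdd : ∀ᵐ x ∂(pipeMeasure ℓ),
    |massFlux a (r x) (v x) - p1 ℓ (nodalFlux a ℓ M r v) x| ≤ 2 * B ^ 3

section Comparison

variable {P : ℝ → ℝ} {α β κ L ρmin ρmax wmax K ε εmax γmin γ a ℓ t B : ℝ} {M N : ℕ}
  {bL bR : ℕ → ℝ} {ρ w ρt wt : ℕ → ℝ → ℝ} {σ : ℕ → Fin M → ℝ}

/-- The flux error splits as `a ((ρ - R) w + R (w - W))`. -/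
lemma CellPair.interpolation (hb : SnapshotBounds P α β κ L ρmin ρmax wmax εmax K)
    (ha : 0 < a) (haK : a ≤ K) (hε : 0 ≤ εmax) (hℓ : 0 < ℓ) (hM : 0 < M) (ht : 0 ≤ t)
    (hB : velocityConst α K ≤ B)
    {s : ℝ} (hs : 0 ≤ s) {r v r' v' : ℝ → ℝ} {i : Fin M}
    (h : CellPair ρmin ρmax wmax K t s (node ℓ M i) (node ℓ M (i + 1)) r v r' v') {x : ℝ}
    (hx : x ∈ cell ℓ M i) :
    |r x - cellMeans ℓ M r i| ≤ B * s ∧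
    |massFlux a (r x) (v x) - p1 ℓ (nodalFlux a ℓ M r v) x| ≤ 2 * B ^ 3 * s := by
  have hα := hb.law.pos
  have hα1 : 3 * α / 2 ≤ ρmin := hb.min
  have hKV : K ≤ velocityConst α K := le_velocityConst hα (hb.law.le.trans hb.beta_le) hb.one_le
  have hKB : K ≤ B := hKV.trans hB
  have hK0 : 0 < K := one_pos.trans_le hb.one_le
  have hB1 : 1 ≤ B := hb.one_le.trans hKB
  have hlt := node_lt_succ hℓ hM (i : ℕ)
  obtain ⟨c1, c2, _⟩ := h.star_close hb ha le_rfl hε hℓ hM ht hs hx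
  have hpos : 0 < cellMeans ℓ M r i :=
    (by linarith : 0 < ρmin).trans_le (intervalMean_mem hlt h.cont_density h.density).1
  refine ⟨c1.space.trans (by gcongr), ?_⟩
  rw [p1_eq_mul_velocity hℓ ha _ hpos hx, massFlux]
  set W := discreteVelocity a ℓ (cellMeans ℓ M r) (nodalFlux a ℓ M r v) x
  have e : a * r x * v x - a * (cellMeans ℓ M r i * W) =
      a * ((r x - cellMeans ℓ M r i) * v x + cellMeans ℓ M r i * (v x - W)) := by ring
  rw [e, abs_mul, abs_of_pos ha]
  have h1 := abs_mul_add_mul_le c1.space (c2.abs_left.trans hB) c1.abs_right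
    (c2.space.trans (mul_le_mul_of_nonneg_right hB hs))
  calc a * _ ≤ K * (K * s * B + K * (B * s)) := by gcongr
    _ = 2 * (K * K * B) * s := by ring
    _ ≤ 2 * (B * B * B) * s := by gcongr
    _ = _ := by ring

/-- The uniform bound on the flux error, besides the one by `σ`, serves to reduce its cube to a
square, since only the squares of `σ` are summable at the right order. -/
lemma Snapshots.interpolationError
    (hS : Snapshots P ρmin ρmax wmax K ε γ a ℓ t M N bL bR ρ w ρt wt σ)
    (hb : SnapshotBounds P α β κ L ρmin ρmax wmax εmax K)
    (ha : 0 < a) (haK : a ≤ K) (hε : 0 ≤ εmax) (hℓ : 0 < ℓ) (hM : 0 < M) (ht : 0 ≤ t)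
    (hB : velocityConst α K ≤ B) {n : ℕ} (hn : n ≤ N) :
    InterpolationError B a ℓ (ρ n) (w n) (σ n) := by
  have hα := hb.law.pos
  have hα1 : 3 * α / 2 ≤ ρmin := hb.min
  have hKV : K ≤ velocityConst α K := le_velocityConst hα (hb.law.le.trans hb.beta_le) hb.one_le
  have hKB : K ≤ B := hKV.trans hB
  have hK0 : 0 < K := one_pos.trans_le hb.one_le
  have hβ : ρmax ≤ K := by
    have := hb.max
    have := hb.beta_le
    have := hb.law.le
    linarith
  have cell_bound : ∀ i : Fin M, ∀ x ∈ cell ℓ M i,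
      (|ρ n x - cellMeans ℓ M (ρ n) i| ≤ B * σ n i ∧
      |massFlux a (ρ n x) (w n x) - p1 ℓ (nodalFlux a ℓ M (ρ n) (w n)) x| ≤ 2 * B ^ 3 * σ n i) ∧
      ∀ y ∈ Icc (node ℓ M i) (node ℓ M (i + 1)), |massFlux a (ρ n y) (w n y)| ≤ B ^ 3 := by
    intro i x hx
    have fl : ∀ {r v : ℝ}, r ∈ Icc ρmin ρmax → |v| ≤ wmax → |massFlux a r v| ≤ B ^ 3 := by
      intro r v hr hv
      have h1 : |r| ≤ K := abs_le.2 ⟨by linarith [hr.1], by linarith [hr.2]⟩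
      have h2 : |v| ≤ K := hv.trans hb.wmax_le
      rw [massFlux, abs_mul, abs_mul, abs_of_pos ha]
      calc a * |r| * |v| ≤ K * K * K := by gcongr
        _ = K ^ 3 := by ring
        _ ≤ B ^ 3 := by gcongr
    have hs := hS.sigma_nonneg n hn i
    rcases n with _ | n
    · have hc := hS.init i
      exact ⟨hc.interpolation hb ha haK hε hℓ hM ht hB hs hx,
        fun y hy => fl (hc.density y hy) (hc.velocity y hy)⟩
    · have hc := hS.pair n hn i
      exact ⟨hc.interpolation hb ha haK hε hℓ hM ht hB hs hx,
        fun y hy => fl (hc.density y hy) (hc.velocity y hy)⟩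
  refine ⟨?_, ?_, ?_⟩
  · filter_upwards [ae_mem_cell hℓ hM] with x ⟨i, hi⟩
    rw [p0_eq hℓ _ hi, p0_eq hℓ _ hi]
    exact (cell_bound i x hi).1.1
  · filter_upwards [ae_mem_cell hℓ hM] with x ⟨i, hi⟩
    rw [p0_eq hℓ _ hi]
    exact (cell_bound i x hi).1.2
  · filter_upwards [ae_mem_cell hℓ hM] with x ⟨i, hi⟩
    have hxI : x ∈ Icc (node ℓ M i) (node ℓ M (i + 1)) := Ioo_subset_Icc_self hi
    have hlt := (node_lt_succ hℓ hM (i : ℕ)).le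
    have hf := (cell_bound i x hi).2
    obtain ⟨θ, hθ, hp⟩ := p1_convex hℓ hM hxI
    have h1 := abs_mul_add_mul_le (x := 1 - θ) (z := θ) (by rw [abs_of_nonneg]; linarith [hθ.2])
      (hf _ (left_mem_Icc.2 hlt)) (by rw [abs_of_nonneg hθ.1]) (hf _ (right_mem_Icc.2 hlt))
    have h2 := hf x hxI
    refine (abs_sub _ _).trans ?_
    rw [hp]
    simp only [nodalFlux, Fin.val_castSucc, Fin.val_succ]
    linarith

/-- The error with respect to the exact solution, in terms of the error with respect to the
reference state. -/
lemma InterpolationError.sq_error_le {r v : ℝ → ℝ} {σ : Fin M → ℝ}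
    (h : InterpolationError B a ℓ r v σ) (hF : FlowBounds P α β κ L εmax wmax γmin B)
    (hPR : ParamRange εmax γmin B ε γ a) (hℓ : 0 < ℓ) (hM : 0 < M)
    (hr : ContinuousOn r (Icc 0 ℓ)) (hv : ContinuousOn v (Icc 0 ℓ)) {q : Fin M → ℝ}
    {s : Fin (M + 1) → ℝ}
    (hA : AdmState a ℓ α β (3 * wmax / 2) (cellMeans ℓ M r) (nodalFlux a ℓ M r v))
    (hA' : AdmState a ℓ α β (3 * wmax / 2) q s) :
    (∫ x, (r x - p0 ℓ q x) ^ 2 ∂(pipeMeasure ℓ))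
        + ε ^ 2 * (∫ x, (massFlux a (r x) (v x) - p1 ℓ s x) ^ 2 ∂(pipeMeasure ℓ)) ≤
      10 * B ^ 8 * (ℓ / M * ∑ i, σ i ^ 2
        + squaredError ε a ℓ (cellMeans ℓ M r) (nodalFlux a ℓ M r v) q s) := by
  have hB1 := hF.one_le
  have hB0 : 0 < B := one_pos.trans_le hB1
  have ha := hPR.area_pos
  have hα := hF.law.pos
  have hεB : ε ≤ B := hPR.eps_le.trans hF.eps_le
  have hε := hPR.eps_nonneg
  have b1 := ((EssBdd.of_continuousOn hr).sub (EssBdd.p0 q)).pow 2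
  have b2 : EssBdd ℓ fun x => (massFlux a (r x) (v x) - p1 ℓ s x) ^ 2 :=
    ((EssBdd.of_continuousOn ((continuousOn_const.mul hr).mul hv)).sub (EssBdd.p1 s)).pow 2
  have b3 := (EssBdd.p0 (ℓ := ℓ) σ).pow 2
  have b4 := essBdd_errorDensity (ε := ε) (a := a) hℓ hM (cellMeans ℓ M r) (nodalFlux a ℓ M r v) q s
  have hpt : ∀ᵐ x ∂(pipeMeasure ℓ), (r x - p0 ℓ q x) ^ 2
      + ε ^ 2 * (massFlux a (r x) (v x) - p1 ℓ s x) ^ 2 ≤ 10 * B ^ 8 * (p0 ℓ σ x ^ 2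
        + errorDensity ε a ℓ (cellMeans ℓ M r) (nodalFlux a ℓ M r v) q s x) := by
    filter_upwards [ae_mem_cell hℓ hM, h.density, h.flux, hA.2] with x ⟨i, hi⟩ h1 h2 h3
    simp only [errorDensity, p0_eq hℓ _ hi] at h1 h2 ⊢
    have hR := hA.1 i
    have hq := hA'.1 i
    rw [p1_eq_mul_velocity hℓ ha _ (hα.trans_le hR.1) hi] at h2
    rw [p1_eq_mul_velocity hℓ ha s (hα.trans_le hq.1) hi]
    set R := cellMeans ℓ M r i
    set W := discreteVelocity a ℓ (cellMeans ℓ M r) (nodalFlux a ℓ M r v) x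
    set d := discreteVelocity a ℓ q s x
    set m := massFlux a (r x) (v x)
    have hWB : |W| ≤ B := h3.trans hF.vel_le
    have hqB : |q i| ≤ B := by
      have := hF.beta_le
      exact abs_le.2 ⟨by linarith [hq.1], by linarith [hq.2]⟩
    have two : ∀ x y : ℝ, (x + y) ^ 2 ≤ 2 * x ^ 2 + 2 * y ^ 2 := fun x y => by
      nlinarith [sq_nonneg (x - y)]
    have sqb : ∀ {x y : ℝ}, |x| ≤ y → x ^ 2 ≤ y ^ 2 := fun {x y} hxy => by
      rw [← sq_abs x]; gcongr
    have p8 : ∀ k ≤ 8, B ^ k ≤ B ^ 8 := fun k hk => pow_le_pow_right₀ hB1 hk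
    have e1 : (r x - q i) ^ 2 ≤ 2 * B ^ 8 * σ i ^ 2 + 2 * B ^ 8 * (q i - R) ^ 2 := by
      have h4 := two (r x - R) (R - q i)
      have h5 := sqb h1
      have h6 : B ^ 2 * σ i ^ 2 ≤ B ^ 8 * σ i ^ 2 := by gcongr 1; exact p8 2 (by norm_num)
      have h7 : (q i - R) ^ 2 ≤ B ^ 8 * (q i - R) ^ 2 :=
        le_mul_of_one_le_left (sq_nonneg _) (one_le_pow₀ hB1)
      have e : r x - q i = (r x - R) + (R - q i) := by ring
      rw [e]
      nlinarith
    have e2 : ε ^ 2 * (m - a * (q i * d)) ^ 2 ≤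
        8 * B ^ 8 * σ i ^ 2 + (4 * B ^ 8 * (q i - R) ^ 2 + 4 * B ^ 8 * (ε ^ 2 * (d - W) ^ 2)) := by
      have h4 := two (m - a * (R * W)) (-(a * (W * (q i - R)) + a * (q i * (d - W))))
      have h5 := sqb h2
      have h6 := two (a * (W * (q i - R))) (a * (q i * (d - W)))
      have e : m - a * (q i * d) =
          (m - a * (R * W)) + -(a * (W * (q i - R)) + a * (q i * (d - W))) := by ring
      have g1 : (a * (W * (q i - R))) ^ 2 ≤ B ^ 4 * (q i - R) ^ 2 := by
        have h7 := sqb hWB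
        have h8 : a ^ 2 ≤ B ^ 2 := by have := hPR.area_le; gcongr
        calc (a * (W * (q i - R))) ^ 2 = a ^ 2 * W ^ 2 * (q i - R) ^ 2 := by ring
          _ ≤ B ^ 2 * B ^ 2 * (q i - R) ^ 2 := by gcongr
          _ = _ := by ring
      have g2 : (a * (q i * (d - W))) ^ 2 ≤ B ^ 4 * (d - W) ^ 2 := by
        have h7 := sqb hqB
        have h8 : a ^ 2 ≤ B ^ 2 := by have := hPR.area_le; gcongr
        calc (a * (q i * (d - W))) ^ 2 = a ^ 2 * q i ^ 2 * (d - W) ^ 2 := by ring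
          _ ≤ B ^ 2 * B ^ 2 * (d - W) ^ 2 := by gcongr
          _ = _ := by ring
      have hε2 : ε ^ 2 ≤ B ^ 2 := by gcongr
      rw [neg_sq] at h4
      have t1 : ε ^ 2 * (2 * (2 * B ^ 3 * σ i) ^ 2) ≤ B ^ 2 * (2 * (2 * B ^ 3 * σ i) ^ 2) := by gcongr
      have t2 : ε ^ 2 * (4 * (B ^ 4 * (q i - R) ^ 2)) ≤ B ^ 2 * (4 * (B ^ 4 * (q i - R) ^ 2)) := by
        gcongr
      have t3 : B ^ 6 * (q i - R) ^ 2 ≤ B ^ 8 * (q i - R) ^ 2 := by gcongr 1; exact p8 6 (by norm_num)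
      have t4 : B ^ 4 * (ε ^ 2 * (d - W) ^ 2) ≤ B ^ 8 * (ε ^ 2 * (d - W) ^ 2) := by
        gcongr 1; exact p8 4 (by norm_num)
      have t5 : (m - a * (q i * d)) ^ 2 ≤ 2 * (2 * B ^ 3 * σ i) ^ 2
          + (4 * (B ^ 4 * (q i - R) ^ 2) + 4 * (B ^ 4 * (d - W) ^ 2)) := by
        rw [e]; linarith
      have t6 := mul_le_mul_of_nonneg_left t5 (sq_nonneg ε)
      linarith
    have p : 0 ≤ B ^ 8 * (q i - R) ^ 2 := by positivity
    have p' : 0 ≤ B ^ 8 * (ε ^ 2 * (d - W) ^ 2) := by positivity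
    linarith
  have hint := integral_mono_ae (b1.add (b2.const_mul (ε ^ 2))).integrable
    ((b3.add b4).const_mul _).integrable hpt
  rw [integral_add b1.integrable (b2.const_mul _).integrable, integral_const_mul,
    integral_const_mul, integral_add b3.integrable b4.integrable, integral_p0_sq hℓ hM] at hint
  exact hint

/-- Split at the interpolated flux by `(x + y)³ ≤ 4 (x³ + y³)`. The interpolation part is reduced to
a square by its uniform bound, and the discrete part is handled by friction and density errors. -/
lemma InterpolationError.cube_error_le {r v : ℝ → ℝ} {σ : Fin M → ℝ}
    (h : InterpolationError B a ℓ r v σ) (hF : FlowBounds P α β κ L εmax wmax γmin B)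
    (hPR : ParamRange εmax γmin B ε γ a) (hℓ : 0 < ℓ) (hM : 0 < M)
    (hr : ContinuousOn r (Icc 0 ℓ)) (hv : ContinuousOn v (Icc 0 ℓ)) {q : Fin M → ℝ}
    {s : Fin (M + 1) → ℝ}
    (hA : AdmState a ℓ α β (3 * wmax / 2) (cellMeans ℓ M r) (nodalFlux a ℓ M r v))
    (hA' : AdmState a ℓ α β (3 * wmax / 2) q s) :
    (∫ x, |massFlux a (r x) (v x) - p1 ℓ s x| ^ 3 ∂(pipeMeasure ℓ)) ≤
      32 * B ^ 9 * (ℓ / M * ∑ i, σ i ^ 2)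
        + 16 * B ^ 7 * (squaredError 0 a ℓ (cellMeans ℓ M r) (nodalFlux a ℓ M r v) q s
          + frictionError a ℓ (cellMeans ℓ M r) (nodalFlux a ℓ M r v) q s) := by
  have hB1 := hF.one_le
  have hB0 : 0 < B := one_pos.trans_le hB1
  have b1 : EssBdd ℓ fun x => |massFlux a (r x) (v x) - p1 ℓ s x| ^ 3 :=
    ((EssBdd.of_continuousOn ((continuousOn_const.mul hr).mul hv)).sub (EssBdd.p1 s)).abs.pow 3
  have b2 := (EssBdd.p0 (ℓ := ℓ) σ).pow 2
  have b3 := (EssBdd.p1 (ℓ := ℓ) (s - nodalFlux a ℓ M r v)).abs.pow 3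
  have hpt : ∀ᵐ x ∂(pipeMeasure ℓ), |massFlux a (r x) (v x) - p1 ℓ s x| ^ 3 ≤
      32 * B ^ 9 * p0 ℓ σ x ^ 2 + 4 * |p1 ℓ (s - nodalFlux a ℓ M r v) x| ^ 3 := by
    filter_upwards [h.flux, h.flux_bdd] with x h1 h2
    rw [p1_sub]
    set e := massFlux a (r x) (v x) - p1 ℓ (nodalFlux a ℓ M r v) x with he
    set d := p1 ℓ s x - p1 ℓ (nodalFlux a ℓ M r v) x with hd
    have e1 : massFlux a (r x) (v x) - p1 ℓ s x = e - d := by rw [he, hd]; ring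
    have h3 : |e - d| ^ 3 ≤ (|e| + |d|) ^ 3 := by gcongr; exact abs_sub _ _
    have h4 := add_pow_le (abs_nonneg e) (abs_nonneg d) 3
    norm_num at h4
    have h5 : |e| ^ 3 ≤ 2 * B ^ 3 * (2 * B ^ 3 * p0 ℓ σ x) ^ 2 := by
      rw [pow_succ']
      gcongr
    rw [e1]
    nlinarith
  have hint := integral_mono_ae b1.integrable
    ((b2.const_mul (32 * B ^ 9)).add (b3.const_mul 4)).integrable hpt
  rw [integral_add (b2.const_mul _).integrable (b3.const_mul _).integrable, integral_const_mul,
    integral_const_mul, integral_p0_sq hℓ hM] at hint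
  have := hF.flux_cubed_le hPR hℓ hM hA hA'
  linarith

end Comparison


/-! ## The main result -/

/-- On a compact interval of positive densities the second and third derivatives are bounded, and
the third one gives the Lipschitz constant of `P''`. -/
lemma exists_pressureLaw {P : ℝ → ℝ} {α β κ : ℝ} (hα : 0 < α) (hαβ : α ≤ β) (hκ : 0 < κ)
    (hP : ContDiffOn ℝ ∞ P (Ioi 0)) (h : ∀ r ∈ Icc α β, κ ≤ r * deriv (deriv P) r) :
    ∃ L, PressureLaw P α β κ L := by
  have h3 : ContDiffOn ℝ 3 P (Ioi 0) := contDiffOn_infty.1 hP 3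
  have h2 : ContDiffOn ℝ 2 (deriv P) (Ioi 0) := h3.deriv_of_isOpen isOpen_Ioi (by norm_num)
  have h1 : ContDiffOn ℝ 1 (deriv (deriv P)) (Ioi 0) := h2.deriv_of_isOpen isOpen_Ioi (by norm_num)
  have h0 : ContDiffOn ℝ 0 (deriv (deriv (deriv P))) (Ioi 0) :=
    h1.deriv_of_isOpen isOpen_Ioi (by norm_num)
  have hsub : Icc α β ⊆ Ioi 0 := fun x hx => hα.trans_le hx.1
  have hd : ∀ {f : ℝ → ℝ} {n : WithTop ℕ∞}, ContDiffOn ℝ n f (Ioi 0) → n ≠ 0 →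
      ∀ x ∈ Icc α β, HasDerivAt f (deriv f x) x := fun hf hn x hx =>
    ((hf.differentiableOn hn).differentiableAt (isOpen_Ioi.mem_nhds (hsub hx))).hasDerivAt
  obtain ⟨A, hA⟩ := isCompact_Icc.exists_bound_of_continuousOn (h1.continuousOn.mono hsub)
  obtain ⟨D, hD⟩ := isCompact_Icc.exists_bound_of_continuousOn (h0.continuousOn.mono hsub)
  have hA0 : 0 ≤ A := (norm_nonneg _).trans (hA α (left_mem_Icc.2 hαβ))
  have hD0 : 0 ≤ D := (norm_nonneg _).trans (hD α (left_mem_Icc.2 hαβ))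
  refine ⟨1 + A + D, hα, hαβ, hκ, by positivity, hd h3 (by simp), hd h2 (by simp), h,
    fun r hr => (hA r hr).trans (by linarith), fun r hr s hs => ?_⟩
  have := (convex_Icc α β).norm_image_sub_le_of_norm_hasDerivWithin_le (C := D)
    (fun z hz => (hd h1 one_ne_zero z hz).hasDerivWithinAt) hD hs hr
  refine this.trans ?_
  rw [Real.norm_eq_abs]
  gcongr
  linarith

lemma sum_fin_Ioc {N : ℕ} (n : Fin (N + 1)) (F : ℕ → ℝ) :
    ∑ k ∈ Finset.Ioc 0 n, F k = ∑ j ∈ Finset.range n, F (j + 1) := by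
  have h1 : ∑ k ∈ Finset.Ioc 0 n, F k = ∑ k ∈ Finset.Ioc 0 (n : ℕ), F k := by
    have := Fin.map_valEmbedding_Ioc (0 : Fin (N + 1)) n
    rw [Fin.val_zero] at this
    rw [← this, Finset.sum_map]
    rfl
  rw [h1]
  generalize (n : ℕ) = k
  induction k with
  | zero => simp
  | succ k ih => rw [Finset.sum_range_succ, Finset.sum_Ioc_succ_top (Nat.zero_le k), ih]

lemma velocityConst_pos {α K : ℝ} (hα : 0 < α) (hK : 0 < K) : 0 < velocityConst α K := by
  unfold velocityConst; positivity

lemma enthalpyConst_nonneg {P : ℝ → ℝ} {α β κ L εmax K : ℝ} (h : PressureLaw P α β κ L)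
    (hK : 0 ≤ K) : 0 ≤ enthalpyConst P α β L εmax K := by
  have := h.L_pos
  have := sub_nonneg.2 h.le
  unfold enthalpyConst; positivity

/-- Bounds for the data of the problem. -/
lemma exists_flowBounds {P : ℝ → ℝ} {α β κ L εmax wmax γmin γmax amin amax K : ℝ}
    (hP : PressureLaw P α β κ L) (hκ : κ = 4 * εmax ^ 2 * wmax ^ 2) (hε : 0 < εmax) (hw : 0 < wmax)
    (hγ : 0 < γmin) (hγ' : 0 < γmax) (ha : 0 < amin) (ha' : 0 < amax) (hK : 1 ≤ K) :
    ∃ B, FlowBounds P α β κ L εmax wmax γmin B ∧ γmax ≤ B ∧ 1 / amin ≤ B ∧ amax ≤ B ∧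
      velocityConst α K ≤ B ∧ enthalpyConst P α β L εmax (velocityConst α K) ≤ B ∧ K ^ 3 ≤ B ∧
      2 * velocityConst α K ^ 2 * K + 2 * K ≤ B := by
  have hK0 : 0 < K := one_pos.trans_le hK
  have hV := velocityConst_pos hP.pos hK0
  have hE := enthalpyConst_nonneg (εmax := εmax) hP hV.le
  have h1 : 0 < 1 / amin := by positivity
  have h2 : 0 < K ^ 3 := by positivity
  have h3 : 0 < 2 * velocityConst α K ^ 2 * K + 2 * K := by positivity
  have h4 := hP.L_pos
  have h5 := hP.pos.trans_le hP.le
  set V := velocityConst α K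
  set E := enthalpyConst P α β L εmax V
  refine ⟨1 + L + β + εmax + 3 * wmax / 2 + γmax + 1 / amin + amax + V + E + K ^ 3
    + (2 * V ^ 2 * K + 2 * K), ⟨hP, hκ, ?_, ?_, ?_, ?_, ?_, hw, hγ⟩, ?_, ?_, ?_, ?_, ?_, ?_, ?_⟩ <;>
    linarith

end PipeFlow

set_option maxHeartbeats 1000000 in
theorem theorem3p4
    -- pressure potential, pipe length, final time
    (P : ℝ → ℝ) (ℓ T : ℝ) (hℓ : 0 < ℓ) (hT : 0 < T)
    -- bounds in the assumptions
    (εmax γmin γmax amin amax ρmin ρmax wmax Cbar : ℝ)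
    (hεmax : 0 < εmax) (hγmin : 0 < γmin) (hγmax : 0 < γmax) (hamin : 0 < amin) (hamax : 0 < amax)
    (hρmin : 0 < ρmin) (hρmax : 0 < ρmax) (hwmax : 0 < wmax) (hCbar : 0 < Cbar)
    -- the potential is smooth, strongly convex on the admissible densities, and subsonic
    (hP : ContDiffOn ℝ ∞ P (Ioi 0))
    (hPconv : ∃ c > 0, StrongConvexOn (Icc (2 * ρmin / 3) (3 * ρmax / 2)) c P)
    (hsubsonic : ∀ r : ℝ, 2 * ρmin / 3 ≤ r → r ≤ 3 * ρmax / 2 →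
      4 * εmax ^ 2 * wmax ^ 2 ≤ r * deriv (deriv P) r)
    -- the constants in `h ≈ Δτ`
    (c₁ c₂ : ℝ) (hc₁ : 0 < c₁) (hc₂ : 0 < c₂) :
    ∃ C > 0, ∃ Δτ₀ > 0,
      ∀ ε γ a : ℝ, 0 ≤ ε → ε ≤ εmax → γmin ≤ γ → γ ≤ γmax → amin ≤ a → a ≤ amax →
      ∀ (hL hR : ℝ → ℝ) (ρ w : ℝ → ℝ → ℝ) (R W : ℝ → H1 ℓ),
        IsClassicalSolution P ε γ a ℓ T hL hR ρ w R W →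
        (∀ τ ∈ Icc 0 T, ∀ᵐ x ∂(volume.restrict (Ioo 0 ℓ)),
          ρmin ≤ ρ τ x ∧ ρ τ x ≤ ρmax ∧ -wmax ≤ w τ x ∧ w τ x ≤ wmax) →
        BoundedInWkInfty 2 T Cbar (fun τ => toL2 (R τ)) → BoundedInWkInfty 1 T Cbar R →
        BoundedInWkInfty 2 T Cbar (fun τ => toL2 (W τ)) → BoundedInWkInfty 1 T Cbar W →
      ∀ M N : ℕ, 0 < M → 0 < N → T / N ≤ Δτ₀ →
        c₁ * (T / N) ≤ ℓ / M → ℓ / M ≤ c₂ * (T / N) →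
        (∃! s : (Fin (N + 1) → Fin M → ℝ) × (Fin (N + 1) → Fin (M + 1) → ℝ),
          IsDiscreteSolution P ε γ a ℓ T hL hR (ρ 0) (fun x => massFlux a (ρ 0 x) (w 0 x))
            M N s.1 s.2 ∧
          IsAdmissibleDiscrete a ℓ ρmin ρmax wmax s.1 s.2) ∧
        ∀ (ρh : Fin (N + 1) → Fin M → ℝ) (mh : Fin (N + 1) → Fin (M + 1) → ℝ),
          IsDiscreteSolution P ε γ a ℓ T hL hR (ρ 0) (fun x => massFlux a (ρ 0 x) (w 0 x))
            M N ρh mh →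
          IsAdmissibleDiscrete a ℓ ρmin ρmax wmax ρh mh →
          ∀ n : Fin (N + 1),
            (∫ x in (0 : ℝ)..ℓ, (ρ (((n : ℕ) : ℝ) * (T / N)) x - p0 ℓ (ρh n) x) ^ 2)
              + ε ^ 2 * (∫ x in (0 : ℝ)..ℓ,
                  (massFlux a (ρ (((n : ℕ) : ℝ) * (T / N)) x) (w (((n : ℕ) : ℝ) * (T / N)) x) - p1 ℓ (mh n) x) ^ 2)
              + ∑ k ∈ Finset.Ioc 0 n, (T / N) * (∫ x in (0 : ℝ)..ℓ,
                  |massFlux a (ρ (((k : ℕ) : ℝ) * (T / N)) x) (w (((k : ℕ) : ℝ) * (T / N)) x) - p1 ℓ (mh k) x| ^ 3)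
              ≤ C * ((T / N) ^ 2 + (ℓ / M) ^ 2) := by
  -- If the density bounds are inconsistent, no solution satisfies them and any constants do.
  by_cases hρρ : ρmin ≤ ρmax
  swap
  · refine ⟨1, one_pos, 1, one_pos, ?_⟩
    intro ε γ a _ _ _ _ _ _ hL hR ρ w R W _ hb
    exfalso
    have hne : (ae (volume.restrict (Ioo 0 ℓ))).NeBot := by
      rw [ae_neBot, Measure.restrict_eq_zero.ne, Real.volume_Ioo]
      simpa using hℓ
    obtain ⟨x, hx⟩ := (hb 0 (left_mem_Icc.2 hT.le)).exists
    exact hρρ (hx.1.trans hx.2.1)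
  obtain ⟨α, hα⟩ : ∃ α, α = 2 * ρmin / 3 := ⟨_, rfl⟩
  obtain ⟨β, hβ⟩ : ∃ β, β = 3 * ρmax / 2 := ⟨_, rfl⟩
  obtain ⟨κ, hκ⟩ : ∃ κ, κ = 4 * εmax ^ 2 * wmax ^ 2 := ⟨_, rfl⟩
  have hα0 : 0 < α := by rw [hα]; positivity
  have hβ0 : 0 < β := by rw [hβ]; positivity
  have hκ0 : 0 < κ := by rw [hκ]; positivity
  obtain ⟨L, hP⟩ := exists_pressureLaw (β := β) hα0 (by rw [hα, hβ]; linarith) hκ0 hP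
    (fun r hr => by
      rw [hα, hβ] at hr
      rw [hκ]
      exact hsubsonic r hr.1 hr.2)
  obtain ⟨S, hS⟩ : ∃ S, S = √(2 / ℓ + 2 * ℓ) * Cbar := ⟨_, rfl⟩
  have hS0 : 0 ≤ S := by rw [hS]; positivity
  have hC6 : 0 < 6 * Cbar ^ 2 := by positivity
  obtain ⟨K, hK⟩ : ∃ K, K = 1 + β + wmax + amax + S + 6 * Cbar ^ 2 := ⟨_, rfl⟩
  have hK1 : 1 ≤ K := by rw [hK]; linarith
  have hK0 : 0 < K := one_pos.trans_le hK1
  have hb : SnapshotBounds P α β κ L ρmin ρmax wmax εmax K :=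
    ⟨hP, by rw [hα]; linarith, by rw [hβ]; linarith, hK1, by rw [hK]; linarith, hwmax,
      by rw [hK]; linarith⟩
  obtain ⟨B, hF, hBγ, hBa, hBa', hB1, hB2, hB3, hB4⟩ :=
    exists_flowBounds hP hκ hεmax hwmax hγmin hγmax hamin hamax hK1
  have hB0 : 0 < B := one_pos.trans_le hF.one_le
  obtain ⟨V, hV⟩ : ∃ V, V = velocityConst α K := ⟨_, rfl⟩
  have hV0 : 0 < V := by rw [hV]; exact velocityConst_pos hα0 hK0
  obtain ⟨G, hG, t₀, ht₀, H⟩ := hF.exists_discrete hℓ T (c₂ := c₂) hc₁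
  -- The first summand is for the squared errors. The second is for the cubic terms bounded at each
  -- time level, summed over a time at most `T`; the third is for the friction errors, whose
  -- weighted sum is bounded already. The step size serves existence, inner states and monotonicity.
  refine ⟨10 * B ^ 8 * (B + G) + T * (32 * B ^ 9 * B + 16 * B ^ 7 * G) + 16 * B ^ 7 * G,
    by positivity,
    min t₀ (min ((wmax / 4) ^ 2 / (V ^ 2 * (K * c₂)))
      (7 / 32 * (κ / β) / (B * (2 * B ^ 3 / α)))), by positivity, ?_⟩
  intro ε γ a hε hε' hγ hγ' ha ha' hL hR ρ w R W hsol hbd hR2 hR1 hW2 hW1 M N hM hN htt hh1 hh2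
  have ht0 : 0 < T / N := by positivity
  have htN : N * (T / N) = T := by field_simp
  have ha0 : 0 < a := hamin.trans_le ha
  have hPR : ParamRange εmax γmin B ε γ a := ⟨hε, hε', hγ, hγ'.trans hBγ, ha0,
    (one_div_le_one_div_of_le hamin ha).trans hBa, ha'.trans hBa'⟩
  have haK : a ≤ K := by rw [hK]; linarith
  have hsmall : velocityConst α K ^ 2 * (K * (ℓ / M)) ≤ (wmax / 4) ^ 2 := by
    have h1 : T / N ≤ (wmax / 4) ^ 2 / (V ^ 2 * (K * c₂)) :=
      htt.trans ((min_le_right _ _).trans (min_le_left _ _))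
    rw [le_div_iff₀ (by positivity)] at h1
    rw [← hV]
    calc V ^ 2 * (K * (ℓ / M)) ≤ V ^ 2 * (K * (c₂ * (T / N))) := by gcongr
      _ = T / N * (V ^ 2 * (K * c₂)) := by ring
      _ ≤ _ := h1
  have hts : T / N * (B * (2 * B ^ 3 / α)) ≤ 7 / 32 * (κ / β) := by
    have h1 : T / N ≤ 7 / 32 * (κ / β) / (B * (2 * B ^ 3 / α)) :=
      htt.trans ((min_le_right _ _).trans (min_le_right _ _))
    rwa [le_div_iff₀ (by positivity)] at h1
  have hPc : ContinuousOn (deriv P) (Icc ρmin ρmax) := fun x hx =>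
    (hP.hasDerivAt_deriv x ⟨by rw [hα]; linarith [hx.1], by rw [hβ]; linarith [hx.2]⟩).continuousAt.continuousWithinAt
  obtain ⟨ρt, wt, σ, hSn⟩ := hsol.snapshots hℓ hT hPc hbd hCbar.le hR2 hR1 hW2 hW1
    (K := K) (by rw [← hS, hK]; linarith) (by rw [hK]; linarith) hM hN
  obtain ⟨f, fa, fb, g, hRef⟩ := hSn.referenceStates hb ha0 haK hε hε' hℓ hM ht0 hsmall hB1 hB2 hB3 hB4
  obtain ⟨q, r, hq0, hr0, hstep, hadm, herr⟩ := H ε γ a (T / N) M N _ _ _ _ σ f fa fb g hPR hM ht0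
    (htt.trans (min_le_left _ _)) htN.le hh1 hh2 hRef
  have hρ0 : ContinuousOn (ρ 0) (Icc 0 ℓ) := (hsol.rep_density 0 (left_mem_Icc.2 hT.le)).1
  have hsolq : IsDiscreteSolution P ε γ a ℓ T hL hR (ρ 0) (fun x => massFlux a (ρ 0 x) (w 0 x))
      M N (fun n => q n) (fun n => r n) := by
    rw [isDiscreteSolution_iff hℓ hM ha0 ht0 hρ0]
    refine ⟨?_, ?_, fun n => ⟨(hstep n n.2).1, fun s => ?_⟩⟩
    · simpa using hq0
    · simp only [Fin.val_zero, hr0, Nat.cast_zero, zero_mul]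
      rfl
    · have := (hstep n n.2).2 s
      rw [Nat.cast_succ] at this
      exact this
  have hadmq : IsAdmissibleDiscrete a ℓ ρmin ρmax wmax (fun n : Fin (N + 1) => q n)
      (fun n : Fin (N + 1) => r n) := by
    intro n
    refine (admState_iff hℓ hM _ _ rfl).2 ?_
    rw [← hα, ← hβ]
    exact hadm n (Nat.lt_succ_iff.1 n.2)
  have huniq : ∀ (ρh : Fin (N + 1) → Fin M → ℝ) (mh : Fin (N + 1) → Fin (M + 1) → ℝ),
      IsDiscreteSolution P ε γ a ℓ T hL hR (ρ 0) (fun x => massFlux a (ρ 0 x) (w 0 x)) M N ρh mh →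
      IsAdmissibleDiscrete a ℓ ρmin ρmax wmax ρh mh →
      ρh = (fun n : Fin (N + 1) => q n) ∧ mh = (fun n : Fin (N + 1) => r n) := by
    intro ρh mh h1 h2
    rw [hα, hβ] at hF hts
    exact hF.discrete_unique hPR hℓ hM ht0 hts hρ0 h1 h2 hsolq hadmq
  refine ⟨⟨(fun n => q n, fun n => r n), ⟨hsolq, hadmq⟩, fun s hs => ?_⟩, ?_⟩
  · obtain ⟨e1, e2⟩ := huniq s.1 s.2 hs.1 hs.2
    exact Prod.ext e1 e2
  intro ρh mh h1 h2 n
  -- Uniqueness transfers the estimate from the constructed solution to an arbitrary admissible one.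
  obtain ⟨rfl, rfl⟩ := huniq ρh mh h1 h2
  have hnN : (n : ℕ) ≤ N := Nat.lt_succ_iff.1 n.2
  obtain ⟨Θ, hΘ⟩ : ∃ Θ, Θ = (T / N) ^ 2 + (ℓ / M) ^ 2 := ⟨_, rfl⟩
  have hΘ0 : 0 ≤ Θ := by rw [hΘ]; positivity
  have hie : ∀ k ≤ N, InterpolationError B a ℓ (ρ (k * (T / N))) (w (k * (T / N))) (σ k) :=
    fun k hk => hSn.interpolationError hb ha0 haK hεmax.le hℓ hM ht0.le hB1 hk
  have hAd : ∀ k ≤ N, AdmState a ℓ α β (3 * wmax / 2) (cellMeans ℓ M (ρ (k * (T / N))))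
      (nodalFlux a ℓ M (ρ (k * (T / N))) (w (k * (T / N)))) := by
    intro k hk
    have := hRef.inner k hk
    refine ⟨this.density_mem hF, ?_⟩
    filter_upwards [this.velocity] with x hx
    linarith
  have hσ : ∀ k ≤ N, ℓ / M * ∑ i, σ k i ^ 2 ≤ B * Θ := fun k hk => by
    rw [hΘ]; exact hRef.sigma_sq k hk
  rw [← hΘ]
  rw [← hΘ] at herr
  have hsum0 : ∀ k, 0 ≤ ∑ j ∈ Finset.range k, T / N * frictionError a ℓ
      (cellMeans ℓ M (ρ ((j + 1 : ℕ) * (T / N))))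
      (nodalFlux a ℓ M (ρ ((j + 1 : ℕ) * (T / N))) (w ((j + 1 : ℕ) * (T / N)))) (q (j + 1)) (r (j + 1)) :=
    fun k => Finset.sum_nonneg fun j _ => mul_nonneg ht0.le (frictionError_nonneg _ _ _ _)
  have hsq : ∀ k ≤ N, squaredError ε a ℓ (cellMeans ℓ M (ρ (k * (T / N))))
      (nodalFlux a ℓ M (ρ (k * (T / N))) (w (k * (T / N)))) (q k) (r k) ≤ G * Θ := fun k hk => by
    linarith [herr k hk, hsum0 k]
  simp only [intervalIntegral_eq_pipe hℓ]
  rw [sum_fin_Ioc n fun k => T / N * ∫ x, |massFlux a (ρ (k * (T / N)) x) (w (k * (T / N)) x)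
    - p1 ℓ (r k) x| ^ 3 ∂(pipeMeasure ℓ)]
  have e1 := (hie n hnN).sq_error_le hF hPR hℓ hM (hSn.cont_density n hnN) (hSn.cont_velocity n hnN)
    (hAd n hnN) (hadm n hnN)
  have e1' : 10 * B ^ 8 * (ℓ / M * ∑ i, σ n i ^ 2
        + squaredError ε a ℓ (cellMeans ℓ M (ρ (n * (T / N))))
          (nodalFlux a ℓ M (ρ (n * (T / N))) (w (n * (T / N)))) (q n) (r n)) ≤
      10 * B ^ 8 * (B * Θ + G * Θ) := by
    have := hσ n hnN
    have := hsq n hnN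
    gcongr
  have e2 : ∑ j ∈ Finset.range n, T / N * ∫ x, |massFlux a (ρ ((j + 1 : ℕ) * (T / N)) x)
      (w ((j + 1 : ℕ) * (T / N)) x) - p1 ℓ (r (j + 1)) x| ^ 3 ∂(pipeMeasure ℓ) ≤
      T * (32 * B ^ 9 * B + 16 * B ^ 7 * G) * Θ + 16 * B ^ 7 * (G * Θ) := by
    have h3 : ∀ j ∈ Finset.range n, T / N * ∫ x, |massFlux a (ρ ((j + 1 : ℕ) * (T / N)) x)
        (w ((j + 1 : ℕ) * (T / N)) x) - p1 ℓ (r (j + 1)) x| ^ 3 ∂(pipeMeasure ℓ) ≤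
        T / N * ((32 * B ^ 9 * B + 16 * B ^ 7 * G) * Θ) + 16 * B ^ 7 * (T / N * frictionError a ℓ
      (cellMeans ℓ M (ρ ((j + 1 : ℕ) * (T / N))))
      (nodalFlux a ℓ M (ρ ((j + 1 : ℕ) * (T / N))) (w ((j + 1 : ℕ) * (T / N)))) (q (j + 1)) (r (j + 1))) := by
      intro j hj
      have hj1 : j + 1 ≤ N := (Nat.succ_le_of_lt (Finset.mem_range.1 hj)).trans hnN
      have h4 := (hie (j + 1) hj1).cube_error_le hF hPR hℓ hM (hSn.cont_density _ hj1)
        (hSn.cont_velocity _ hj1) (hAd _ hj1) (hadm _ hj1)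
      have h5 := hσ (j + 1) hj1
      have h6 := (squaredError_zero_le (ε := ε) (a := a) hℓ hM _ _ _ _).trans (hsq (j + 1) hj1)
      have h7 := mul_le_mul_of_nonneg_left h4 ht0.le
      refine h7.trans ?_
      have h8 := mul_le_mul_of_nonneg_left h5 (by positivity : 0 ≤ T / N * (32 * B ^ 9))
      have h9 := mul_le_mul_of_nonneg_left h6 (by positivity : 0 ≤ T / N * (16 * B ^ 7))
      linarith
    refine (Finset.sum_le_sum h3).trans ?_
    rw [Finset.sum_add_distrib, Finset.sum_const, Finset.card_range, nsmul_eq_mul, ← Finset.mul_sum]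
    -- The terms without friction do not depend on the level, and their weights add up to at most
    -- `T`.
    have h4 : (n : ℕ) * (T / N) ≤ T := by
      have : ((n : ℕ) : ℝ) ≤ N := by exact_mod_cast hnN
      calc ((n : ℕ) : ℝ) * (T / N) ≤ N * (T / N) := by gcongr
        _ = T := htN
    have h5 := mul_le_mul_of_nonneg_right h4
      (by positivity : 0 ≤ (32 * B ^ 9 * B + 16 * B ^ 7 * G) * Θ)
    have h6 := herr n hnN
    have h7 := squaredError_nonneg (ε := ε) (a := a) (ℓ := ℓ) (cellMeans ℓ M (ρ (n * (T / N))))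
      (nodalFlux a ℓ M (ρ (n * (T / N))) (w (n * (T / N)))) (q n) (r n)
    have h8 := mul_le_mul_of_nonneg_left ((le_add_of_nonneg_left h7).trans h6)
      (by positivity : 0 ≤ 16 * B ^ 7)
    linarith
  linarith
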